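/- **Setting.** Let $d\in\mathbb N$ and let $\mathcal M_\delta(\mathbb R^d)$ be the space of $\sigma$-finite measures on $\mathbb R^d$ that are sums of Dirac masses, with the $\sigma$-algebra generated by $\mu\mapsto\mu(V)$, $V$ Borel. Let $\mathbf a_\circ:\mathcal M_\delta(\mathbb R^d)\to\mathbb R^{d\times d}_{\mathrm{sym}}$ be measurable and such that, for some $\Lambda<\infty$ and every $\mu$, $\mathrm{Id}\le \mathbf a_\circ(\mu)\le\Lambda\,\mathrm{Id}$ and $\mathbf a_\circ(\mu)=\mathbf a_\circ(\mu|_{B_{1/2}})$, where $B_{1/2}$ is the ball of radius $1/2$ centered at the origin. Set $\mathbf a(\mu,x):=\mathbf a_\circ(\tau_{-x}\mu)$ with $\tau_{-x}\mu(V)=\mu(x+V)$. For $\rho_0>0$ let $\mathbb P_{\rho_0}$ be the law of the Poisson point process on $\mathbb R^d$ with constant intensity $\rho_0$, with expectation $\mathbb E_{\rho_0}$, and let $\square_m:=(-3^m/2,3^m/2)^d$. For $f:\mathcal M_\delta(\mathbb R^d)\to\mathbb R$ and a particle $x$ of $\mu$, the gradient $\nabla f(\mu,x)\in\mathbb R^d$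 is defined by $\mathrm e_k\cdot\nabla f(\mu,x)=\lim_{h\to0}h^{-1}\big(f(\mu-\delta_x+\delta_{x+h\mathrm e_k})-f(\mu)\big)$. For a bounded open set $U$, $\mathcal C^\infty(U)$ is the set of functions $f$, measurable up to $\mathbb P_{\rho_0}$-null sets, such that for all $\mu$ and $n$ the map $(x_1,\dots,x_n)\mapsto f(\sum_i\delta_{x_i}+\mu|_{U^c})$ is smooth on $U^n$, and $\mathcal H^1(U)$ is the completion of the set of $f\in\mathcal C^\infty(U)$ of finite norm for $\|f\|^2_{\mathcal H^1(U)}=\mathbb E_{\rho_0}[f^2]+\mathbb E_{\rho_0}\big[\int_U|\nabla f|^2\,\mathrm d\mu\big]$. For $q\in\mathbb R^d$ let $$\nu_*(U,q,\rho_0):=\sup_{u\in\mathcal H^1(U)}\mathbb E_{\rho_0}\Big[\frac1{\rho_0|U|}\int_U\big(-\tfrac12\nabla u\cdot\mathbf a\nabla u+q\cdot\nabla u\big)\,\mathrm d\mu\Big].$$ There are unique symmetric matrices $\bar{\mathbf a}_*(\square_m,\rho_0)$ with $\mathrm{Id}\le\bar{\mathbf a}_*(\square_m,\rho_0)\le\Lambda\,\mathrm{Id}$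 and $\nu_*(\square_m,q,\rho_0)=\frac12q\cdot\bar{\mathbf a}_*^{-1}(\square_m,\rho_0)q$ for all $q$, and the limit $\bar{\mathbf a}(\rho_0):=\lim_{m\to\infty}\bar{\mathbf a}_*(\square_m,\rho_0)$, the bulk diffusion matrix, exists. Fix $q\in\mathbb R^d$. A maximizer $\psi_m\in\mathcal H^1(\square_m)$ for $\nu_*(\square_m,q,\rho_0)$ exists, and can be chosen such that $\mathbb E_{\rho_0}[\psi_m\,|\,\mu(\square_m),\mu|_{\square_m^c}]=0$; the formula below involves only $\nabla\psi_m$ and does not depend on how $\psi_m$ is normalized. **Theorem ($C^{1,1}$ regularity).** For every $\rho_0>0$ the following integrals converge absolutely, and the limit $$c_1(\rho_0):=\lim_{m\to\infty}\int_{\mathbb R^d}\mathbb E_{\rho_0}\Big[\frac1{\rho_0|\square_m|}\int_{\square_m}\nabla\psi_m(\mu,z)\cdot\big(\mathbf a(\mu,z)-\mathbf a(\mu+\delta_{x_1},z)\big)\nabla\psi_m(\mu+\delta_{x_1},z)\,\mathrm d\mu(z)\Big]\,\mathrm dx_1$$ exists and is finite. Moreover, there is a constant $C<\infty$ depending only on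 $d$, $\Lambda$ and $|q|$ such that for all $\rho_0>0$ and $\rho\in\mathbb R$ with $\rho_0+\rho>0$, $$\big|q\cdot\bar{\mathbf a}^{-1}(\rho_0+\rho)q-q\cdot\bar{\mathbf a}^{-1}(\rho_0)q-\rho\,c_1(\rho_0)\big|\le C\rho^2.$$ In particular, $q\cdot\bar{\mathbf a}^{-1}(\cdot)q$ is $C^{1,1}$ on $(0,\infty)$: it is differentiable with derivative $c_1$, and $|c_1(\rho_1)-c_1(\rho_0)|\le C|\rho_1-\rho_0|$ for all $\rho_0,\rho_1>0$. -/

import Mathlib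

open MeasureTheory Filter Topology
open scoped ENNReal Matrix

noncomputable section

/-- Euclidean space `ℝ^d`. -/
abbrev Space (d : ℕ) := EuclideanSpace ℝ (Fin d)

/-- A cloud of particles: a `σ`-finite measure which is a sum of Dirac masses. -/
def IsConfig {d : ℕ} (μ : Measure (Space d)) : Prop :=
  SigmaFinite μ ∧ ∃ (ι : Type) (_ : Countable ι) (x : ι → Space d),
    μ = Measure.sum fun i => Measure.dirac (x i)

/-- The configuration space `M_δ(ℝ^d)`, with the `σ`-algebra generated by the maps `μ ↦ μ(V)`,
`V` Borel (this is Mathlib's `σ`-algebra on measures, restricted to the subtype). -/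
abbrev Config (d : ℕ) := {μ : Measure (Space d) // IsConfig μ}

namespace Config

variable {d : ℕ}

theorem isConfig_add {μ ν : Measure (Space d)} (hμ : IsConfig μ) (hν : IsConfig ν) :
    IsConfig (μ + ν) := by
  obtain ⟨h1, ι, _, x, rfl⟩ := hμ
  obtain ⟨h2, κ, _, y, rfl⟩ := hν
  refine ⟨inferInstance, ι ⊕ κ, inferInstance, Sum.elim x y, ?_⟩
  ext s hs
  rw [Measure.add_apply, Measure.sum_apply _ hs, Measure.sum_apply _ hs, Measure.sum_apply _ hs,
    Summable.tsum_sum ENNReal.summable ENNReal.summable]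
  rfl

theorem isConfig_zero : IsConfig (0 : Measure (Space d)) :=
  ⟨inferInstance, Empty, inferInstance, Empty.elim, by simp⟩

theorem isConfig_dirac (x : Space d) : IsConfig (Measure.dirac x) :=
  ⟨inferInstance, Unit, inferInstance, fun _ => x, by
    ext s hs
    rw [Measure.sum_apply _ hs]
    simp⟩

theorem isConfig_restrict {μ : Measure (Space d)} (hμ : IsConfig μ) (U : Set (Space d)) :
    IsConfig (μ.restrict U) := by
  classical
  obtain ⟨h1, ι, _, x, rfl⟩ := hμ
  refine ⟨inferInstance, {i // x i ∈ U}, inferInstance, fun i => x i, ?_⟩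
  rw [Measure.restrict_sum_of_countable]
  ext s hs
  rw [Measure.sum_apply _ hs, Measure.sum_apply _ hs]
  refine Eq.trans ?_ (tsum_subtype {i | x i ∈ U} (fun i => Measure.dirac (x i) s)).symm
  refine tsum_congr fun i => ?_
  rw [restrict_dirac]
  by_cases h : x i ∈ U <;> simp [h]

theorem isConfig_translate {μ : Measure (Space d)} (hμ : IsConfig μ) (x : Space d) :
    IsConfig (μ.map fun y => y - x) := by
  obtain ⟨h1, ι, _, z, rfl⟩ := hμ
  refine ⟨(MeasurableEquiv.subRight x).sigmaFinite_map, ι, inferInstance, fun i => z i - x, ?_⟩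
  have hm : Measurable fun y : Space d => y - x := measurable_id.sub_const x
  rw [Measure.map_sum hm.aemeasurable]
  simp only [Measure.map_dirac' hm]

/-- Superposition `μ + ν` of two configurations. -/
def add (μ ν : Config d) : Config d := ⟨μ.1 + ν.1, isConfig_add μ.2 ν.2⟩

/-- The configuration `δ_x` with one particle. -/
def point (x : Space d) : Config d := ⟨Measure.dirac x, isConfig_dirac x⟩

/-- The configuration `∑ δ_{x_i}`. -/
def points {n : ℕ} (x : Fin n → Space d) : Config d :=
  ⟨∑ i, Measure.dirac (x i), Finset.sum_induction _ IsConfig (fun _ _ => isConfig_add)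
    isConfig_zero fun i _ => isConfig_dirac (x i)⟩

/-- The restriction of `μ` to `U`. -/
def res (μ : Config d) (U : Set (Space d)) : Config d :=
  ⟨μ.1.restrict U, isConfig_restrict μ.2 U⟩

/-- The translated configuration `τ_{-x} μ`, with `τ_{-x} μ (U) = μ (x + U)`. -/
def shift (x : Space d) (μ : Config d) : Config d :=
  ⟨μ.1.map fun y => y - x, isConfig_translate μ.2 x⟩

end Config

/-- `P` is the law of a Poisson point process on `ℝ^d` with constant intensity `ρ`: the number of
particles in a Borel set of finite volume is Poisson distributed, and the numbers of particles in
disjoint Borel sets are independent. -/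
structure IsPoissonLaw {d : ℕ} (ρ : ℝ) (P : Measure (Config d)) : Prop where
  isProbabilityMeasure : IsProbabilityMeasure P
  law_count : ∀ B : Set (Space d), MeasurableSet B → volume B ≠ ⊤ →
    P.map (fun μ : Config d => μ.1 B) =
      (ProbabilityTheory.poissonMeasure (ENNReal.ofReal ρ * volume B).toNNReal).map
        (fun k : ℕ => (k : ℝ≥0∞))
  indep_count : ∀ (n : ℕ) (B : Fin n → Set (Space d)), (∀ i, MeasurableSet (B i)) →
    Pairwise (fun i j => Disjoint (B i) (B j)) →
    ProbabilityTheory.iIndepFun (fun i (μ : Config d) => μ.1 (B i)) P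

/-- The open cube `□_m = (-3^m/2, 3^m/2)^d`. -/
def cube (d m : ℕ) : Set (Space d) := {x | ∀ i, x i ∈ Set.Ioo (-((3 : ℝ) ^ m / 2)) ((3 : ℝ) ^ m / 2)}

/-- The bilinear expression `v · A w`. -/
def bil {d : ℕ} (A : Matrix (Fin d) (Fin d) ℝ) (v w : Space d) : ℝ := v.ofLp ⬝ᵥ A *ᵥ w.ofLp

/-- The assumptions on the coefficient field `a_∘ : M_δ(ℝ^d) → ℝ^{d × d}_sym`: it is measurable,
takes symmetric values, satisfies `Id ≤ a_∘ ≤ Λ Id`, and has finite range of dependence. -/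
structure IsCoefficient {d : ℕ} (Λ : ℝ) (a₀ : Config d → Matrix (Fin d) (Fin d) ℝ) : Prop where
  measurable : ∀ i j, Measurable fun μ => a₀ μ i j
  symm : ∀ μ, (a₀ μ).IsSymm
  lower : ∀ μ, (a₀ μ - 1).PosSemidef
  upper : ∀ μ, (Λ • (1 : Matrix (Fin d) (Fin d) ℝ) - a₀ μ).PosSemidef
  finite_range : ∀ μ, a₀ μ = a₀ (μ.res (Metric.ball 0 (1 / 2)))

/-- The stationary extension `a(μ, x) = a_∘(τ_{-x} μ)`. -/
def coeff {d : ℕ} (a₀ : Config d → Matrix (Fin d) (Fin d) ℝ) (μ : Config d) (x : Space d) :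
    Matrix (Fin d) (Fin d) ℝ := a₀ (μ.shift x)

open Classical in
/-- The gradient `∇f(μ, x)` at a particle `x` of `μ`, with
`e_k · ∇f(μ, x) = lim_{h → 0} (f(μ - δ_x + δ_{x + h e_k}) - f(μ)) / h`;
it is set to `0` if `μ` has no particle at `x`. The (unique) `ν` with `μ = ν + δ_x` is
`μ - δ_x`. -/
def grad {d : ℕ} (f : Config d → ℝ) (μ : Config d) (x : Space d) : Space d :=
  if h : ∃ ν : Config d, μ = ν.add (Config.point x) then
    WithLp.toLp 2 fun k =>
      deriv (fun t : ℝ => f (h.choose.add (Config.point (x + t • EuclideanSpace.single k 1)))) 0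
  else 0

/-- The space `C^∞(U)`: functions, measurable for the completion of the `σ`-algebra under `P`,
whose projections `(x_1, …, x_n) ↦ f(∑ δ_{x_i} + μ|_{U^c})` are all smooth on `U^n`. -/
def IsSmooth {d : ℕ} (P : Measure (Config d)) (U : Set (Space d)) (f : Config d → ℝ) : Prop :=
  AEMeasurable f P ∧ ∀ (μ : Config d) (n : ℕ),
    ContDiffOn ℝ (⊤ : ℕ∞) (fun x : Fin n → Space d => f ((Config.points x).add (μ.res Uᶜ)))
      (Set.univ.pi fun _ => U)

/-- The square of the `H^1(U)` norm, for a function `f` with gradient field `G`: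
`E[f^2] + E[∫_U |G(μ, x)|^2 dμ(x)]`. -/
def h1NormSq {d : ℕ} (P : Measure (Config d)) (U : Set (Space d)) (f : Config d → ℝ)
    (G : Config d → Space d → Space d) : ℝ≥0∞ :=
  (∫⁻ μ, ‖f μ‖ₑ ^ 2 ∂P) + ∫⁻ μ, ∫⁻ x in U, ‖G μ x‖ₑ ^ 2 ∂μ.1 ∂P

/-- `f` belongs to `H^1(U)`, with gradient `∇f = G`. The space `H^1(U)` is the completion of
the functions in `C^∞(U)` of finite norm, realized as the closure of the set of pairs `(f, ∇f)` in
`L^2 × L^2`. -/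
structure IsH1 {d : ℕ} (P : Measure (Config d)) (U : Set (Space d)) (f : Config d → ℝ)
    (G : Config d → Space d → Space d) : Prop where
  aemeasurable : AEMeasurable f P
  measurable_grad : Measurable (Function.uncurry G)
  approx : ∃ g : ℕ → Config d → ℝ,
    (∀ k, IsSmooth P U (g k) ∧ h1NormSq P U (g k) (grad (g k)) < ⊤) ∧
    Tendsto (fun k => h1NormSq P U (fun μ => g k μ - f μ) (fun μ x => grad (g k) μ x - G μ x))
      atTop (𝓝 0)

/-- The functional `E[(ρ|U|)^{-1} ∫_U (-1/2 ∇u · a ∇u + q · ∇u) dμ]`, for `∇u = G`. -/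
def dualEnergy {d : ℕ} (P : Measure (Config d)) (a₀ : Config d → Matrix (Fin d) (Fin d) ℝ)
    (ρ : ℝ) (U : Set (Space d)) (q : Space d) (G : Config d → Space d → Space d) : ℝ :=
  ∫ μ, (ρ * volume.real U)⁻¹ *
    ∫ x in U, (-(1 / 2) * bil (coeff a₀ μ x) (G μ x) (G μ x) + inner ℝ q (G μ x)) ∂μ.1 ∂P

/-- The quantity `ν_*(U, q, ρ)`: the supremum of the functional over `H^1(U)`. -/
def nuStar {d : ℕ} (P : Measure (Config d)) (a₀ : Config d → Matrix (Fin d) (Fin d) ℝ)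
    (ρ : ℝ) (U : Set (Space d)) (q : Space d) : ℝ :=
  sSup {e | ∃ u G, IsH1 P U u G ∧ dualEnergy P a₀ ρ U q G = e}

/-- `u`, with gradient `G`, is an optimizer in the definition of `ν_*(U, q, ρ)`. -/
def IsOptimizer {d : ℕ} (P : Measure (Config d)) (a₀ : Config d → Matrix (Fin d) (Fin d) ℝ)
    (ρ : ℝ) (U : Set (Space d)) (q : Space d) (u : Config d → ℝ)
    (G : Config d → Space d → Space d) : Prop :=
  IsH1 P U u G ∧
    ∀ v H, IsH1 P U v H → dualEnergy P a₀ ρ U q H ≤ dualEnergy P a₀ ρ U q G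

/-- The `σ`-algebra generated by `μ(U)` and `μ|_{U^c}`. -/
abbrev outerAlgebra {d : ℕ} (U : Set (Space d)) : MeasurableSpace (Config d) :=
  MeasurableSpace.comap (fun μ : Config d => (μ.1 U, μ.res Uᶜ)) inferInstance

/-- `A` is the matrix `ā_*(U, ρ)`: symmetric, `Id ≤ A ≤ Λ Id`, and
`ν_*(U, q, ρ) = 1/2 q · A⁻¹ q` for every `q`. -/
def IsDualMatrix {d : ℕ} (Λ : ℝ) (P : Measure (Config d))
    (a₀ : Config d → Matrix (Fin d) (Fin d) ℝ) (ρ : ℝ) (U : Set (Space d))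
    (A : Matrix (Fin d) (Fin d) ℝ) : Prop :=
  A.IsSymm ∧ (A - 1).PosSemidef ∧ (Λ • (1 : Matrix (Fin d) (Fin d) ℝ) - A).PosSemidef ∧
    ∀ q, BddAbove {e | ∃ u G, IsH1 P U u G ∧ dualEnergy P a₀ ρ U q G = e} ∧
      nuStar P a₀ ρ U q = 1 / 2 * bil A⁻¹ q q

/-- `∇ψ(μ, z) · (a(μ, z) - a(μ + δ_{x₁}, z)) ∇ψ(μ + δ_{x₁}, z)`, for `∇ψ = G`. -/
def firstIntegrand {d : ℕ} (a₀ : Config d → Matrix (Fin d) (Fin d) ℝ)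
    (G : Config d → Space d → Space d) (x₁ : Space d) (μ : Config d) (z : Space d) : ℝ :=
  bil (coeff a₀ μ z - coeff a₀ (μ.add (Config.point x₁)) z) (G μ z)
    (G (μ.add (Config.point x₁)) z)

/-- `∫ E[(ρ|U|)^{-1} ∫_U ∇ψ · (a - a^{1}) ∇ψ^{1} dμ] dx₁`, for `∇ψ = G`. -/
def firstCoeff {d : ℕ} (P : Measure (Config d)) (a₀ : Config d → Matrix (Fin d) (Fin d) ℝ)
    (ρ : ℝ) (U : Set (Space d)) (G : Config d → Space d → Space d) : ℝ :=
  ∫ x₁ : Space d, ∫ μ, (ρ * volume.real U)⁻¹ * ∫ z in U, firstIntegrand a₀ G x₁ μ z ∂μ.1 ∂P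

end

/-! Moving particles does not change their number, so the dual problem splits according to the
number of particles. Let `U` be a cube `□_m` and `W = □_{m+1}`; since `W` contains the
`1/2`-neighborhood of `U`, the coefficients at points of `U` only see particles of `W`. For every
`n` there is an elliptic equation for one tagged particle in `U` and `n` others in `W`, all
distributed according to Lebesgue measure (`level`, `lm`). Its solution, a limit of gradients `Γ`
(`USol`, `exists_uSol`), does not involve the density. A Poisson law of intensity `ρ` is a mixture
of these levels with explicit weights, and the same `Γ` gives the gradient of the maximizer for
every `ρ` (`USol.isSol_law`, `USol.red_eq`). Hence `q · ā_*(□_m, ρ)⁻¹ q = |U|⁻¹ e^{-ρ|W|} ∑ ρⁿ/n!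
c_n`, where `c_n` is the integral of `q · Γ` over level `n` (`pairing`). This is an entire function
of `ρ`. One derivative replaces `c_n` by `c_{n+1} - |W| c_n`, two by `c_{n+2} - 2|W| c_{n+1} + |W|²
c_n` (`hasDerivAt_avg`). The first difference is the expression that defines `c₁`
(`USol.pairing_succ_sub`, `USol.firstCoeff_eq`).

Everything rests on a bound of the second difference by `C |q|² |U| |W|ⁿ`, with `C` independent of
`n` and of the domain (`USol.quad`). Consider `Γ` with no, one or two additional particles `x`, `y`
as four vectors `g₀, gx, gy, gxy` of an `L²` space in which `x` and `y` range over `W`. Integrating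
over the position of an additional particle maps gradients to gradients, and fields orthogonal to
gradients to fields of the same kind (`Grad.addInt`, `Perp.addInt`); this is a duality based on the
Mecke formula. So each of the four vectors is orthogonal to each of the four fluxes
(`USol.orth_shifts`). The coefficient feels `x` only within distance `1/2` of the tagged particle,
which happens with relative measure at most `s² = |B_{1/2}|/|W|`. Energy estimates give `gx - g₀ =
O(s)` and `gxy - gx - gy + g₀ = O(s²)`, and then `O(s⁴)` for the second difference of the energy
(`Quad.abs_second_difference`). Since the total mass is `|U| |W|^{n+2}`, this is the required order.
One term looks like `O(s³)`; it is saved because, after averaging over `x` and `y`, it is a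
quadratic form of a single averaged field (`Quad.abs_mean`).

The functions of `ρ` thus have second derivatives bounded uniformly in `m`. They decrease in `m`, by
restriction of test functions to the tiles of a larger cube (`USol.avg_le_of_tiling`), hence
converge; the uniform Taylor bound passes to the limit and forces the derivatives to converge
(`exists_deriv_of_uniform_taylor`). The rest connects the levels with the definitions: Poisson laws,
given only through counts, are identified by characteristic functions (`IsPoissonLaw.eq_mixed`), and
a Poincaré inequality (`poincare`) turns limits of gradients into gradients of elements of `H¹`
(`exists_isH1`). -/

noncomputable section

/-! ### Configurations: measurability, addition and removal of particles. -/

namespace Config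

variable {d : ℕ}

theorem ext_val {μ ν : Config d} (h : μ.1 = ν.1) : μ = ν := Subtype.ext h

theorem add_comm (μ ν : Config d) : μ.add ν = ν.add μ := ext_val (_root_.add_comm _ _)

theorem add_assoc (μ ν η : Config d) : (μ.add ν).add η = μ.add (ν.add η) :=
  ext_val (_root_.add_assoc _ _ _)

theorem add_right_comm (μ ν η : Config d) : (μ.add ν).add η = (μ.add η).add ν :=
  ext_val (_root_.add_right_comm _ _ _)

/-- The empty configuration. -/
def empty : Config d := ⟨0, isConfig_zero⟩

theorem add_empty (μ : Config d) : μ.add empty = μ := ext_val (_root_.add_zero _)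

theorem empty_add (μ : Config d) : empty.add μ = μ := ext_val (_root_.zero_add _)

theorem add_apply (μ ν : Config d) (B : Set (Space d)) : (μ.add ν).1 B = μ.1 B + ν.1 B := rfl

theorem point_apply (x : Space d) {B : Set (Space d)} (hB : MeasurableSet B) :
    (point x).1 B = B.indicator 1 x := Measure.dirac_apply' x hB

theorem res_apply (μ : Config d) {U B : Set (Space d)} (hB : MeasurableSet B) :
    (μ.res U).1 B = μ.1 (B ∩ U) := Measure.restrict_apply hB

theorem shift_apply (μ : Config d) (x : Space d) {B : Set (Space d)} (hB : MeasurableSet B) :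
    (μ.shift x).1 B = μ.1 ((fun y => y - x) ⁻¹' B) :=
  Measure.map_apply (measurable_id.sub_const x) hB

theorem points_val {n : ℕ} (x : Fin n → Space d) :
    (points x).1 = ∑ i, Measure.dirac (x i) := rfl

theorem measurable_eval {B : Set (Space d)} (hB : MeasurableSet B) :
    Measurable fun μ : Config d => μ.1 B :=
  (Measure.measurable_coe hB).comp measurable_subtype_coe

theorem measurable_of_eval {α : Type*} [MeasurableSpace α] {f : α → Config d}
    (h : ∀ B, MeasurableSet B → Measurable fun a => (f a).1 B) : Measurable f :=
  (Measure.measurable_of_measurable_coe _ h).subtype_mk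

theorem measurable_add' : Measurable fun p : Config d × Config d => p.1.add p.2 :=
  measurable_of_eval fun _ hB =>
    ((measurable_eval hB).comp measurable_fst).add ((measurable_eval hB).comp measurable_snd)

theorem measurable_point : Measurable (point : Space d → Config d) :=
  Measure.measurable_dirac.subtype_mk

theorem _root_.Measurable.config_add {α : Type*} [MeasurableSpace α] {f g : α → Config d}
    (hf : Measurable f) (hg : Measurable g) : Measurable fun a => (f a).add (g a) :=
  measurable_add'.comp (hf.prodMk hg)

theorem _root_.Measurable.config_point {α : Type*} [MeasurableSpace α] {f : α → Space d}
    (hf : Measurable f) : Measurable fun a => point (f a) := measurable_point.comp hf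

theorem measurable_res {U : Set (Space d)} (hU : MeasurableSet U) :
    Measurable fun μ : Config d => μ.res U :=
  measurable_of_eval fun B hB => by
    simp only [res_apply _ hB]
    exact measurable_eval (hB.inter hU)

theorem measurable_shift (x : Space d) : Measurable fun μ : Config d => μ.shift x :=
  measurable_of_eval fun B hB => by
    simp only [shift_apply _ _ hB]
    exact measurable_eval ((measurable_id.sub_const x) hB)

theorem points_snoc {n : ℕ} (x : Fin n → Space d) (z : Space d) :
    points (Fin.snoc x z : Fin (n + 1) → Space d) = (points x).add (point z) := by
  apply ext_val
  simp only [points_val, add, point, Fin.sum_univ_castSucc, Fin.snoc_castSucc, Fin.snoc_last]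

theorem points_zero (x : Fin 0 → Space d) : points x = empty := ext_val (by simp [points_val, empty])

theorem res_add (μ ν : Config d) (U : Set (Space d)) :
    (μ.add ν).res U = (μ.res U).add (ν.res U) := ext_val (Measure.restrict_add _ _ _)

theorem res_point_of_mem {x : Space d} {U : Set (Space d)} (hx : x ∈ U) :
    (point x).res U = point x := by
  classical
  exact ext_val (by simp [res, point, restrict_dirac, hx])

theorem res_point_of_notMem {x : Space d} {U : Set (Space d)} (hx : x ∉ U) :
    (point x).res U = empty := by
  classical
  exact ext_val (by simp [res, point, empty, restrict_dirac, hx])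

theorem res_empty (U : Set (Space d)) : (empty : Config d).res U = empty :=
  ext_val (Measure.restrict_zero _)

theorem res_res {U V : Set (Space d)} (hU : MeasurableSet U) (μ : Config d) :
    (μ.res V).res U = μ.res (U ∩ V) := ext_val (Measure.restrict_restrict hU)

theorem res_add_res_compl {U : Set (Space d)} (hU : MeasurableSet U) (μ : Config d) :
    (μ.res U).add (μ.res Uᶜ) = μ := ext_val (Measure.restrict_add_restrict_compl hU)

theorem res_points_of_mem {n : ℕ} {x : Fin n → Space d} {U : Set (Space d)}
    (hx : ∀ i, x i ∈ U) : (points x).res U = points x := by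
  induction n with
  | zero => simp only [points_zero, res_empty]
  | succ n ih =>
    rw [← Fin.snoc_init_self x, points_snoc, res_add, ih (x := Fin.init x) (fun i => hx _),
      res_point_of_mem (hx _)]

theorem points_apply_of_mem {n : ℕ} {x : Fin n → Space d} {U : Set (Space d)}
    (hU : MeasurableSet U) (hx : ∀ i, x i ∈ U) : (points x).1 U = n := by
  simp [points_val, Measure.dirac_apply' _ hU, hx]

/-- A Dirac mass is finite on every set, so it cancels even where `μ` has infinite mass. This makes
`μ - δ_x`, and with it the gradient, unambiguous. -/
theorem add_point_inj {μ ν : Config d} {x : Space d} (h : μ.add (point x) = ν.add (point x)) :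
    μ = ν := by
  apply ext_val
  ext B hB
  have := congrArg (fun η : Config d => η.1 B) h
  simp only [add_apply] at this
  exact (ENNReal.add_left_inj (measure_ne_top (Measure.dirac x) B)).1 this

/-- A configuration with finite mass in `U` has finitely many particles there. -/
theorem exists_points {μ : Config d} {U : Set (Space d)} (hU : MeasurableSet U)
    (h : μ.1 U ≠ ⊤) : ∃ (n : ℕ) (x : Fin n → Space d), (∀ i, x i ∈ U) ∧ μ.res U = points x ∧
      μ.1 U = n := by
  classical
  obtain ⟨m, hm, ι, _, y, rfl⟩ := μ
  have hfin : {i | y i ∈ U}.Finite := by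
    by_contra hinf
    apply h
    change Measure.sum _ U = ⊤
    rw [Measure.sum_apply _ hU]
    have := Set.infinite_coe_iff.2 hinf
    rw [eq_top_iff, ← ENNReal.tsum_const_eq_top_of_ne_zero (α := {i | y i ∈ U})
      (c := 1) one_ne_zero]
    refine le_trans (le_of_eq (tsum_congr fun i => ?_))
      (ENNReal.tsum_comp_le_tsum_of_injective Subtype.val_injective _)
    rw [Measure.dirac_apply' _ hU,
      Set.indicator_of_mem (show y i ∈ U from i.2) (1 : Space d → ℝ≥0∞)]
    rfl
  have := hfin.fintype
  let e := (Fintype.equivFin {i | y i ∈ U})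
  have key : (Measure.sum fun i => Measure.dirac (y i)).restrict U =
      ∑ j, Measure.dirac (y (e.symm j)) := by
    rw [Measure.restrict_sum_of_countable]
    ext s hs
    rw [Measure.sum_apply _ hs, Measure.coe_finsetSum, Finset.sum_apply,
      e.symm.sum_comp (fun i => Measure.dirac (y i) s), ← tsum_fintype (L := .unconditional _)]
    refine Eq.trans ?_ (tsum_subtype {i | y i ∈ U} (fun i => Measure.dirac (y i) s)).symm
    refine tsum_congr fun i => ?_
    rw [restrict_dirac]
    by_cases h : y i ∈ U <;> simp [h]
  refine ⟨_, fun j => y (e.symm j), fun j => (e.symm j).2, ext_val key, ?_⟩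
  change (Measure.sum fun i => Measure.dirac (y i)) U = _
  rw [← Measure.restrict_apply_self, key]
  simp only [Measure.coe_finsetSum, Finset.sum_apply, Measure.dirac_apply' _ hU]
  rw [Finset.sum_congr rfl fun j _ =>
    Set.indicator_of_mem (show y (e.symm j) ∈ U from (e.symm j).2) (1 : Space d → ℝ≥0∞)]
  simp

theorem sum_dirac_erase {ι : Type*} (y : ι → Space d) (i : ι) :
    (Measure.sum fun i => Measure.dirac (y i)) =
      (Measure.sum fun j : {j // j ≠ i} => Measure.dirac (y j)) + Measure.dirac (y i) := by
  classical
  ext s hs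
  rw [Measure.add_apply, Measure.sum_apply _ hs, Measure.sum_apply _ hs]
  have h1 := ENNReal.tsum_eq_add_tsum_ite (f := fun j => Measure.dirac (y j) s) i
  have h2 := tsum_subtype {j | j ≠ i} (fun j => Measure.dirac (y j) s)
  rw [h1, _root_.add_comm]
  congr 1
  refine Eq.trans (tsum_congr fun j => ?_) h2.symm
  by_cases hj : j = i
  · simp [hj]
  · rw [if_neg hj, Set.indicator_of_mem (show j ∈ {j | j ≠ i} from hj)]

/-- Replaces the existence of a decomposition by a condition on masses, which can be shown to be
measurable in `(μ, x)`. -/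
theorem exists_add_point_iff {μ : Config d} {x : Space d} :
    (∃ ν : Config d, μ = ν.add (point x)) ↔ 1 ≤ μ.1 {x} := by
  constructor
  · rintro ⟨ν, rfl⟩
    rw [add_apply, point_apply x (measurableSet_singleton x)]
    simp
  · intro h
    obtain ⟨hm, ι, hι, y, hy⟩ := μ.2
    have h' : ∃ i, y i = x := by
      by_contra! hne
      rw [hy, Measure.sum_apply _ (measurableSet_singleton x)] at h
      simp [hne] at h
    obtain ⟨i, hi⟩ := h'
    have key := sum_dirac_erase y i
    rw [← hy, hi] at key
    -- The remaining sum is dominated by `μ`, hence `σ`-finite, as needed for it to be a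
    -- configuration.
    have hsf : SigmaFinite (Measure.sum fun j : {j // j ≠ i} => Measure.dirac (y j)) := by
      refine Measure.sigmaFinite_of_le μ.1 ?_
      rw [key]
      exact Measure.le_add_right le_rfl
    exact ⟨⟨_, hsf, {j // j ≠ i}, inferInstance, fun j => y j, rfl⟩, ext_val key⟩

open Classical in
/-- The configuration `μ - δ_x`, if `μ` has a particle at `x`. -/
def rem (x : Space d) (μ : Config d) : Config d :=
  if h : ∃ ν : Config d, μ = ν.add (point x) then h.choose else μ

theorem rem_add_point (x : Space d) (μ : Config d) : rem x (μ.add (point x)) = μ := by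
  have h : ∃ ν : Config d, μ.add (point x) = ν.add (point x) := ⟨μ, rfl⟩
  rw [rem, dif_pos h]
  exact (add_point_inj h.choose_spec).symm

/-- The particles of `μ` in `W`, as a kernel; configurations with infinitely many particles in `W`
are sent to `0`. -/
def kernel (W : Set (Space d)) (hW : MeasurableSet W) :
    ProbabilityTheory.Kernel (Config d) (Space d) :=
  open Classical in
  ⟨fun μ => if μ.1 W = ⊤ then 0 else μ.1.restrict W,
    Measurable.ite ((measurable_eval hW) (measurableSet_singleton ⊤)) measurable_const
      (Measure.measurable_of_measurable_coe _ fun B hB => by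
        simp only [Measure.restrict_apply hB]
        exact measurable_eval (hB.inter hW))⟩

theorem kernel_apply {W : Set (Space d)} (hW : MeasurableSet W) {μ : Config d}
    (h : μ.1 W ≠ ⊤) : kernel W hW μ = μ.1.restrict W := if_neg h

theorem kernel_apply_top {W : Set (Space d)} (hW : MeasurableSet W) {μ : Config d}
    (h : μ.1 W = ⊤) : kernel W hW μ = 0 := if_pos h

/-- The masses are not bounded uniformly in `μ`. Cutting according to the number of particles in `W`
gives countably many finite kernels; the infinite case is harmless because the kernel vanishes
there. -/
instance (W : Set (Space d)) (hW : MeasurableSet W) :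
    ProbabilityTheory.IsSFiniteKernel (kernel W hW) := by
  classical
  let S : ℕ → Set (Config d) := fun n => {μ | μ.1 W = n}
  have hS : ∀ n, MeasurableSet (S n) := fun n => (measurable_eval hW) (measurableSet_singleton _)
  refine ⟨⟨fun n => ProbabilityTheory.Kernel.piecewise (hS n) (kernel W hW) 0, fun n => ?_, ?_⟩⟩
  · refine ⟨⟨n, by simp, fun μ => ?_⟩⟩
    rw [ProbabilityTheory.Kernel.piecewise_apply]
    split_ifs with h
    · rw [kernel_apply hW (by rw [h]; simp), Measure.restrict_apply_univ, h]
    · simp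
  · ext μ B hB
    rw [ProbabilityTheory.Kernel.sum_apply' _ _ hB]
    by_cases h : μ.1 W = ⊤
    · have h0 := kernel_apply_top hW h
      rw [h0]
      symm
      simp only [ENNReal.tsum_eq_zero, Measure.coe_zero, Pi.zero_apply]
      intro n
      rw [ProbabilityTheory.Kernel.piecewise_apply, h0]
      split_ifs <;> simp
    · obtain ⟨n, x, -, -, hn⟩ := exists_points hW h
      rw [tsum_eq_single n]
      · rw [ProbabilityTheory.Kernel.piecewise_apply, if_pos (show μ ∈ S n from hn)]
      · intro m hm
        rw [ProbabilityTheory.Kernel.piecewise_apply, if_neg]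
        · simp
        · intro h'
          exact hm (by exact_mod_cast (h'.symm.trans hn))

/-- The set `{x}` varies with the argument, so the mass is written as a kernel integral of the
indicator function of the diagonal. -/
theorem measurable_mass {W : Set (Space d)} (hW : MeasurableSet W) :
    Measurable fun p : Config d × Space d => kernel W hW p.1 {p.2} := by
  have h1 : Measurable fun q : (Config d × Space d) × Space d =>
      ({q : (Config d × Space d) × Space d | q.2 = q.1.2}).indicator (fun _ => (1 : ℝ≥0∞)) q :=
    measurable_const.indicator (measurableSet_eq_fun measurable_snd measurable_fst.snd)
  have h2 := h1.lintegral_kernel_prod_right' (κ := (kernel W hW).comap Prod.fst measurable_fst)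
  convert h2 using 1
  funext p
  rw [← lintegral_indicator_one (measurableSet_singleton p.2)]
  rfl

/-- The removal of a particle in `W`, as a measurable map. -/
def remIn (W : Set (Space d)) (hW : MeasurableSet W) (p : Config d × Space d) : Config d :=
  open Classical in
  if 1 ≤ kernel W hW p.1 {p.2} then rem p.2 p.1 else p.1

/-- Although `rem` is defined by a choice, its value on a Borel set is explicit: the indicator of
the removed particle is subtracted. -/
theorem measurable_remIn {W : Set (Space d)} (hW : MeasurableSet W) :
    Measurable (remIn W hW) := by
  classical
  have hS : MeasurableSet {p : Config d × Space d | 1 ≤ kernel W hW p.1 {p.2}} :=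
    measurableSet_le measurable_const (measurable_mass hW)
  refine measurable_of_eval fun B hB => ?_
  have : (fun p : Config d × Space d => (remIn W hW p).1 B) = fun p =>
      if 1 ≤ kernel W hW p.1 {p.2} then
        p.1.1 B - B.indicator 1 p.2 else p.1.1 B := by
    funext p
    rw [remIn]
    by_cases hp : 1 ≤ kernel W hW p.1 {p.2}
    · rw [if_pos hp, if_pos hp]
      obtain ⟨ν, hν⟩ : ∃ ν : Config d, p.1 = ν.add (point p.2) := by
        rw [exists_add_point_iff]
        refine hp.trans ?_
        by_cases h : p.1.1 W = ⊤
        · rw [kernel_apply_top hW h]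
          simp
        · rw [kernel_apply hW h]
          exact Measure.restrict_apply_le _ _
      rw [hν, rem_add_point, add_apply, point_apply _ hB, ENNReal.add_sub_cancel_right]
      by_cases h : p.2 ∈ B <;> simp [h]
    · rw [if_neg hp, if_neg hp]
  rw [this]
  exact Measurable.ite hS (((measurable_eval hB).comp measurable_fst).sub
    ((measurable_one.indicator hB).comp measurable_snd)) ((measurable_eval hB).comp measurable_fst)

theorem remIn_add_point {W : Set (Space d)} (hW : MeasurableSet W) {μ : Config d}
    (h : μ.1 W ≠ ⊤) {x : Space d} (hx : x ∈ W) : remIn W hW (μ.add (point x), x) = μ := by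
  have h1 : (μ.add (point x)).1 W ≠ ⊤ := by
    rw [add_apply]
    exact ENNReal.add_ne_top.2 ⟨h, measure_ne_top (Measure.dirac x) W⟩
  have : 1 ≤ kernel W hW (μ.add (point x)) {x} := by
    rw [kernel_apply hW h1, Measure.restrict_apply (measurableSet_singleton x),
      Set.inter_eq_left.2 (by simpa using hx)]
    exact exists_add_point_iff.1 ⟨μ, rfl⟩
  simp only [remIn]
  rw [if_pos this, rem_add_point]

/-- Joint measurability of `(μ, x) ↦ μ|_W - x`, for configurations which are finite on `W`. -/
def shiftIn (W : Set (Space d)) (p : Config d × Space d) : Config d :=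
  open Classical in
  if p.1.1 W ≠ ⊤ then (p.1.res W).shift p.2 else empty

theorem measurable_shiftIn {W : Set (Space d)} (hW : MeasurableSet W) :
    Measurable (shiftIn W) := by
  classical
  refine measurable_of_eval fun B hB => ?_
  have h1 : Measurable fun q : (Config d × Space d) × Space d =>
      B.indicator (1 : Space d → ℝ≥0∞) (q.2 - q.1.2) :=
    (measurable_one.indicator hB).comp (measurable_snd.sub measurable_fst.snd)
  have h2 := h1.lintegral_kernel_prod_right' (κ := (kernel W hW).comap Prod.fst measurable_fst)
  convert h2 using 1
  funext p
  change _ = ∫⁻ y, _ ∂(kernel W hW p.1)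
  by_cases h : p.1.1 W = ⊤
  · rw [kernel_apply_top hW h, shiftIn, if_neg (by simpa using h)]
    simp [empty]
  · rw [kernel_apply hW h, shiftIn, if_pos h, shift_apply _ _ hB,
      ← lintegral_indicator_one (show MeasurableSet ((fun y => y - p.2) ⁻¹' B) from
        (measurable_id.sub_const p.2) hB)]
    rfl

end Config

/-- The gradient in reduced coordinates: `∇f(μ + δ_z, z)`. -/
def rgrad {d : ℕ} (f : Config d → ℝ) (μ : Config d) (z : Space d) : Space d :=
  WithLp.toLp 2 fun k =>
    deriv (fun t : ℝ => f (μ.add (Config.point (z + t • EuclideanSpace.single k 1)))) 0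

/-- From here on a particle `z` of a configuration is described by the pair (other particles, `z`),
which removes the choice in `grad`. -/
theorem grad_add_point {d : ℕ} (f : Config d → ℝ) (μ : Config d) (z : Space d) :
    grad f (μ.add (Config.point z)) z = rgrad f μ z := by
  have h : ∃ ν : Config d, μ.add (Config.point z) = ν.add (Config.point z) := ⟨μ, rfl⟩
  rw [grad, dif_pos h, ← Config.add_point_inj h.choose_spec]
  rfl

end

/-! ### Levels with a fixed number of particles, Poisson processes on bounded sets, the Mecke
formula. -/

noncomputable section

variable {d : ℕ}

namespace Config

/-- The image of the Lebesgue measure on `W^n` under `x ↦ ∑ δ_{x_i}`. -/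
def level (W : Set (Space d)) : ℕ → Measure (Config d)
  | 0 => Measure.dirac empty
  | n + 1 => ((level W n).prod (volume.restrict W)).map fun p => p.1.add (point p.2)

theorem measurable_add_point : Measurable fun p : Config d × Space d => p.1.add (point p.2) :=
  measurable_fst.config_add measurable_snd.config_point

instance instSFiniteLevel (W : Set (Space d)) (n : ℕ) : SFinite (level W n) := by
  induction n with
  | zero => exact (inferInstance : SFinite (Measure.dirac (empty : Config d)))
  | succ n ih => simp only [level]; infer_instance

theorem lintegral_level_succ (W : Set (Space d)) (n : ℕ) {F : Config d → ℝ≥0∞}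
    (hF : Measurable F) : ∫⁻ μ, F μ ∂(level W (n + 1)) =
      ∫⁻ μ, ∫⁻ x in W, F (μ.add (point x)) ∂volume ∂(level W n) := by
  rw [level, lintegral_map hF measurable_add_point]
  exact lintegral_prod _ (hF.comp measurable_add_point).aemeasurable

theorem level_univ (W : Set (Space d)) (n : ℕ) : level W n Set.univ = volume W ^ n := by
  induction n with
  | zero => simp [level]
  | succ n ih =>
    rw [← setLIntegral_one, Measure.restrict_univ, lintegral_level_succ _ _ measurable_const]
    simp [ih, pow_succ, mul_comm]

theorem isFiniteMeasure_level {W : Set (Space d)} (hv : volume W ≠ ⊤) (n : ℕ) :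
    IsFiniteMeasure (level W n) :=
  ⟨by rw [level_univ]; exact ENNReal.pow_lt_top hv.lt_top⟩

theorem ae_level {W : Set (Space d)} (hW : MeasurableSet W) (n : ℕ) :
    ∀ᵐ μ ∂(level W n), μ.1 W = (n : ℝ≥0∞) ∧ μ.1 Wᶜ = 0 := by
  have hm : MeasurableSet {μ : Config d | μ.1 W = (n : ℝ≥0∞) ∧ μ.1 Wᶜ = 0} :=
    ((measurable_eval hW) (measurableSet_singleton _)).inter
      ((measurable_eval hW.compl) (measurableSet_singleton _))
  induction n with
  | zero => exact (ae_dirac_iff hm).2 (by simp [empty])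
  | succ n ih =>
    have hm' : MeasurableSet {μ : Config d | μ.1 W = (n : ℝ≥0∞) ∧ μ.1 Wᶜ = 0} :=
      ((measurable_eval hW) (measurableSet_singleton _)).inter
        ((measurable_eval hW.compl) (measurableSet_singleton _))
    rw [level, ae_map_iff measurable_add_point.aemeasurable hm]
    refine (Measure.ae_prod_iff_ae_ae (measurable_add_point hm)).2 ?_
    filter_upwards [ih hm'] with μ hμ
    filter_upwards [ae_restrict_mem hW] with x hx
    simp [add_apply, point_apply _ hW, point_apply _ hW.compl, hx, hμ.1, hμ.2]

theorem kernel_add_point {W : Set (Space d)} (hW : MeasurableSet W) {μ : Config d}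
    (h : μ.1 W ≠ ⊤) {x : Space d} (hx : x ∈ W) :
    kernel W hW (μ.add (point x)) = kernel W hW μ + Measure.dirac x := by
  classical
  have h1 : (μ.add (point x)).1 W ≠ ⊤ := by
    rw [add_apply]
    exact ENNReal.add_ne_top.2 ⟨h, measure_ne_top (Measure.dirac x) W⟩
  rw [kernel_apply hW h, kernel_apply hW h1]
  change (μ.1 + Measure.dirac x).restrict W = _
  rw [Measure.restrict_add, restrict_dirac, if_pos hx]

theorem kernel_add_of_eq_zero {W : Set (Space d)} (hW : MeasurableSet W) {μ η : Config d}
    (h : η.1 W = 0) : kernel W hW (μ.add η) = kernel W hW μ := by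
  by_cases hμ : μ.1 W = ⊤
  · rw [kernel_apply_top hW hμ, kernel_apply_top hW (by rw [add_apply, hμ]; simp)]
  · rw [kernel_apply hW hμ, kernel_apply hW (by rw [add_apply, h]; simpa using hμ)]
    change (μ.1 + η.1).restrict W = _
    rw [Measure.restrict_add, Measure.restrict_eq_zero.2 h, add_zero]

theorem measurable_lintegral_kernel {W : Set (Space d)} (hW : MeasurableSet W)
    {F : Config d × Space d → ℝ≥0∞} (hF : Measurable F) :
    Measurable fun μ => ∫⁻ z, F (μ, z) ∂(kernel W hW μ) :=
  hF.lintegral_kernel_prod_right'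

/-- The Mecke formula for a fixed number of particles. -/
theorem level_mecke {W : Set (Space d)} (hW : MeasurableSet W) (n : ℕ)
    {F : Config d × Space d → ℝ≥0∞} (hF : Measurable F) :
    ∫⁻ μ, ∫⁻ z, F (μ, z) ∂(kernel W hW μ) ∂(level W (n + 1)) =
      (n + 1) * ∫⁻ μ, ∫⁻ z in W, F (μ.add (point z), z) ∂volume ∂(level W n) := by
  have hF2 : Measurable fun q : Config d × Space d => F (q.1.add (point q.2), q.2) :=
    hF.comp (measurable_add_point.prodMk measurable_snd)
  -- In a configuration with `n + 1` particles the selected one is either the last, which gives one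
  -- copy of the right-hand side, or one of the first `n`, where the formula for `n` applies with
  -- the last particle frozen.
  have key : ∀ (n : ℕ) (F : Config d × Space d → ℝ≥0∞), Measurable F →
      (∫⁻ μ, ∫⁻ x in W, ∫⁻ z, F (μ.add (point x), z) ∂(kernel W hW μ) ∂volume ∂(level W n) =
        n * ∫⁻ μ, ∫⁻ z in W, F (μ.add (point z), z) ∂volume ∂(level W n)) →
      ∫⁻ μ, ∫⁻ z, F (μ, z) ∂(kernel W hW μ) ∂(level W (n + 1)) =
      (n + 1) * ∫⁻ μ, ∫⁻ z in W, F (μ.add (point z), z) ∂volume ∂(level W n) := by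
    intro n F hF h
    have hF2 : Measurable fun q : Config d × Space d => F (q.1.add (point q.2), q.2) :=
      hF.comp (measurable_add_point.prodMk measurable_snd)
    rw [lintegral_level_succ _ _ (measurable_lintegral_kernel hW hF)]
    have h1 : ∫⁻ μ, ∫⁻ x in W, ∫⁻ z, F (μ.add (point x), z) ∂(kernel W hW (μ.add (point x)))
          ∂volume ∂(level W n) =
        ∫⁻ μ, ((∫⁻ x in W, ∫⁻ z, F (μ.add (point x), z) ∂(kernel W hW μ)) +
          ∫⁻ z in W, F (μ.add (point z), z)) ∂(level W n) := by
      refine lintegral_congr_ae ?_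
      filter_upwards [ae_level hW n] with μ hμ
      have h2 : Measurable fun z => F (μ.add (point z), z) := hF2.comp measurable_prodMk_left
      rw [← lintegral_add_right _ h2]
      refine setLIntegral_congr_fun hW fun x hx => ?_
      rw [kernel_add_point hW (by rw [hμ.1]; simp) hx, lintegral_add_measure,
        lintegral_dirac]
    rw [h1, lintegral_add_right _ hF2.lintegral_prod_right', h, add_mul, one_mul]
  induction n generalizing F with
  | zero =>
    refine key 0 F hF ?_
    have : ∫⁻ x in W, ∫⁻ z, F ((empty : Config d).add (point x), z) ∂(kernel W hW empty) = 0 := by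
      rw [kernel_apply hW (by simp [empty])]
      simp [empty]
    simp only [level]
    rw [lintegral_dirac']
    · simpa using this
    · have h3 : Measurable fun q : (Config d × Space d) × Space d =>
          F (q.1.1.add (point q.1.2), q.2) :=
        hF.comp ((measurable_add_point.comp measurable_fst).prodMk measurable_snd)
      exact (h3.lintegral_kernel_prod_right'
        (κ := (kernel W hW).comap Prod.fst measurable_fst)).lintegral_prod_right'
  | succ n ih =>
    refine key (n + 1) F hF ?_
    have h3 : Measurable fun q : (Config d × Space d) × Space d =>
        F (q.1.1.add (point q.1.2), q.2) :=
      hF.comp ((measurable_add_point.comp measurable_fst).prodMk measurable_snd)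
    have h4 : Measurable fun q : (Config d × Space d) × Space d =>
        F ((q.1.1.add (point q.1.2)).add (point q.2), q.2) :=
      hF.comp (((measurable_add_point.comp measurable_fst).config_add
        measurable_snd.config_point).prodMk measurable_snd)
    calc ∫⁻ μ, ∫⁻ x in W, ∫⁻ z, F (μ.add (point x), z) ∂(kernel W hW μ) ∂volume ∂(level W (n + 1))
        = ∫⁻ x in W, ∫⁻ μ, ∫⁻ z, F (μ.add (point x), z) ∂(kernel W hW μ) ∂(level W (n + 1))
            ∂volume := lintegral_lintegral_swap (h3.lintegral_kernel_prod_right'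
              (κ := (kernel W hW).comap Prod.fst measurable_fst)).aemeasurable
      _ = ∫⁻ x in W, (n + 1) * ∫⁻ μ, ∫⁻ z in W, F ((μ.add (point x)).add (point z), z) ∂volume
            ∂(level W n) ∂volume := by
          refine lintegral_congr fun x => ?_
          rw [ih (F := fun q => F (q.1.add (point x), q.2))]
          · simp only [add_right_comm _ (point x)]
          · exact hF.comp ((measurable_fst.config_add measurable_const).prodMk measurable_snd)
          · exact hF.comp (((measurable_fst.config_add measurable_snd.config_point).config_add
              measurable_const).prodMk measurable_snd)
      _ = (n + 1) * ∫⁻ x in W, ∫⁻ μ, ∫⁻ z in W, F ((μ.add (point x)).add (point z), z) ∂volume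
            ∂(level W n) ∂volume := lintegral_const_mul' _ _ (by simp)
      _ = (n + 1) * ∫⁻ μ, ∫⁻ x in W, ∫⁻ z in W, F ((μ.add (point x)).add (point z), z) ∂volume
            ∂volume ∂(level W n) := by
          rw [← lintegral_lintegral_swap]
          exact h4.lintegral_prod_right'.aemeasurable
      _ = _ := by
          rw [lintegral_level_succ _ _ hF2.lintegral_prod_right']
          push_cast
          rfl

/-- The weights of the Poisson distribution of parameter `ρ |W|`, relative to `|W|^n`. -/
def weight (ρ : ℝ) (W : Set (Space d)) (n : ℕ) : ℝ :=
  Real.exp (-(ρ * volume.real W)) * (ρ ^ n / n.factorial)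

theorem weight_nonneg {ρ : ℝ} (hρ : 0 ≤ ρ) (W : Set (Space d)) (n : ℕ) : 0 ≤ weight ρ W n := by
  unfold weight; positivity

theorem weight_pos {ρ : ℝ} (hρ : 0 < ρ) (W : Set (Space d)) (n : ℕ) : 0 < weight ρ W n := by
  unfold weight; positivity

/-- The factor `n + 1`, which counts the choices of a particle, is traded for the intensity and a
shift of the level. This is the source of the Mecke formula. -/
theorem weight_succ (ρ : ℝ) (W : Set (Space d)) (n : ℕ) :
    weight ρ W (n + 1) * (n + 1) = ρ * weight ρ W n := by
  unfold weight
  rw [Nat.factorial_succ]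
  push_cast
  field_simp
  ring

/-- The Poisson point process of intensity `ρ` on `W`. -/
def poissonOn (ρ : ℝ) (W : Set (Space d)) : Measure (Config d) :=
  Measure.sum fun n => ENNReal.ofReal (weight ρ W n) • level W n

instance (ρ : ℝ) (W : Set (Space d)) : SFinite (poissonOn ρ W) := by
  unfold poissonOn; infer_instance

theorem lintegral_poissonOn (ρ : ℝ) (W : Set (Space d)) (F : Config d → ℝ≥0∞) :
    ∫⁻ μ, F μ ∂(poissonOn ρ W) = ∑' n, ENNReal.ofReal (weight ρ W n) * ∫⁻ μ, F μ ∂(level W n) := by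
  simp [poissonOn, lintegral_sum_measure]

theorem isProbabilityMeasure_poissonOn {ρ : ℝ} (hρ : 0 ≤ ρ) {W : Set (Space d)}
    (hv : volume W ≠ ⊤) : IsProbabilityMeasure (poissonOn ρ W) := by
  constructor
  rw [← setLIntegral_one, Measure.restrict_univ, lintegral_poissonOn]
  have h1 : ∀ n, ENNReal.ofReal (weight ρ W n) * ∫⁻ _, 1 ∂(level W n) =
      ENNReal.ofReal (Real.exp (-(ρ * volume.real W)) *
        ((ρ * volume.real W) ^ n / n.factorial)) := by
    intro n
    rw [lintegral_one, level_univ, ← ENNReal.ofReal_toReal hv,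
      ← ENNReal.ofReal_pow ENNReal.toReal_nonneg, ← ENNReal.ofReal_mul (weight_nonneg hρ W n)]
    congr 1
    unfold weight
    rw [mul_pow, Measure.real]
    ring
  have h2 := (NormedSpace.expSeries_div_hasSum_exp (ρ * volume.real W)).mul_left
    (Real.exp (-(ρ * volume.real W)))
  rw [← Real.exp_eq_exp_ℝ, ← Real.exp_add, neg_add_cancel, Real.exp_zero] at h2
  simp only [h1]
  rw [← ENNReal.ofReal_tsum_of_nonneg (fun n => by positivity) h2.summable, h2.tsum_eq,
    ENNReal.ofReal_one]

theorem ae_poissonOn {ρ : ℝ} {W : Set (Space d)} (hW : MeasurableSet W) :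
    ∀ᵐ μ ∂(poissonOn ρ W), μ.1 W ≠ ⊤ ∧ μ.1 Wᶜ = 0 := by
  rw [poissonOn, Measure.ae_sum_iff]
  intro n
  refine Measure.ae_smul_measure ?_ _
  filter_upwards [ae_level hW n] with μ hμ
  exact ⟨by rw [hμ.1]; simp, hμ.2⟩

theorem poissonOn_mecke {ρ : ℝ} (hρ : 0 ≤ ρ) {W : Set (Space d)} (hW : MeasurableSet W)
    {F : Config d × Space d → ℝ≥0∞} (hF : Measurable F) :
    ∫⁻ μ, ∫⁻ z, F (μ, z) ∂(kernel W hW μ) ∂(poissonOn ρ W) =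
      ENNReal.ofReal ρ * ∫⁻ μ, ∫⁻ z in W, F (μ.add (point z), z) ∂volume ∂(poissonOn ρ W) := by
  -- The empty level contributes nothing; level `n + 1` on the left corresponds to level `n` on the
  -- right.
  rw [lintegral_poissonOn, lintegral_poissonOn, tsum_eq_zero_add' ENNReal.summable]
  have h0 : ∫⁻ μ, ∫⁻ z, F (μ, z) ∂(kernel W hW μ) ∂(level W 0) = 0 := by
    simp only [level]
    rw [lintegral_dirac' _ (measurable_lintegral_kernel hW hF), kernel_apply hW (by simp [empty])]
    simp [empty]
  rw [h0, mul_zero, zero_add, ← ENNReal.tsum_mul_left]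
  refine tsum_congr fun n => ?_
  rw [level_mecke hW n hF, ← mul_assoc, ← mul_assoc, ← ENNReal.ofReal_mul hρ, ← weight_succ,
    ENNReal.ofReal_mul (weight_nonneg hρ W _)]
  congr 2
  rw [ENNReal.ofReal_add (by positivity) zero_le_one]
  simp

/-- The superposition of a Poisson process on `W` and an independent configuration of law `κ`. -/
def mixed (ρ : ℝ) (W : Set (Space d)) (κ : Measure (Config d)) : Measure (Config d) :=
  ((poissonOn ρ W).prod κ).map fun p => p.1.add p.2

/-- `Q` satisfies the Mecke formula on `U`, with intensity `ρ`. -/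
structure Mecke (ρ : ℝ) (U : Set (Space d)) (hU : MeasurableSet U) (Q : Measure (Config d)) :
    Prop where
  fin : ∀ᵐ μ ∂Q, μ.1 U ≠ ⊤
  eq : ∀ F : Config d × Space d → ℝ≥0∞, Measurable F →
    ∫⁻ μ, ∫⁻ z, F (μ, z) ∂(kernel U hU μ) ∂Q =
      ENNReal.ofReal ρ * ∫⁻ μ, ∫⁻ z in U, F (μ.add (point z), z) ∂volume ∂Q

/-- The particles of `κ` are frozen: they are not in `W`, so the kernel does not see them and the
formula for `poissonOn` applies. -/
theorem mixed_mecke {ρ : ℝ} (hρ : 0 ≤ ρ) {W : Set (Space d)} (hW : MeasurableSet W)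
    {κ : Measure (Config d)} [SFinite κ] (hκ : ∀ᵐ η ∂κ, η.1 W = 0) :
    Mecke ρ W hW (mixed ρ W κ) := by
  have hm : MeasurableSet {μ : Config d | μ.1 W ≠ ⊤} :=
    (measurable_eval hW) (measurableSet_singleton ⊤).compl
  refine ⟨?_, fun F hF => ?_⟩
  · rw [mixed, ae_map_iff measurable_add'.aemeasurable hm]
    refine (Measure.ae_prod_iff_ae_ae (measurable_add' hm)).2 ?_
    filter_upwards [ae_poissonOn hW] with μ hμ
    filter_upwards [hκ] with η hη
    simpa [add_apply, hη] using hμ.1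
  · have hF2 : Measurable fun q : Config d × Space d => F (q.1.add (point q.2), q.2) :=
      hF.comp (measurable_add_point.prodMk measurable_snd)
    rw [mixed, lintegral_map (measurable_lintegral_kernel hW hF) measurable_add',
      lintegral_map hF2.lintegral_prod_right' measurable_add']
    refine (lintegral_prod_symm' _ ((measurable_lintegral_kernel hW hF).comp
      measurable_add')).trans (Eq.trans ?_ (congrArg _ (lintegral_prod_symm' _
        (hF2.lintegral_prod_right'.comp measurable_add')).symm))
    rw [← lintegral_const_mul' _ _ ENNReal.ofReal_ne_top]
    refine lintegral_congr_ae ?_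
    filter_upwards [hκ] with η hη
    simp only [Function.comp_def, kernel_add_of_eq_zero hW hη]
    rw [poissonOn_mecke hρ hW (F := fun q => F (q.1.add η, q.2))]
    · simp only [add_right_comm _ η]
    · exact hF.comp ((measurable_fst.config_add measurable_const).prodMk measurable_snd)

theorem kernel_restrict {U W : Set (Space d)} (hU : MeasurableSet U) (hW : MeasurableSet W)
    (hUW : U ⊆ W) {μ : Config d} (h : μ.1 W ≠ ⊤) :
    kernel U hU μ = (kernel W hW μ).restrict U := by
  rw [kernel_apply hW h, kernel_apply hU (measure_ne_top_of_subset hUW h),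
    Measure.restrict_restrict hU, Set.inter_eq_left.2 hUW]

theorem Mecke.mono {ρ : ℝ} {U W : Set (Space d)} {hW : MeasurableSet W}
    {Q : Measure (Config d)} (h : Mecke ρ W hW Q) (hU : MeasurableSet U) (hUW : U ⊆ W) :
    Mecke ρ U hU Q := by
  refine ⟨h.fin.mono fun μ hμ => measure_ne_top_of_subset hUW hμ, fun F hF => ?_⟩
  have h1 := h.eq (fun p => U.indicator (fun _ => F p) p.2)
    (hF.indicator (measurable_snd hU) : Measurable ((Prod.snd ⁻¹' U).indicator F))
  have h2 : ∫⁻ μ, ∫⁻ z, F (μ, z) ∂(kernel U hU μ) ∂Q =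
      ∫⁻ μ, ∫⁻ z, U.indicator (fun _ => F (μ, z)) z ∂(kernel W hW μ) ∂Q := by
    refine lintegral_congr_ae ?_
    filter_upwards [h.fin] with μ hμ
    rw [kernel_restrict hU hW hUW hμ, ← lintegral_indicator hU]
    rfl
  rw [h2, h1]
  congr 1
  refine lintegral_congr fun μ => ?_
  rw [← lintegral_indicator hU, ← lintegral_indicator hW]
  refine lintegral_congr fun z => ?_
  by_cases hz : z ∈ U
  · simp [hz, hUW hz]
  · simp [hz]

end Config

end

/-! ### Characteristic functions of counts; stationarity and spatial independence of Poisson laws.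
-/

noncomputable section

variable {d : ℕ}

namespace Config

/-- `exp (i ∑ t_j μ(B_j))`. -/
def phase {ι : Type*} [Fintype ι] (B : ι → Set (Space d)) (t : ι → ℝ) (μ : Config d) : ℂ :=
  Complex.exp ((∑ j, t j * (μ.1 (B j)).toReal : ℝ) * Complex.I)

/-- `exp (i ∑ t_j 1_{B_j}(x))`. -/
def phaseAt {ι : Type*} [Fintype ι] (B : ι → Set (Space d)) (t : ι → ℝ) (x : Space d) : ℂ :=
  Complex.exp ((∑ j, t j * (B j).indicator 1 x : ℝ) * Complex.I)

section phase

variable {ι : Type*} [Fintype ι] {B : ι → Set (Space d)} (t : ι → ℝ)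

theorem norm_phase (μ : Config d) : ‖phase B t μ‖ = 1 := Complex.norm_exp_ofReal_mul_I _

theorem norm_phaseAt (x : Space d) : ‖phaseAt B t x‖ = 1 := Complex.norm_exp_ofReal_mul_I _

theorem measurable_phase (hB : ∀ j, MeasurableSet (B j)) : Measurable (phase B t) := by
  have := fun j => measurable_eval (hB j)
  unfold phase
  fun_prop

theorem measurable_phaseAt (hB : ∀ j, MeasurableSet (B j)) : Measurable (phaseAt B t) := by
  have : ∀ j, Measurable ((B j).indicator (1 : Space d → ℝ)) :=
    fun j => measurable_one.indicator (hB j)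
  unfold phaseAt
  fun_prop

theorem integrable_phase (hB : ∀ j, MeasurableSet (B j)) (Q : Measure (Config d))
    [IsFiniteMeasure Q] : Integrable (phase B t) Q :=
  ⟨(measurable_phase t hB).aestronglyMeasurable,
    HasFiniteIntegral.of_bounded (C := 1) (ae_of_all _ fun μ => (norm_phase t μ).le)⟩

theorem phase_add {μ η : Config d} (hμ : ∀ j, μ.1 (B j) ≠ ⊤) (hη : ∀ j, η.1 (B j) ≠ ⊤) :
    phase B t (μ.add η) = phase B t μ * phase B t η := by
  unfold phase
  rw [← Complex.exp_add, ← add_mul, ← Complex.ofReal_add, ← Finset.sum_add_distrib]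
  congr 3
  refine Finset.sum_congr rfl fun j _ => ?_
  rw [add_apply, ENNReal.toReal_add (hμ j) (hη j), mul_add]

theorem phase_point (hB : ∀ j, MeasurableSet (B j)) (x : Space d) :
    phase B t (point x) = phaseAt B t x := by
  unfold phase phaseAt
  congr 3
  refine Finset.sum_congr rfl fun j _ => ?_
  rw [point_apply _ (hB j)]
  by_cases h : x ∈ B j <;> simp [h]

/-- The phase is multiplicative under superposition, so the integral over independent particles
factorizes. -/
theorem integral_phase_level {W : Set (Space d)} (hW : MeasurableSet W) (hv : volume W ≠ ⊤)
    (hB : ∀ j, MeasurableSet (B j)) (n : ℕ) :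
    ∫ μ, phase B t μ ∂(level W n) = (∫ x in W, phaseAt B t x) ^ n := by
  induction n with
  | zero =>
    rw [level, integral_dirac' _ _ (measurable_phase t hB).stronglyMeasurable]
    simp [phase, empty]
  | succ n ih =>
    have := isFiniteMeasure_level hv n
    have : IsFiniteMeasure (volume.restrict W) := ⟨by simpa using hv.lt_top⟩
    have h1 : ∀ᵐ p ∂((level W n).prod (volume.restrict W)),
        phase B t (p.1.add (point p.2)) = phase B t p.1 * phaseAt B t p.2 := by
      have h2 : ∀ᵐ p ∂((level W n).prod (volume.restrict W)), p.1.1 W = (n : ℝ≥0∞) ∧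
          p.1.1 Wᶜ = 0 := Measure.quasiMeasurePreserving_fst.ae (ae_level hW n)
      filter_upwards [h2] with p hp
      rw [phase_add t, phase_point t hB]
      · intro j
        refine ne_top_of_le_ne_top (b := p.1.1 Set.univ) ?_ (measure_mono (Set.subset_univ _))
        rw [← measure_add_measure_compl hW, hp.1, hp.2]
        simp
      · intro j
        exact measure_ne_top (Measure.dirac p.2) _
    rw [level, integral_map measurable_add_point.aemeasurable
      (measurable_phase t hB).aestronglyMeasurable, integral_congr_ae h1,
      integral_prod_mul, ih, pow_succ]

theorem integral_phase_poissonOn {ρ : ℝ} (hρ : 0 ≤ ρ) {W : Set (Space d)} (hW : MeasurableSet W)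
    (hv : volume W ≠ ⊤) (hB : ∀ j, MeasurableSet (B j)) :
    ∫ μ, phase B t μ ∂(poissonOn ρ W) =
      Complex.exp (ρ * ∫ x in W, (phaseAt B t x - 1)) := by
  have := isProbabilityMeasure_poissonOn hρ hv
  have : IsFiniteMeasure (volume.restrict W) := ⟨by simpa using hv.lt_top⟩
  have h1 := hasSum_integral_measure (integrable_phase t hB (poissonOn ρ W))
  have h2 : ∀ n, ∫ μ, phase B t μ ∂(ENNReal.ofReal (weight ρ W n) • level W n) =
      Complex.exp (-(ρ * volume.real W)) *
        ((ρ * ∫ x in W, phaseAt B t x) ^ n / n.factorial) := by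
    intro n
    rw [integral_smul_measure, integral_phase_level t hW hv hB,
      ENNReal.toReal_ofReal (weight_nonneg hρ W n), weight, mul_pow, Complex.real_smul]
    push_cast
    ring
  simp only [h2] at h1
  have h3 := (NormedSpace.expSeries_div_hasSum_exp (ρ * ∫ x in W, phaseAt B t x : ℂ)).mul_left
    (Complex.exp (-(ρ * volume.real W)))
  rw [← Complex.exp_eq_exp_ℂ, ← Complex.exp_add] at h3
  rw [poissonOn, h1.unique h3]
  congr 1
  have h4 : Integrable (phaseAt B t) (volume.restrict W) :=
    ⟨(measurable_phaseAt t hB).aestronglyMeasurable,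
      HasFiniteIntegral.of_bounded (C := 1) (ae_of_all _ fun μ => (norm_phaseAt t μ).le)⟩
  rw [integral_sub h4 (integrable_const 1)]
  simp only [integral_const, measureReal_restrict_apply_univ, Complex.real_smul, mul_one]
  ring

end phase

/-- The atoms of the algebra generated by the sets `B j`. -/
def atom {ι : Type*} (B : ι → Set (Space d)) (S : Finset ι) : Set (Space d) :=
  {x | ∀ j, x ∈ B j ↔ j ∈ S}

section atom

variable {ι : Type*} [Fintype ι] {B : ι → Set (Space d)}

theorem measurableSet_atom (hB : ∀ j, MeasurableSet (B j)) (S : Finset ι) :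
    MeasurableSet (atom B S) := by
  have : atom B S = ⋂ j, {x | x ∈ B j ↔ j ∈ S} := by ext; simp [atom]
  rw [this]
  refine MeasurableSet.iInter fun j => ?_
  by_cases hj : j ∈ S
  · simpa [hj] using hB j
  · simp only [hj, iff_false]
    exact (hB j).compl

theorem disjoint_atom {S T : Finset ι} (h : S ≠ T) : Disjoint (atom B S) (atom B T) := by
  rw [Set.disjoint_left]
  intro x hx hx'
  exact h (Finset.ext fun j => (hx j).symm.trans (hx' j))

/-- The empty index set is left out on purpose: its atom is the complement of all the `B j`, which
need not have finite volume. -/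
theorem measure_eq_sum_atom [DecidableEq ι] (hB : ∀ j, MeasurableSet (B j))
    (m : Measure (Space d)) (j : ι) :
    m (B j) = ∑ S : {S : Finset ι // S.Nonempty}, if j ∈ S.1 then m (atom B S.1) else 0 := by
  classical
  have h1 : B j = ⋃ S ∈ (Finset.univ : Finset {S : Finset ι // S.Nonempty}).filter
      (fun S => j ∈ S.1), atom B S.1 := by
    ext x
    simp only [Finset.mem_filter, Finset.mem_univ, true_and, Set.mem_iUnion, exists_prop]
    constructor
    · intro hx
      refine ⟨⟨Finset.univ.filter fun i => x ∈ B i, ⟨j, by simpa using hx⟩⟩, by simpa using hx, ?_⟩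
      intro i
      simp
    · rintro ⟨S, hS, hx⟩
      exact (hx j).2 hS
  conv_lhs => rw [h1]
  rw [measure_biUnion_finset]
  · rw [Finset.sum_filter]
  · intro S _ T _ hST
    exact disjoint_atom fun h => hST (Subtype.ext h)
  · intro S _
    exact measurableSet_atom hB _

end atom

theorem _root_.IsPoissonLaw.ae_ne_top {ρ : ℝ} {P : Measure (Config d)} (hP : IsPoissonLaw ρ P)
    {B : Set (Space d)} (hB : MeasurableSet B) (hv : volume B ≠ ⊤) :
    ∀ᵐ μ ∂P, μ.1 B ≠ ⊤ := by
  have h1 : ∀ᵐ k ∂(P.map fun μ : Config d => μ.1 B), k ≠ ⊤ := by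
    rw [hP.law_count B hB hv]
    refine (ae_map_iff (measurable_from_nat (f := fun k : ℕ => (k : ℝ≥0∞))).aemeasurable
      (measurableSet_singleton (⊤ : ℝ≥0∞)).compl).2 ?_
    exact ae_of_all _ fun k => ENNReal.natCast_ne_top k
  exact (ae_map_iff (measurable_eval hB).aemeasurable (measurableSet_singleton ⊤).compl).1 h1

theorem _root_.IsPoissonLaw.integral_exp {ρ : ℝ} (hρ : 0 ≤ ρ) {P : Measure (Config d)}
    (hP : IsPoissonLaw ρ P) {A : Set (Space d)} (hA : MeasurableSet A) (hv : volume A ≠ ⊤)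
    (c : ℝ) : ∫ μ : Config d, Complex.exp ((c * (μ.1 A).toReal : ℝ) * Complex.I) ∂P =
      Complex.exp (ρ * (volume.real A * (Complex.exp (c * Complex.I) - 1))) := by
  have h1 : ∫ μ : Config d, Complex.exp ((c * (μ.1 A).toReal : ℝ) * Complex.I) ∂P =
      ∫ k, Complex.exp ((c * k.toReal : ℝ) * Complex.I) ∂(P.map fun μ : Config d => μ.1 A) := by
    rw [integral_map (measurable_eval hA).aemeasurable]
    exact Measurable.aestronglyMeasurable (by fun_prop)
  have h2 := ProbabilityTheory.charFun_map_cast_poissonMeasure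
    (ENNReal.ofReal ρ * volume A).toNNReal c
  rw [charFun_apply_real, integral_map (by fun_prop)
    (Measurable.aestronglyMeasurable (by fun_prop))] at h2
  rw [h1, hP.law_count A hA hv, integral_map (by fun_prop)
    (Measurable.aestronglyMeasurable (by fun_prop))]
  have h3 : (((ENNReal.ofReal ρ * volume A).toNNReal : ℝ) : ℂ) = ρ * volume.real A := by
    rw [ENNReal.coe_toNNReal_eq_toReal, ENNReal.toReal_mul, ENNReal.toReal_ofReal hρ]
    push_cast
    rfl
  rw [h3] at h2
  rw [← mul_assoc, ← h2]
  simp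

/-- The sets may overlap, while independence is given for disjoint ones. Splitting all counts along
the atoms yields a product of one-dimensional Poisson characteristic functions, and the same
splitting computes the exponent. -/
theorem _root_.IsPoissonLaw.integral_phase {ρ : ℝ} (hρ : 0 ≤ ρ) {P : Measure (Config d)}
    (hP : IsPoissonLaw ρ P) {ι : Type*} [Fintype ι] {B : ι → Set (Space d)}
    (hB : ∀ j, MeasurableSet (B j)) (hv : ∀ j, volume (B j) ≠ ⊤) (t : ι → ℝ) :
    ∫ μ, phase B t μ ∂P = Complex.exp (ρ * ∫ x, (phaseAt B t x - 1)) := by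
  classical
  let T := {S : Finset ι // S.Nonempty}
  let c : T → ℝ := fun S => ∑ j ∈ S.1, t j
  have hvA : ∀ S : T, volume (atom B S.1) ≠ ⊤ := by
    rintro ⟨S, j, hj⟩
    exact measure_ne_top_of_subset (fun x hx => (hx j).2 hj) (hv j)
  have hmA : ∀ S : T, MeasurableSet (atom B S.1) := fun S => measurableSet_atom hB _
  have h1 : ∀ᵐ μ ∂P, phase B t μ =
      ∏ S : T, Complex.exp ((c S * (μ.1 (atom B S.1)).toReal : ℝ) * Complex.I) := by
    have : ∀ᵐ μ ∂P, ∀ S : T, μ.1 (atom B S.1) ≠ ⊤ :=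
      ae_all_iff.2 fun S => hP.ae_ne_top (hmA S) (hvA S)
    filter_upwards [this] with μ hμ
    rw [phase, ← Complex.exp_sum, ← Finset.sum_mul, ← Complex.ofReal_sum]
    congr 3
    have : ∀ j, (μ.1 (B j)).toReal =
        ∑ S : T, if j ∈ S.1 then (μ.1 (atom B S.1)).toReal else 0 := by
      intro j
      rw [measure_eq_sum_atom hB, ENNReal.toReal_sum]
      · refine Finset.sum_congr rfl fun S _ => ?_
        split_ifs <;> simp
      · intro S _
        split_ifs
        · exact hμ S
        · simp
    simp only [this, Finset.mul_sum, c, Finset.sum_mul]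
    rw [Finset.sum_comm]
    refine Finset.sum_congr rfl fun S _ => ?_
    rw [← Finset.sum_filter_add_sum_filter_not Finset.univ (fun j => j ∈ S.1)]
    rw [Finset.sum_eq_zero (s := Finset.univ.filter fun j => j ∉ S.1), add_zero]
    · rw [Finset.filter_mem_eq_inter, Finset.univ_inter]
      exact Finset.sum_congr rfl fun j hj => by simp [hj]
    · intro j hj
      simp [(Finset.mem_filter.1 hj).2]
  -- The function is constant on each atom and vanishes off the union of the `B j`.
  have h2 : ∀ x, phaseAt B t x - 1 =
      ∑ S : T, (atom B S.1).indicator (fun _ => Complex.exp (c S * Complex.I) - 1) x := by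
    intro x
    let S : Finset ι := Finset.univ.filter fun i => x ∈ B i
    have hS : x ∈ atom B S := fun j => by simp [S]
    have h3 : ∑ j, t j * (B j).indicator 1 x = ∑ j ∈ S, t j := by
      rw [Finset.sum_filter]
      refine Finset.sum_congr rfl fun j _ => ?_
      by_cases h : x ∈ B j <;> simp [h]
    by_cases hne : S.Nonempty
    · rw [Finset.sum_eq_single (⟨S, hne⟩ : T)]
      · rw [Set.indicator_of_mem hS, phaseAt, h3]
      · intro S' _ hS'
        refine Set.indicator_of_notMem (fun hx => hS' (Subtype.ext ?_)) _
        by_contra hne'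
        exact Set.disjoint_left.1 (disjoint_atom hne') hx hS
      · simp
    · rw [Finset.sum_eq_zero]
      · rw [phaseAt, h3, Finset.not_nonempty_iff_eq_empty.1 hne]
        simp
      · rintro ⟨S', hS'⟩ _
        refine Set.indicator_of_notMem (fun hx => hne ?_) _
        have : S' = S := by
          by_contra hne'
          exact Set.disjoint_left.1 (disjoint_atom hne') hx hS
        rwa [← this]
  have := hP.isProbabilityMeasure
  let e := Fintype.equivFin T
  have h3 := hP.indep_count _ (fun i => atom B (e.symm i).1) (fun i => hmA _) (fun i j hij =>
    disjoint_atom fun h => hij (e.symm.injective (Subtype.ext h)))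
  have h4 := (h3.comp (fun i k => Complex.exp ((c (e.symm i) * k.toReal : ℝ) * Complex.I))
    (fun i => by fun_prop)).integral_fun_prod_eq_prod_integral (fun i =>
      Measurable.aestronglyMeasurable (by
        have := measurable_eval (hmA (e.symm i))
        simp only [Function.comp_def]
        fun_prop))
  simp only [Function.comp_def] at h4
  rw [integral_congr_ae h1]
  simp only [h2]
  have h5 : ∀ μ : Config d, ∏ S : T, Complex.exp ((c S * (μ.1 (atom B S.1)).toReal : ℝ) *
      Complex.I) = ∏ i, Complex.exp ((c (e.symm i) * (μ.1 (atom B (e.symm i).1)).toReal : ℝ) *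
      Complex.I) := fun μ => (e.symm.prod_comp (fun S => Complex.exp ((c S *
        (μ.1 (atom B S.1)).toReal : ℝ) * Complex.I))).symm
  simp only [h5]
  rw [h4, e.symm.prod_comp (fun S => ∫ μ : Config d, Complex.exp ((c S *
        (μ.1 (atom B S.1)).toReal : ℝ) * Complex.I) ∂P), integral_finsetSum, Finset.mul_sum,
        Complex.exp_sum]
  · refine Finset.prod_congr rfl fun S _ => ?_
    rw [hP.integral_exp hρ (hmA S) (hvA S), integral_indicator (hmA S), setIntegral_const,
      Complex.real_smul]
  · intro S _
    rw [integrable_indicator_iff (hmA S)]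
    exact integrableOn_const (hvA S)

/-- A probability measure on configurations is determined by the joint laws of the particle
counts in sets of finite volume. -/
theorem ext_of_phase {P Q : Measure (Config d)} [IsProbabilityMeasure P] [IsProbabilityMeasure Q]
    (hP : ∀ B, MeasurableSet B → volume B ≠ ⊤ → ∀ᵐ μ ∂P, μ.1 B ≠ ⊤)
    (hQ : ∀ B, MeasurableSet B → volume B ≠ ⊤ → ∀ᵐ μ ∂Q, μ.1 B ≠ ⊤)
    (h : ∀ (I : Finset {B : Set (Space d) // MeasurableSet B ∧ volume B ≠ ⊤}) (t : I → ℝ),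
      ∫ μ, phase (fun j : I => j.1.1) t μ ∂P = ∫ μ, phase (fun j : I => j.1.1) t μ ∂Q) :
    P = Q := by
  let K := {B : Set (Space d) // MeasurableSet B ∧ volume B ≠ ⊤}
  let Φ : Config d → K → ℝ≥0∞ := fun μ B => μ.1 B.1
  have hΦ : Measurable Φ := measurable_pi_lambda _ fun B => measurable_eval B.2.1
  -- Counts in sets of finite volume generate the `σ`-algebra, since a Borel set is exhausted by its
  -- intersections with balls.
  have hle : (inferInstance : MeasurableSpace (Config d)) ≤ MeasurableSpace.comap Φ inferInstance := by
    have : @Measurable _ _ (MeasurableSpace.comap Φ inferInstance) _ (id : Config d → Config d) := by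
      refine @measurable_of_eval d _ (MeasurableSpace.comap Φ inferInstance) _ fun B hB => ?_
      have h1 : (fun μ : Config d => μ.1 B) =
          fun μ => ⨆ n : ℕ, μ.1 (B ∩ Metric.ball 0 n) := by
        funext μ
        rw [← Monotone.measure_iUnion, ← Set.inter_iUnion, Metric.iUnion_ball_nat, Set.inter_univ]
        intro m n hmn
        exact Set.inter_subset_inter_right _ (Metric.ball_subset_ball (by exact_mod_cast hmn))
      simp only [id, h1]
      refine Measurable.iSup fun n => ?_
      let b : K := ⟨B ∩ Metric.ball 0 n, hB.inter Metric.isOpen_ball.measurableSet,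
        measure_ne_top_of_subset Set.inter_subset_right Metric.isBounded_ball.measure_lt_top.ne⟩
      exact (measurable_pi_apply b).comp (comap_measurable Φ)
    intro A hA
    exact this hA
  have key : P.map Φ = Q.map Φ := by
    -- The counts are almost surely finite, so a finite family of them is the image of a real random
    -- vector, whose law is determined by its characteristic function.
    have hfd : ∀ I : Finset K, (P.map Φ).map I.restrict = (Q.map Φ).map I.restrict := by
      intro I
      have hI : Measurable (I.restrict : (K → ℝ≥0∞) → _) := measurable_pi_lambda _ fun i =>
        measurable_pi_apply _
      let R : Config d → EuclideanSpace ℝ I := fun μ => WithLp.toLp 2 fun j => (μ.1 j.1.1).toReal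
      have hR : Measurable R := by
        refine (WithLp.measurable_toLp 2 _).comp (measurable_pi_lambda _ fun j => ?_)
        exact (measurable_eval j.1.2.1).ennreal_toReal
      have hmap : ∀ (m : Measure (Config d)), (∀ B, MeasurableSet B → volume B ≠ ⊤ →
          ∀ᵐ μ ∂m, μ.1 B ≠ ⊤) → (m.map Φ).map I.restrict =
            (m.map R).map fun r j => ENNReal.ofReal (r j) := by
        intro m hm
        rw [Measure.map_map hI hΦ, Measure.map_map (by fun_prop) hR]
        refine Measure.map_congr ?_
        filter_upwards [ae_all_iff.2 fun j : I => hm j.1.1 j.1.2.1 j.1.2.2] with μ hμ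
        funext j
        exact (ENNReal.ofReal_toReal (hμ j)).symm
      rw [hmap P hP, hmap Q hQ]
      congr 1
      have := Measure.isProbabilityMeasure_map (μ := P) hR.aemeasurable
      have := Measure.isProbabilityMeasure_map (μ := Q) hR.aemeasurable
      refine Measure.ext_of_charFun (funext fun t => ?_)
      have hc : ∀ m : Measure (Config d), charFun (m.map R) t =
          ∫ μ, phase (fun j : I => j.1.1) t μ ∂m := by
        intro m
        rw [charFun_apply, integral_map hR.aemeasurable
          (Measurable.aestronglyMeasurable (by fun_prop))]
        refine integral_congr_ae (ae_of_all _ fun μ => ?_)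
        simp only [phase, R, PiLp.inner_apply]
        congr 3
      rw [hc, hc, h]
    have := Measure.isProbabilityMeasure_map (μ := P) hΦ.aemeasurable
    have : ∀ I : Finset K, IsFiniteMeasure ((P.map Φ).map I.restrict) := fun I => inferInstance
    exact IsProjectiveLimit.unique (P := fun I : Finset K => (P.map Φ).map I.restrict)
      (fun I => rfl) (fun I => (hfd I).symm)
  ext A hA
  obtain ⟨A', hA', rfl⟩ := hle A hA
  rw [← Measure.map_apply hΦ hA', ← Measure.map_apply hΦ hA', key]

/-- By translation invariance of Lebesgue measure, both laws have the same characteristic functions.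
-/
theorem _root_.IsPoissonLaw.map_shift {ρ : ℝ} (hρ : 0 ≤ ρ) {P : Measure (Config d)}
    (hP : IsPoissonLaw ρ P) (z : Space d) : P.map (fun μ => μ.shift z) = P := by
  have := hP.isProbabilityMeasure
  have hm : Measurable fun y : Space d => y - z := measurable_id.sub_const z
  have hvol : ∀ B : Set (Space d), volume ((fun y => y - z) ⁻¹' B) = volume B := fun B =>
    by simpa [sub_eq_add_neg] using measure_preimage_add_right volume (-z) B
  have := Measure.isProbabilityMeasure_map (μ := P) (measurable_shift z).aemeasurable
  refine ext_of_phase (fun B hB hv => ?_) (fun B => hP.ae_ne_top) fun I t => ?_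
  · refine (ae_map_iff (measurable_shift z).aemeasurable
      ((measurable_eval hB) (measurableSet_singleton ⊤).compl)).2 ?_
    filter_upwards [hP.ae_ne_top (hm hB) (by rwa [hvol])] with μ hμ
    exact (shift_apply μ z hB).trans_ne hμ
  · have hB : ∀ j : I, MeasurableSet j.1.1 := fun j => j.1.2.1
    rw [integral_map (measurable_shift z).aemeasurable (measurable_phase t hB).aestronglyMeasurable]
    have h1 : ∀ μ : Config d, phase (fun j : I => j.1.1) t (μ.shift z) =
        phase (fun j : I => (fun y => y - z) ⁻¹' j.1.1) t μ := by
      intro μ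
      simp only [phase, shift_apply _ _ (hB _)]
    simp only [h1]
    rw [hP.integral_phase hρ (fun j => hm (hB j)) fun j => by rw [hvol]; exact j.1.2.2,
      hP.integral_phase hρ hB fun j => j.1.2.2]
    congr 2
    exact integral_sub_right_eq_self (fun x => phaseAt (fun j : I => j.1.1) t x - 1) z

/-- The particles of a Poisson process inside and outside `V` are independent. -/
theorem _root_.IsPoissonLaw.eq_mixed {ρ : ℝ} (hρ : 0 ≤ ρ) {P : Measure (Config d)}
    (hP : IsPoissonLaw ρ P) {V : Set (Space d)} (hV : MeasurableSet V) (hv : volume V ≠ ⊤) :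
    P = mixed ρ V (P.map fun μ => μ.res Vᶜ) := by
  have := hP.isProbabilityMeasure
  have := isProbabilityMeasure_poissonOn hρ hv
  have := Measure.isProbabilityMeasure_map (μ := P) (measurable_res hV.compl).aemeasurable
  have : IsProbabilityMeasure (mixed ρ V (P.map fun μ => μ.res Vᶜ)) :=
    Measure.isProbabilityMeasure_map measurable_add'.aemeasurable
  set κ := P.map fun μ => μ.res Vᶜ with hκ
  have hfin : ∀ B, MeasurableSet B → volume B ≠ ⊤ → ∀ᵐ η ∂κ, η.1 B ≠ ⊤ := by
    intro B hB hv
    refine (ae_map_iff (measurable_res hV.compl).aemeasurable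
      ((measurable_eval hB) (measurableSet_singleton ⊤).compl)).2 ?_
    filter_upwards [hP.ae_ne_top hB hv] with μ hμ
    rw [res_apply _ hB]
    exact measure_ne_top_of_subset Set.inter_subset_left hμ
  have hfin' : ∀ᵐ μ ∂(poissonOn ρ V), ∀ B, μ.1 B ≠ ⊤ := by
    filter_upwards [ae_poissonOn hV] with μ hμ B
    refine ne_top_of_le_ne_top (b := μ.1 Set.univ) ?_ (measure_mono (Set.subset_univ _))
    rw [← measure_add_measure_compl hV, hμ.2, add_zero]
    exact hμ.1
  refine ext_of_phase (fun B => hP.ae_ne_top) (fun B hB hv => ?_) fun I t => ?_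
  · have hm := (measurable_eval hB) (measurableSet_singleton ⊤).compl
    refine (ae_map_iff measurable_add'.aemeasurable hm).2 ?_
    refine (Measure.ae_prod_iff_ae_ae (measurable_add' hm)).2 ?_
    filter_upwards [hfin'] with μ hμ
    filter_upwards [hfin B hB hv] with η hη
    exact ENNReal.add_ne_top.2 ⟨hμ B, hη⟩
  · have hB : ∀ j : I, MeasurableSet j.1.1 := fun j => j.1.2.1
    rw [hP.integral_phase hρ hB fun j => j.1.2.2, mixed,
      integral_map measurable_add'.aemeasurable (measurable_phase t hB).aestronglyMeasurable]
    have h1 : ∀ᵐ p ∂((poissonOn ρ V).prod κ), phase (fun j : I => j.1.1) t (p.1.add p.2) =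
        phase (fun j : I => j.1.1) t p.1 * phase (fun j : I => j.1.1) t p.2 := by
      have h2 : ∀ᵐ p ∂((poissonOn ρ V).prod κ), ∀ B, p.1.1 B ≠ ⊤ :=
        Measure.quasiMeasurePreserving_fst.ae hfin'
      have h3 : ∀ᵐ p ∂((poissonOn ρ V).prod κ), ∀ j : I, p.2.1 j.1.1 ≠ ⊤ :=
        Measure.quasiMeasurePreserving_snd.ae
          (ae_all_iff.2 fun j : I => hfin j.1.1 j.1.2.1 j.1.2.2)
      filter_upwards [h2, h3] with p hp hp'
      exact phase_add t (fun j => hp _) hp'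
    rw [integral_congr_ae h1, integral_prod_mul, integral_phase_poissonOn t hρ hV hv hB]
    have h4 : ∫ η, phase (fun j : I => j.1.1) t η ∂κ =
        ∫ μ, phase (fun j : I => j.1.1 ∩ Vᶜ) t μ ∂P := by
      rw [hκ, integral_map (measurable_res hV.compl).aemeasurable
        (measurable_phase t hB).aestronglyMeasurable]
      refine integral_congr_ae (ae_of_all _ fun μ => ?_)
      simp only [phase, res_apply _ (hB _)]
    rw [h4, hP.integral_phase hρ (fun j => (hB j).inter hV.compl) fun j =>
      measure_ne_top_of_subset Set.inter_subset_left j.1.2.2, ← Complex.exp_add, ← mul_add]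
    congr 2
    -- Intersecting all sets with `Vᶜ` cuts `phaseAt - 1` to `Vᶜ`, so the exponents of the inner and
    -- the outer part add up to the integral over the whole space.
    have h5 : ∀ x, phaseAt (fun j : I => j.1.1 ∩ Vᶜ) t x - 1 =
        Vᶜ.indicator (fun x => phaseAt (fun j : I => j.1.1) t x - 1) x := by
      intro x
      by_cases hx : x ∈ V
      · rw [Set.indicator_of_notMem (by simpa using hx)]
        simp [phaseAt, hx]
      · rw [Set.indicator_of_mem (by simpa using hx)]
        simp only [phaseAt]
        congr 5
        funext j
        by_cases h : x ∈ j.1.1 <;> simp [h, hx]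
    simp only [h5]
    rw [integral_indicator hV.compl]
    refine (integral_add_compl hV ?_).symm
    have hU : MeasurableSet (⋃ j : I, j.1.1) := MeasurableSet.iUnion hB
    have hUv : volume (⋃ j : I, j.1.1) ≠ ⊤ :=
      ((measure_iUnion_fintype_le volume fun j : I => j.1.1).trans_lt
        (ENNReal.sum_lt_top.2 fun j _ => j.1.2.2.lt_top)).ne
    -- Integrability over the unbounded space holds because the function is supported in a set of
    -- finite volume.
    have h6 : (fun x => phaseAt (fun j : I => j.1.1) t x - 1) =
        (⋃ j : I, j.1.1).indicator (fun x => phaseAt (fun j : I => j.1.1) t x - 1) := by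
      funext x
      by_cases hx : x ∈ ⋃ j : I, j.1.1
      · rw [Set.indicator_of_mem hx]
      · rw [Set.indicator_of_notMem hx]
        have : ∀ j : I, x ∉ j.1.1 := fun j hj => hx (Set.mem_iUnion.2 ⟨j, hj⟩)
        simp [phaseAt, this]
    rw [h6, integrable_indicator_iff hU]
    refine Measure.integrableOn_of_bounded (M := 2) hUv
      ((measurable_phaseAt t hB).sub measurable_const).aestronglyMeasurable
      (ae_of_all _ fun x => ?_)
    refine (norm_sub_le _ _).trans ?_
    rw [norm_phaseAt]
    norm_num

end Config

end

/-! ### Reduced coordinates, smooth functions and test functions. -/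

noncomputable section

variable {d : ℕ}

namespace Config

/-- Every point charged by a configuration in `U` is a particle. -/
theorem ae_exists_add_point {U : Set (Space d)} (hU : MeasurableSet U) {μ : Config d}
    (h : μ.1 U ≠ ⊤) : ∀ᵐ x ∂(μ.1.restrict U), x ∈ U ∧ ∃ ν : Config d, ν.1 U ≠ ⊤ ∧
      μ = ν.add (point x) ∧ remIn U hU (μ, x) = ν := by
  obtain ⟨n, x, hx, hμ, -⟩ := exists_points hU h
  have h1 : ∀ᵐ y ∂(μ.1.restrict U), ∃ i, y = x i := by
    have : μ.1.restrict U = ∑ i, Measure.dirac (x i) := congrArg Subtype.val hμ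
    rw [this, ae_iff, Measure.coe_finsetSum, Finset.sum_apply]
    refine Finset.sum_eq_zero fun i _ => ?_
    rw [Measure.dirac_apply, Set.indicator_of_notMem]
    simp
  filter_upwards [h1] with y hy
  obtain ⟨i, rfl⟩ := hy
  have h2 : ∃ ν : Config d, μ = ν.add (point (x i)) := by
    rw [exists_add_point_iff]
    calc (1 : ℝ≥0∞) ≤ (points x).1 {x i} := by
          rw [points_val, Measure.coe_finsetSum, Finset.sum_apply]
          refine le_trans ?_ (Finset.single_le_sum (fun j _ => bot_le) (Finset.mem_univ i))
          simp
      _ = (μ.res U).1 {x i} := by rw [hμ]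
      _ ≤ μ.1 {x i} := Measure.restrict_apply_le _ _
  obtain ⟨ν, hν⟩ := h2
  have h3 : ν.1 U ≠ ⊤ := by
    refine ne_top_of_le_ne_top h ?_
    rw [hν, add_apply]
    exact le_self_add
  refine ⟨hx i, ν, h3, hν, ?_⟩
  rw [hν]
  exact remIn_add_point hU h3 (hx i)

theorem measurable_reduce :
    Measurable fun p : Config d × Space d => (p.1.add (point p.2), p.2) :=
  measurable_add_point.prodMk measurable_snd

section mecke

variable {ρ : ℝ} {U : Set (Space d)} {hU : MeasurableSet U} {Q : Measure (Config d)}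

/-- Almost sure properties in reduced coordinates. -/
theorem Mecke.ae_reduced (hQ : Mecke ρ U hU Q) {p : Config d × Space d → Prop}
    (hp : ∀ᵐ q ∂(Q.prod (volume.restrict U)), p q) :
    ∀ᵐ μ ∂Q, ∀ᵐ x ∂(μ.1.restrict U), ∃ ν : Config d, μ = ν.add (point x) ∧
      remIn U hU (μ, x) = ν ∧ p (ν, x) := by
  -- The exceptional set is enlarged to a measurable null set, so that the Mecke formula applies to
  -- its indicator evaluated with the tagged particle removed.
  let N := toMeasurable (Q.prod (volume.restrict U)) {q | ¬ p q}
  have hN : MeasurableSet N := measurableSet_toMeasurable _ _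
  have hN0 : Q.prod (volume.restrict U) N = 0 := by rw [measure_toMeasurable]; exact hp
  have hm : Measurable fun q : Config d × Space d => (remIn U hU q, q.2) :=
    (measurable_remIn hU).prodMk measurable_snd
  have h1 := hQ.eq (fun q => N.indicator 1 (remIn U hU q, q.2)) ((measurable_one.indicator hN).comp hm)
  have h2 : ∫⁻ μ, ∫⁻ z in U, N.indicator 1 (remIn U hU (μ.add (point z), z), z) ∂volume ∂Q = 0 := by
    have h3 : ∫⁻ μ, ∫⁻ z in U, N.indicator (1 : Config d × Space d → ℝ≥0∞) (μ, z) ∂volume ∂Q = 0 := by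
      rw [← lintegral_prod _ (measurable_one.indicator hN).aemeasurable,
        lintegral_indicator_one hN, hN0]
    rw [← h3]
    refine lintegral_congr_ae ?_
    filter_upwards [hQ.fin] with μ hμ
    refine setLIntegral_congr_fun hU fun z hz => ?_
    rw [remIn_add_point hU hμ hz]
  rw [h2, mul_zero] at h1
  have h1' := (lintegral_eq_zero_iff
    (measurable_lintegral_kernel hU ((measurable_one.indicator hN).comp hm))).1 h1
  filter_upwards [h1', hQ.fin] with μ hμ hfin
  rw [Pi.zero_apply, kernel_apply hU hfin] at hμ
  have h4 := (lintegral_eq_zero_iff ((measurable_one.indicator hN).comp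
    (hm.comp measurable_prodMk_left))).1 hμ
  filter_upwards [h4, ae_exists_add_point hU hfin] with x hx hx'
  obtain ⟨-, ν, -, h5, h6⟩ := hx'
  refine ⟨ν, h5, h6, ?_⟩
  by_contra hc
  have : (ν, x) ∈ N := subset_toMeasurable _ _ hc
  simp [h6, this] at hx

theorem Mecke.ae_fin_mem (hQ : Mecke ρ U hU Q) :
    ∀ᵐ q ∂(Q.prod (volume.restrict U)), q.1.1 U ≠ ⊤ ∧ q.2 ∈ U := by
  have h1 : ∀ᵐ q ∂(Q.prod (volume.restrict U)), q.1.1 U ≠ ⊤ :=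
    Measure.quasiMeasurePreserving_fst.ae hQ.fin
  have h2 : ∀ᵐ q ∂(Q.prod (volume.restrict U)), q.2 ∈ U :=
    Measure.quasiMeasurePreserving_snd.ae (ae_restrict_mem hU)
  filter_upwards [h1, h2] with q hq hq' using ⟨hq, hq'⟩

/-- Extends the Mecke formula to integrands that are only almost everywhere measurable, and only in
reduced coordinates: they are replaced by a measurable function of `(μ - δ_x, x)`. -/
theorem Mecke.lintegral_eq (hQ : Mecke ρ U hU Q) {F : Config d → Space d → ℝ≥0∞}
    (hF : AEMeasurable (fun q : Config d × Space d => F (q.1.add (point q.2)) q.2)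
      (Q.prod (volume.restrict U))) :
    ∫⁻ μ, ∫⁻ x in U, F μ x ∂μ.1 ∂Q =
      ENNReal.ofReal ρ * ∫⁻ q, F (q.1.add (point q.2)) q.2 ∂(Q.prod (volume.restrict U)) := by
  obtain ⟨F', hF', hFF'⟩ := hF
  have hm : Measurable fun q : Config d × Space d => F' (remIn U hU q, q.2) :=
    hF'.comp ((measurable_remIn hU).prodMk measurable_snd)
  have h1 := hQ.eq _ hm
  have h2 : ∫⁻ μ, ∫⁻ x in U, F μ x ∂μ.1 ∂Q =
      ∫⁻ μ, ∫⁻ x, F' (remIn U hU (μ, x), x) ∂(kernel U hU μ) ∂Q := by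
    refine lintegral_congr_ae ?_
    filter_upwards [hQ.ae_reduced hFF', hQ.fin] with μ hμ hfin
    rw [kernel_apply hU hfin]
    refine lintegral_congr_ae ?_
    filter_upwards [hμ] with x hx
    obtain ⟨ν, h3, h4, h5⟩ := hx
    rw [h4, ← h5, ← h3]
  have h6 : Measurable fun q : Config d × Space d =>
      F' (remIn U hU (q.1.add (point q.2), q.2), q.2) := hm.comp measurable_reduce
  rw [h2, h1, lintegral_congr_ae hFF', lintegral_prod _ hF'.aemeasurable]
  congr 1
  refine lintegral_congr_ae ?_
  filter_upwards [hQ.fin] with μ hμ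
  refine setLIntegral_congr_fun hU fun z hz => ?_
  rw [remIn_add_point hU hμ hz]

/-- The Mecke formula as an identity of measures, the form needed for integrals of signed functions.
-/
theorem Mecke.compProd_eq [SFinite Q] (hQ : Mecke ρ U hU Q) :
    Measure.compProd Q (kernel U hU) = ENNReal.ofReal ρ •
      (Q.prod (volume.restrict U)).map fun p => (p.1.add (point p.2), p.2) := by
  ext A hA
  have h1 := hQ.eq (A.indicator 1) (measurable_one.indicator hA)
  rw [← lintegral_indicator_one hA, Measure.lintegral_compProd (measurable_one.indicator hA), h1,
    Measure.smul_apply, smul_eq_mul, ← lintegral_indicator_one hA,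
    lintegral_map (measurable_one.indicator hA) measurable_reduce, lintegral_prod]
  exact ((measurable_one.indicator hA).comp measurable_reduce).aemeasurable

theorem Mecke.integral_eq [SFinite Q] (hρ : 0 ≤ ρ) (hQ : Mecke ρ U hU Q) {F : Config d → Space d → ℝ}
    (hF : Integrable (fun q : Config d × Space d => F (q.1.add (point q.2)) q.2)
      (Q.prod (volume.restrict U))) :
    ∫ μ, ∫ x in U, F μ x ∂μ.1 ∂Q =
      ρ * ∫ q, F (q.1.add (point q.2)) q.2 ∂(Q.prod (volume.restrict U)) := by
  obtain ⟨F', hF', hFF'⟩ := hF.aestronglyMeasurable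
  have hm : StronglyMeasurable fun q : Config d × Space d => F' (remIn U hU q, q.2) :=
    hF'.comp_measurable ((measurable_remIn hU).prodMk measurable_snd)
  have h2 : ∫ μ, ∫ x in U, F μ x ∂μ.1 ∂Q =
      ∫ μ, ∫ x, F' (remIn U hU (μ, x), x) ∂(kernel U hU μ) ∂Q := by
    refine integral_congr_ae ?_
    filter_upwards [hQ.ae_reduced hFF', hQ.fin] with μ hμ hfin
    rw [kernel_apply hU hfin]
    refine integral_congr_ae ?_
    filter_upwards [hμ] with x hx
    obtain ⟨ν, h3, h4, h5⟩ := hx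
    rw [h4, ← h5, ← h3]
  have h7 : (fun q : Config d × Space d => F' (remIn U hU (q.1.add (point q.2), q.2), q.2))
      =ᵐ[Q.prod (volume.restrict U)] fun q => F (q.1.add (point q.2)) q.2 := by
    filter_upwards [hFF', hQ.ae_fin_mem] with q hq hq'
    rw [remIn_add_point hU hq'.1 hq'.2, hq]
  have h8 : Integrable (fun q : Config d × Space d => F' (remIn U hU q, q.2))
      (Measure.compProd Q (kernel U hU)) := by
    rw [hQ.compProd_eq]
    refine Integrable.smul_measure ?_ ENNReal.ofReal_ne_top
    refine (integrable_map_measure hm.aestronglyMeasurable measurable_reduce.aemeasurable).2 ?_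
    exact hF.congr h7.symm
  rw [h2, ← Measure.integral_compProd h8, hQ.compProd_eq, integral_smul_measure,
    integral_map measurable_reduce.aemeasurable hm.aestronglyMeasurable,
    ENNReal.toReal_ofReal hρ, smul_eq_mul, integral_congr_ae h7]

/-- Null sets remain null when a particle is added, so almost sure statements can be used at
configurations with one more particle. This needs `0 < ρ`. -/
theorem Mecke.quasiMeasurePreserving (hρ : 0 < ρ) (hQ : Mecke ρ U hU Q) :
    Measure.QuasiMeasurePreserving (fun q : Config d × Space d => q.1.add (point q.2))
      (Q.prod (volume.restrict U)) Q := by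
  refine ⟨measurable_add_point, Measure.AbsolutelyContinuous.mk fun N hN hN0 => ?_⟩
  rw [Measure.map_apply measurable_add_point hN, ← lintegral_indicator_one (measurable_add_point hN)]
  have h1 := hQ.lintegral_eq (F := fun μ _ => N.indicator 1 μ)
    ((measurable_one.indicator hN).comp measurable_add_point).aemeasurable
  have h2 : ∫⁻ μ, ∫⁻ x in U, N.indicator 1 μ ∂μ.1 ∂Q = 0 := by
    rw [lintegral_eq_zero_of_ae_eq_zero]
    filter_upwards [measure_eq_zero_iff_ae_notMem.1 hN0] with μ hμ
    simp [hμ]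
  rw [h2] at h1
  exact (mul_eq_zero.1 h1.symm).resolve_left (by simpa using hρ)

end mecke

/-- The smoothness condition in the definition of `C^∞(U)`. -/
def SmoothOn (U : Set (Space d)) (f : Config d → ℝ) : Prop :=
  ∀ (μ : Config d) (n : ℕ),
    ContDiffOn ℝ (⊤ : ℕ∞) (fun x : Fin n → Space d => f ((points x).add (μ.res Uᶜ)))
      (Set.univ.pi fun _ => U)

theorem contDiff_snoc {n : ℕ} (x : Fin n → Space d) :
    ContDiff ℝ (⊤ : ℕ∞) fun z : Space d => (Fin.snoc x z : Fin (n + 1) → Space d) := by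
  rw [contDiff_pi]
  intro i
  refine Fin.lastCases ?_ (fun j => ?_) i
  · simpa using contDiff_fun_id
  · simpa using contDiff_const

/-- The finitely many particles of `μ` in `U` become frozen coordinates of a smooth function of `n +
1` variables. -/
theorem SmoothOn.contDiffOn {U : Set (Space d)} (hU : MeasurableSet U) {f : Config d → ℝ}
    (hf : SmoothOn U f) {μ : Config d} (hμ : μ.1 U ≠ ⊤) :
    ContDiffOn ℝ (⊤ : ℕ∞) (fun z => f (μ.add (point z))) U := by
  obtain ⟨n, x, hx, hμx, -⟩ := exists_points hU hμ
  have h1 : ∀ z, f (μ.add (point z)) =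
      f ((points (Fin.snoc x z : Fin (n + 1) → Space d)).add (μ.res Uᶜ)) := by
    intro z
    rw [points_snoc, ← hμx, add_right_comm, res_add_res_compl hU]
  simp only [h1]
  refine (hf μ (n + 1)).comp (contDiff_snoc x).contDiffOn fun z hz => ?_
  refine Set.mem_univ_pi.2 fun i => ?_
  refine Fin.lastCases ?_ (fun j => ?_) i
  · simpa using hz
  · simpa using hx j

/-- `rgrad` is made of partial derivatives; joint smoothness upgrades it to a total derivative, from
which the calculus rules below follow. -/
theorem SmoothOn.hasFDerivAt {U : Set (Space d)} (hU : IsOpen U) {f : Config d → ℝ}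
    (hf : SmoothOn U f) {μ : Config d} (hμ : μ.1 U ≠ ⊤) {z : Space d} (hz : z ∈ U) :
    HasFDerivAt (fun z => f (μ.add (point z))) (innerSL ℝ (rgrad f μ z)) z := by
  have h1 := ((hf.contDiffOn hU.measurableSet hμ).differentiableOn (by simp)).differentiableAt
    (hU.mem_nhds hz) |>.hasFDerivAt
  have h2 : innerSL ℝ (rgrad f μ z) = fderiv ℝ (fun z => f (μ.add (point z))) z := by
    refine ContinuousLinearMap.coe_injective
      ((EuclideanSpace.basisFun (Fin d) ℝ).toBasis.ext fun k => ?_)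
    have h3 : HasDerivAt (fun t : ℝ => z + t • (EuclideanSpace.single k 1 : Space d))
        (EuclideanSpace.single k 1) 0 := by
      simpa using ((hasDerivAt_id (0 : ℝ)).smul_const (EuclideanSpace.single k 1 : Space d)).const_add z
    have h4 : HasFDerivAt (fun z => f (μ.add (point z)))
        (fderiv ℝ (fun z => f (μ.add (point z))) z)
        (z + (0 : ℝ) • (EuclideanSpace.single k 1 : Space d)) := by simpa using h1
    have h5 := (h4.comp_hasDerivAt (0 : ℝ) h3).deriv
    simp only [OrthonormalBasis.coe_toBasis, EuclideanSpace.basisFun_apply,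
      ContinuousLinearMap.coe_coe, innerSL_apply_apply]
    rw [EuclideanSpace.inner_single_right, ← h5]
    simp [rgrad, Function.comp_def]
  rw [h2]
  exact h1

/-- Functions which do not change when a particle is moved inside `U`. -/
def Inv (U : Set (Space d)) (h : Config d → ℝ) : Prop :=
  ∀ (μ : Config d) (z z' : Space d), z ∈ U → z' ∈ U → h (μ.add (point z)) = h (μ.add (point z'))

theorem Inv.points_eq {U : Set (Space d)} {h : Config d → ℝ} (hh : Inv U h) {n : ℕ}
    {x x' : Fin n → Space d} (hx : ∀ i, x i ∈ U) (hx' : ∀ i, x' i ∈ U) (η : Config d) :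
    h ((points x).add η) = h ((points x').add η) := by
  induction n generalizing η with
  | zero => simp only [points_zero]
  | succ n ih =>
    rw [← Fin.snoc_init_self x, ← Fin.snoc_init_self x', points_snoc, points_snoc, add_assoc,
      ih (x := Fin.init x) (x' := Fin.init x') (fun i => hx _) (fun i => hx' _), ← add_assoc,
      add_right_comm, hh _ _ _ (hx _) (hx' (Fin.last n)), add_right_comm]

/-- On `U^n` such a function is constant, for every `n`. Functions of this kind (events on the
number of particles, conditional expectations) behave as scalars for the gradient. -/
theorem Inv.smoothOn {U : Set (Space d)} {h : Config d → ℝ} (hh : Inv U h) : SmoothOn U h := by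
  intro μ n
  rcases (Set.univ.pi fun _ : Fin n => U).eq_empty_or_nonempty with he | ⟨x₀, hx₀⟩
  · rw [he]
    exact contDiffOn_empty
  · refine (contDiffOn_const (c := h ((points x₀).add (μ.res Uᶜ)))).congr fun x hx => ?_
    exact hh.points_eq (Set.mem_univ_pi.1 hx) (Set.mem_univ_pi.1 hx₀) _

theorem SmoothOn.mul {U : Set (Space d)} {f g : Config d → ℝ} (hf : SmoothOn U f)
    (hg : SmoothOn U g) : SmoothOn U fun μ => f μ * g μ := fun μ n => (hf μ n).mul (hg μ n)

theorem SmoothOn.add {U : Set (Space d)} {f g : Config d → ℝ} (hf : SmoothOn U f)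
    (hg : SmoothOn U g) : SmoothOn U fun μ => f μ + g μ := fun μ n => (hf μ n).add (hg μ n)

theorem SmoothOn.sub {U : Set (Space d)} {f g : Config d → ℝ} (hf : SmoothOn U f)
    (hg : SmoothOn U g) : SmoothOn U fun μ => f μ - g μ := fun μ n => (hf μ n).sub (hg μ n)

theorem SmoothOn.const_mul {U : Set (Space d)} {f : Config d → ℝ} (c : ℝ) (hf : SmoothOn U f) :
    SmoothOn U fun μ => c * f μ := fun μ n => contDiffOn_const.mul (hf μ n)

theorem rgrad_eq_of_hasFDerivAt {f : Config d → ℝ} {μ : Config d} {z v : Space d}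
    (h : HasFDerivAt (fun z => f (μ.add (point z))) (innerSL ℝ v) z) : rgrad f μ z = v := by
  ext k
  have h3 : HasDerivAt (fun t : ℝ => z + t • (EuclideanSpace.single k 1 : Space d))
      (EuclideanSpace.single k 1) 0 := by
    simpa using ((hasDerivAt_id (0 : ℝ)).smul_const (EuclideanSpace.single k 1 : Space d)).const_add z
  have h4 : HasFDerivAt (fun z => f (μ.add (point z))) (innerSL ℝ v)
      (z + (0 : ℝ) • (EuclideanSpace.single k 1 : Space d)) := by simpa using h
  have h5 := (h4.comp_hasDerivAt (0 : ℝ) h3).deriv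
  rw [innerSL_apply_apply, EuclideanSpace.inner_single_right] at h5
  simpa [rgrad, Function.comp_def] using h5

section rgrad

variable {U : Set (Space d)} (hU : IsOpen U) {f g : Config d → ℝ} {μ : Config d}
  (hμ : μ.1 U ≠ ⊤) {z : Space d} (hz : z ∈ U)

include hU hμ hz

theorem rgrad_add (hf : SmoothOn U f) (hg : SmoothOn U g) :
    rgrad (fun μ => f μ + g μ) μ z = rgrad f μ z + rgrad g μ z :=
  rgrad_eq_of_hasFDerivAt (by
    rw [map_add]
    exact (hf.hasFDerivAt hU hμ hz).add (hg.hasFDerivAt hU hμ hz))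

theorem rgrad_sub (hf : SmoothOn U f) (hg : SmoothOn U g) :
    rgrad (fun μ => f μ - g μ) μ z = rgrad f μ z - rgrad g μ z :=
  rgrad_eq_of_hasFDerivAt (by
    rw [map_sub]
    exact (hf.hasFDerivAt hU hμ hz).sub (hg.hasFDerivAt hU hμ hz))

theorem rgrad_const_mul (hf : SmoothOn U f) (c : ℝ) :
    rgrad (fun μ => c * f μ) μ z = c • rgrad f μ z :=
  rgrad_eq_of_hasFDerivAt (by
    rw [map_smul]
    exact (hf.hasFDerivAt hU hμ hz).const_mul c)

omit hμ in
theorem rgrad_inv (hg : Inv U g) : rgrad g μ z = 0 := by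
  refine rgrad_eq_of_hasFDerivAt ?_
  rw [map_zero]
  refine (hasFDerivAt_const (g (μ.add (point z))) z).congr_of_eventuallyEq ?_
  filter_upwards [hU.mem_nhds hz] with y hy
  exact hg _ _ _ hy hz

theorem rgrad_inv_mul (hg : Inv U g) (hf : SmoothOn U f) :
    rgrad (fun μ => g μ * f μ) μ z = g (μ.add (point z)) • rgrad f μ z := by
  refine rgrad_eq_of_hasFDerivAt ?_
  rw [map_smul]
  refine ((hf.hasFDerivAt hU hμ hz).const_mul (g (μ.add (point z)))).congr_of_eventuallyEq ?_
  filter_upwards [hU.mem_nhds hz] with y hy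
  rw [hg _ _ _ hy hz]

end rgrad

/-- As `f` is only almost everywhere measurable, the gradient is obtained as an almost everywhere
limit of difference quotients. These are measurable because neither adding a particle nor
translating its position charges null sets. -/
theorem Mecke.aemeasurable_rgrad {ρ : ℝ} (hρ : 0 < ρ) {U : Set (Space d)} (hU : IsOpen U)
    {Q : Measure (Config d)} [SFinite Q] (hQ : Mecke ρ U hU.measurableSet Q) {f : Config d → ℝ}
    (hf : IsSmooth Q U f) :
    AEMeasurable (fun q : Config d × Space d => rgrad f q.1 q.2)
      (Q.prod (volume.restrict U)) := by
  have hQU : Q.prod (volume.restrict U) =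
      (Q.prod volume).restrict (Set.univ ×ˢ U : Set (Config d × Space d)) := by
    rw [← Measure.prod_restrict, Measure.restrict_univ]
  have hmU : MeasurableSet (Set.univ ×ˢ U : Set (Config d × Space d)) :=
    MeasurableSet.univ.prod hU.measurableSet
  -- Extension by zero outside `U`, so that translations act on the whole space.
  let g : Config d × Space d → ℝ :=
    (Set.univ ×ˢ U : Set (Config d × Space d)).indicator fun q => f (q.1.add (point q.2))
  have hg : AEMeasurable g (Q.prod volume) := by
    rw [aemeasurable_indicator_iff hmU, ← hQU]
    exact hf.1.comp_quasiMeasurePreserving (hQ.quasiMeasurePreserving hρ)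
  refine (WithLp.measurable_toLp 2 _).comp_aemeasurable (aemeasurable_pi_lambda _ fun k => ?_)
  let h : ℕ → ℝ := fun j => 1 / ((j : ℝ) + 1)
  let D : ℕ → Config d × Space d → ℝ := fun j q =>
    (h j)⁻¹ • (g (q.1, q.2 + h j • EuclideanSpace.single k 1) - g q)
  have hD : ∀ j, AEMeasurable (D j) (Q.prod (volume.restrict U)) := by
    intro j
    have h1 : AEMeasurable (fun q : Config d × Space d =>
        g (q.1, q.2 + h j • EuclideanSpace.single k 1)) (Q.prod volume) :=
      hg.comp_quasiMeasurePreserving ((MeasurePreserving.id Q).prod (measurePreserving_add_right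
        volume (h j • EuclideanSpace.single k (1 : ℝ)))).quasiMeasurePreserving
    have h2 : AEMeasurable (D j) (Q.prod volume) := (h1.sub hg).const_smul (h j)⁻¹
    rw [hQU]
    exact h2.restrict
  refine aemeasurable_of_tendsto_metrizable_ae atTop hD ?_
  filter_upwards [hQ.ae_fin_mem] with q hq
  have hfd := SmoothOn.hasFDerivAt hU hf.2 hq.1 hq.2
  have h3 : HasDerivAt (fun t : ℝ => q.2 + t • (EuclideanSpace.single k 1 : Space d))
      (EuclideanSpace.single k 1) 0 := by
    simpa using
      ((hasDerivAt_id (0 : ℝ)).smul_const (EuclideanSpace.single k 1 : Space d)).const_add q.2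
  have h4 : HasFDerivAt (fun z => f (q.1.add (point z))) (innerSL ℝ (rgrad f q.1 q.2))
      (q.2 + (0 : ℝ) • (EuclideanSpace.single k 1 : Space d)) := by simpa using hfd
  have h5 := h4.comp_hasDerivAt (0 : ℝ) h3
  have h6 : Tendsto h atTop (𝓝[≠] 0) := by
    refine tendsto_nhdsWithin_iff.2 ⟨tendsto_one_div_add_atTop_nhds_zero_nat, ?_⟩
    exact Eventually.of_forall fun j => (by positivity : (1 : ℝ) / ((j : ℝ) + 1) ≠ 0)
  have h7 := h5.tendsto_slope_zero.comp h6
  rw [← h5.deriv] at h7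
  -- `U` is open, so for small increments the extension by zero is not seen.
  have h8 : ∀ᶠ j in atTop, q.2 + h j • (EuclideanSpace.single k 1 : Space d) ∈ U := by
    have h9 : Tendsto (fun j => q.2 + h j • (EuclideanSpace.single k 1 : Space d)) atTop
        (𝓝 q.2) := by
      simpa using ((tendsto_nhds_of_tendsto_nhdsWithin h6).smul_const
        (EuclideanSpace.single k 1 : Space d)).const_add q.2
    exact h9 (hU.mem_nhds hq.2)
  refine h7.congr' ?_
  filter_upwards [h8] with j hj
  simp [D, g, hj, hq.2]

/-- Test functions: elements of `C^∞(U)` of finite norm. The norm of the function is taken with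
respect to `Q`, the norm of its reduced gradient with respect to `Q'`. -/
structure IsTest (Q Q' : Measure (Config d)) (U : Set (Space d)) (f : Config d → ℝ) : Prop where
  smoothOn : SmoothOn U f
  memLp : MemLp f 2 Q
  memLp_rgrad : MemLp (fun q : Config d × Space d => rgrad f q.1 q.2) 2
    (Q'.prod (volume.restrict U))

theorem lintegral_enorm_sq_eq {α F : Type*} [MeasurableSpace α] [NormedAddCommGroup F]
    (m : Measure α) (f : α → F) : ∫⁻ a, ‖f a‖ₑ ^ 2 ∂m = eLpNorm f 2 m ^ 2 := by
  rw [eLpNorm_eq_lintegral_rpow_enorm_toReal (by simp) (by simp), ← ENNReal.rpow_natCast,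
    ← ENNReal.rpow_mul]
  simp

theorem Mecke.h1NormSq_eq {ρ : ℝ} {U : Set (Space d)} {hU : MeasurableSet U}
    {Q : Measure (Config d)} [SFinite Q] (hQ : Mecke ρ U hU Q) (f : Config d → ℝ)
    {G : Config d → Space d → Space d}
    (hG : AEMeasurable (fun q : Config d × Space d => G (q.1.add (point q.2)) q.2)
      (Q.prod (volume.restrict U))) :
    h1NormSq Q U f G = eLpNorm f 2 Q ^ 2 + ENNReal.ofReal ρ *
      eLpNorm (fun q : Config d × Space d => G (q.1.add (point q.2)) q.2) 2
        (Q.prod (volume.restrict U)) ^ 2 := by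
  rw [h1NormSq, hQ.lintegral_eq (hG.enorm.pow_const 2), lintegral_enorm_sq_eq,
    lintegral_enorm_sq_eq]

/-- Under the Mecke formula one measure serves for the function and for its gradient. On levels the
two differ by the tagged particle, which is why `IsTest` has two measures. -/
theorem Mecke.isTest_iff {ρ : ℝ} (hρ : 0 < ρ) {U : Set (Space d)} (hU : IsOpen U)
    {Q : Measure (Config d)} [SFinite Q] (hQ : Mecke ρ U hU.measurableSet Q) {f : Config d → ℝ} :
    IsTest Q Q U f ↔ IsSmooth Q U f ∧ h1NormSq Q U f (grad f) < ⊤ := by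
  have key : ∀ hf : IsSmooth Q U f, h1NormSq Q U f (grad f) = eLpNorm f 2 Q ^ 2 +
      ENNReal.ofReal ρ * eLpNorm (fun q : Config d × Space d => rgrad f q.1 q.2) 2
        (Q.prod (volume.restrict U)) ^ 2 := by
    intro hf
    have h1 := hQ.aemeasurable_rgrad hρ hU hf
    rw [hQ.h1NormSq_eq f (G := grad f)] <;> simp only [grad_add_point]
    exact h1
  constructor
  · rintro ⟨hf, h1, h2⟩
    have hf' : IsSmooth Q U f := ⟨h1.1.aemeasurable, hf⟩
    refine ⟨hf', ?_⟩
    rw [key hf']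
    exact ENNReal.add_lt_top.2 ⟨ENNReal.pow_lt_top h1.2,
      ENNReal.mul_lt_top ENNReal.ofReal_lt_top (ENNReal.pow_lt_top h2.2)⟩
  · rintro ⟨hf, h⟩
    rw [key hf, ENNReal.add_lt_top] at h
    refine ⟨hf.2, ⟨hf.1.aestronglyMeasurable, ?_⟩,
      ⟨(hQ.aemeasurable_rgrad hρ hU hf).aestronglyMeasurable, ?_⟩⟩
    · exact (ENNReal.pow_lt_top_iff.1 h.1).resolve_right (by norm_num)
    · exact (ENNReal.pow_lt_top_iff.1 (ENNReal.lt_top_of_mul_ne_top_right h.2.ne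
        (by simpa using hρ))).resolve_right (by norm_num)

end Config

end

/-! ### A Poincaré inequality for functions of many particles. -/

noncomputable section

variable {d : ℕ}

theorem sq_lintegral_le {α : Type*} [MeasurableSpace α] (m : Measure α) {f : α → ℝ≥0∞}
    (hf : AEMeasurable f m) : (∫⁻ x, f x ∂m) ^ 2 ≤ m Set.univ * ∫⁻ x, f x ^ 2 ∂m := by
  have h := ENNReal.lintegral_mul_le_Lp_mul_Lq m Real.HolderConjugate.two_two
    (aemeasurable_const (b := (1 : ℝ≥0∞))) hf
  simp only [Pi.mul_apply, one_mul, ENNReal.one_rpow, lintegral_one] at h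
  calc (∫⁻ x, f x ∂m) ^ 2 ≤ (m Set.univ ^ (1 / 2 : ℝ) *
        (∫⁻ x, f x ^ (2 : ℝ) ∂m) ^ (1 / 2 : ℝ)) ^ 2 := by gcongr
    _ = _ := by
      rw [mul_pow, ← ENNReal.rpow_natCast, ← ENNReal.rpow_natCast, ← ENNReal.rpow_mul,
        ← ENNReal.rpow_mul]
      simp

/-- The mean square oscillation of a function. -/
def osc {α : Type*} [MeasurableSpace α] (m : Measure α) (f : α → ℝ) : ℝ≥0∞ :=
  ∫⁻ x, ∫⁻ y, ENNReal.ofReal ((f x - f y) ^ 2) ∂m ∂m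

section osc

variable {α β : Type*} [MeasurableSpace α] [MeasurableSpace β]

theorem osc_congr {m : Measure α} {f g : α → ℝ} (h : f =ᵐ[m] g) : osc m f = osc m g := by
  refine lintegral_congr_ae ?_
  filter_upwards [h] with x hx
  refine lintegral_congr_ae ?_
  filter_upwards [h] with y hy
  rw [hx, hy]

theorem measurable_osc {n : Measure β} [SFinite n] {f : α × β → ℝ} (hf : Measurable f) :
    Measurable fun x => osc n fun y => f (x, y) := by
  have : Measurable fun q : (α × β) × β => ENNReal.ofReal ((f q.1 - f (q.1.1, q.2)) ^ 2) := by
    have : Measurable fun q : (α × β) × β => f (q.1.1, q.2) :=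
      hf.comp ((measurable_fst.comp measurable_fst).prodMk measurable_snd)
    exact (((hf.comp measurable_fst).sub this).pow_const 2).ennreal_ofReal
  exact this.lintegral_prod_right'.lintegral_prod_right'

theorem osc_map {m : Measure α} [SFinite m] {g : α → β} (hg : Measurable g) {f : β → ℝ}
    (hf : Measurable f) : osc (m.map g) f = osc m (f ∘ g) := by
  have h1 : Measurable fun q : β × β => ENNReal.ofReal ((f q.1 - f q.2) ^ 2) :=
    (((hf.comp measurable_fst).sub (hf.comp measurable_snd)).pow_const 2).ennreal_ofReal
  rw [osc, lintegral_map h1.lintegral_prod_right' hg]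
  refine lintegral_congr fun x => ?_
  exact lintegral_map (h1.comp measurable_prodMk_left) hg

/-- In the expanded square the cross term vanishes with the mean; of the two equal remaining terms
only one is kept. -/
theorem mul_lintegral_sq_le_osc {m : Measure α} [IsFiniteMeasure m] {f : α → ℝ}
    (hf : MemLp f 2 m) (h0 : ∫ x, f x ∂m = 0) :
    m Set.univ * ∫⁻ x, ‖f x‖ₑ ^ 2 ∂m ≤ osc m f := by
  have h1 : Integrable f m := hf.integrable (by norm_num)
  have h2 : Integrable (fun x => f x ^ 2) m := hf.integrable_sq
  rw [← lintegral_const_mul'' _ (hf.1.aemeasurable.enorm.pow_const 2)]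
  refine lintegral_mono fun x => ?_
  rw [← ofReal_integral_eq_lintegral_ofReal]
  · have h3 : ∫ y, (f x - f y) ^ 2 ∂m = m.real Set.univ * f x ^ 2 + ∫ y, f y ^ 2 ∂m := by
      have : ∀ y, (f x - f y) ^ 2 = f x ^ 2 - 2 * f x * f y + f y ^ 2 := fun y => by ring
      simp only [this]
      rw [integral_add _ h2, integral_sub (integrable_const _) (h1.const_mul _),
        integral_const, integral_const_mul, h0]
      · simp
      · exact (integrable_const _).sub (h1.const_mul _)
    rw [h3, ← ENNReal.ofReal_toReal (measure_ne_top m Set.univ), Real.enorm_eq_ofReal_abs,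
      ← ENNReal.ofReal_pow (abs_nonneg _), sq_abs, ← ENNReal.ofReal_mul ENNReal.toReal_nonneg]
    refine ENNReal.ofReal_le_ofReal (le_add_of_nonneg_right (integral_nonneg fun y => sq_nonneg _))
  · have : ∀ y, (f x - f y) ^ 2 = f x ^ 2 - 2 * f x * f y + f y ^ 2 := fun y => by ring
    simp only [this]
    exact ((integrable_const _).sub (h1.const_mul _)).add h2
  · exact Eventually.of_forall fun y => sq_nonneg _

theorem measurable_ofReal_sub_sq {u v : α → ℝ} (hu : Measurable u) (hv : Measurable v) :
    Measurable fun c => ENNReal.ofReal ((u c - v c) ^ 2) :=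
  ((hu.sub hv).pow_const 2).ennreal_ofReal

/-- Tensorization by doubling both variables. The two diagonals of the rectangle `(x, y), (x', y),
(x', y'), (x, y')` have the same mean square. The sum of their squares is at most the sum over the
four sides, the defect being the square of the mixed second difference. No integrability is
required. -/
theorem osc_prod {m : Measure α} {n : Measure β} [SFinite m] [SFinite n] {f : α × β → ℝ}
    (hf : Measurable f) : osc (m.prod n) f ≤
      m Set.univ * ∫⁻ x, osc n (fun y => f (x, y)) ∂m +
      n Set.univ * ∫⁻ y, osc m (fun x => f (x, y)) ∂n := by
  let g : ℝ → ℝ → ℝ≥0∞ := fun a b => ENNReal.ofReal ((a - b) ^ 2)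
  have hgc : ∀ a b, g a b = g b a := fun a b => by simp only [g]; rw [← neg_sub, neg_sq]
  -- the four coordinates of a quadruple
  let X : ((α × α) × β) × β → α := fun p => p.1.1.1
  let X' : ((α × α) × β) × β → α := fun p => p.1.1.2
  let Y : ((α × α) × β) × β → β := fun p => p.1.2
  let Y' : ((α × α) × β) × β → β := fun p => p.2
  have hX : Measurable X := measurable_fst.comp (measurable_fst.comp measurable_fst)
  have hX' : Measurable X' := measurable_snd.comp (measurable_fst.comp measurable_fst)
  have hY : Measurable Y := measurable_snd.comp measurable_fst
  have hY' : Measurable Y' := measurable_snd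
  let L : (((α × α) × β) × β → ℝ≥0∞) → ℝ≥0∞ := fun F =>
    ∫⁻ x, ∫⁻ x', ∫⁻ y, ∫⁻ y', F (((x, x'), y), y') ∂n ∂n ∂m ∂m
  have hL : ∀ F, Measurable F → L F = ∫⁻ p, F p ∂(((m.prod m).prod n).prod n) := by
    intro F hF
    rw [lintegral_prod _ hF.aemeasurable, lintegral_prod _ hF.lintegral_prod_right'.aemeasurable,
      lintegral_prod _ hF.lintegral_prod_right'.lintegral_prod_right'.aemeasurable]
  have hLadd : ∀ F F', Measurable F → Measurable F' → L (fun p => F p + F' p) = L F + L F' := by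
    intro F F' hF hF'
    rw [hL _ hF, hL _ hF', hL (fun p => F p + F' p) (hF.add hF')]
    exact lintegral_add_left hF _
  have e1 : osc (m.prod n) f = L fun p => g (f (X p, Y p)) (f (X' p, Y' p)) := by
    have h1 : Measurable fun q : (α × β) × (α × β) => g (f q.1) (f q.2) :=
      measurable_ofReal_sub_sq (hf.comp measurable_fst) (hf.comp measurable_snd)
    rw [osc, lintegral_prod _ h1.lintegral_prod_right'.aemeasurable]
    refine lintegral_congr fun x => ?_
    have h2 : ∀ y, ∫⁻ q', g (f (x, y)) (f q') ∂(m.prod n) =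
        ∫⁻ x', ∫⁻ y', g (f (x, y)) (f (x', y')) ∂n ∂m := fun y =>
      lintegral_prod _ (measurable_ofReal_sub_sq measurable_const hf).aemeasurable
    change ∫⁻ y, ∫⁻ q', g (f (x, y)) (f q') ∂(m.prod n) ∂n = _
    simp only [h2]
    rw [lintegral_lintegral_swap]
    have h3 : Measurable fun p : (β × α) × β => g (f (x, p.1.1)) (f (p.1.2, p.2)) :=
      measurable_ofReal_sub_sq (hf.comp (measurable_const.prodMk (measurable_fst.comp measurable_fst)))
        (hf.comp ((measurable_snd.comp measurable_fst).prodMk measurable_snd))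
    exact h3.lintegral_prod_right'.aemeasurable
  have e2 : osc (m.prod n) f = L fun p => g (f (X p, Y' p)) (f (X' p, Y p)) := by
    rw [e1]
    refine lintegral_congr fun x => lintegral_congr fun x' => ?_
    rw [lintegral_lintegral_swap]
    exact (measurable_ofReal_sub_sq (hf.comp (measurable_const.prodMk measurable_fst))
      (hf.comp (measurable_const.prodMk measurable_snd))).aemeasurable
  have e3 : L (fun p => g (f (X p, Y p)) (f (X p, Y' p))) =
      m Set.univ * ∫⁻ x, osc n (fun y => f (x, y)) ∂m := by
    change ∫⁻ x, ∫⁻ x', osc n (fun y => f (x, y)) ∂m ∂m = _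
    simp only [lintegral_const]
    rw [lintegral_mul_const _ (measurable_osc hf), mul_comm]
  have e4 : L (fun p => g (f (X' p, Y' p)) (f (X' p, Y p))) =
      m Set.univ * ∫⁻ x, osc n (fun y => f (x, y)) ∂m := by
    have : L (fun p => g (f (X' p, Y' p)) (f (X' p, Y p))) =
        ∫⁻ x, ∫⁻ x', osc n (fun y => f (x', y)) ∂m ∂m := by
      refine lintegral_congr fun x => lintegral_congr fun x' => lintegral_congr fun y =>
        lintegral_congr fun y' => ?_
      exact hgc _ _
    rw [this, lintegral_const, mul_comm]
  have e5' : ∫⁻ x, ∫⁻ x', ∫⁻ y, g (f (x, y)) (f (x', y)) ∂n ∂m ∂m =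
      ∫⁻ y, osc m (fun x => f (x, y)) ∂n := by
    have h1 : Measurable fun p : (α × α) × β => g (f (p.1.1, p.2)) (f (p.1.2, p.2)) :=
      measurable_ofReal_sub_sq (hf.comp ((measurable_fst.comp measurable_fst).prodMk measurable_snd))
        (hf.comp ((measurable_snd.comp measurable_fst).prodMk measurable_snd))
    have h2 := lintegral_lintegral_swap (μ := m.prod m) (ν := n)
      (f := fun p y => g (f (p.1, y)) (f (p.2, y))) h1.aemeasurable
    rw [lintegral_prod _ h1.lintegral_prod_right'.aemeasurable] at h2
    rw [h2]
    refine lintegral_congr fun y => ?_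
    rw [lintegral_prod]
    · rfl
    · exact (h1.comp (measurable_id.prodMk measurable_const)).aemeasurable
  have e5 : L (fun p => g (f (X p, Y' p)) (f (X' p, Y' p))) =
      n Set.univ * ∫⁻ y, osc m (fun x => f (x, y)) ∂n := by
    have h1 : Measurable fun p : (α × α) × β => g (f (p.1.1, p.2)) (f (p.1.2, p.2)) :=
      measurable_ofReal_sub_sq (hf.comp ((measurable_fst.comp measurable_fst).prodMk measurable_snd))
        (hf.comp ((measurable_snd.comp measurable_fst).prodMk measurable_snd))
    change ∫⁻ x, ∫⁻ x', ∫⁻ y, ∫⁻ y', g (f (x, y')) (f (x', y')) ∂n ∂n ∂m ∂m = _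
    simp only [lintegral_const]
    rw [← e5', mul_comm, ← lintegral_mul_const _ h1.lintegral_prod_right'.lintegral_prod_right']
    refine lintegral_congr fun x => ?_
    exact lintegral_mul_const _ (h1.lintegral_prod_right'.comp measurable_prodMk_left)
  have e6 : L (fun p => g (f (X' p, Y p)) (f (X p, Y p))) =
      n Set.univ * ∫⁻ y, osc m (fun x => f (x, y)) ∂n := by
    rw [← e5]
    refine lintegral_congr fun x => lintegral_congr fun x' => ?_
    simp only [X, X', Y, Y', lintegral_const]
    rw [lintegral_mul_const]
    · congr 1
      exact lintegral_congr fun y => hgc _ _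
    · exact measurable_ofReal_sub_sq (hf.comp (measurable_const.prodMk measurable_id))
        (hf.comp (measurable_const.prodMk measurable_id))
  have m1 : Measurable fun p => f (X p, Y p) := hf.comp (hX.prodMk hY)
  have m2 : Measurable fun p => f (X p, Y' p) := hf.comp (hX.prodMk hY')
  have m3 : Measurable fun p => f (X' p, Y' p) := hf.comp (hX'.prodMk hY')
  have m4 : Measurable fun p => f (X' p, Y p) := hf.comp (hX'.prodMk hY)
  have main : osc (m.prod n) f + osc (m.prod n) f ≤
      (m Set.univ * ∫⁻ x, osc n (fun y => f (x, y)) ∂m +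
        n Set.univ * ∫⁻ y, osc m (fun x => f (x, y)) ∂n) +
      (m Set.univ * ∫⁻ x, osc n (fun y => f (x, y)) ∂m +
        n Set.univ * ∫⁻ y, osc m (fun x => f (x, y)) ∂n) := by
    nth_rewrite 1 [e1]
    rw [e2, ← hLadd _ _ (measurable_ofReal_sub_sq m1 m3) (measurable_ofReal_sub_sq m2 m4)]
    nth_rewrite 1 [← e3]
    nth_rewrite 1 [← e5]
    rw [← e4, ← e6, ← hLadd _ _ (measurable_ofReal_sub_sq m1 m2) (measurable_ofReal_sub_sq m2 m3), ← hLadd _ _ (measurable_ofReal_sub_sq m3 m4) (measurable_ofReal_sub_sq m4 m1)]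
    refine le_trans ?_ (hLadd _ _
      ((measurable_ofReal_sub_sq m1 m2).add (measurable_ofReal_sub_sq m2 m3))
      ((measurable_ofReal_sub_sq m3 m4).add (measurable_ofReal_sub_sq m4 m1))).le
    refine lintegral_mono fun x => lintegral_mono fun x' => lintegral_mono fun y =>
      lintegral_mono fun y' => ?_
    simp only [g, X, X', Y, Y', Pi.add_apply]
    rw [← ENNReal.ofReal_add (sq_nonneg _) (sq_nonneg _),
      ← ENNReal.ofReal_add (sq_nonneg _) (sq_nonneg _),
      ← ENNReal.ofReal_add (sq_nonneg _) (sq_nonneg _),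
      ← ENNReal.ofReal_add (by positivity) (by positivity)]
    refine ENNReal.ofReal_le_ofReal ?_
    nlinarith [sq_nonneg (f (x, y) + f (x', y') - f (x, y') - f (x', y))]
  rw [← two_mul, ← two_mul] at main
  exact (ENNReal.mul_le_mul_iff_right (by norm_num) (by norm_num)).1 main

end osc

/-- The map contracts towards `y` by the factor `1 - t ≥ 1/2`, so the change of variables costs at
most `2 ^ d`; convexity keeps the image inside `U`. -/
theorem lintegral_comp_segment_le {U : Set (Space d)} (hU : Convex ℝ U) (hUm : MeasurableSet U)
    {h : Space d → ℝ≥0∞} (hm : Measurable (U.indicator h)) {y : Space d} (hy : y ∈ U) {t : ℝ} (ht0 : 0 ≤ t)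
    (ht : t ≤ 1 / 2) :
    ∫⁻ x in U, h (x + t • (y - x)) ≤ 2 ^ d * ∫⁻ x in U, h x := by
  have h1 : ∫⁻ x in U, h (x + t • (y - x)) ≤ ∫⁻ x, U.indicator h ((1 - t) • x + t • y) := by
    rw [← lintegral_indicator hUm]
    refine lintegral_mono fun x => ?_
    by_cases hx : x ∈ U
    · have e : x + t • (y - x) = (1 - t) • x + t • y := by
        rw [smul_sub, sub_smul, one_smul]; abel
      have : (1 - t) • x + t • y ∈ U := hU hx hy (by linarith) ht0 (by ring)
      simp [hx, e, this]
    · simp [hx]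
  refine h1.trans ?_
  have ht1 : (1 - t) ≠ 0 := by linarith
  have h2 : ∫⁻ x, U.indicator h ((1 - t) • x + t • y) =
      ENNReal.ofReal |((1 - t) ^ d)⁻¹| * ∫⁻ x in U, h x := by
    have h3 : Measurable fun x => U.indicator h (x + t • y) := hm.comp (measurable_add_const _)
    have h4 := lintegral_map (μ := (volume : Measure (Space d))) h3
      (measurable_const_smul (1 - t))
    rw [← h4, Measure.map_addHaar_smul volume ht1, lintegral_smul_measure,
      lintegral_add_right_eq_self (fun x => U.indicator h x), lintegral_indicator hUm]
    simp
  rw [h2]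
  gcongr
  have h5 : |((1 - t) ^ d)⁻¹| ≤ 2 ^ d := by
    rw [abs_of_nonneg (inv_nonneg.2 (pow_nonneg (by linarith) d)), ← inv_pow]
    refine pow_le_pow_left₀ (by rw [inv_nonneg]; linarith) ?_ d
    rw [inv_le_comm₀ (by linarith) (by norm_num)]
    linarith
  calc ENNReal.ofReal |((1 - t) ^ d)⁻¹| ≤ ENNReal.ofReal (2 ^ d) := ENNReal.ofReal_le_ofReal h5
    _ = 2 ^ d := by rw [ENNReal.ofReal_pow (by norm_num)]; simp

/-- The increment of `g` is the integral of its gradient along the segment, which stays in `U` by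
convexity; Cauchy–Schwarz in the parameter leaves averages of `‖v‖²` over intermediate points. -/
theorem osc_le_of_convex {U : Set (Space d)} (hUo : IsOpen U) (hU : Convex ℝ U) {D : ℝ}
    (hD : ∀ x ∈ U, ∀ y ∈ U, ‖y - x‖ ≤ D) {g : Space d → ℝ} {v : Space d → Space d}
    (hg : ∀ z ∈ U, HasFDerivAt g (innerSL ℝ (v z)) z) (hv : ContinuousOn v U) :
    osc (volume.restrict U) g ≤
      ENNReal.ofReal D ^ 2 * (volume U * (2 ^ d * ∫⁻ z in U, ‖v z‖ₑ ^ 2)) := by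
  have hUm := hUo.measurableSet
  let h : Space d → ℝ≥0∞ := fun z => ‖v z‖ₑ ^ 2
  have hH : Measurable (U.indicator h) := by
    classical
    rw [← Set.piecewise_eq_indicator]
    refine ContinuousOn.measurable_piecewise ?_ continuousOn_const hUm
    exact (ENNReal.continuous_pow 2).comp_continuousOn (continuous_enorm.comp_continuousOn hv)
  have hseg : ∀ x ∈ U, ∀ y ∈ U, ∀ t : ℝ, 0 ≤ t → t ≤ 1 → x + t • (y - x) ∈ U :=
    fun x hx y hy t h0 h1 => hU.add_smul_sub_mem hx hy ⟨h0, h1⟩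
  have pt : ∀ x ∈ U, ∀ y ∈ U, ENNReal.ofReal ((g x - g y) ^ 2) ≤
      ENNReal.ofReal D ^ 2 * ∫⁻ t in Set.Ioc (0 : ℝ) 1, U.indicator h (x + t • (y - x)) := by
    intro x hx y hy
    have hγ : ContinuousOn (fun t : ℝ => v (x + t • (y - x))) (Set.Icc 0 1) :=
      hv.comp (by fun_prop) fun t ht => hseg x hx y hy t ht.1 ht.2
    have hd : ∀ t ∈ Set.uIcc (0 : ℝ) 1, HasDerivAt (fun t : ℝ => g (x + t • (y - x)))
        (inner ℝ (v (x + t • (y - x))) (y - x)) t := by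
      intro t ht
      rw [Set.uIcc_of_le zero_le_one] at ht
      have h3 : HasDerivAt (fun t : ℝ => x + t • (y - x)) (y - x) t := by
        simpa using ((hasDerivAt_id t).smul_const (y - x)).const_add x
      exact (hg _ (hseg x hx y hy t ht.1 ht.2)).comp_hasDerivAt t h3
    have hc : ContinuousOn (fun t : ℝ => inner ℝ (v (x + t • (y - x))) (y - x)) (Set.uIcc 0 1) := by
      rw [Set.uIcc_of_le zero_le_one]
      exact hγ.inner continuousOn_const
    have h1 := intervalIntegral.integral_eq_sub_of_hasDerivAt hd hc.intervalIntegrable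
    rw [intervalIntegral.integral_of_le zero_le_one] at h1
    simp only [one_smul, add_sub_cancel, zero_smul, add_zero] at h1
    have h2 : ENNReal.ofReal ((g x - g y) ^ 2) = ‖g y - g x‖ₑ ^ 2 := by
      rw [Real.enorm_eq_ofReal_abs, ← ENNReal.ofReal_pow (abs_nonneg _), sq_abs, ← neg_sub, neg_sq]
    have hm : AEMeasurable (fun t : ℝ => ‖v (x + t • (y - x))‖ₑ)
        (volume.restrict (Set.Ioc 0 1)) :=
      ((hγ.mono Set.Ioc_subset_Icc_self).aemeasurable measurableSet_Ioc).enorm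
    rw [h2, ← h1]
    calc ‖∫ t in Set.Ioc (0 : ℝ) 1, inner ℝ (v (x + t • (y - x))) (y - x)‖ₑ ^ 2
        ≤ (∫⁻ t in Set.Ioc (0 : ℝ) 1, ‖v (x + t • (y - x))‖ₑ * ENNReal.ofReal D) ^ 2 := by
          gcongr
          refine (enorm_integral_le_lintegral_enorm _).trans (lintegral_mono fun t => ?_)
          rw [← ofReal_norm, ← ofReal_norm, ← ENNReal.ofReal_mul (norm_nonneg _)]
          exact ENNReal.ofReal_le_ofReal ((norm_inner_le_norm _ _).trans (by gcongr; exact hD x hx y hy))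
      _ ≤ 1 * ∫⁻ t in Set.Ioc (0 : ℝ) 1, (‖v (x + t • (y - x))‖ₑ * ENNReal.ofReal D) ^ 2 := by
          refine (sq_lintegral_le _ (hm.mul_const _)).trans ?_
          simp
      _ = _ := by
          simp only [mul_pow]
          rw [one_mul, lintegral_mul_const'' _ (hm.pow_const 2), mul_comm]
          congr 1
          refine setLIntegral_congr_fun measurableSet_Ioc fun t ht => ?_
          simp [hseg x hx y hy t ht.1.le ht.2, h]
  have hmeas : Measurable fun p : (Space d × Space d) × ℝ =>
      U.indicator h (p.1.1 + p.2 • (p.1.2 - p.1.1)) :=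
    hH.comp (by fun_prop)
  have bd : ∀ t ∈ Set.Ioc (0 : ℝ) 1, ∫⁻ x in U, ∫⁻ y in U, U.indicator h (x + t • (y - x)) ≤
      volume U * (2 ^ d * ∫⁻ z in U, h z) := by
    intro t ht
    have hi : ∫⁻ z in U, U.indicator h z = ∫⁻ z in U, h z :=
      setLIntegral_congr_fun hUm fun z hz => by simp [hz]
    have hH' : Measurable (U.indicator (U.indicator h)) := by
      rwa [Set.indicator_indicator, Set.inter_self]
    -- The endpoint farther from a contraction is integrated first: `x` for `t ≤ 1/2`, `y` for `t ≥
    -- 1/2`, so that the contraction factor is never below `1/2`.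
    rcases le_total t (1 / 2) with ht2 | ht2
    · rw [lintegral_lintegral_swap]
      · calc ∫⁻ y in U, ∫⁻ x in U, U.indicator h (x + t • (y - x))
            ≤ ∫⁻ y in U, 2 ^ d * ∫⁻ z in U, h z :=
              setLIntegral_mono' hUm fun y hy => by
                rw [← hi]
                exact lintegral_comp_segment_le hU hUm hH' hy ht.1.le ht2
          _ = _ := by rw [setLIntegral_const, mul_comm]
      · exact (hmeas.comp (measurable_id.prodMk measurable_const)).aemeasurable
    · calc ∫⁻ x in U, ∫⁻ y in U, U.indicator h (x + t • (y - x))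
            ≤ ∫⁻ x in U, 2 ^ d * ∫⁻ z in U, h z :=
              setLIntegral_mono' hUm fun x hx => by
                rw [← hi]
                have h3 : ∀ y, x + t • (y - x) = y + (1 - t) • (x - y) := fun y => by
                  rw [sub_smul, one_smul, ← neg_sub x y, smul_neg]; abel
                simp only [h3]
                exact lintegral_comp_segment_le hU hUm hH' hx (by linarith [ht.2]) (by linarith)
          _ = _ := by rw [setLIntegral_const, mul_comm]
  calc osc (volume.restrict U) g
      ≤ ∫⁻ x in U, ∫⁻ y in U, ENNReal.ofReal D ^ 2 *
          ∫⁻ t in Set.Ioc (0 : ℝ) 1, U.indicator h (x + t • (y - x)) :=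
        setLIntegral_mono' hUm fun x hx => setLIntegral_mono' hUm fun y hy => pt x hx y hy
    _ = ENNReal.ofReal D ^ 2 * ∫⁻ x in U, ∫⁻ y in U,
          ∫⁻ t in Set.Ioc (0 : ℝ) 1, U.indicator h (x + t • (y - x)) := by
        have hne : ENNReal.ofReal D ^ 2 ≠ ⊤ := by finiteness
        simp_rw [lintegral_const_mul' _ _ hne]
    _ = ENNReal.ofReal D ^ 2 * ∫⁻ t in Set.Ioc (0 : ℝ) 1, ∫⁻ x in U, ∫⁻ y in U,
          U.indicator h (x + t • (y - x)) := by
        congr 1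
        have h4 := lintegral_lintegral_swap (μ := (volume.restrict U).prod (volume.restrict U))
          (ν := volume.restrict (Set.Ioc (0 : ℝ) 1))
          (f := fun p t => U.indicator h (p.1 + t • (p.2 - p.1))) hmeas.aemeasurable
        rw [lintegral_prod _ hmeas.lintegral_prod_right'.aemeasurable] at h4
        rw [h4]
        refine lintegral_congr fun t => ?_
        exact lintegral_prod _ (hmeas.comp (measurable_id.prodMk measurable_const)).aemeasurable
    _ ≤ ENNReal.ofReal D ^ 2 * ∫⁻ t in Set.Ioc (0 : ℝ) 1,
          volume U * (2 ^ d * ∫⁻ z in U, h z) := by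
        exact mul_le_mul_right (setLIntegral_mono' measurableSet_Ioc bd) _
    _ = _ := by simp [h]

namespace Config

theorem osc_level_zero {W : Set (Space d)} {f : Config d → ℝ} (hf : AEMeasurable f (level W 0)) :
    osc (level W 0) f = 0 := by
  rw [osc_congr hf.ae_eq_mk]
  have hm : Measurable fun q : Config d × Config d =>
      ENNReal.ofReal ((hf.mk f q.1 - hf.mk f q.2) ^ 2) :=
    measurable_ofReal_sub_sq (hf.measurable_mk.comp measurable_fst)
      (hf.measurable_mk.comp measurable_snd)
  have h1 := lintegral_dirac' (empty : Config d)
    (hm.lintegral_prod_right' (ν := level W 0))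
  have h2 := lintegral_dirac' (empty : Config d) (hm.comp (measurable_prodMk_left (x := empty)))
  simp only [osc, level]
  refine h1.trans ?_
  refine Eq.trans ?_ (h2.trans ?_)
  · simp only [level]
    rfl
  · simp

/-- Tensorization over the particles; by exchangeability the `n + 1` contributions coincide. -/
theorem osc_level {W : Set (Space d)} {f : Config d → ℝ} (hf : Measurable f)
    (n : ℕ) : osc (level W (n + 1)) f ≤ (n + 1) * (volume W ^ n *
      ∫⁻ μ, osc (volume.restrict W) (fun x => f (μ.add (point x))) ∂(level W n)) := by
  have step : ∀ (n : ℕ) (f : Config d → ℝ), Measurable f → osc (level W (n + 1)) f ≤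
      volume W ^ n * ∫⁻ μ, osc (volume.restrict W) (fun x => f (μ.add (point x))) ∂(level W n) +
      volume W * ∫⁻ x in W, osc (level W n) (fun μ => f (μ.add (point x))) := by
    intro n f hf
    rw [level, osc_map measurable_add_point hf]
    refine (osc_prod (hf.comp measurable_add_point)).trans ?_
    rw [level_univ, Measure.restrict_apply_univ]
    rfl
  induction n generalizing f with
  | zero =>
    refine (step 0 f hf).trans ?_
    have : ∀ x, osc (level W 0) (fun μ => f (μ.add (point x))) = 0 := fun x => by
      have hm : Measurable fun μ : Config d => f (μ.add (point x)) :=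
        hf.comp (measurable_id.config_add measurable_const)
      exact osc_level_zero hm.aemeasurable
    simp [this]
  | succ n ih =>
    have hosc : Measurable fun μ : Config d =>
        osc (volume.restrict W) fun x => f (μ.add (point x)) :=
      measurable_osc (hf.comp measurable_add_point)
    refine (step (n + 1) f hf).trans ?_
    have h1 : ∫⁻ x in W, osc (level W (n + 1)) (fun μ => f (μ.add (point x))) ≤
        (n + 1) * (volume W ^ n *
          ∫⁻ μ, osc (volume.restrict W) (fun x => f (μ.add (point x))) ∂(level W (n + 1))) := by
      calc ∫⁻ x in W, osc (level W (n + 1)) (fun μ => f (μ.add (point x)))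
          ≤ ∫⁻ x in W, (n + 1) * (volume W ^ n * ∫⁻ μ, osc (volume.restrict W)
              (fun y => f ((μ.add (point x)).add (point y))) ∂(level W n)) := by
            refine lintegral_mono fun x => ?_
            refine (ih (f := fun μ => f (μ.add (point x)))
              (hf.comp (measurable_id.config_add measurable_const))).trans (le_of_eq ?_)
            simp only [add_right_comm _ _ (point x)]
        _ = _ := by
            have hm3 : Measurable fun q : Config d × Space d =>
                osc (volume.restrict W) fun y => f ((q.1.add (point q.2)).add (point y)) :=
              hosc.comp measurable_add_point
            rw [lintegral_level_succ _ _ hosc, lintegral_lintegral_swap hm3.aemeasurable,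
              lintegral_const_mul, lintegral_const_mul]
            · exact hm3.lintegral_prod_left'
            · exact hm3.lintegral_prod_left'.const_mul _
    calc _ ≤ volume W ^ (n + 1) * ∫⁻ μ, osc (volume.restrict W)
              (fun x => f (μ.add (point x))) ∂(level W (n + 1)) + volume W * ((n + 1) * (volume W ^ n *
          ∫⁻ μ, osc (volume.restrict W) (fun x => f (μ.add (point x))) ∂(level W (n + 1)))) := by
            gcongr
      _ = _ := by push_cast; ring

theorem SmoothOn.continuousOn_rgrad {U : Set (Space d)} (hU : IsOpen U) {f : Config d → ℝ}
    (hf : SmoothOn U f) {μ : Config d} (hμ : μ.1 U ≠ ⊤) :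
    ContinuousOn (fun z => rgrad f μ z) U := by
  have h1 := (hf.contDiffOn hU.measurableSet hμ).continuousOn_fderiv_of_isOpen hU (by simp)
  refine ((InnerProductSpace.toDual ℝ (Space d)).symm.continuous.comp_continuousOn h1).congr ?_
  intro z hz
  have h2 := (hf.hasFDerivAt hU hμ hz).fderiv
  simp only [Function.comp_apply, h2]
  exact ((InnerProductSpace.toDual ℝ (Space d)).symm_apply_apply _).symm

theorem osc_level_le {U : Set (Space d)} (hUo : IsOpen U) (hU : Convex ℝ U)
    (hv : volume U ≠ ⊤) {D : ℝ} (hD : ∀ x ∈ U, ∀ y ∈ U, ‖y - x‖ ≤ D) {f : Config d → ℝ}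
    (hf : SmoothOn U f) {η : Config d} (hη : η.1 U = 0) {n : ℕ}
    (hm : AEMeasurable (fun μ => f (μ.add η)) (level U (n + 1))) :
    osc (level U (n + 1)) (fun μ => f (μ.add η)) ≤ (n + 1) * (volume U ^ (n + 1) *
      (ENNReal.ofReal D ^ 2 * 2 ^ d *
        ∫⁻ μ, ∫⁻ z in U, ‖rgrad f (μ.add η) z‖ₑ ^ 2 ∂volume ∂(level U n))) := by
  obtain ⟨g, hg, hfg⟩ := hm
  rw [osc_congr hfg]
  refine (osc_level hg n).trans ?_
  have h1 : ∀ᵐ μ ∂(level U n), osc (volume.restrict U) (fun x => g (μ.add (point x))) ≤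
      (ENNReal.ofReal D ^ 2 * 2 ^ d * volume U) * ∫⁻ z in U, ‖rgrad f (μ.add η) z‖ₑ ^ 2 := by
    have h2 := Measure.ae_ae_of_ae_prod (ae_of_ae_map measurable_add_point.aemeasurable hfg)
    filter_upwards [h2, ae_level hUo.measurableSet n] with μ hμ hμ'
    have h3 : (μ.add η).1 U ≠ ⊤ := by
      rw [add_apply, hμ'.1, hη]; simp
    rw [← osc_congr hμ]
    refine (osc_le_of_convex hUo hU hD (v := fun z => rgrad f (μ.add η) z) (fun z hz => ?_)
      (hf.continuousOn_rgrad hUo h3)).trans (le_of_eq (by ring))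
    have := hf.hasFDerivAt hUo h3 hz
    simpa only [add_right_comm _ η] using this
  calc _ ≤ (n + 1) * (volume U ^ n * ∫⁻ μ, (ENNReal.ofReal D ^ 2 * 2 ^ d * volume U) *
        ∫⁻ z in U, ‖rgrad f (μ.add η) z‖ₑ ^ 2 ∂volume ∂(level U n)) :=
          mul_le_mul_right (mul_le_mul_right (lintegral_mono_ae h1) _) _
    _ = _ := by
      rw [lintegral_const_mul' _ _ (by finiteness)]
      ring

end Config

theorem MeasureTheory.MemLp.ae_slice {α β F : Type*} [MeasurableSpace α] [MeasurableSpace β]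
    [NormedAddCommGroup F] {m : Measure α} {n : Measure β} [SFinite m] [SFinite n] {f : α × β → F}
    (hf : MemLp f 2 (m.prod n)) : ∀ᵐ x ∂m, MemLp (fun y => f (x, y)) 2 n := by
  have h1 : ∫⁻ x, ∫⁻ y, ‖f (x, y)‖ₑ ^ 2 ∂n ∂m < ⊤ := by
    rw [← lintegral_prod _ (hf.1.enorm.pow_const 2), Config.lintegral_enorm_sq_eq]
    exact ENNReal.pow_lt_top hf.2
  have h2 := ae_lt_top' (hf.1.enorm.pow_const 2).lintegral_prod_right' h1.ne
  filter_upwards [h2, hf.1.prodMk_left] with x hx hx'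
  refine ⟨hx', ?_⟩
  rw [Config.lintegral_enorm_sq_eq] at hx
  exact (ENNReal.pow_lt_top_iff.1 hx).resolve_right (by norm_num)

theorem MeasureTheory.MemLp.ae_slice_right {α β F : Type*} [MeasurableSpace α]
    [MeasurableSpace β] [NormedAddCommGroup F] {m : Measure α} {n : Measure β} [SFinite m]
    [SFinite n] {f : α × β → F} (hf : MemLp f 2 (m.prod n)) :
    ∀ᵐ y ∂n, MemLp (fun x => f (x, y)) 2 m := by
  have : MemLp (fun q : β × α => f q.swap) 2 (n.prod m) :=
    hf.comp_measurePreserving Measure.measurePreserving_swap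
  exact this.ae_slice

namespace Config

theorem lintegral_mixed {ρ : ℝ} {U : Set (Space d)} {κ : Measure (Config d)} [SFinite κ]
    {F : Config d → ℝ≥0∞} (hF : AEMeasurable F (mixed ρ U κ)) :
    ∫⁻ μ, F μ ∂(mixed ρ U κ) = ∫⁻ η, ∑' n, ENNReal.ofReal (weight ρ U n) *
      ∫⁻ μ, F (μ.add η) ∂(level U n) ∂κ := by
  rw [mixed, lintegral_map' hF measurable_add'.aemeasurable]
  refine (lintegral_prod_symm _ (hF.comp_measurable measurable_add')).trans ?_
  exact lintegral_congr fun η => lintegral_poissonOn _ _ _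

theorem level_absolutelyContinuous {ρ : ℝ} (hρ : 0 < ρ) (U : Set (Space d)) (n : ℕ) :
    level U n ≪ poissonOn ρ U := by
  refine Measure.AbsolutelyContinuous.mk fun s hs h => ?_
  rw [poissonOn, Measure.sum_apply _ hs, ENNReal.tsum_eq_zero] at h
  have := h n
  rw [Measure.smul_apply, smul_eq_mul, mul_eq_zero] at this
  exact this.resolve_left (by simpa using weight_pos hρ U n)

theorem memLp_level {ρ : ℝ} (hρ : 0 < ρ) {U : Set (Space d)} {F : Type*} [NormedAddCommGroup F]
    {f : Config d → F} (hf : MemLp f 2 (poissonOn ρ U)) (n : ℕ) : MemLp f 2 (level U n) := by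
  refine ⟨hf.1.mono_ac (level_absolutelyContinuous hρ U n), ?_⟩
  have h := hf.2
  rw [← ENNReal.pow_lt_top_iff (n := 2) |>.trans (or_iff_left (by norm_num)),
    ← lintegral_enorm_sq_eq, lintegral_poissonOn] at h
  have h2 := (ENNReal.le_tsum n).trans_lt h
  rw [← ENNReal.pow_lt_top_iff (n := 2) |>.trans (or_iff_left (by norm_num)),
    ← lintegral_enorm_sq_eq]
  exact ENNReal.lt_top_of_mul_ne_top_right h2.ne (by simpa using weight_pos hρ U n)

/-- The inequality is proved on each level, with the configuration outside `U` frozen, where the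
mean vanishes. The factor `n + 1` from tensorization is absorbed by `weight_succ`, so the constant
does not grow with the number of particles. -/
theorem poincare {ρ : ℝ} (hρ : 0 < ρ) {U : Set (Space d)} (hUo : IsOpen U) (hU : Convex ℝ U)
    (hv0 : volume U ≠ 0) (hv : volume U ≠ ⊤) {D : ℝ} (hD : ∀ x ∈ U, ∀ y ∈ U, ‖y - x‖ ≤ D)
    {κ : Measure (Config d)} [SFinite κ] (hκ : ∀ᵐ η ∂κ, η.1 U = 0) {f : Config d → ℝ}
    (hf : IsTest (mixed ρ U κ) (mixed ρ U κ) U f)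
    (h0 : ∀ n, ∀ᵐ η ∂κ, ∫ μ, f (μ.add η) ∂(level U n) = 0) :
    ∫⁻ μ, ‖f μ‖ₑ ^ 2 ∂(mixed ρ U κ) ≤ ENNReal.ofReal ρ * (ENNReal.ofReal D ^ 2 * 2 ^ d) *
      ∫⁻ q, ‖rgrad f q.1 q.2‖ₑ ^ 2 ∂((mixed ρ U κ).prod (volume.restrict U)) := by
  have hmix : SFinite (mixed ρ U κ) := by unfold mixed; infer_instance
  have hm : AEMeasurable (fun q : Config d × Space d => ‖rgrad f q.1 q.2‖ₑ ^ 2)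
      ((mixed ρ U κ).prod (volume.restrict U)) := hf.memLp_rgrad.1.enorm.pow_const 2
  rw [lintegral_mixed (hf.memLp.1.enorm.pow_const 2), lintegral_prod _ hm,
    lintegral_mixed hm.lintegral_prod_right',
    ← lintegral_const_mul' _ _ (by finiteness)]
  have hsl : ∀ᵐ η ∂κ, MemLp (fun μ => f (μ.add η)) 2 (poissonOn ρ U) := by
    have h1 : MemLp (fun q : Config d × Config d => f (q.1.add q.2)) 2 ((poissonOn ρ U).prod κ) :=
      (memLp_map_measure_iff hf.memLp.1 measurable_add'.aemeasurable).1 hf.memLp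
    exact h1.ae_slice_right
  refine lintegral_mono_ae ?_
  filter_upwards [hκ, hsl, ae_all_iff.2 h0] with η hη hη2 hη0
  have key : ∀ n, volume U ^ n * ∫⁻ μ, ‖f (μ.add η)‖ₑ ^ 2 ∂(level U n) ≤
      osc (level U n) fun μ => f (μ.add η) := by
    intro n
    have := isFiniteMeasure_level hv n
    rw [← level_univ]
    exact mul_lintegral_sq_le_osc (memLp_level hρ hη2 n) (hη0 n)
  rw [tsum_eq_zero_add' ENNReal.summable, ← ENNReal.tsum_mul_left]
  -- Without particles in `U` there is no oscillation, so a function of mean zero vanishes.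
  have k0 := key 0
  rw [osc_level_zero (memLp_level hρ hη2 0).1.aemeasurable, pow_zero, one_mul] at k0
  rw [le_zero_iff.1 k0, mul_zero, zero_add]
  refine ENNReal.tsum_le_tsum fun n => ?_
  have k1 := (key (n + 1)).trans (osc_level_le hUo hU hv hD hf.smoothOn hη
    (memLp_level hρ hη2 (n + 1)).1.aemeasurable)
  have k2 : ∫⁻ μ, ‖f (μ.add η)‖ₑ ^ 2 ∂(level U (n + 1)) ≤ (n + 1) *
      (ENNReal.ofReal D ^ 2 * 2 ^ d *
        ∫⁻ μ, ∫⁻ z in U, ‖rgrad f (μ.add η) z‖ₑ ^ 2 ∂volume ∂(level U n)) := by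
    refine (ENNReal.mul_le_mul_iff_right (pow_ne_zero (n + 1) hv0)
      (ENNReal.pow_ne_top hv)).1 (k1.trans (le_of_eq (by ring)))
  calc _ ≤ ENNReal.ofReal (weight ρ U (n + 1)) * ((n + 1) * (ENNReal.ofReal D ^ 2 * 2 ^ d *
        ∫⁻ μ, ∫⁻ z in U, ‖rgrad f (μ.add η) z‖ₑ ^ 2 ∂volume ∂(level U n))) := by gcongr
    _ = ENNReal.ofReal (weight ρ U (n + 1) * (n + 1)) * (ENNReal.ofReal D ^ 2 * 2 ^ d *
        ∫⁻ μ, ∫⁻ z in U, ‖rgrad f (μ.add η) z‖ₑ ^ 2 ∂volume ∂(level U n)) := by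
      rw [ENNReal.ofReal_mul (weight_nonneg hρ.le _ _), ENNReal.ofReal_add (by positivity)
        zero_le_one, ENNReal.ofReal_natCast, ENNReal.ofReal_one]
      ring
    _ = _ := by
      rw [weight_succ, ENNReal.ofReal_mul hρ.le]
      ring

theorem poissonOn_restrict (ρ : ℝ) {U : Set (Space d)} (hU : MeasurableSet U) (n : ℕ) :
    (poissonOn ρ U).restrict {μ | μ.1 U = n} = ENNReal.ofReal (weight ρ U n) • level U n := by
  have hm : MeasurableSet {μ : Config d | μ.1 U = n} :=
    (measurable_eval hU) (measurableSet_singleton _)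
  have h1 : ∀ k, (level U k).restrict {μ | μ.1 U = n} = if k = n then level U k else 0 := by
    intro k
    split_ifs with h
    · refine Measure.restrict_eq_self_of_ae_mem ?_
      filter_upwards [ae_level hU k] with μ hμ
      simp [hμ.1, h]
    · rw [Measure.restrict_eq_zero]
      refine measure_eq_zero_iff_ae_notMem.2 ?_
      filter_upwards [ae_level hU k] with μ hμ
      simp [hμ.1, h]
  ext s hs
  rw [poissonOn, Measure.restrict_sum _ hm, Measure.sum_apply _ hs, tsum_eq_single n]
  · rw [Measure.restrict_smul, h1, if_pos rfl]
  · intro k hk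
    rw [Measure.restrict_smul, h1, if_neg hk]
    simp

theorem mixed_restrict (ρ : ℝ) {U : Set (Space d)} (hU : MeasurableSet U)
    {κ : Measure (Config d)} [SFinite κ] (hκ : ∀ᵐ η ∂κ, η.1 U = 0) (n : ℕ) {B : Set (Config d)}
    (hB : MeasurableSet B) :
    (mixed ρ U κ).restrict {μ | μ.1 U = n ∧ μ.res Uᶜ ∈ B} = ((ENNReal.ofReal (weight ρ U n) •
      level U n).prod (κ.restrict B)).map fun q => q.1.add q.2 := by
  have hm : MeasurableSet {μ : Config d | μ.1 U = n ∧ μ.res Uᶜ ∈ B} :=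
    ((measurable_eval hU) (measurableSet_singleton _)).inter (measurable_res hU.compl hB)
  rw [mixed, Measure.restrict_map measurable_add' hm, ← poissonOn_restrict ρ hU,
    Measure.prod_restrict]
  congr 1
  refine Measure.restrict_congr_set ?_
  have h1 : ∀ᵐ q ∂((poissonOn ρ U).prod κ), q.1.1 Uᶜ = 0 :=
    Measure.quasiMeasurePreserving_fst.ae ((ae_poissonOn hU).mono fun μ hμ => hμ.2)
  have h2 : ∀ᵐ q ∂((poissonOn ρ U).prod κ), q.2.1 U = 0 :=
    Measure.quasiMeasurePreserving_snd.ae hκ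
  filter_upwards [h1, h2] with q hq1 hq2
  have e1 : (q.1.add q.2).res Uᶜ = q.2 := by
    rw [res_add]
    refine ext_val ?_
    change q.1.1.restrict Uᶜ + q.2.1.restrict Uᶜ = q.2.1
    rw [Measure.restrict_eq_zero.2 hq1, zero_add]
    refine Measure.restrict_eq_self_of_ae_mem ?_
    rw [ae_iff]
    simpa using hq2
  refine propext ?_
  change (q.1.add q.2).1 U = n ∧ (q.1.add q.2).res Uᶜ ∈ B ↔ q.1.1 U = n ∧ q.2 ∈ B
  rw [e1, add_apply, hq2, add_zero]

/-- The conditioning `σ`-algebra contains the events that there are `n` particles in `U` and that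
the outer configuration lies in `B`. On such an event the law is a product, so integrals of `f` over
level `n` have zero integral over every `B`. -/
theorem integral_level_eq_zero_of_condExp {ρ : ℝ} (hρ : 0 < ρ) {U : Set (Space d)}
    (hU : MeasurableSet U) {κ : Measure (Config d)} [SigmaFinite κ] (hκ : ∀ᵐ η ∂κ, η.1 U = 0)
    [IsFiniteMeasure (mixed ρ U κ)] {f : Config d → ℝ} (hf : Integrable f (mixed ρ U κ))
    (h : (mixed ρ U κ)[f | outerAlgebra U] =ᵐ[mixed ρ U κ] 0) (n : ℕ) :
    ∀ᵐ η ∂κ, ∫ μ, f (μ.add η) ∂(level U n) = 0 := by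
  have hle : outerAlgebra U ≤ (inferInstance : MeasurableSpace (Config d)) :=
    ((measurable_eval hU).prodMk (measurable_res hU.compl)).comap_le
  have hw : (ENNReal.ofReal (weight ρ U n)).toReal ≠ 0 := by
    rw [ENNReal.toReal_ofReal (weight_nonneg hρ.le _ _)]
    exact (weight_pos hρ U n).ne'
  have hfi : Integrable (fun q : Config d × Config d => f (q.1.add q.2))
      ((ENNReal.ofReal (weight ρ U n) • level U n).prod κ) := by
    have h1 : Integrable (fun q : Config d × Config d => f (q.1.add q.2))
        ((poissonOn ρ U).prod κ) :=
      (integrable_map_measure hf.1 measurable_add'.aemeasurable).1 hf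
    rw [← poissonOn_restrict ρ hU, ← Measure.restrict_univ (μ := κ), Measure.prod_restrict]
    exact h1.restrict
  have h3 : (fun η => ∫ μ, f (μ.add η) ∂(ENNReal.ofReal (weight ρ U n) • level U n)) =ᵐ[κ] 0 := by
    refine Integrable.ae_eq_zero_of_forall_setIntegral_eq_zero hfi.integral_prod_right
      fun B hB _ => ?_
    have hS : MeasurableSet[outerAlgebra U] {μ : Config d | μ.1 U = n ∧ μ.res Uᶜ ∈ B} :=
      ⟨{(n : ℝ≥0∞)} ×ˢ B, (measurableSet_singleton _).prod hB, rfl⟩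
    have h4 : ∫ μ in {μ : Config d | μ.1 U = n ∧ μ.res Uᶜ ∈ B}, f μ ∂(mixed ρ U κ) = 0 := by
      rw [← setIntegral_condExp hle hf hS,
        setIntegral_congr_ae (hle _ hS) (h.mono fun μ hμ _ => hμ)]
      simp
    rw [mixed_restrict ρ hU hκ n hB, integral_map measurable_add'.aemeasurable,
      integral_prod_symm] at h4
    · exact h4
    · rw [← Measure.restrict_univ (μ := ENNReal.ofReal (weight ρ U n) • level U n),
        Measure.prod_restrict]
      exact hfi.restrict
    · rw [← mixed_restrict ρ hU hκ n hB]
      exact hf.1.restrict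
  filter_upwards [h3] with η hη
  rw [integral_smul_measure] at hη
  exact (smul_eq_zero.1 hη).resolve_left hw

end Config

end

/-! ### Multiplication operators, gradient fields and weak solutions. -/

noncomputable section

variable {d : ℕ}

section mulOp

variable {Ω E : Type*} [MeasurableSpace Ω] [NormedAddCommGroup E] [InnerProductSpace ℝ E]
  {m : Measure Ω}

/-- Bounded, strongly measurable fields of operators. -/
structure IsBddField (a : Ω → E →L[ℝ] E) : Prop where
  sm : StronglyMeasurable a
  bdd : ∃ C : ℝ, ∀ ω v, ‖a ω v‖ ≤ C * ‖v‖

theorem IsBddField.memLp {a : Ω → E →L[ℝ] E} (ha : IsBddField a) {u : Ω → E}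
    (hu : MemLp u 2 m) : MemLp (fun ω => a ω (u ω)) 2 m := by
  obtain ⟨C, hC⟩ := ha.bdd
  exact hu.of_le_mul (isBoundedBilinearMap_apply.continuous.comp_aestronglyMeasurable
    (ha.sm.aestronglyMeasurable.prodMk hu.1))
    (Eventually.of_forall fun ω => hC ω (u ω))

theorem IsBddField.sub {a b : Ω → E →L[ℝ] E} (ha : IsBddField a) (hb : IsBddField b) :
    IsBddField fun ω => a ω - b ω := by
  obtain ⟨C, hC⟩ := ha.bdd
  obtain ⟨C', hC'⟩ := hb.bdd
  refine ⟨ha.sm.sub hb.sm, C + C', fun ω v => ?_⟩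
  rw [sub_apply, add_mul]
  exact (norm_sub_le _ _).trans (add_le_add (hC ω v) (hC' ω v))

theorem IsBddField.comp {Ω' : Type*} [MeasurableSpace Ω'] {a : Ω → E →L[ℝ] E}
    (ha : IsBddField a) {g : Ω' → Ω} (hg : Measurable g) : IsBddField fun ω => a (g ω) :=
  ⟨ha.sm.comp_measurable hg, ha.bdd.imp fun _ hC ω => hC (g ω)⟩

/-- Multiplication by a bounded field of operators, on `L²`. -/
def mulOp (m : Measure Ω) {a : Ω → E →L[ℝ] E} (ha : IsBddField a) :
    Lp E 2 m →L[ℝ] Lp E 2 m :=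
  LinearMap.mkContinuousOfExistsBound
    { toFun := fun u => (ha.memLp (Lp.memLp u)).toLp
      map_add' := fun u v => by
        rw [← MemLp.toLp_add]
        refine MemLp.toLp_congr _ _ ?_
        filter_upwards [Lp.coeFn_add u v] with ω hω
        rw [hω, Pi.add_apply, Pi.add_apply, map_add]
      map_smul' := fun c u => by
        rw [RingHom.id_apply, ← MemLp.toLp_const_smul]
        refine MemLp.toLp_congr _ _ ?_
        filter_upwards [Lp.coeFn_smul c u] with ω hω
        simp [hω] }
    (by
      obtain ⟨C, hC⟩ := ha.bdd
      refine ⟨C, fun u => Lp.norm_le_mul_norm_of_ae_le_mul ?_⟩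
      filter_upwards [MemLp.coeFn_toLp (ha.memLp (Lp.memLp u))] with ω hω
      exact (congrArg norm hω).trans_le (hC ω _))

theorem coeFn_mulOp {a : Ω → E →L[ℝ] E} (ha : IsBddField a) (u : Lp E 2 m) :
    mulOp m ha u =ᵐ[m] fun ω => a ω (u ω) :=
  MemLp.coeFn_toLp (ha.memLp (Lp.memLp u))

theorem mulOp_toLp {a : Ω → E →L[ℝ] E} (ha : IsBddField a) {u : Ω → E} (hu : MemLp u 2 m) :
    mulOp m ha hu.toLp = (ha.memLp hu).toLp := by
  refine Lp.ext ?_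
  filter_upwards [coeFn_mulOp ha hu.toLp, hu.coeFn_toLp, (ha.memLp hu).coeFn_toLp] with ω h1 h2 h3
  rw [h1, h2, h3]

theorem inner_toLp {u v : Ω → E} (hu : MemLp u 2 m) (hv : MemLp v 2 m) :
    inner ℝ hu.toLp hv.toLp = ∫ ω, inner ℝ (u ω) (v ω) ∂m := by
  rw [L2.inner_def]
  refine integral_congr_ae ?_
  filter_upwards [hu.coeFn_toLp, hv.coeFn_toLp] with ω h1 h2
  rw [h1, h2]

theorem inner_toLp_left {u : Ω → E} (hu : MemLp u 2 m) (v : Lp E 2 m) :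
    inner ℝ hu.toLp v = ∫ ω, inner ℝ (u ω) (v ω) ∂m := by
  rw [L2.inner_def]
  refine integral_congr_ae ?_
  filter_upwards [hu.coeFn_toLp] with ω h1
  rw [h1]

theorem MeasureTheory.MemLp.integrable_inner' {u v : Ω → E} (hu : MemLp u 2 m)
    (hv : MemLp v 2 m) : Integrable (fun ω => inner ℝ (u ω) (v ω)) m := by
  refine (L2.integrable_inner (𝕜 := ℝ) hu.toLp hv.toLp).congr ?_
  filter_upwards [hu.coeFn_toLp, hv.coeFn_toLp] with ω h1 h2
  rw [h1, h2]

/-- Lax–Milgram on the subspace `G`; only the projection of `q` onto `G` matters. -/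
theorem exists_mem_forall_inner_eq {H : Type*} [NormedAddCommGroup H] [InnerProductSpace ℝ H]
    [CompleteSpace H] (G : Submodule ℝ H) [CompleteSpace G] (A : H →L[ℝ] H)
    (hA : ∀ u, ‖u‖ ^ 2 ≤ inner ℝ u (A u)) (q : H) :
    ∃ g ∈ G, ∀ v ∈ G, inner ℝ v (A g - q) = 0 := by
  let B : G →L[ℝ] G →L[ℝ] ℝ := (innerSL ℝ).bilinearComp (A ∘L G.subtypeL) G.subtypeL
  have hB : IsCoercive B := by
    refine ⟨1, one_pos, fun u => ?_⟩
    have := hA u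
    rw [one_mul, ← pow_two]
    simpa [B, real_inner_comm] using this
  let p : G := ⟨G.starProjection q, G.starProjection_apply_mem q⟩
  refine ⟨hB.continuousLinearEquivOfBilin.symm p, Subtype.mem _, fun v hv => ?_⟩
  have h1 := hB.continuousLinearEquivOfBilin_apply (hB.continuousLinearEquivOfBilin.symm p) ⟨v, hv⟩
  rw [ContinuousLinearEquiv.apply_symm_apply] at h1
  have h2 : inner ℝ (p : H) v = inner ℝ q v := by
    have h3 := G.starProjection_inner_eq_zero q v hv
    rw [inner_sub_left, sub_eq_zero] at h3
    exact h3.symm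
  rw [inner_sub_right, real_inner_comm, real_inner_comm q, ← h2, sub_eq_zero]
  exact h1.symm

end mulOp

namespace Config

section sol

variable (Q Q' : Measure (Config d)) (U : Set (Space d))

/-- Square integrable fields which are orthogonal to all gradients. -/
def Perp (B : Config d × Space d → Space d) : Prop :=
  MemLp B 2 (Q'.prod (volume.restrict U)) ∧ ∀ φ, IsTest Q Q' U φ →
    ∫ q, inner ℝ (rgrad φ q.1 q.2) (B q) ∂(Q'.prod (volume.restrict U)) = 0

/-- Square integrable fields which are limits of gradients. -/
def Grad (A : Config d × Space d → Space d) : Prop :=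
  MemLp A 2 (Q'.prod (volume.restrict U)) ∧ ∀ B, Perp Q Q' U B →
    ∫ q, inner ℝ (A q) (B q) ∂(Q'.prod (volume.restrict U)) = 0

/-- Weak solutions of the equation `∇ · (a Γ - p) = 0`, with `Γ` a limit of gradients. -/
structure IsSol (a : Config d × Space d → Space d →L[ℝ] Space d) (p : Space d)
    (Γ : Config d × Space d → Space d) : Prop where
  grad : Grad Q Q' U Γ
  perp : Perp Q Q' U fun q => a q (Γ q) - p

variable {Q Q' U}

theorem Perp.congr {B B' : Config d × Space d → Space d} (h : Perp Q Q' U B)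
    (hB : B =ᵐ[Q'.prod (volume.restrict U)] B') : Perp Q Q' U B' := by
  refine ⟨(memLp_congr_ae hB).1 h.1, fun φ hφ => ?_⟩
  rw [← h.2 φ hφ]
  refine integral_congr_ae ?_
  filter_upwards [hB] with q hq
  rw [hq]

theorem Grad.congr {B B' : Config d × Space d → Space d} (h : Grad Q Q' U B)
    (hB : B =ᵐ[Q'.prod (volume.restrict U)] B') : Grad Q Q' U B' := by
  refine ⟨(memLp_congr_ae hB).1 h.1, fun φ hφ => ?_⟩
  rw [← h.2 φ hφ]
  refine integral_congr_ae ?_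
  filter_upwards [hB] with q hq
  rw [hq]

theorem IsTest.grad {φ : Config d → ℝ} (hφ : IsTest Q Q' U φ) :
    Grad Q Q' U fun q => rgrad φ q.1 q.2 :=
  ⟨hφ.memLp_rgrad, fun _ hB => hB.2 φ hφ⟩

/-- The gradients of the test functions. -/
def gradSet (Q Q' : Measure (Config d)) (U : Set (Space d)) :
    Set (Lp (Space d) 2 (Q'.prod (volume.restrict U))) :=
  {u | ∃ φ, ∃ hφ : IsTest Q Q' U φ, u = hφ.memLp_rgrad.toLp}

/-- The double orthogonal complement is the closure of the span. The description of `Grad` by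
duality is the useful one, because it can be transported through adjoint operators. -/
theorem mem_closure_gradSet_iff {A : Config d × Space d → Space d}
    (hA : MemLp A 2 (Q'.prod (volume.restrict U))) :
    hA.toLp ∈ (Submodule.span ℝ (gradSet Q Q' U)).topologicalClosure ↔ Grad Q Q' U A := by
  have h1 : ∀ b : Lp (Space d) 2 (Q'.prod (volume.restrict U)),
      b ∈ (Submodule.span ℝ (gradSet Q Q' U))ᗮ ↔ Perp Q Q' U b := by
    intro b
    constructor
    · intro hb
      refine ⟨Lp.memLp b, fun φ hφ => ?_⟩
      rw [← inner_toLp_left hφ.memLp_rgrad]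
      exact hb _ (Submodule.subset_span ⟨φ, hφ, rfl⟩)
    · rintro ⟨-, hb⟩ u hu
      induction hu using Submodule.span_induction with
      | mem x hx =>
        obtain ⟨φ, hφ, rfl⟩ := hx
        rw [inner_toLp_left]
        exact hb φ hφ
      | zero => simp
      | add x y _ _ hx hy => rw [inner_add_left, hx, hy, add_zero]
      | smul c x _ hx => rw [inner_smul_left, hx, mul_zero]
  rw [← Submodule.orthogonal_orthogonal_eq_closure]
  constructor
  · intro h
    refine ⟨hA, fun B hB => ?_⟩
    have h2 : hB.1.toLp ∈ (Submodule.span ℝ (gradSet Q Q' U))ᗮ :=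
      (h1 _).2 (hB.congr hB.1.coeFn_toLp.symm)
    have h3 := h _ h2
    rw [inner_toLp] at h3
    simpa only [real_inner_comm] using h3
  · rintro ⟨-, h⟩ b hb
    have h3 := h b ((h1 b).1 hb)
    rw [real_inner_comm, inner_toLp_left]
    exact h3

theorem exists_isSol [SFinite Q'] [IsFiniteMeasure (Q'.prod (volume.restrict U))]
    {a : Config d × Space d → Space d →L[ℝ] Space d} (ha : IsBddField a)
    (hl : ∀ q v, ‖v‖ ^ 2 ≤ inner ℝ v (a q v)) (p : Space d) : ∃ Γ, IsSol Q Q' U a p Γ := by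
  have hp : MemLp (fun _ : Config d × Space d => p) 2 (Q'.prod (volume.restrict U)) :=
    memLp_const p
  have hA : ∀ u : Lp (Space d) 2 (Q'.prod (volume.restrict U)),
      ‖u‖ ^ 2 ≤ inner ℝ u (mulOp _ ha u) := by
    intro u
    rw [← real_inner_self_eq_norm_sq, L2.inner_def, L2.inner_def]
    refine integral_mono_ae (L2.integrable_inner u u) (L2.integrable_inner _ _) ?_
    filter_upwards [coeFn_mulOp ha u] with q hq
    rw [hq, real_inner_self_eq_norm_sq]
    exact hl q _
  obtain ⟨g, hg, hg'⟩ := exists_mem_forall_inner_eq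
    (Submodule.span ℝ (gradSet Q Q' U)).topologicalClosure (mulOp _ ha) hA hp.toLp
  have hgm := Lp.memLp g
  have hgt : hgm.toLp = g := Lp.toLp_coeFn g hgm
  refine ⟨g, (mem_closure_gradSet_iff hgm).1 (by rwa [hgt]),
    (ha.memLp hgm).sub hp, fun φ hφ => ?_⟩
  have h1 := hg' hφ.memLp_rgrad.toLp
    (Submodule.le_topologicalClosure _ (Submodule.subset_span ⟨φ, hφ, rfl⟩))
  rw [← hgt, mulOp_toLp ha hgm, ← MemLp.toLp_sub, inner_toLp] at h1
  exact h1

theorem IsTest.add (hU : IsOpen U) (hfin : ∀ᵐ q ∂(Q'.prod (volume.restrict U)),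
    q.1.1 U ≠ ⊤ ∧ q.2 ∈ U) {φ ψ : Config d → ℝ} (hφ : IsTest Q Q' U φ) (hψ : IsTest Q Q' U ψ) :
    IsTest Q Q' U fun μ => φ μ + ψ μ := by
  refine ⟨hφ.smoothOn.add hψ.smoothOn, hφ.memLp.add hψ.memLp,
    (memLp_congr_ae ?_).2 (hφ.memLp_rgrad.add hψ.memLp_rgrad)⟩
  filter_upwards [hfin] with q hq
  exact rgrad_add hU hq.1 hq.2 hφ.smoothOn hψ.smoothOn

theorem IsTest.const_mul (hU : IsOpen U) (hfin : ∀ᵐ q ∂(Q'.prod (volume.restrict U)),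
    q.1.1 U ≠ ⊤ ∧ q.2 ∈ U) {φ : Config d → ℝ} (hφ : IsTest Q Q' U φ) (c : ℝ) :
    IsTest Q Q' U fun μ => c * φ μ := by
  refine ⟨hφ.smoothOn.const_mul c, hφ.memLp.const_mul c,
    (memLp_congr_ae ?_).2 (hφ.memLp_rgrad.const_smul c)⟩
  filter_upwards [hfin] with q hq
  exact rgrad_const_mul hU hq.1 hq.2 hφ.smoothOn c

/-- Gradients of test functions already form a linear space, since `rgrad` is linear almost
everywhere; so taking the span was no enlargement and the approximants are single gradients. -/
theorem Grad.exists_tendsto (hU : IsOpen U) (hfin : ∀ᵐ q ∂(Q'.prod (volume.restrict U)),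
    q.1.1 U ≠ ⊤ ∧ q.2 ∈ U) {A : Config d × Space d → Space d} (hA : Grad Q Q' U A) :
    ∃ φ : ℕ → Config d → ℝ, (∀ k, IsTest Q Q' U (φ k)) ∧
      Tendsto (fun k => eLpNorm (fun q => rgrad (φ k) q.1 q.2 - A q) 2
        (Q'.prod (volume.restrict U))) atTop (𝓝 0) := by
  have hspan : ∀ u ∈ Submodule.span ℝ (gradSet Q Q' U), u ∈ gradSet Q Q' U := by
    intro u hu
    induction hu using Submodule.span_induction with
    | mem x hx => exact hx
    | zero =>
      have h0 : Inv U fun _ : Config d => (0 : ℝ) := fun _ _ _ _ _ => rfl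
      have h1 : (fun q : Config d × Space d => rgrad (fun _ : Config d => (0 : ℝ)) q.1 q.2)
          =ᵐ[Q'.prod (volume.restrict U)] fun _ => 0 := by
        filter_upwards [hfin] with q hq
        exact rgrad_inv hU hq.2 h0
      have h2 : IsTest Q Q' U fun _ : Config d => (0 : ℝ) :=
        ⟨h0.smoothOn, MemLp.zero', (memLp_congr_ae h1).2 MemLp.zero'⟩
      refine ⟨_, h2, Lp.ext ?_⟩
      filter_upwards [h1, h2.memLp_rgrad.coeFn_toLp, Lp.coeFn_zero (Space d) 2
        (Q'.prod (volume.restrict U))] with q e1 e2 e3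
      rw [e2, e3, e1]
      rfl
    | add x y _ _ hx hy =>
      obtain ⟨φ, hφ, rfl⟩ := hx
      obtain ⟨ψ, hψ, rfl⟩ := hy
      refine ⟨_, hφ.add hU hfin hψ, ?_⟩
      rw [← MemLp.toLp_add]
      refine MemLp.toLp_congr _ _ ?_
      filter_upwards [hfin] with q hq
      exact (rgrad_add hU hq.1 hq.2 hφ.smoothOn hψ.smoothOn).symm
    | smul c x _ hx =>
      obtain ⟨φ, hφ, rfl⟩ := hx
      refine ⟨_, hφ.const_mul hU hfin c, ?_⟩
      rw [← MemLp.toLp_const_smul]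
      refine MemLp.toLp_congr _ _ ?_
      filter_upwards [hfin] with q hq
      exact (rgrad_const_mul hU hq.1 hq.2 hφ.smoothOn c).symm
  have h1 := (mem_closure_gradSet_iff hA.1).2 hA
  rw [← SetLike.mem_coe, Submodule.topologicalClosure_coe, mem_closure_iff_seq_limit] at h1
  obtain ⟨x, hx, hx'⟩ := h1
  choose φ hφ hφ' using fun k => hspan _ (hx k)
  refine ⟨φ, hφ, ?_⟩
  have h2 := (Lp.tendsto_Lp_iff_tendsto_eLpNorm' _ _).1 hx'
  refine h2.congr fun k => eLpNorm_congr_ae ?_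
  rw [hφ' k]
  filter_upwards [(hφ k).memLp_rgrad.coeFn_toLp, hA.1.coeFn_toLp] with q e1 e2
  rw [Pi.sub_apply, e1, e2]

end sol

end Config

end

/-! ### The second difference of the energy in an abstract Hilbert space. -/

noncomputable section

section abstract

variable {H : Type*} [NormedAddCommGroup H] [InnerProductSpace ℝ H]

/-- Four solutions `g` of `a g = f + q`, and their coefficients: the unperturbed one, the ones with
one of two perturbations, and the one with both. The perturbations of the coefficients are localized
by `Px`, `Py`. -/
structure Quad (q : H) (g₀ gx gy gxy : H) (a₀ ax ay axy Px Py Pxy : H →L[ℝ] H) (L s : ℝ) :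
    Prop where
  hL : 0 ≤ L
  hs : 0 ≤ s
  coercive₀ : ∀ u, ‖u‖ ^ 2 ≤ inner ℝ u (a₀ u)
  coercive_x : ∀ u, ‖u‖ ^ 2 ≤ inner ℝ u (ax u)
  coercive_y : ∀ u, ‖u‖ ^ 2 ≤ inner ℝ u (ay u)
  coercive_xy : ∀ u, ‖u‖ ^ 2 ≤ inner ℝ u (axy u)
  symm₀ : ∀ u v, inner ℝ (a₀ u) v = inner ℝ u (a₀ v)
  symm_x : ∀ u v, inner ℝ (ax u) v = inner ℝ u (ax v)
  symm_y : ∀ u v, inner ℝ (ay u) v = inner ℝ u (ay v)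
  -- Every solution is orthogonal to every flux, even if they carry different perturbations. This
  -- holds although the solutions live with different numbers of particles.
  orth : ∀ g ∈ ({g₀, gx, gy, gxy} : Set H),
    ∀ f ∈ ({a₀ g₀ - q, ax gx - q, ay gy - q, axy gxy - q} : Set H), inner ℝ g f = 0
  norm_Px : ∀ u, ‖Px u‖ ≤ ‖u‖
  norm_Py : ∀ u, ‖Py u‖ ≤ ‖u‖
  norm_Pxy : ∀ u, ‖Pxy u‖ ≤ ‖u‖
  norm_Pxy_x : ∀ u, ‖Pxy u‖ ≤ ‖Px u‖
  norm_Pxy_y : ∀ u, ‖Pxy u‖ ≤ ‖Py u‖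
  bound_x : ∀ u v, |inner ℝ u (ax v - a₀ v)| ≤ L * (‖Px u‖ * ‖Px v‖)
  bound_x' : ∀ u v, |inner ℝ u (axy v - ay v)| ≤ L * (‖Px u‖ * ‖Px v‖)
  bound_y : ∀ u v, |inner ℝ u (ay v - a₀ v)| ≤ L * (‖Py u‖ * ‖Py v‖)
  bound_y' : ∀ u v, |inner ℝ u (axy v - ax v)| ≤ L * (‖Py u‖ * ‖Py v‖)
  bound_xy : ∀ u v, |inner ℝ u (axy v - ax v - ay v + a₀ v)| ≤ L * (‖Pxy u‖ * ‖Pxy v‖)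
  bound_mul : ∀ u v, |inner ℝ (ax u - a₀ u) (ay v - a₀ v)| ≤ L ^ 2 * (‖Pxy u‖ * ‖Pxy v‖)
  -- `s ^ 2` stands for the probability that a given additional particle is close. The vector `g₀`
  -- depends on neither particle, `gy - g₀` not on `x`, and `gx - g₀` not on `y`.
  loc_x : ‖Px g₀‖ ≤ s * ‖g₀‖
  loc_y : ‖Py g₀‖ ≤ s * ‖g₀‖
  loc_xy : ‖Pxy g₀‖ ≤ s ^ 2 * ‖g₀‖
  loc_x' : ‖Px (gy - g₀)‖ ≤ s * ‖gy - g₀‖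
  loc_y' : ‖Py (gx - g₀)‖ ≤ s * ‖gx - g₀‖
  -- The last three fields encode that `x` and `y` are independent copies: pairing a function of `x`
  -- with one of `y` amounts to pairing their averages.
  mean_nonneg : 0 ≤ inner ℝ (gx - g₀) (gy - g₀)
  mean_coercive : inner ℝ (gx - g₀) (gy - g₀) ≤ inner ℝ (gx - g₀) (a₀ (gy - g₀))
  mean_schwarz_x : inner ℝ (gx - g₀) (ay gy - a₀ gy) ^ 2 ≤
    inner ℝ (gx - g₀) (gy - g₀) * inner ℝ (ax gx - a₀ gx) (ay gy - a₀ gy)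

variable {q g₀ gx gy gxy : H} {a₀ ax ay axy Px Py Pxy : H →L[ℝ] H} {L s : ℝ}

theorem le_of_sq_le_mul {t b : ℝ} (ht : 0 ≤ t) (hb : 0 ≤ b) (h : t ^ 2 ≤ t * b) : t ≤ b := by
  rcases ht.eq_or_lt with rfl | ht
  · exact hb
  · rw [pow_two] at h
    exact le_of_mul_le_mul_left h ht

namespace Quad

theorem norm_g₀ (h : Quad q g₀ gx gy gxy a₀ ax ay axy Px Py Pxy L s) : ‖g₀‖ ≤ ‖q‖ := by
  have h1 := h.orth g₀ (by simp) (a₀ g₀ - q) (by simp)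
  rw [inner_sub_right, sub_eq_zero] at h1
  refine le_of_sq_le_mul (norm_nonneg _) (norm_nonneg _) ((h.coercive₀ g₀).trans ?_)
  rw [h1]
  exact real_inner_le_norm _ _

/-- Energy estimate for the difference: its only source is `(ax - a₀) g₀`, supported where `x` is
close, and there `g₀` has norm at most `s ‖g₀‖`. -/
theorem norm_dx (h : Quad q g₀ gx gy gxy a₀ ax ay axy Px Py Pxy L s) :
    ‖gx - g₀‖ ≤ L * s * ‖g₀‖ := by
  have hL := h.hL
  have hs := h.hs
  have e1 := h.orth g₀ (by simp) (a₀ g₀ - q) (by simp)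
  have e2 := h.orth g₀ (by simp) (ax gx - q) (by simp)
  have e3 := h.orth gx (by simp) (a₀ g₀ - q) (by simp)
  have e4 := h.orth gx (by simp) (ax gx - q) (by simp)
  have h1 : inner ℝ (gx - g₀) (ax (gx - g₀)) = -inner ℝ (gx - g₀) (ax g₀ - a₀ g₀) := by
    simp only [inner_sub_left, inner_sub_right, map_sub] at *
    linarith
  have h2 := (abs_le.1 (h.bound_x (gx - g₀) g₀)).1
  refine le_of_sq_le_mul (norm_nonneg _) (by positivity) ((h.coercive_x _).trans ?_)
  rw [h1]
  calc _ ≤ L * (‖Px (gx - g₀)‖ * ‖Px g₀‖) := by linarith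
    _ ≤ L * (‖gx - g₀‖ * (s * ‖g₀‖)) := by
      gcongr
      · exact h.norm_Px _
      · exact h.loc_x
    _ = _ := by ring

theorem norm_dy (h : Quad q g₀ gx gy gxy a₀ ax ay axy Px Py Pxy L s) :
    ‖gy - g₀‖ ≤ L * s * ‖g₀‖ := by
  have hL := h.hL
  have hs := h.hs
  have e1 := h.orth g₀ (by simp) (a₀ g₀ - q) (by simp)
  have e2 := h.orth g₀ (by simp) (ay gy - q) (by simp)
  have e3 := h.orth gy (by simp) (a₀ g₀ - q) (by simp)
  have e4 := h.orth gy (by simp) (ay gy - q) (by simp)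
  have h1 : inner ℝ (gy - g₀) (ay (gy - g₀)) = -inner ℝ (gy - g₀) (ay g₀ - a₀ g₀) := by
    simp only [inner_sub_left, inner_sub_right, map_sub] at *
    linarith
  have h2 := (abs_le.1 (h.bound_y (gy - g₀) g₀)).1
  refine le_of_sq_le_mul (norm_nonneg _) (by positivity) ((h.coercive_y _).trans ?_)
  rw [h1]
  calc _ ≤ L * (‖Py (gy - g₀)‖ * ‖Py g₀‖) := by linarith
    _ ≤ L * (‖gy - g₀‖ * (s * ‖g₀‖)) := by
      gcongr
      · exact h.norm_Py _
      · exact h.loc_y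
    _ = _ := by ring

/-- The mixed difference has three sources: the change of coefficient in `y` acting on `gx - g₀`,
the one in `x` acting on `gy - g₀`, and the mixed change of coefficient acting on `g₀`. Each is of
order `s ^ 2`. -/
theorem norm_dxy (h : Quad q g₀ gx gy gxy a₀ ax ay axy Px Py Pxy L s) :
    ‖gxy - gx - gy + g₀‖ ≤ (2 * L ^ 2 + L) * s ^ 2 * ‖g₀‖ := by
  have hL := h.hL
  have hs := h.hs
  set D := gxy - gx - gy + g₀ with hD
  have hf : ∀ f ∈ ({a₀ g₀ - q, ax gx - q, ay gy - q, axy gxy - q} : Set H), inner ℝ D f = 0 := by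
    intro f hf
    rw [hD, inner_add_left, inner_sub_left, inner_sub_left, h.orth gxy (by simp) f hf,
      h.orth gx (by simp) f hf, h.orth gy (by simp) f hf, h.orth g₀ (by simp) f hf]
    simp
  have e1 := hf (a₀ g₀ - q) (by simp)
  have e2 := hf (ax gx - q) (by simp)
  have e3 := hf (ay gy - q) (by simp)
  have e4 := hf (axy gxy - q) (by simp)
  have hg : gxy = D + (gx - g₀) + (gy - g₀) + g₀ := by rw [hD]; abel
  have h1 : inner ℝ D (axy D) = -inner ℝ D (axy (gx - g₀) - ax (gx - g₀)) -
      inner ℝ D (axy (gy - g₀) - ay (gy - g₀)) - inner ℝ D (axy g₀ - ax g₀ - ay g₀ + a₀ g₀) := by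
    rw [hg] at e4
    simp only [inner_sub_right, inner_add_right, map_sub, map_add] at *
    linarith
  have h2 := (abs_le.1 (h.bound_y' D (gx - g₀))).1
  have h3 := (abs_le.1 (h.bound_x' D (gy - g₀))).1
  have h4 := (abs_le.1 (h.bound_xy D g₀)).1
  have b1 : ‖Py D‖ * ‖Py (gx - g₀)‖ ≤ ‖D‖ * (s * (L * s * ‖g₀‖)) := by
    gcongr
    · exact h.norm_Py _
    · exact h.loc_y'.trans (by gcongr; exact h.norm_dx)
  have b2 : ‖Px D‖ * ‖Px (gy - g₀)‖ ≤ ‖D‖ * (s * (L * s * ‖g₀‖)) := by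
    gcongr
    · exact h.norm_Px _
    · exact h.loc_x'.trans (by gcongr; exact h.norm_dy)
  have b3 : ‖Pxy D‖ * ‖Pxy g₀‖ ≤ ‖D‖ * (s ^ 2 * ‖g₀‖) := by
    gcongr
    · exact h.norm_Pxy _
    · exact h.loc_xy
  refine le_of_sq_le_mul (norm_nonneg _) (by positivity) ((h.coercive_xy _).trans ?_)
  rw [h1]
  have c1 := mul_le_mul_of_nonneg_left b1 hL
  have c2 := mul_le_mul_of_nonneg_left b2 hL
  have c3 := mul_le_mul_of_nonneg_left b3 hL
  calc _ ≤ L * (‖D‖ * (s * (L * s * ‖g₀‖))) + L * (‖D‖ * (s * (L * s * ‖g₀‖))) +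
        L * (‖D‖ * (s ^ 2 * ‖g₀‖)) := by linarith
    _ = _ := by ring

theorem norm_Py_dx (h : Quad q g₀ gx gy gxy a₀ ax ay axy Px Py Pxy L s) :
    ‖Py (gx - g₀)‖ ≤ L * s ^ 2 * ‖g₀‖ := by
  have hs := h.hs
  calc _ ≤ s * ‖gx - g₀‖ := h.loc_y'
    _ ≤ s * (L * s * ‖g₀‖) := by gcongr; exact h.norm_dx
    _ = _ := by ring

theorem norm_Px_dy (h : Quad q g₀ gx gy gxy a₀ ax ay axy Px Py Pxy L s) :
    ‖Px (gy - g₀)‖ ≤ L * s ^ 2 * ‖g₀‖ := by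
  have hs := h.hs
  calc _ ≤ s * ‖gy - g₀‖ := h.loc_x'
    _ ≤ s * (L * s * ‖g₀‖) := by gcongr; exact h.norm_dy
    _ = _ := by ring

theorem norm_Pxy_gx (h : Quad q g₀ gx gy gxy a₀ ax ay axy Px Py Pxy L s) :
    ‖Pxy gx‖ ≤ (L + 1) * s ^ 2 * ‖g₀‖ := by
  calc ‖Pxy gx‖ = ‖Pxy (gx - g₀) + Pxy g₀‖ := by rw [← map_add, sub_add_cancel]
    _ ≤ ‖Pxy (gx - g₀)‖ + ‖Pxy g₀‖ := norm_add_le _ _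
    _ ≤ L * s ^ 2 * ‖g₀‖ + s ^ 2 * ‖g₀‖ :=
      add_le_add ((h.norm_Pxy_y _).trans h.norm_Py_dx) h.loc_xy
    _ = _ := by ring

theorem norm_Pxy_gy (h : Quad q g₀ gx gy gxy a₀ ax ay axy Px Py Pxy L s) :
    ‖Pxy gy‖ ≤ (L + 1) * s ^ 2 * ‖g₀‖ := by
  calc ‖Pxy gy‖ = ‖Pxy (gy - g₀) + Pxy g₀‖ := by rw [← map_add, sub_add_cancel]
    _ ≤ ‖Pxy (gy - g₀)‖ + ‖Pxy g₀‖ := norm_add_le _ _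
    _ ≤ L * s ^ 2 * ‖g₀‖ + s ^ 2 * ‖g₀‖ :=
      add_le_add ((h.norm_Pxy_x _).trans h.norm_Px_dy) h.loc_xy
    _ = _ := by ring

/-- Locality alone gives only `s ^ 3`. By the equations, the pairing `e` equals `-⟨gx - g₀, a₀ (gy -
g₀)⟩`, so `|e|` dominates `b = ⟨gx - g₀, gy - g₀⟩ ≥ 0`. The Cauchy–Schwarz inequality for averages
gives `e² ≤ b γ`, where `γ` requires both particles to be close and is of order `s ^ 4`. Hence `|e|
≤ |γ|`. -/
theorem abs_mean (h : Quad q g₀ gx gy gxy a₀ ax ay axy Px Py Pxy L s) :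
    |inner ℝ (gx - g₀) (ay gy - a₀ gy)| ≤ L ^ 2 * (L + 1) ^ 2 * s ^ 4 * ‖g₀‖ ^ 2 := by
  have hL := h.hL
  have hs := h.hs
  have e1 := h.orth g₀ (by simp) (a₀ g₀ - q) (by simp)
  have e2 := h.orth g₀ (by simp) (ay gy - q) (by simp)
  have e3 := h.orth gx (by simp) (a₀ g₀ - q) (by simp)
  have e4 := h.orth gx (by simp) (ay gy - q) (by simp)
  have h1 : inner ℝ (gx - g₀) (ay gy - a₀ gy) = -inner ℝ (gx - g₀) (a₀ (gy - g₀)) := by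
    simp only [inner_sub_left, inner_sub_right, map_sub] at *
    linarith
  set e := inner ℝ (gx - g₀) (ay gy - a₀ gy)
  set γ := inner ℝ (ax gx - a₀ gx) (ay gy - a₀ gy)
  have hγ : |γ| ≤ L ^ 2 * (L + 1) ^ 2 * s ^ 4 * ‖g₀‖ ^ 2 := by
    calc |γ| ≤ L ^ 2 * (‖Pxy gx‖ * ‖Pxy gy‖) := h.bound_mul _ _
      _ ≤ L ^ 2 * (((L + 1) * s ^ 2 * ‖g₀‖) * ((L + 1) * s ^ 2 * ‖g₀‖)) := by
        gcongr
        · exact h.norm_Pxy_gx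
        · exact h.norm_Pxy_gy
      _ = _ := by ring
  refine le_trans (le_of_sq_le_mul (abs_nonneg _) (abs_nonneg γ) ?_) hγ
  have hb := h.mean_nonneg
  have hc := h.mean_coercive
  have he : |e| = -e := abs_of_nonpos (by linarith)
  rw [sq_abs]
  calc e ^ 2 ≤ inner ℝ (gx - g₀) (gy - g₀) * γ := h.mean_schwarz_x
    _ ≤ inner ℝ (gx - g₀) (gy - g₀) * |γ| := by gcongr; exact le_abs_self _
    _ ≤ |e| * |γ| := by gcongr; rw [he]; linarith

theorem abs_cross_le {D dx gy' dxy : ℝ} : D = dx + gy' + dxy → |D| ≤ |dx| + |gy'| + |dxy| := by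
  rintro rfl
  exact (abs_add_le _ _).trans (add_le_add_left (abs_add_le _ _) _)

/-- The contribution of one of the two first-order perturbations. -/
theorem abs_cross (h : Quad q g₀ gx gy gxy a₀ ax ay axy Px Py Pxy L s) :
    |inner ℝ g₀ (ax (gxy - gx) - a₀ (gxy - gx))| ≤
      (L ^ 2 * (2 * L ^ 2 + 2 * L) + L ^ 2 * (L + 1) + L ^ 2 * (L + 1) ^ 2) * s ^ 4 * ‖g₀‖ ^ 2 := by
  have hL := h.hL
  have hs := h.hs
  have hf : ∀ g ∈ ({g₀, gx, gy, gxy} : Set H), inner ℝ g (a₀ g₀ - q) = 0 ∧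
      inner ℝ g (ax gx - q) = 0 ∧ inner ℝ g (ay gy - q) = 0 ∧ inner ℝ g (axy gxy - q) = 0 :=
    fun g hg => ⟨h.orth g hg _ (by simp), h.orth g hg _ (by simp), h.orth g hg _ (by simp),
      h.orth g hg _ (by simp)⟩
  obtain ⟨a1, a2, -, a4⟩ := hf g₀ (by simp)
  obtain ⟨b1, b2, -, b4⟩ := hf gx (by simp)
  obtain ⟨c1, c2, -, -⟩ := hf gxy (by simp)
  have s1 := h.symm_x (gxy - gx) (gx - g₀)
  have s2 := h.symm_x g₀ gxy
  have s3 := h.symm_x g₀ gx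
  have s4 := h.symm₀ g₀ gxy
  have s5 := h.symm₀ g₀ gx
  have s6 := h.symm_x gx gxy
  have s7 := h.symm_x gxy gx
  -- Symmetry and the equations trade the perturbation in `x` for a perturbation in `y`, tested with
  -- `gx - g₀`, which is of order `s ^ 2` where `y` is close.
  have k1 : inner ℝ g₀ (ax (gxy - gx) - a₀ (gxy - gx)) =
      inner ℝ (gx - g₀) (axy gxy - ax gxy) := by
    simp only [inner_sub_left, inner_sub_right, map_sub] at *
    have r1 := real_inner_comm (ax gx) gxy
    have r2 := real_inner_comm (a₀ g₀) gxy
    have r3 := real_inner_comm (a₀ g₀) gx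
    have r4 := real_inner_comm q gxy
    have r5 := real_inner_comm q gx
    have r6 := real_inner_comm (ax gxy) gx
    have r7 := real_inner_comm (ax g₀) gx
    have r8 := real_inner_comm (ax g₀) gxy
    linarith
  set D := gxy - gx - gy + g₀ with hD
  -- Near `y`, the bracket is of order `s ^ 2`, while `gy` is not. For `gy`, the mixed change of
  -- coefficient is split off, and what remains is the pairing of `abs_mean`.
  have hg : gxy = (D + (gx - g₀)) + gy := by rw [hD]; abel
  have k2 : inner ℝ (gx - g₀) (axy gxy - ax gxy) =
      inner ℝ (gx - g₀) (axy (D + (gx - g₀)) - ax (D + (gx - g₀))) +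
      inner ℝ (gx - g₀) (axy gy - ax gy - ay gy + a₀ gy) +
      inner ℝ (gx - g₀) (ay gy - a₀ gy) := by
    nth_rewrite 1 2 [hg]
    rw [← inner_add_right, ← inner_add_right, map_add axy _ gy, map_add ax _ gy]
    congr 1
    abel
  have m1 : |inner ℝ (gx - g₀) (axy (D + (gx - g₀)) - ax (D + (gx - g₀)))| ≤
      L ^ 2 * (2 * L ^ 2 + 2 * L) * s ^ 4 * ‖g₀‖ ^ 2 := by
    have n1 : ‖Py (D + (gx - g₀))‖ ≤ (2 * L ^ 2 + 2 * L) * s ^ 2 * ‖g₀‖ := by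
      rw [map_add]
      calc _ ≤ ‖Py D‖ + ‖Py (gx - g₀)‖ := norm_add_le _ _
        _ ≤ (2 * L ^ 2 + L) * s ^ 2 * ‖g₀‖ + L * s ^ 2 * ‖g₀‖ :=
          add_le_add ((h.norm_Py _).trans h.norm_dxy) h.norm_Py_dx
        _ = _ := by ring
    calc _ ≤ L * (‖Py (gx - g₀)‖ * ‖Py (D + (gx - g₀))‖) := h.bound_y' _ _
      _ ≤ L * ((L * s ^ 2 * ‖g₀‖) * ((2 * L ^ 2 + 2 * L) * s ^ 2 * ‖g₀‖)) := by
        gcongr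
        exact h.norm_Py_dx
      _ = _ := by ring
  have m2 : |inner ℝ (gx - g₀) (axy gy - ax gy - ay gy + a₀ gy)| ≤
      L ^ 2 * (L + 1) * s ^ 4 * ‖g₀‖ ^ 2 := by
    calc _ ≤ L * (‖Pxy (gx - g₀)‖ * ‖Pxy gy‖) := h.bound_xy _ _
      _ ≤ L * ((L * s ^ 2 * ‖g₀‖) * ((L + 1) * s ^ 2 * ‖g₀‖)) := by
        gcongr
        · exact (h.norm_Pxy_y _).trans h.norm_Py_dx
        · exact h.norm_Pxy_gy
      _ = _ := by ring
  rw [k1]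
  refine (abs_cross_le k2).trans ?_
  calc _ ≤ L ^ 2 * (2 * L ^ 2 + 2 * L) * s ^ 4 * ‖g₀‖ ^ 2 + L ^ 2 * (L + 1) * s ^ 4 * ‖g₀‖ ^ 2 +
        L ^ 2 * (L + 1) ^ 2 * s ^ 4 * ‖g₀‖ ^ 2 := add_le_add (add_le_add m1 m2) h.abs_mean
    _ = _ := by ring

/-- The second difference of the energy is of the order of the product of the perturbations. -/
theorem abs_second_difference (h : Quad q g₀ gx gy gxy a₀ ax ay axy Px Py Pxy L s)
    (h' : Quad q g₀ gy gx gxy a₀ ay ax axy Py Px Pxy L s) :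
    |inner ℝ q (gxy - gx - gy + g₀)| ≤
      (2 * (L ^ 2 * (2 * L ^ 2 + 2 * L) + L ^ 2 * (L + 1) + L ^ 2 * (L + 1) ^ 2) +
        L * (2 * L ^ 2 + 3 * L + 1)) * s ^ 4 * ‖q‖ ^ 2 := by
  have hL := h.hL
  have hs := h.hs
  obtain ⟨f0, fx, fy, fxy⟩ : inner ℝ g₀ (a₀ g₀ - q) = 0 ∧ inner ℝ g₀ (ax gx - q) = 0 ∧
      inner ℝ g₀ (ay gy - q) = 0 ∧ inner ℝ g₀ (axy gxy - q) = 0 :=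
    ⟨h.orth _ (by simp) _ (by simp), h.orth _ (by simp) _ (by simp), h.orth _ (by simp) _ (by simp),
      h.orth _ (by simp) _ (by simp)⟩
  have x0 := h.orth gx (by simp) (a₀ g₀ - q) (by simp)
  have y0 := h.orth gy (by simp) (a₀ g₀ - q) (by simp)
  have xy0 := h.orth gxy (by simp) (a₀ g₀ - q) (by simp)
  -- All perturbed equations are tested with `g₀`, and the unperturbed one with all solutions; the
  -- result is two cross terms, exchanged by `x ↔ y`, and a mixed term.
  have k : inner ℝ q (gxy - gx - gy + g₀) = -inner ℝ g₀ (ax (gxy - gx) - a₀ (gxy - gx)) +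
      -inner ℝ g₀ (ay (gxy - gy) - a₀ (gxy - gy)) +
      -inner ℝ g₀ (axy gxy - ax gxy - ay gxy + a₀ gxy) := by
    have s1 := h.symm₀ g₀ gx
    have s2 := h.symm₀ g₀ gy
    have s3 := h.symm₀ g₀ gxy
    have s4 := h.symm₀ g₀ g₀
    simp only [inner_sub_right, inner_add_right, map_sub] at *
    have r1 := real_inner_comm (a₀ g₀) gx
    have r2 := real_inner_comm (a₀ g₀) gy
    have r3 := real_inner_comm (a₀ g₀) gxy
    have r4 := real_inner_comm q gx
    have r5 := real_inner_comm q gy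
    have r6 := real_inner_comm q gxy
    have r7 := real_inner_comm q g₀
    linarith
  have m3 : |inner ℝ g₀ (axy gxy - ax gxy - ay gxy + a₀ gxy)| ≤
      L * (2 * L ^ 2 + 3 * L + 1) * s ^ 4 * ‖g₀‖ ^ 2 := by
    have n1 : ‖Pxy gxy‖ ≤ (2 * L ^ 2 + 3 * L + 1) * s ^ 2 * ‖g₀‖ := by
      have e : gxy = ((gxy - gx - gy + g₀) + (gy - g₀)) + gx := by abel
      calc ‖Pxy gxy‖ = ‖Pxy (gxy - gx - gy + g₀) + Pxy (gy - g₀) + Pxy gx‖ := by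
            rw [← map_add, ← map_add, ← e]
        _ ≤ ‖Pxy (gxy - gx - gy + g₀)‖ + ‖Pxy (gy - g₀)‖ + ‖Pxy gx‖ := norm_add₃_le
        _ ≤ (2 * L ^ 2 + L) * s ^ 2 * ‖g₀‖ + L * s ^ 2 * ‖g₀‖ + (L + 1) * s ^ 2 * ‖g₀‖ :=
          add_le_add (add_le_add ((h.norm_Pxy _).trans h.norm_dxy)
            ((h.norm_Pxy_x _).trans h.norm_Px_dy)) h.norm_Pxy_gx
        _ = _ := by ring
    calc _ ≤ L * (‖Pxy g₀‖ * ‖Pxy gxy‖) := h.bound_xy _ _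
      _ ≤ L * ((s ^ 2 * ‖g₀‖) * ((2 * L ^ 2 + 3 * L + 1) * s ^ 2 * ‖g₀‖)) := by
        gcongr
        exact h.loc_xy
      _ = _ := by ring
  have m1 := h.abs_cross
  have m2 := h'.abs_cross
  refine (abs_cross_le k).trans ?_
  rw [abs_neg, abs_neg, abs_neg]
  have hq : ‖g₀‖ ^ 2 ≤ ‖q‖ ^ 2 := by gcongr; exact h.norm_g₀
  calc _ ≤ (2 * (L ^ 2 * (2 * L ^ 2 + 2 * L) + L ^ 2 * (L + 1) + L ^ 2 * (L + 1) ^ 2) +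
        L * (2 * L ^ 2 + 3 * L + 1)) * s ^ 4 * ‖g₀‖ ^ 2 := by linarith
    _ ≤ _ := by gcongr

end Quad

end abstract

end

/-! ### Coefficients in reduced coordinates; the operators which add and remove a particle. -/

noncomputable section

variable {d : ℕ}

theorem bil_eq_inner (A : Matrix (Fin d) (Fin d) ℝ) (v w : Space d) :
    bil A v w = inner ℝ v (Matrix.toEuclideanCLM (n := Fin d) (𝕜 := ℝ) A w) :=
  (Matrix.inner_toEuclideanCLM A v w).symm

namespace Config

/-- The coefficient field in reduced coordinates, for particles in the interior of `W`. -/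
def redCoeff (a₀ : Config d → Matrix (Fin d) (Fin d) ℝ) (W : Set (Space d))
    (q : Config d × Space d) : Space d →L[ℝ] Space d :=
  Matrix.toEuclideanCLM (n := Fin d) (𝕜 := ℝ) (a₀ (shiftIn W (q.1.add (point q.2), q.2)))

section coeff

variable {Λ : ℝ} {a₀ : Config d → Matrix (Fin d) (Fin d) ℝ} (ha : IsCoefficient Λ a₀)
  {W : Set (Space d)}

include ha

theorem redCoeff_lower (q : Config d × Space d) (v : Space d) :
    ‖v‖ ^ 2 ≤ inner ℝ v (redCoeff a₀ W q v) := by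
  have h := (ha.lower (shiftIn W (q.1.add (point q.2), q.2))).dotProduct_mulVec_nonneg v.ofLp
  rw [Matrix.sub_mulVec, dotProduct_sub, Matrix.one_mulVec] at h
  rw [redCoeff, ← bil_eq_inner, bil, EuclideanSpace.norm_sq_eq]
  simp only [star_trivial] at h
  have : ∑ i, ‖v i‖ ^ 2 = v.ofLp ⬝ᵥ v.ofLp := by simp [dotProduct, pow_two]
  rw [this]
  linarith

theorem redCoeff_inner_le (q : Config d × Space d) (v : Space d) :
    inner ℝ v (redCoeff a₀ W q v) ≤ Λ * ‖v‖ ^ 2 := by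
  have h := (ha.upper (shiftIn W (q.1.add (point q.2), q.2))).dotProduct_mulVec_nonneg v.ofLp
  rw [Matrix.sub_mulVec, dotProduct_sub, Matrix.smul_mulVec, Matrix.one_mulVec,
    dotProduct_smul] at h
  rw [redCoeff, ← bil_eq_inner, bil, EuclideanSpace.norm_sq_eq]
  simp only [star_trivial, smul_eq_mul] at h
  have : ∑ i, ‖v i‖ ^ 2 = v.ofLp ⬝ᵥ v.ofLp := by simp [dotProduct, pow_two]
  rw [this]
  linarith

theorem redCoeff_symm (q : Config d × Space d) (v w : Space d) :
    inner ℝ (redCoeff a₀ W q v) w = inner ℝ v (redCoeff a₀ W q w) := by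
  rw [real_inner_comm, redCoeff, ← bil_eq_inner, ← bil_eq_inner, bil, bil,
    Matrix.dotProduct_mulVec, ← Matrix.mulVec_transpose, (ha.symm _).eq, dotProduct_comm]

/-- The assumptions bound the quadratic form only; polarization of the symmetric nonnegative form
gives the operator norm. -/
theorem norm_redCoeff_le (hΛ : 0 ≤ Λ) (q : Config d × Space d) (v : Space d) :
    ‖redCoeff a₀ W q v‖ ≤ Λ * ‖v‖ := by
  set b := redCoeff a₀ W q
  have hs : ∀ v w, inner ℝ (b v) w = inner ℝ v (b w) := redCoeff_symm ha q
  have key : ∀ v w : Space d, 2 * inner ℝ w (b v) ≤ Λ * (‖v‖ ^ 2 + ‖w‖ ^ 2) := by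
    intro v w
    have h1 := (sq_nonneg _).trans (redCoeff_lower ha (W := W) q (v - w))
    have h2 := redCoeff_inner_le ha (W := W) q v
    have h3 := redCoeff_inner_le ha (W := W) q w
    change 0 ≤ inner ℝ (v - w) (b (v - w)) at h1
    change inner ℝ v (b v) ≤ _ at h2
    change inner ℝ w (b w) ≤ _ at h3
    have h4 : inner ℝ v (b w) = inner ℝ w (b v) := by rw [← hs, real_inner_comm]
    simp only [map_sub, inner_sub_left, inner_sub_right] at h1
    linarith
  rcases eq_or_ne (b v) 0 with h0 | h0
  · rw [h0, norm_zero]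
    positivity
  · rcases eq_or_ne v 0 with rfl | hv
    · simp
    have hb : 0 < ‖b v‖ := norm_pos_iff.2 h0
    have hv' : 0 < ‖v‖ := norm_pos_iff.2 hv
    -- The second vector is parallel to `b v` and has the length of `v`, which is optimal.
    have h5 := key v ((‖v‖ / ‖b v‖) • b v)
    rw [real_inner_smul_left, real_inner_self_eq_norm_sq, norm_smul, Real.norm_eq_abs,
      abs_of_pos (by positivity), div_mul_cancel₀ _ hb.ne'] at h5
    have h6 : ‖v‖ / ‖b v‖ * ‖b v‖ ^ 2 = ‖v‖ * ‖b v‖ := by field_simp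
    rw [h6] at h5
    have h7 : ‖v‖ * ‖b v‖ ≤ ‖v‖ * (Λ * ‖v‖) := by nlinarith
    exact le_of_mul_le_mul_left h7 hv'

theorem isBddField_redCoeff (hW : MeasurableSet W) (hΛ : 0 ≤ Λ) : IsBddField (redCoeff a₀ W) := by
  refine ⟨?_, Λ, fun q v => norm_redCoeff_le ha hΛ q v⟩
  have h1 : Measurable fun q : Config d × Space d =>
      shiftIn W (q.1.add (point q.2), q.2) :=
    (measurable_shiftIn hW).comp measurable_reduce
  let l : (Fin d → Fin d → ℝ) →ₗ[ℝ] (Space d →L[ℝ] Space d) :=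
    { toFun := fun A => Matrix.toEuclideanCLM (n := Fin d) (𝕜 := ℝ) (Matrix.of A)
      map_add' := fun A B => map_add (Matrix.toEuclideanCLM (n := Fin d) (𝕜 := ℝ)) _ _
      map_smul' := fun c A => map_smul (Matrix.toEuclideanCLM (n := Fin d) (𝕜 := ℝ)) c _ }
  have h2 : Measurable fun q : Config d × Space d =>
      (fun i j => a₀ (shiftIn W (q.1.add (point q.2), q.2)) i j : Fin d → Fin d → ℝ) :=
    measurable_pi_lambda _ fun i => measurable_pi_lambda _ fun j => (ha.measurable i j).comp h1
  exact (l.continuous_of_finiteDimensional.comp_stronglyMeasurable h2.stronglyMeasurable)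

theorem coeff_shift_res {μ : Config d} {z : Space d} (hz : Metric.ball z (1 / 2) ⊆ W) :
    a₀ ((μ.res W).shift z) = a₀ (μ.shift z) := by
  rw [ha.finite_range, ha.finite_range (μ.shift z)]
  congr 1
  refine ext_val (Measure.ext fun B hB => ?_)
  have hb : MeasurableSet (Metric.ball (0 : Space d) (1 / 2)) := Metric.isOpen_ball.measurableSet
  rw [res_apply _ hB, res_apply _ hB, shift_apply _ _ (hB.inter hb), shift_apply _ _ (hB.inter hb),
    res_apply]
  · congr 1
    refine Set.inter_eq_left.2 fun y hy => hz ?_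
    have : y - z ∈ Metric.ball (0 : Space d) (1 / 2) := hy.2
    rwa [mem_ball_zero_iff, ← mem_ball_iff_norm] at this
  · exact (measurable_id.sub_const z) (hB.inter hb)

/-- Justifies the restriction to `W` in `redCoeff`: near `U` nothing is lost by finite range, while
joint measurability in the configuration and the point is gained. -/
theorem redCoeff_eq {q : Config d × Space d} (hz : Metric.ball q.2 (1 / 2) ⊆ W)
    (hμ : q.1.1 W ≠ ⊤) : redCoeff a₀ W q =
      Matrix.toEuclideanCLM (n := Fin d) (𝕜 := ℝ) (coeff a₀ (q.1.add (point q.2)) q.2) := by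
  have h1 : (q.1.add (point q.2)).1 W ≠ ⊤ := by
    rw [add_apply]
    exact ENNReal.add_ne_top.2 ⟨hμ, measure_ne_top (Measure.dirac q.2) W⟩
  rw [redCoeff, coeff, shiftIn, if_pos h1, coeff_shift_res ha hz]

theorem coeff_add_point_of_notMem {μ : Config d} {x z : Space d}
    (hx : x ∉ Metric.ball z (1 / 2)) : a₀ ((μ.add (point x)).shift z) = a₀ (μ.shift z) := by
  have hb : MeasurableSet (Metric.ball (0 : Space d) (1 / 2)) := Metric.isOpen_ball.measurableSet
  rw [ha.finite_range, ha.finite_range (μ.shift z)]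
  congr 1
  refine ext_val (Measure.ext fun B hB => ?_)
  have hB' : MeasurableSet ((fun y : Space d => y - z) ⁻¹' (B ∩ Metric.ball 0 (1 / 2))) :=
    (measurable_id.sub_const z) (hB.inter hb)
  rw [res_apply _ hB, res_apply _ hB, shift_apply _ _ (hB.inter hb), shift_apply _ _ (hB.inter hb),
    add_apply, point_apply _ hB', Set.indicator_of_notMem, add_zero]
  rintro ⟨-, h⟩
  refine hx ?_
  rwa [mem_ball_zero_iff, ← mem_ball_iff_norm] at h

/-- The locality on which the second difference estimate rests. It also holds for configurations
with infinite mass in `W`, where both sides use the empty configuration. -/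
theorem redCoeff_add_point_of_notMem {q : Config d × Space d} {x : Space d}
    (hx : x ∉ Metric.ball q.2 (1 / 2)) :
    redCoeff a₀ W (q.1.add (point x), q.2) = redCoeff a₀ W q := by
  have hc : ((q.1.add (point x)).add (point q.2)) = (q.1.add (point q.2)).add (point x) :=
    add_right_comm _ _ _
  rw [redCoeff, redCoeff, hc]
  congr 1
  by_cases h : (q.1.add (point q.2)).1 W = ⊤
  · have h' : ((q.1.add (point q.2)).add (point x)).1 W = ⊤ := by
      rw [add_apply, h]; simp
    simp only [shiftIn]
    rw [if_neg (by simpa using h'), if_neg (by simpa using h)]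
  · have h' : ((q.1.add (point q.2)).add (point x)).1 W ≠ ⊤ := by
      rw [add_apply]
      exact ENNReal.add_ne_top.2 ⟨h, measure_ne_top (Measure.dirac x) W⟩
    simp only [shiftIn]
    rw [if_pos h, if_pos h', res_add]
    by_cases hxW : x ∈ W
    · rw [res_point_of_mem hxW]
      exact coeff_add_point_of_notMem ha hx
    · rw [res_point_of_notMem hxW, add_empty]

end coeff

/-- The reference measure for `n` particles in `W` and one distinguished particle in `U`. -/
abbrev lm (W U : Set (Space d)) (n : ℕ) : Measure (Config d × Space d) :=
  (level W n).prod (volume.restrict U)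

/-- Addition of a particle. -/
def sh (p : (Config d × Space d) × Space d) : Config d × Space d :=
  (p.1.1.add (point p.2), p.1.2)

theorem measurable_sh : Measurable (sh : (Config d × Space d) × Space d → _) :=
  ((measurable_fst.comp measurable_fst).config_add measurable_snd.config_point).prodMk
    (measurable_snd.comp measurable_fst)

theorem _root_.MeasureTheory.measurePreserving_prod_right_comm {α β γ : Type*} [MeasurableSpace α]
    [MeasurableSpace β] [MeasurableSpace γ] (m : Measure α) (n : Measure β) (k : Measure γ)
    [SFinite m] [SFinite n] [SFinite k] :
    MeasurePreserving (fun p : (α × β) × γ => ((p.1.1, p.2), p.1.2)) ((m.prod n).prod k)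
      ((m.prod k).prod n) := by
  have h1 := measurePreserving_prodAssoc m n k
  have h2 : MeasurePreserving (Prod.map id Prod.swap : α × β × γ → α × γ × β)
      (m.prod (n.prod k)) (m.prod (k.prod n)) :=
    (MeasurePreserving.id m).prod Measure.measurePreserving_swap
  have h3 := (measurePreserving_prodAssoc m k n).symm
  exact h3.comp (h2.comp h1)

section shift

variable {W U : Set (Space d)}

theorem measurePreserving_sh (n : ℕ) :
    MeasurePreserving sh ((lm W U n).prod (volume.restrict W)) (lm W U (n + 1)) := by
  have h1 := measurePreserving_prod_right_comm (level W n) (volume.restrict U) (volume.restrict W)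
  have h2 : MeasurePreserving (fun p : Config d × Space d => p.1.add (point p.2))
      ((level W n).prod (volume.restrict W)) (level W (n + 1)) := ⟨measurable_add_point, rfl⟩
  exact (h2.prod (MeasurePreserving.id (volume.restrict U))).comp h1

theorem ae_lm (hW : MeasurableSet W) (hU : MeasurableSet U) (n : ℕ) :
    ∀ᵐ q ∂(lm W U n), q.1.1 W = (n : ℝ≥0∞) ∧ q.1.1 Wᶜ = 0 ∧ q.2 ∈ U := by
  filter_upwards [Measure.quasiMeasurePreserving_fst.ae (ae_level hW n),
    Measure.quasiMeasurePreserving_snd.ae (ae_restrict_mem hU)] with q h1 h2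
  exact ⟨h1.1, h1.2, h2⟩

theorem isFiniteMeasure_lm (hv : volume W ≠ ⊤) (hvU : volume U ≠ ⊤) (n : ℕ) :
    IsFiniteMeasure (lm W U n) := by
  have := isFiniteMeasure_level hv n
  have : IsFiniteMeasure (volume.restrict U) := isFiniteMeasure_restrict.2 hvU
  infer_instance

/-- Removal of a particle. -/
def unsh (W : Set (Space d)) (hW : MeasurableSet W) (p : (Config d × Space d) × Space d) :
    Config d × Space d :=
  (remIn W hW (p.1.1, p.2), p.1.2)

theorem measurable_unsh (hW : MeasurableSet W) : Measurable (unsh W hW) :=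
  ((measurable_remIn hW).comp ((measurable_fst.comp measurable_fst).prodMk measurable_snd)).prodMk
    (measurable_snd.comp measurable_fst)

/-- The particles of the first component, as a kernel. -/
abbrev ker (W : Set (Space d)) (hW : MeasurableSet W) :
    ProbabilityTheory.Kernel (Config d × Space d) (Space d) :=
  (kernel W hW).comap Prod.fst measurable_fst

/-- The Mecke formula of a level as an identity of measures: a configuration with a marked particle
is one with that particle added, and there are `n + 1` ways of marking. -/
theorem level_compProd (hW : MeasurableSet W) (n : ℕ) :
    (lm W U (n + 1)).compProd (ker W hW) = ((n : ℝ≥0∞) + 1) •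
      ((lm W U n).prod (volume.restrict W)).map fun p => (sh p, p.2) := by
  have hm : Measurable fun p : (Config d × Space d) × Space d => (sh p, p.2) :=
    measurable_sh.prodMk measurable_snd
  refine Measure.ext_of_lintegral _ fun F hF => ?_
  rw [Measure.lintegral_compProd hF, lintegral_smul_measure, lintegral_map hF hm,
    lintegral_prod_symm _ hF.lintegral_kernel_prod_right'.aemeasurable]
  have h1 : ∫⁻ p, F (sh p, p.2) ∂((lm W U n).prod (volume.restrict W)) =
      ∫⁻ z in U, ∫⁻ μ, ∫⁻ x in W, F (sh ((μ, z), x), x) ∂volume ∂(level W n) :=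
    (lintegral_prod _ (hF.comp hm).aemeasurable).trans
      (lintegral_prod_symm _ (hF.comp hm).lintegral_prod_right'.aemeasurable)
  rw [h1, smul_eq_mul, ← lintegral_const_mul' _ _ (by finiteness)]
  refine lintegral_congr fun z => ?_
  exact level_mecke hW n (F := fun p => F ((p.1, z), p.2))
    (hF.comp ((measurable_fst.prodMk measurable_const).prodMk measurable_snd))

theorem ae_unsh_sh (hW : MeasurableSet W) (n : ℕ) :
    ∀ᵐ p ∂((lm W U n).prod (volume.restrict W)), unsh W hW (sh p, p.2) = p.1 := by
  have h1 : ∀ᵐ p ∂((lm W U n).prod (volume.restrict W)), p.1.1.1 W = (n : ℝ≥0∞) :=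
    Measure.quasiMeasurePreserving_fst.ae
      (Measure.quasiMeasurePreserving_fst.ae ((ae_level hW n).mono fun _ h => h.1))
  filter_upwards [h1, Measure.quasiMeasurePreserving_snd.ae (ae_restrict_mem hW)] with p h1 h2
  rw [unsh, sh]
  simp only
  rw [remIn_add_point hW (by rw [h1]; simp) h2]

/-- Forgetting the marked particle leaves the lower level, with a factor `n + 1` for the mark and
`volume W` for its position. -/
theorem map_unsh (hW : MeasurableSet W) (n : ℕ) :
    ((lm W U (n + 1)).compProd (ker W hW)).map (unsh W hW) =
      (((n : ℝ≥0∞) + 1) * volume W) • lm W U n := by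
  have hm : Measurable fun p : (Config d × Space d) × Space d => (sh p, p.2) :=
    measurable_sh.prodMk measurable_snd
  rw [level_compProd, Measure.map_smul, Measure.map_map (measurable_unsh hW) hm,
    Measure.map_congr (f := unsh W hW ∘ fun p => (sh p, p.2)) (g := Prod.fst) (ae_unsh_sh hW n), Measure.map_fst_prod,
    Measure.restrict_apply_univ, smul_smul]

theorem quasiMeasurePreserving_unsh (hW : MeasurableSet W) (n : ℕ) :
    Measure.QuasiMeasurePreserving (unsh W hW) ((lm W U (n + 1)).compProd (ker W hW))
      (lm W U n) :=
  ⟨measurable_unsh hW, by rw [map_unsh]; exact Measure.smul_absolutelyContinuous⟩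

/-- The sum over the particles of a field evaluated with this particle removed. -/
def remSum (W : Set (Space d)) (hW : MeasurableSet W) {F : Type*} [NormedAddCommGroup F]
    [NormedSpace ℝ F] (A : Config d × Space d → F) (q : Config d × Space d) : F :=
  ∫ x, A (remIn W hW (q.1, x), q.2) ∂(kernel W hW q.1)

/-- The integral of a field over the position of an additional particle. -/
def addInt (W : Set (Space d)) {F : Type*} [NormedAddCommGroup F]
    [NormedSpace ℝ F] (A : Config d × Space d → F) (q : Config d × Space d) : F :=
  ∫ x in W, A (q.1.add (point x), q.2)

section ops

variable {F : Type*} [NormedAddCommGroup F] [InnerProductSpace ℝ F] {A B : Config d × Space d → F}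

theorem memLp_comp_sh {n : ℕ} (hA : MemLp A 2 (lm W U (n + 1))) :
    MemLp (fun p => A (sh p)) 2 ((lm W U n).prod (volume.restrict W)) :=
  hA.comp_measurePreserving (measurePreserving_sh n)

theorem memLp_addInt [CompleteSpace F] (hv : volume W ≠ ⊤) {n : ℕ}
    (hA : MemLp A 2 (lm W U (n + 1))) : MemLp (addInt W A) 2 (lm W U n) := by
  have h1 := memLp_comp_sh hA
  refine ⟨h1.1.integral_prod_right', ?_⟩
  rw [← ENNReal.pow_lt_top_iff (n := 2) |>.trans (or_iff_left (by norm_num)),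
    ← lintegral_enorm_sq_eq]
  have h2 : ∫⁻ q, ‖addInt W A q‖ₑ ^ 2 ∂(lm W U n) ≤
      ∫⁻ q, volume W * ∫⁻ x in W, ‖A (sh (q, x))‖ₑ ^ 2 ∂volume ∂(lm W U n) := by
    refine lintegral_mono_ae ?_
    filter_upwards [h1.1.prodMk_left] with q hq
    calc ‖addInt W A q‖ₑ ^ 2 ≤ (∫⁻ x in W, ‖A (sh (q, x))‖ₑ) ^ 2 := by
          gcongr
          exact enorm_integral_le_lintegral_enorm _
      _ ≤ _ := by
          refine (sq_lintegral_le _ hq.enorm).trans (le_of_eq ?_)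
          rw [Measure.restrict_apply_univ]
  refine h2.trans_lt ?_
  rw [lintegral_const_mul' _ _ hv, ← lintegral_prod _ (h1.1.enorm.pow_const 2),
    lintegral_enorm_sq_eq]
  exact ENNReal.mul_lt_top hv.lt_top (ENNReal.pow_lt_top h1.2)

theorem integral_inner_addInt [CompleteSpace F] (hv : volume W ≠ ⊤) {n : ℕ}
    (hA : MemLp A 2 (lm W U (n + 1))) (hB : MemLp B 2 (lm W U n)) :
    ∫ q, inner ℝ (addInt W A q) (B q) ∂(lm W U n) =
      ∫ p, inner ℝ (A (sh p)) (B p.1) ∂((lm W U n).prod (volume.restrict W)) := by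
  have : IsFiniteMeasure (volume.restrict W) := isFiniteMeasure_restrict.2 hv
  have h1 := memLp_comp_sh hA
  rw [integral_prod _ (h1.integrable_inner' (hB.comp_fst _))]
  refine integral_congr_ae ?_
  filter_upwards [h1.ae_slice] with q hq
  rw [real_inner_comm]
  have h2 := integral_inner (𝕜 := ℝ) (hq.integrable (by norm_num)) (B q)
  rw [addInt]
  refine h2.symm.trans (integral_congr_ae (Eventually.of_forall fun x => ?_))
  exact real_inner_comm _ _

theorem remSum_congr (hW : MeasurableSet W) {n : ℕ} (h : A =ᵐ[lm W U n] B) :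
    remSum W hW A =ᵐ[lm W U (n + 1)] remSum W hW B := by
  have h1 := Measure.ae_ae_of_ae_compProd ((quasiMeasurePreserving_unsh hW n).ae h)
  filter_upwards [h1] with q hq
  exact integral_congr_ae hq

theorem aestronglyMeasurable_remSum (hW : MeasurableSet W) {n : ℕ}
    (hA : AEStronglyMeasurable A (lm W U n)) :
    AEStronglyMeasurable (remSum W hW A) (lm W U (n + 1)) := by
  obtain ⟨A', hA', h⟩ := hA
  refine ⟨remSum W hW A', ?_, remSum_congr hW h⟩
  exact StronglyMeasurable.integral_kernel_prod_right' (κ := ker W hW)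
    (hA'.comp_measurable (measurable_unsh hW))

theorem memLp_comp_unsh (hW : MeasurableSet W) (hv : volume W ≠ ⊤) {n : ℕ}
    (hA : MemLp A 2 (lm W U n)) :
    MemLp (fun p => A (unsh W hW p)) 2 ((lm W U (n + 1)).compProd (ker W hW)) := by
  have h1 : MemLp A 2 (((lm W U (n + 1)).compProd (ker W hW)).map (unsh W hW)) := by
    rw [map_unsh]
    exact hA.smul_measure (by finiteness)
  exact (memLp_map_measure_iff h1.1 (measurable_unsh hW).aemeasurable).1 h1

theorem kernel_univ (hW : MeasurableSet W) {μ : Config d} (h : μ.1 W ≠ ⊤) :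
    kernel W hW μ Set.univ = μ.1 W := by
  rw [kernel_apply hW h, Measure.restrict_apply_univ]

theorem memLp_remSum (hW : MeasurableSet W) (hU : MeasurableSet U) (hv : volume W ≠ ⊤) {n : ℕ}
    (hA : MemLp A 2 (lm W U n)) : MemLp (remSum W hW A) 2 (lm W U (n + 1)) := by
  obtain ⟨A', hA', hAA'⟩ := hA.1
  refine (memLp_congr_ae (remSum_congr hW hAA')).2 ?_
  rw [memLp_congr_ae hAA'] at hA
  have h1 := memLp_comp_unsh hW hv hA
  have hm : Measurable fun p => ‖A' (unsh W hW p)‖ₑ :=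
    (hA'.comp_measurable (measurable_unsh hW)).enorm
  refine ⟨aestronglyMeasurable_remSum hW hA.1, ?_⟩
  rw [← ENNReal.pow_lt_top_iff (n := 2) |>.trans (or_iff_left (by norm_num)),
    ← lintegral_enorm_sq_eq]
  have h2 : ∫⁻ q, ‖remSum W hW A' q‖ₑ ^ 2 ∂(lm W U (n + 1)) ≤
      ∫⁻ q, ((n + 1 : ℕ) : ℝ≥0∞) * ∫⁻ x, ‖A' (unsh W hW (q, x))‖ₑ ^ 2 ∂(ker W hW q)
        ∂(lm W U (n + 1)) := by
    refine lintegral_mono_ae ?_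
    filter_upwards [ae_lm hW hU (n + 1)] with q hq'
    calc ‖remSum W hW A' q‖ₑ ^ 2 ≤ (∫⁻ x, ‖A' (unsh W hW (q, x))‖ₑ ∂(ker W hW q)) ^ 2 := by
          gcongr
          exact enorm_integral_le_lintegral_enorm _
      _ ≤ _ := by
          refine (sq_lintegral_le _ (hm.comp measurable_prodMk_left).aemeasurable).trans
            (le_of_eq ?_)
          rw [ProbabilityTheory.Kernel.comap_apply,
            kernel_univ hW (by rw [hq'.1]; exact ENNReal.natCast_ne_top _), hq'.1]
          rfl
  refine h2.trans_lt ?_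
  rw [lintegral_const_mul' _ _ (by finiteness),
    ← Measure.lintegral_compProd (hm.pow_const 2), lintegral_enorm_sq_eq]
  exact ENNReal.mul_lt_top (by finiteness) (ENNReal.pow_lt_top h1.2)

/-- Together with `integral_inner_addInt`, this says that `remSum` and `addInt` are adjoint up to
the factor `n + 1`. -/
theorem integral_inner_remSum [CompleteSpace F] (hW : MeasurableSet W) (hU : MeasurableSet U)
    (hv : volume W ≠ ⊤) {n : ℕ} (hA : MemLp A 2 (lm W U n)) (hB : MemLp B 2 (lm W U (n + 1))) :
    ∫ q, inner ℝ (remSum W hW A q) (B q) ∂(lm W U (n + 1)) =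
      (n + 1) * ∫ p, inner ℝ (A p.1) (B (sh p)) ∂((lm W U n).prod (volume.restrict W)) := by
  have : IsFiniteMeasure (volume.restrict W) := isFiniteMeasure_restrict.2 hv
  have hm : Measurable fun p : (Config d × Space d) × Space d => (sh p, p.2) :=
    measurable_sh.prodMk measurable_snd
  obtain ⟨A', hA', hAA'⟩ := hA.1
  obtain ⟨B', hB', hBB'⟩ := hB.1
  have e1 : ∫ q, inner ℝ (remSum W hW A q) (B q) ∂(lm W U (n + 1)) =
      ∫ q, inner ℝ (remSum W hW A' q) (B' q) ∂(lm W U (n + 1)) := by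
    refine integral_congr_ae ?_
    filter_upwards [remSum_congr hW hAA', hBB'] with q h1 h2
    rw [h1, h2]
  have e2 : ∫ p, inner ℝ (A p.1) (B (sh p)) ∂((lm W U n).prod (volume.restrict W)) =
      ∫ p, inner ℝ (A' p.1) (B' (sh p)) ∂((lm W U n).prod (volume.restrict W)) := by
    refine integral_congr_ae ?_
    filter_upwards [Measure.quasiMeasurePreserving_fst.ae hAA',
      (measurePreserving_sh n).quasiMeasurePreserving.ae hBB'] with p h1 h2
    rw [h1, h2]
  rw [memLp_congr_ae hAA'] at hA
  rw [memLp_congr_ae hBB'] at hB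
  rw [e1, e2]
  have h1 := memLp_comp_unsh hW hv hA
  have hA'' := hA'.comp_measurable (measurable_unsh hW)
  have h3 : StronglyMeasurable fun p => inner ℝ (A' (unsh W hW p)) (B' p.1) :=
    hA''.inner (hB'.comp_measurable measurable_fst)
  have h4 : (fun p => inner ℝ (A' (unsh W hW (sh p, p.2))) (B' (sh p)))
      =ᵐ[(lm W U n).prod (volume.restrict W)] fun p => inner ℝ (A' p.1) (B' (sh p)) := by
    filter_upwards [ae_unsh_sh hW n] with p hp
    rw [hp]
  have h5 : Integrable (fun p => inner ℝ (A' (unsh W hW p)) (B' p.1))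
      ((lm W U (n + 1)).compProd (ker W hW)) := by
    rw [level_compProd]
    refine Integrable.smul_measure ?_ (by finiteness)
    refine (integrable_map_measure h3.aestronglyMeasurable hm.aemeasurable).2 ?_
    exact ((hA.comp_fst _).integrable_inner' (memLp_comp_sh hB)).congr h4.symm
  have h6 : ∫ q, inner ℝ (remSum W hW A' q) (B' q) ∂(lm W U (n + 1)) =
      ∫ q, ∫ x, inner ℝ (A' (unsh W hW (q, x))) (B' q) ∂(ker W hW q) ∂(lm W U (n + 1)) := by
    refine integral_congr_ae ?_
    have h7 : ∀ᵐ q ∂(lm W U (n + 1)), ∫⁻ x, ‖A' (unsh W hW (q, x))‖ₑ ^ 2 ∂(ker W hW q) < ⊤ := by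
      have hm2 : Measurable fun p => ‖A' (unsh W hW p)‖ₑ ^ 2 := hA''.enorm.pow_const 2
      refine ae_lt_top hm2.lintegral_kernel_prod_right' ?_
      rw [← Measure.lintegral_compProd hm2, lintegral_enorm_sq_eq]
      exact (ENNReal.pow_lt_top h1.2).ne
    filter_upwards [h7, ae_lm hW hU (n + 1)] with q hq2 hq3
    have hfin : IsFiniteMeasure (ker W hW q) := ⟨by
      rw [ProbabilityTheory.Kernel.comap_apply,
        kernel_univ hW (by rw [hq3.1]; exact ENNReal.natCast_ne_top _), hq3.1]
      exact ENNReal.natCast_lt_top _⟩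
    have h8 : MemLp (fun x => A' (unsh W hW (q, x))) 2 (ker W hW q) := by
      refine ⟨(hA''.comp_measurable measurable_prodMk_left).aestronglyMeasurable, ?_⟩
      rw [lintegral_enorm_sq_eq] at hq2
      exact (ENNReal.pow_lt_top_iff.1 hq2).resolve_right (by norm_num)
    rw [real_inner_comm]
    have h9 := integral_inner (𝕜 := ℝ) (h8.integrable (by norm_num)) (B' q)
    refine h9.symm.trans (integral_congr_ae (Eventually.of_forall fun x => ?_))
    exact real_inner_comm _ _
  rw [h6, ← Measure.integral_compProd h5, level_compProd, integral_smul_measure,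
    integral_map hm.aemeasurable h3.aestronglyMeasurable, integral_congr_ae h4, smul_eq_mul]
  congr 1

end ops

end shift

end Config

end

/-! ### Adding and removing particles preserves gradients and their orthogonal complement. -/

noncomputable section

variable {d : ℕ}

namespace Config

theorem contDiff_snoc_left {n : ℕ} (z : Space d) :
    ContDiff ℝ (⊤ : ℕ∞) fun x : Fin n → Space d => (Fin.snoc x z : Fin (n + 1) → Space d) := by
  rw [contDiff_pi]
  intro i
  refine Fin.lastCases ?_ (fun j => ?_) i
  · simpa using contDiff_const
  · simpa using contDiff_apply ℝ (Space d) j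

/-- If `x ∈ U`, it is a frozen variable; otherwise it belongs to the outer configuration. Both cases
occur, as additional particles range over `W`. -/
theorem SmoothOn.comp_add_point {U : Set (Space d)} {φ : Config d → ℝ} (hφ : SmoothOn U φ)
    (x : Space d) : SmoothOn U fun μ => φ (μ.add (point x)) := by
  intro μ n
  by_cases hx : x ∈ U
  · have h1 : ∀ y : Fin n → Space d, φ (((points y).add (μ.res Uᶜ)).add (point x)) =
        φ ((points (Fin.snoc y x : Fin (n + 1) → Space d)).add (μ.res Uᶜ)) := fun y => by
      rw [points_snoc, add_right_comm]
    simp only [h1]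
    refine (hφ μ (n + 1)).comp (contDiff_snoc_left x).contDiffOn fun y hy => ?_
    refine Set.mem_univ_pi.2 fun i => ?_
    refine Fin.lastCases ?_ (fun j => ?_) i
    · simpa using hx
    · simpa using hy j (Set.mem_univ j)
  · have h1 : ∀ y : Fin n → Space d, φ (((points y).add (μ.res Uᶜ)).add (point x)) =
        φ ((points y).add ((μ.add (point x)).res Uᶜ)) := fun y => by
      rw [res_add, res_point_of_mem (show x ∈ Uᶜ from hx), add_assoc]
    simp only [h1]
    exact hφ _ n

theorem rgrad_comp_add (φ : Config d → ℝ) (η μ : Config d) (z : Space d) :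
    rgrad (fun μ => φ (μ.add η)) μ z = rgrad φ (μ.add η) z := by
  simp only [rgrad, add_right_comm _ _ η]

section level

variable {W U : Set (Space d)}

/-- Test functions of `n + 1` particles in `W`. -/
abbrev LevelTest (W U : Set (Space d)) (n : ℕ) (φ : Config d → ℝ) : Prop :=
  IsTest (level W (n + 1)) (level W n) U φ

theorem LevelTest.ae_slice {n : ℕ} {φ : Config d → ℝ} (hφ : LevelTest W U (n + 1) φ) :
    ∀ᵐ x ∂(volume.restrict W), LevelTest W U n fun μ => φ (μ.add (point x)) := by
  have h1 : MemLp (fun p : Config d × Space d => φ (p.1.add (point p.2))) 2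
      ((level W (n + 1)).prod (volume.restrict W)) :=
    (memLp_map_measure_iff hφ.memLp.1 measurable_add_point.aemeasurable).1 hφ.memLp
  have h2 := memLp_comp_sh hφ.memLp_rgrad
  filter_upwards [h1.ae_slice_right, h2.ae_slice_right] with x hx1 hx2
  refine ⟨hφ.smoothOn.comp_add_point x, hx1, ?_⟩
  simp only [rgrad_comp_add]
  exact hx2

/-- Against a test function, the removed particle becomes an independent variable `x`; for fixed
`x`, the function `φ (· + δ_x)` is a test function with one particle less. -/
theorem Perp.remSum (hW : MeasurableSet W) (hU : MeasurableSet U) (hv : volume W ≠ ⊤) {n : ℕ}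
    {B : Config d × Space d → Space d} (hB : Perp (level W (n + 1)) (level W n) U B) :
    Perp (level W (n + 2)) (level W (n + 1)) U (remSum W hW B) := by
  have : IsFiniteMeasure (volume.restrict W) := isFiniteMeasure_restrict.2 hv
  refine ⟨memLp_remSum hW hU hv hB.1, fun φ hφ => ?_⟩
  have h1 := integral_inner_remSum hW hU hv hB.1 hφ.memLp_rgrad
  have h2 : ∫ p, inner ℝ (B p.1) (rgrad φ (sh p).1 (sh p).2)
      ∂((lm W U n).prod (volume.restrict W)) = 0 := by
    rw [integral_prod_symm _ ((hB.1.comp_fst _).integrable_inner' (memLp_comp_sh hφ.memLp_rgrad))]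
    refine integral_eq_zero_of_ae ?_
    filter_upwards [LevelTest.ae_slice hφ] with x hx
    have := hB.2 _ hx
    simp only [rgrad_comp_add] at this
    rw [Pi.zero_apply, ← this]
    exact integral_congr_ae (Eventually.of_forall fun q => real_inner_comm _ _)
  rw [h2, mul_zero] at h1
  rw [← h1]
  exact integral_congr_ae (Eventually.of_forall fun q => real_inner_comm _ _)

/-- Dual to `Perp.remSum` by adjointness; no potential has to be exhibited. -/
theorem Grad.addInt (hW : MeasurableSet W) (hU : MeasurableSet U) (hv : volume W ≠ ⊤) {n : ℕ}
    {A : Config d × Space d → Space d} (hA : Grad (level W (n + 2)) (level W (n + 1)) U A) :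
    Grad (level W (n + 1)) (level W n) U (addInt W A) := by
  refine ⟨memLp_addInt hv hA.1, fun B hB => ?_⟩
  rw [integral_inner_addInt hv hA.1 hB.1]
  have h1 := integral_inner_remSum hW hU hv hB.1 hA.1
  have h2 := hA.2 _ (hB.remSum hW hU hv)
  have h3 : ∫ q, inner ℝ (Config.remSum W hW B q) (A q) ∂(lm W U (n + 1)) = 0 := by
    rw [← h2]
    exact integral_congr_ae (Eventually.of_forall fun q => real_inner_comm _ _)
  rw [h3] at h1
  have h4 := (mul_eq_zero.1 h1.symm).resolve_left (by positivity)
  rw [← h4]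
  exact integral_congr_ae (Eventually.of_forall fun q => real_inner_comm _ _)

theorem exists_kernel_eq_sum (hW : MeasurableSet W) {μ : Config d} (h : μ.1 W ≠ ⊤) :
    ∃ (n : ℕ) (y : Fin n → Space d), (∀ i, y i ∈ W) ∧
      kernel W hW μ = ∑ i, Measure.dirac (y i) ∧
      ∀ i, μ = (remIn W hW (μ, y i)).add (point (y i)) := by
  obtain ⟨n, y, hy, hμ, -⟩ := exists_points hW h
  have hk : kernel W hW μ = ∑ i, Measure.dirac (y i) := by
    rw [kernel_apply hW h]
    exact congrArg Subtype.val hμ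
  refine ⟨n, y, hy, hk, fun i => ?_⟩
  have h1 := ae_exists_add_point hW h
  rw [← kernel_apply hW h, hk, ae_iff, Measure.coe_finsetSum, Finset.sum_apply,
    Finset.sum_eq_zero_iff] at h1
  have h2 := h1 i (Finset.mem_univ i)
  rw [Measure.dirac_apply, Set.indicator_apply_eq_zero] at h2
  by_contra hc
  refine one_ne_zero (α := ℝ≥0∞) (h2 ?_)
  rintro ⟨-, ν, -, h3, h4⟩
  exact hc (by rw [h4]; exact h3)

theorem integrable_kernel (hW : MeasurableSet W) {F : Type*} [NormedAddCommGroup F] {μ : Config d}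
    (h : μ.1 W ≠ ⊤) (f : Space d → F) : Integrable f (kernel W hW μ) := by
  obtain ⟨n, y, -, hk, -⟩ := exists_kernel_eq_sum hW h
  rw [hk, integrable_finsetSum_measure]
  exact fun i _ => integrable_dirac (by finiteness)

theorem integral_sum_dirac {n : ℕ} {F : Type*} [NormedAddCommGroup F] [NormedSpace ℝ F]
    [CompleteSpace F] (y : Fin n → Space d) (f : Space d → F) :
    ∫ x, f x ∂(∑ i, Measure.dirac (y i)) = ∑ i, f (y i) := by
  rw [integral_finsetSum_measure fun i _ => integrable_dirac (by finiteness)]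
  simp

/-- The sum over the particles in `W` of a function evaluated with this particle removed. -/
def remFun (W : Set (Space d)) (hW : MeasurableSet W) (φ : Config d → ℝ) (μ : Config d) : ℝ :=
  ∫ x, φ (remIn W hW (μ, x)) ∂(kernel W hW μ)

theorem kernel_add (hW : MeasurableSet W) {μ ξ : Config d} (h : (μ.add ξ).1 W ≠ ⊤) :
    kernel W hW (μ.add ξ) = kernel W hW μ + kernel W hW ξ := by
  have h1 := ENNReal.add_ne_top.1 h
  rw [kernel_apply hW h, kernel_apply hW h1.1, kernel_apply hW h1.2]
  exact Measure.restrict_add _ _ _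

theorem integral_remIn_add (hW : MeasurableSet W) {μ ξ : Config d} (h : (μ.add ξ).1 W ≠ ⊤)
    (φ : Config d → ℝ) : ∫ x, φ (remIn W hW (μ.add ξ, x)) ∂(kernel W hW μ) =
      ∫ x, φ ((remIn W hW (μ, x)).add ξ) ∂(kernel W hW μ) := by
  have h1 := ENNReal.add_ne_top.1 h
  refine integral_congr_ae ?_
  rw [kernel_apply hW h1.1]
  filter_upwards [ae_exists_add_point hW h1.1] with x hx
  obtain ⟨hxW, ν, hν, h2, h3⟩ := hx
  have h4 : (ν.add ξ).1 W ≠ ⊤ := ENNReal.add_ne_top.2 ⟨hν, h1.2⟩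
  rw [h3, h2, add_right_comm, remIn_add_point hW h4 hxW]

theorem remFun_add (hW : MeasurableSet W) {μ ξ : Config d} (h : (μ.add ξ).1 W ≠ ⊤)
    (φ : Config d → ℝ) : remFun W hW φ (μ.add ξ) =
      ∫ x, φ ((remIn W hW (μ, x)).add ξ) ∂(kernel W hW μ) +
      ∫ x, φ ((remIn W hW (ξ, x)).add μ) ∂(kernel W hW ξ) := by
  have h1 := ENNReal.add_ne_top.1 h
  rw [remFun, kernel_add hW h, integral_add_measure (integrable_kernel hW h1.1 _)
    (integrable_kernel hW h1.2 _), integral_remIn_add hW h]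
  congr 1
  rw [add_comm μ ξ] at h ⊢
  exact integral_remIn_add hW h φ

theorem remFun_add_point (hW : MeasurableSet W) {μ : Config d} (h : μ.1 W ≠ ⊤) {z : Space d}
    (hz : z ∈ W) (φ : Config d → ℝ) : remFun W hW φ (μ.add (point z)) =
      ∫ x, φ ((remIn W hW (μ, x)).add (point z)) ∂(kernel W hW μ) + φ μ := by
  have he : (empty : Config d).1 W ≠ ⊤ := by simp [empty]
  have hp : (point z).1 W ≠ ⊤ := measure_ne_top (Measure.dirac z) W
  have h1 : kernel W hW (point z) = Measure.dirac z := by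
    have := kernel_add_point hW he hz
    rw [empty_add, kernel_apply hW he] at this
    simpa [empty] using this
  have h2 : remIn W hW (point z, z) = empty := by
    have := remIn_add_point hW he hz
    rwa [empty_add] at this
  rw [remFun_add hW (ENNReal.add_ne_top.2 ⟨h, hp⟩), h1, integral_dirac, h2, empty_add]

/-- When the tagged particle `z` itself is removed, the term is `φ μ`, which does not depend on `z`;
only the other particles contribute to the derivative. -/
theorem rgrad_remFun (hW : MeasurableSet W) (hU : IsOpen U) (hUW : U ⊆ W) {φ : Config d → ℝ}
    (hφ : SmoothOn U φ) {μ : Config d} (h : μ.1 W ≠ ⊤) {z : Space d} (hz : z ∈ U) :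
    rgrad (remFun W hW φ) μ z = remSum W hW (fun q => rgrad φ q.1 q.2) (μ, z) := by
  obtain ⟨n, y, hy, hk, hrem⟩ := exists_kernel_eq_sum hW h
  have h1 : ∀ z' ∈ U, remFun W hW φ (μ.add (point z')) =
      ∑ i, φ ((remIn W hW (μ, y i)).add (point z')) + φ μ := fun z' hz' => by
    rw [remFun_add_point hW h (hUW hz'), hk, integral_sum_dirac]
  have h2 : remSum W hW (fun q => rgrad φ q.1 q.2) (μ, z) =
      ∑ i, rgrad φ (remIn W hW (μ, y i)) z := by
    simp only [remSum]
    rw [hk, integral_sum_dirac]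
  rw [h2]
  refine rgrad_eq_of_hasFDerivAt ?_
  have h3 : ∀ i, (remIn W hW (μ, y i)).1 U ≠ ⊤ := fun i => by
    refine ne_top_of_le_ne_top (measure_ne_top_of_subset hUW h) ?_
    conv_rhs => rw [hrem i, add_apply]
    exact le_self_add
  have h4 : HasFDerivAt (fun z' => ∑ i, φ ((remIn W hW (μ, y i)).add (point z')) + φ μ)
      (∑ i, innerSL ℝ (rgrad φ (remIn W hW (μ, y i)) z)) z :=
    (HasFDerivAt.fun_sum fun i _ => hφ.hasFDerivAt hU (h3 i) hz).add_const _
  rw [map_sum]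
  refine h4.congr_of_eventuallyEq ?_
  filter_upwards [hU.mem_nhds hz] with z' hz'
  exact h1 z' hz'

theorem points_succAbove {n : ℕ} (x : Fin (n + 1) → Space d) (i : Fin (n + 1)) :
    points x = (points fun j => x (i.succAbove j)).add (point (x i)) := by
  refine ext_val ?_
  change (points x).1 = (points fun j => x (i.succAbove j)).1 + Measure.dirac (x i)
  rw [points_val, points_val, Fin.sum_univ_succAbove _ i, _root_.add_comm]

theorem points_apply_ne_top {n : ℕ} (x : Fin n → Space d) (B : Set (Space d)) :
    (points x).1 B ≠ ⊤ := by
  rw [points_val, Measure.coe_finsetSum, Finset.sum_apply]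
  exact ENNReal.sum_ne_top.2 fun i _ => measure_ne_top _ _

theorem kernel_points (hW : MeasurableSet W) {n : ℕ} {x : Fin n → Space d} (hx : ∀ i, x i ∈ W) :
    kernel W hW (points x) = ∑ i, Measure.dirac (x i) := by
  rw [kernel_apply hW (points_apply_ne_top x W), ← points_val]
  exact congrArg Subtype.val (res_points_of_mem hx)

/-- The removed particle is one of the variable particles in `U` or one of the frozen ones in `W \
U`; both give finite sums of smooth functions. -/
theorem SmoothOn.remFun (hW : MeasurableSet W) (hUW : U ⊆ W) (hU : MeasurableSet U)
    {φ : Config d → ℝ} (hφ : SmoothOn U φ) : SmoothOn U (remFun W hW φ) := by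
  intro μ n
  -- With infinitely many frozen particles in `W` the kernel vanishes by convention, and so does the
  -- function.
  by_cases hη : (μ.res Uᶜ).1 W = ⊤
  · have h1 : ∀ x : Fin n → Space d, Config.remFun W hW φ ((points x).add (μ.res Uᶜ)) = 0 := by
      intro x
      rw [Config.remFun, kernel_apply_top hW (by rw [add_apply, hη]; simp), integral_zero_measure]
    simp only [h1]
    exact contDiffOn_const
  obtain ⟨l, y, hy, hk, hrem⟩ := exists_kernel_eq_sum hW hη
  have hout : ∀ j, (remIn W hW (μ.res Uᶜ, y j)).res Uᶜ = remIn W hW (μ.res Uᶜ, y j) := by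
    intro j
    have h0 : (μ.res Uᶜ).1 U = 0 := by rw [res_apply _ hU]; simp
    have h1 : (remIn W hW (μ.res Uᶜ, y j)).1 U = 0 := by
      refine le_zero_iff.1 (h0 ▸ ?_)
      conv_rhs => rw [hrem j, add_apply]
      exact le_self_add
    refine ext_val (Measure.restrict_eq_self_of_ae_mem ?_)
    rw [ae_iff]
    simpa using h1
  have h2 : ContDiffOn ℝ (⊤ : ℕ∞) (fun x : Fin n → Space d =>
      ∑ j, φ ((points x).add ((remIn W hW (μ.res Uᶜ, y j)).res Uᶜ)))
      (Set.univ.pi fun _ => U) := ContDiffOn.sum fun j _ => hφ _ n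
  have hfin : ∀ x : Fin n → Space d, ((points x).add (μ.res Uᶜ)).1 W ≠ ⊤ := fun x =>
    ENNReal.add_ne_top.2 ⟨points_apply_ne_top x W, hη⟩
  have h3 : ∀ x : Fin n → Space d, ∫ a, φ ((remIn W hW (μ.res Uᶜ, a)).add (points x))
      ∂(kernel W hW (μ.res Uᶜ)) =
      ∑ j, φ ((points x).add ((remIn W hW (μ.res Uᶜ, y j)).res Uᶜ)) := by
    intro x
    rw [hk, integral_sum_dirac]
    refine Finset.sum_congr rfl fun j _ => ?_
    rw [hout, add_comm]
  cases n with
  | zero =>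
    refine h2.congr fun x hx => ?_
    rw [remFun_add hW (hfin x), h3, kernel_points hW (fun i => i.elim0), integral_sum_dirac]
    simp
  | succ n =>
    have h4 : ContDiffOn ℝ (⊤ : ℕ∞) (fun x : Fin (n + 1) → Space d =>
        ∑ i : Fin (n + 1), φ ((points fun j => x (i.succAbove j)).add (μ.res Uᶜ)))
        (Set.univ.pi fun _ => U) := by
      refine ContDiffOn.sum fun i _ => (hφ μ n).comp (t := Set.univ.pi fun _ => U)
        (f := fun (x : Fin (n + 1) → Space d) j => x (i.succAbove j)) ?_ ?_
      · exact (contDiff_pi.2 fun j => contDiff_apply ℝ (Space d) (i.succAbove j)).contDiffOn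
      · exact fun x hx => Set.mem_univ_pi.2 fun j => hx _ (Set.mem_univ _)
    refine (h4.add h2).congr fun x hx => ?_
    have hx' : ∀ i, x i ∈ W := fun i => hUW (hx i (Set.mem_univ i))
    rw [remFun_add hW (hfin x), h3, kernel_points hW hx', integral_sum_dirac]
    congr 1
    refine Finset.sum_congr rfl fun i _ => ?_
    have : remIn W hW (points x, x i) = points fun j => x (i.succAbove j) := by
      rw [points_succAbove x i]
      exact remIn_add_point hW (points_apply_ne_top _ _) (hx' i)
    rw [this]

theorem LevelTest.remFun (hW : MeasurableSet W) (hU : IsOpen U) (hUW : U ⊆ W)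
    (hv : volume W ≠ ⊤) (hvU : volume U ≠ 0) {n : ℕ} {φ : Config d → ℝ}
    (hφ : LevelTest W U n φ) : LevelTest W U (n + 1) (remFun W hW φ) := by
  have hvU' : volume U ≠ ⊤ := measure_ne_top_of_subset hUW hv
  have : IsFiniteMeasure (volume.restrict U) := isFiniteMeasure_restrict.2 hvU'
  refine ⟨hφ.smoothOn.remFun hW hUW hU.measurableSet, ?_, ?_⟩
  -- Square integrability is read off from the bound on `remSum`, applied to a field that ignores
  -- the tagged particle; one admissible position in `U` suffices, and it exists since `U` has
  -- positive volume.
  · have h1 : MemLp (fun q : Config d × Space d => φ q.1) 2 (lm W U (n + 1)) :=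
      hφ.memLp.comp_fst _
    have h2 := (memLp_remSum hW hU.measurableSet hv h1).ae_slice_right
    have : NeBot (ae (volume.restrict U)) := by
      rw [ae_neBot]
      exact fun h => hvU (Measure.restrict_eq_zero.1 h)
    obtain ⟨z, hz⟩ := h2.exists
    exact hz
  · refine (memLp_congr_ae ?_).2 (memLp_remSum hW hU.measurableSet hv hφ.memLp_rgrad)
    filter_upwards [ae_lm hW hU.measurableSet (n + 1)] with q hq
    exact rgrad_remFun hW hU hUW hφ.smoothOn (by rw [hq.1]; exact ENNReal.natCast_ne_top _) hq.2.2

/-- The pairing with `∇φ` is moved to the upper level, where `remSum` of `∇φ` is the gradient of the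
test function `remFun φ`. -/
theorem Perp.addInt (hW : MeasurableSet W) (hU : IsOpen U) (hUW : U ⊆ W)
    (hv : volume W ≠ ⊤) (hvU : volume U ≠ 0) {n : ℕ}
    {B : Config d × Space d → Space d} (hB : Perp (level W (n + 2)) (level W (n + 1)) U B) :
    Perp (level W (n + 1)) (level W n) U (addInt W B) := by
  refine ⟨memLp_addInt hv hB.1, fun φ hφ => ?_⟩
  have h1 := integral_inner_remSum hW hU.measurableSet hv hφ.memLp_rgrad hB.1
  have h2 := hB.2 _ (LevelTest.remFun hW hU hUW hv hvU hφ)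
  have h3 : ∫ q, inner ℝ (Config.remSum W hW (fun q => rgrad φ q.1 q.2) q) (B q)
      ∂(lm W U (n + 1)) = 0 := by
    rw [← h2]
    refine integral_congr_ae ?_
    filter_upwards [ae_lm hW hU.measurableSet (n + 1)] with q hq
    rw [rgrad_remFun hW hU hUW hφ.smoothOn (by rw [hq.1]; exact ENNReal.natCast_ne_top _) hq.2.2]
  rw [h3] at h1
  have h4 := (mul_eq_zero.1 h1.symm).resolve_left (by positivity)
  have h5 := integral_inner_addInt hv hB.1 hφ.memLp_rgrad
  have h6 : ∫ p, inner ℝ (B (sh p)) (rgrad φ p.1.1 p.1.2)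
      ∂((lm W U n).prod (volume.restrict W)) = 0 := by
    rw [← h4]
    exact integral_congr_ae (Eventually.of_forall fun q => real_inner_comm _ _)
  rw [h6] at h5
  rw [← h5]
  exact integral_congr_ae (Eventually.of_forall fun q => real_inner_comm _ _)

end level

end Config

end

/-! ### Averages over additional variables; cut-off operators. -/

noncomputable section

section mean

variable {α β E : Type*} [MeasurableSpace α] [MeasurableSpace β] {m : Measure α} {ν : Measure β}
  [SFinite m] [IsFiniteMeasure ν] [NormedAddCommGroup E] [InnerProductSpace ℝ E] [CompleteSpace E]

theorem MeasureTheory.MemLp.integral_right {A : α × β → E} (hA : MemLp A 2 (m.prod ν)) :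
    MemLp (fun q => ∫ x, A (q, x) ∂ν) 2 m := by
  refine ⟨hA.1.integral_prod_right', ?_⟩
  rw [← ENNReal.pow_lt_top_iff (n := 2) |>.trans (or_iff_left (by norm_num)),
    ← Config.lintegral_enorm_sq_eq]
  have h2 : ∫⁻ q, ‖∫ x, A (q, x) ∂ν‖ₑ ^ 2 ∂m ≤
      ∫⁻ q, ν Set.univ * ∫⁻ x, ‖A (q, x)‖ₑ ^ 2 ∂ν ∂m := by
    refine lintegral_mono_ae ?_
    filter_upwards [hA.1.prodMk_left] with q hq
    refine le_trans ?_ (sq_lintegral_le _ hq.enorm)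
    gcongr
    exact enorm_integral_le_lintegral_enorm _
  refine h2.trans_lt ?_
  rw [lintegral_const_mul' _ _ (measure_ne_top _ _), ← lintegral_prod _ (hA.1.enorm.pow_const 2),
    Config.lintegral_enorm_sq_eq]
  exact ENNReal.mul_lt_top (measure_lt_top _ _) (ENNReal.pow_lt_top hA.2)

theorem integral_inner_right {A : α × β → E} {B : α → E} (hA : MemLp A 2 (m.prod ν))
    (hB : MemLp B 2 m) : ∫ p, inner ℝ (B p.1) (A p) ∂(m.prod ν) =
      ∫ q, inner ℝ (B q) (∫ x, A (q, x) ∂ν) ∂m := by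
  rw [integral_prod _ ((hB.comp_fst _).integrable_inner' hA)]
  refine integral_congr_ae ?_
  filter_upwards [hA.ae_slice] with q hq
  exact integral_inner (𝕜 := ℝ) (hq.integrable (by norm_num)) (B q)

theorem integral_inner_right_right {A : (α × β) × β → E} {B : α → E}
    (hA : MemLp A 2 ((m.prod ν).prod ν)) (hB : MemLp B 2 m) :
    ∫ ω, inner ℝ (B ω.1.1) (A ω) ∂((m.prod ν).prod ν) =
      ∫ q, inner ℝ (B q) (∫ x, ∫ y, A ((q, x), y) ∂ν ∂ν) ∂m :=
  (integral_inner_right (B := fun p => B p.1) hA (hB.comp_fst _)).trans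
    (integral_inner_right hA.integral_right hB)

theorem MeasureTheory.MemLp.comp_right_comm {A : α × β → E} (hA : MemLp A 2 (m.prod ν)) :
    MemLp (fun ω : (α × β) × β => A (ω.1.1, ω.2)) 2 ((m.prod ν).prod ν) :=
  (hA.comp_fst ν).comp_measurePreserving (measurePreserving_prod_right_comm m ν ν)

/-- Given the first component, the two additional variables are independent with the same law, so
the pairing factors through the averages. This is what provides the positivity in `Quad`. -/
theorem integral_inner_mean {A B : α × β → E} (hA : MemLp A 2 (m.prod ν))
    (hB : MemLp B 2 (m.prod ν)) :
    ∫ ω, inner ℝ (A ω.1) (B (ω.1.1, ω.2)) ∂((m.prod ν).prod ν) =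
      ∫ q, inner ℝ (∫ x, A (q, x) ∂ν) (∫ x, B (q, x) ∂ν) ∂m := by
  rw [integral_inner_right hB.comp_right_comm hA]
  simp only [real_inner_comm _ (A _)]
  simp only [real_inner_comm (∫ x, B (_, x) ∂ν) (∫ x, A (_, x) ∂ν)]
  exact integral_inner_right hA hB.integral_right |>.trans rfl

theorem integral_inner_mean' {A B : α × β → E} (hA : MemLp A 2 (m.prod ν))
    (hB : MemLp B 2 (m.prod ν)) :
    ∫ ω, inner ℝ (A (ω.1.1, ω.2)) (B ω.1) ∂((m.prod ν).prod ν) =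
      ∫ q, inner ℝ (∫ x, A (q, x) ∂ν) (∫ x, B (q, x) ∂ν) ∂m := by
  simp only [real_inner_comm (B _), real_inner_comm (∫ x, B (_, x) ∂ν)]
  exact integral_inner_mean hB hA

theorem sq_integral_inner_le {A B : α → E} (hA : MemLp A 2 m) (hB : MemLp B 2 m) :
    (∫ q, inner ℝ (A q) (B q) ∂m) ^ 2 ≤
      (∫ q, inner ℝ (A q) (A q) ∂m) * ∫ q, inner ℝ (B q) (B q) ∂m := by
  rw [← inner_toLp hA hB, ← inner_toLp hA hA, ← inner_toLp hB hB, pow_two]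
  exact real_inner_mul_inner_self_le _ _

end mean

section cut

variable {Ω E : Type*} [MeasurableSpace Ω] [NormedAddCommGroup E] [InnerProductSpace ℝ E]
  {m : Measure Ω}

theorem isBddField_indicator {S : Set Ω} (hS : MeasurableSet S) :
    IsBddField (S.indicator fun _ => ContinuousLinearMap.id ℝ E) := by
  refine ⟨stronglyMeasurable_const.indicator hS, 1, fun ω v => ?_⟩
  by_cases h : ω ∈ S <;> simp [h]

/-- Multiplication by the indicator function of `S`. -/
def cut (m : Measure Ω) {S : Set Ω} (hS : MeasurableSet S) : Lp E 2 m →L[ℝ] Lp E 2 m :=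
  mulOp m (isBddField_indicator hS)

theorem coeFn_cut {S : Set Ω} (hS : MeasurableSet S) (u : Lp E 2 m) :
    cut m hS u =ᵐ[m] S.indicator u := by
  filter_upwards [coeFn_mulOp (isBddField_indicator hS) u] with ω h
  rw [cut, h]
  by_cases h : ω ∈ S <;> simp [h]

theorem cut_toLp {S : Set Ω} (hS : MeasurableSet S) {u : Ω → E} (hu : MemLp u 2 m) :
    cut m hS hu.toLp = (hu.indicator hS).toLp := by
  refine Lp.ext ?_
  filter_upwards [coeFn_cut hS hu.toLp, hu.coeFn_toLp, (hu.indicator hS).coeFn_toLp]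
    with ω h1 h2 h3
  rw [h1, h3]
  by_cases h : ω ∈ S <;> simp [h, h2]

theorem norm_cut_le_norm_cut {S S' : Set Ω} (hS : MeasurableSet S) (hS' : MeasurableSet S')
    (h : S ⊆ S') (u : Lp E 2 m) : ‖cut m hS u‖ ≤ ‖cut m hS' u‖ := by
  refine Lp.norm_le_norm_of_ae_le ?_
  filter_upwards [coeFn_cut hS u, coeFn_cut hS' u] with ω h1 h2
  rw [h1, h2]
  exact norm_indicator_le_of_subset h _ _

theorem norm_cut_le {S : Set Ω} (hS : MeasurableSet S) (u : Lp E 2 m) : ‖cut m hS u‖ ≤ ‖u‖ := by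
  refine Lp.norm_le_norm_of_ae_le ?_
  filter_upwards [coeFn_cut hS u] with ω h1
  rw [h1]
  exact norm_indicator_le_norm_self _ _

theorem norm_mulOp_le {a : Ω → E →L[ℝ] E} (ha : IsBddField a) {C : ℝ}
    (hC : ∀ ω v, ‖a ω v‖ ≤ C * ‖v‖) (u : Lp E 2 m) : ‖mulOp m ha u‖ ≤ C * ‖u‖ := by
  refine Lp.norm_le_mul_norm_of_ae_le_mul ?_
  filter_upwards [coeFn_mulOp ha u] with ω h
  rw [h]
  exact hC _ _

theorem cut_mulOp_cut {a : Ω → E →L[ℝ] E} (ha : IsBddField a) {S : Set Ω} (hS : MeasurableSet S)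
    (hz : ∀ ω, ω ∉ S → a ω = 0) (u : Lp E 2 m) : cut m hS (mulOp m ha (cut m hS u)) =
      mulOp m ha u := by
  refine Lp.ext ?_
  filter_upwards [coeFn_cut hS (mulOp m ha (cut m hS u)), coeFn_mulOp ha (cut m hS u),
    coeFn_cut hS u, coeFn_mulOp ha u] with ω h1 h2 h3 h4
  rw [h1, h4]
  by_cases h : ω ∈ S
  · rw [Set.indicator_of_mem h, h2, h3, Set.indicator_of_mem h]
  · simp [h, hz ω h]

theorem inner_cut {S : Set Ω} (hS : MeasurableSet S) (u v : Lp E 2 m) :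
    inner ℝ u (cut m hS v) = inner ℝ (cut m hS u) v := by
  rw [L2.inner_def, L2.inner_def]
  refine integral_congr_ae ?_
  filter_upwards [coeFn_cut hS u, coeFn_cut hS v] with ω h1 h2
  rw [h1, h2]
  by_cases h : ω ∈ S <;> simp [h]

/-- A field of operators supported in `S` can be placed between two cut-offs to `S`, so both
arguments are measured on `S` only. -/
theorem abs_inner_mulOp_le {a : Ω → E →L[ℝ] E} (ha : IsBddField a) {S : Set Ω}
    (hS : MeasurableSet S) (hz : ∀ ω, ω ∉ S → a ω = 0) {C : ℝ} (hC : ∀ ω v, ‖a ω v‖ ≤ C * ‖v‖)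
    (u v : Lp E 2 m) : |inner ℝ u (mulOp m ha v)| ≤ C * (‖cut m hS u‖ * ‖cut m hS v‖) := by
  rw [← cut_mulOp_cut ha hS hz, inner_cut]
  refine (abs_real_inner_le_norm _ _).trans ?_
  refine (mul_le_mul_of_nonneg_left (norm_mulOp_le ha hC _) (norm_nonneg _)).trans (le_of_eq ?_)
  ring

theorem abs_inner_mulOp_mulOp_le {a b : Ω → E →L[ℝ] E} (ha : IsBddField a) (hb : IsBddField b)
    {S T : Set Ω} (hS : MeasurableSet S) (hT : MeasurableSet T) (hST : MeasurableSet (S ∩ T))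
    (hz : ∀ ω, ω ∉ S → a ω = 0) (hz' : ∀ ω, ω ∉ T → b ω = 0) {C : ℝ} (hC0 : 0 ≤ C)
    (hC : ∀ ω v, ‖a ω v‖ ≤ C * ‖v‖) (hC' : ∀ ω v, ‖b ω v‖ ≤ C * ‖v‖) (u v : Lp E 2 m) :
    |inner ℝ (mulOp m ha u) (mulOp m hb v)| ≤ C ^ 2 * (‖cut m hST u‖ * ‖cut m hST v‖) := by
  have h1 : inner ℝ (mulOp m ha u) (mulOp m hb v) =
      inner ℝ (mulOp m ha (cut m hST u)) (mulOp m hb (cut m hST v)) := by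
    rw [L2.inner_def, L2.inner_def]
    refine integral_congr_ae ?_
    filter_upwards [coeFn_mulOp ha u, coeFn_mulOp hb v, coeFn_mulOp ha (cut m hST u),
      coeFn_mulOp hb (cut m hST v), coeFn_cut hST u, coeFn_cut hST v] with ω h1 h2 h3 h4 h5 h6
    rw [h1, h2, h3, h4, h5, h6]
    by_cases hs : ω ∈ S
    · by_cases ht : ω ∈ T
      · have hst : ω ∈ S ∩ T := ⟨hs, ht⟩
        rw [Set.indicator_of_mem hst, Set.indicator_of_mem hst]
      · simp [hz' ω ht]
    · simp [hz ω hs]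
  rw [h1]
  refine (abs_real_inner_le_norm _ _).trans ?_
  refine (mul_le_mul (norm_mulOp_le ha hC _) (norm_mulOp_le hb hC' _) (norm_nonneg _)
    (by positivity)).trans (le_of_eq ?_)
  ring

theorem mulOp_sub {a b : Ω → E →L[ℝ] E} (ha : IsBddField a) (hb : IsBddField b) (u : Lp E 2 m) :
    mulOp m ha u - mulOp m hb u = mulOp m (ha.sub hb) u := by
  refine Lp.ext ?_
  filter_upwards [Lp.coeFn_sub (mulOp m ha u) (mulOp m hb u), coeFn_mulOp ha u, coeFn_mulOp hb u,
    coeFn_mulOp (ha.sub hb) u] with ω h1 h2 h3 h4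
  rw [h1, Pi.sub_apply, h2, h3, h4, sub_apply]

theorem le_inner_mulOp {a : Ω → E →L[ℝ] E} (ha : IsBddField a)
    (hl : ∀ ω v, ‖v‖ ^ 2 ≤ inner ℝ v (a ω v)) (u : Lp E 2 m) :
    ‖u‖ ^ 2 ≤ inner ℝ u (mulOp m ha u) := by
  rw [← real_inner_self_eq_norm_sq, L2.inner_def, L2.inner_def]
  refine integral_mono_ae (L2.integrable_inner u u) (L2.integrable_inner _ _) ?_
  filter_upwards [coeFn_mulOp ha u] with q hq
  rw [hq, real_inner_self_eq_norm_sq]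
  exact hl q _

theorem inner_mulOp_symm {a : Ω → E →L[ℝ] E} (ha : IsBddField a)
    (hs : ∀ ω v w, inner ℝ (a ω v) w = inner ℝ v (a ω w)) (u v : Lp E 2 m) :
    inner ℝ (mulOp m ha u) v = inner ℝ u (mulOp m ha v) := by
  rw [L2.inner_def, L2.inner_def]
  refine integral_congr_ae ?_
  filter_upwards [coeFn_mulOp ha u, coeFn_mulOp ha v] with q h1 h2
  rw [h1, h2, hs]

theorem norm_toLp_le_of_lintegral_le {u v : Ω → E} (hu : MemLp u 2 m) (hv : MemLp v 2 m) {s : ℝ}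
    (hs : 0 ≤ s) (h : ∫⁻ ω, ‖u ω‖ₑ ^ 2 ∂m ≤ ENNReal.ofReal (s ^ 2) * ∫⁻ ω, ‖v ω‖ₑ ^ 2 ∂m) :
    ‖hu.toLp‖ ≤ s * ‖hv.toLp‖ := by
  rw [Config.lintegral_enorm_sq_eq, Config.lintegral_enorm_sq_eq, ENNReal.ofReal_pow hs,
    ← mul_pow, ENNReal.pow_le_pow_left_iff (by norm_num)] at h
  rw [Lp.norm_toLp, Lp.norm_toLp, ← ENNReal.toReal_ofReal hs, ← ENNReal.toReal_mul]
  exact ENNReal.toReal_mono (ENNReal.mul_ne_top ENNReal.ofReal_ne_top hv.2.ne) h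

end cut
end

/-! ### Solutions for all numbers of particles and their orthogonality relations. -/

noncomputable section

variable {d : ℕ}

namespace Config

/-- A bounded domain `U`, and a domain `W` which contains its `1/2`-neighborhood. -/
structure Dom (U W : Set (Space d)) : Prop where
  isOpen : IsOpen U
  meas : MeasurableSet W
  sub : U ⊆ W
  fin : volume W ≠ ⊤
  pos : volume U ≠ 0
  convex : Convex ℝ U
  bdd : Bornology.IsBounded U
  ball : ∀ z ∈ U, Metric.ball z (1 / 2) ⊆ W

/-- A measurable field which solves the equation for every number of particles in `W`. -/
structure USol (a₀ : Config d → Matrix (Fin d) (Fin d) ℝ) (U W : Set (Space d)) (p : Space d)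
    (Γ : Config d × Space d → Space d) : Prop where
  measurable : Measurable Γ
  sol : ∀ n, IsSol (level W (n + 1)) (level W n) U (redCoeff a₀ W) p Γ

theorem Dom.fin' {U W : Set (Space d)} (h : Dom U W) : volume U ≠ ⊤ :=
  ((measure_mono h.sub).trans_lt h.fin.lt_top).ne

theorem Dom.measU {U W : Set (Space d)} (h : Dom U W) : MeasurableSet U := h.isOpen.measurableSet

theorem Dom.pos' {U W : Set (Space d)} (h : Dom U W) : 0 < volume.real W :=
  ENNReal.toReal_pos (fun h0 => h.pos (measure_mono_null h.sub h0)) h.fin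

theorem measurePreserving_sh_fst {U W : Set (Space d)} (n : ℕ) :
    MeasurePreserving
      (fun ω : ((Config d × Space d) × Space d) × Space d => ((sh ω.1, ω.2) : _ × Space d))
      (((lm W U n).prod (volume.restrict W)).prod (volume.restrict W))
      ((lm W U (n + 1)).prod (volume.restrict W)) :=
  (measurePreserving_sh n).prod (MeasurePreserving.id _)

theorem memLp_comp_sh_sh {F : Type*} [NormedAddCommGroup F] [InnerProductSpace ℝ F]
    {U W : Set (Space d)} {A : Config d × Space d → F} {n : ℕ} (hA : MemLp A 2 (lm W U (n + 2))) :
    MemLp (fun ω => A (sh (sh ω.1, ω.2))) 2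
      (((lm W U n).prod (volume.restrict W)).prod (volume.restrict W)) := by
  have h1 := memLp_comp_sh hA
  have h2 := MemLp.comp_measurePreserving h1 (measurePreserving_sh_fst n)
  exact h2

section domain

variable {Λ : ℝ} {a₀ : Config d → Matrix (Fin d) (Fin d) ℝ} (ha : IsCoefficient Λ a₀)
  (hΛ : 0 ≤ Λ) {U W : Set (Space d)} (hD : Dom U W)

include ha hΛ hD in
-- One solution is chosen for each number of particles and they are glued together. The density does
-- not enter, so one field serves all Poisson laws.
theorem exists_uSol (p : Space d) : ∃ Γ, USol a₀ U W p Γ := by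
  have h1 : ∀ n, ∃ Γ : Config d × Space d → Space d, Measurable Γ ∧
      IsSol (level W (n + 1)) (level W n) U (redCoeff a₀ W) p Γ := by
    intro n
    have : IsFiniteMeasure (lm W U n) := isFiniteMeasure_lm hD.fin hD.fin' n
    obtain ⟨Γ, hΓ⟩ := exists_isSol (Q := level W (n + 1)) (Q' := level W n) (U := U)
      (isBddField_redCoeff ha hD.meas hΛ) (redCoeff_lower ha) p
    obtain ⟨Γ', hm, he⟩ := hΓ.grad.1.1
    refine ⟨Γ', hm.measurable, hΓ.grad.congr he, hΓ.perp.congr ?_⟩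
    filter_upwards [he] with q hq
    rw [hq]
  choose Γ hm hs using h1
  -- The index of the level as a measurable function of the configuration.
  have hN : Measurable fun q : Config d × Space d => ⌊(q.1.1 W).toReal⌋₊ :=
    ((measurable_eval hD.meas).comp measurable_fst).ennreal_toReal.nat_floor
  refine ⟨fun q => Γ ⌊(q.1.1 W).toReal⌋₊ q, ?_, fun n => ?_⟩
  · exact (measurable_from_prod_countable_right (f := fun x : ℕ × (Config d × Space d) => Γ x.1 x.2)
      hm).comp (hN.prodMk measurable_id)
  · have he : Γ n =ᵐ[lm W U n] fun q => Γ ⌊(q.1.1 W).toReal⌋₊ q := by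
      filter_upwards [ae_lm hD.meas hD.measU n] with q hq
      simp [hq.1]
    refine ⟨(hs n).grad.congr he, (hs n).perp.congr ?_⟩
    filter_upwards [he] with q hq
    rw [hq]

/-- The flux `a Γ - p`. -/
def flux (a₀ : Config d → Matrix (Fin d) (Fin d) ℝ) (W : Set (Space d)) (p : Space d)
    (Γ : Config d × Space d → Space d) (q : Config d × Space d) : Space d :=
  redCoeff a₀ W q (Γ q) - p

variable {p p' : Space d} {Γ Γ' : Config d × Space d → Space d}

theorem USol.memLp (h : USol a₀ U W p Γ) (n : ℕ) : MemLp Γ 2 (lm W U n) := (h.sol n).grad.1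

theorem USol.memLp_flux (h : USol a₀ U W p Γ) (n : ℕ) : MemLp (flux a₀ W p Γ) 2 (lm W U n) :=
  (h.sol n).perp.1

section orth

variable (h : USol a₀ U W p Γ) (h' : USol a₀ U W p' Γ') (n : ℕ)
include h h'

theorem USol.inner_flux : ∫ q, inner ℝ (Γ q) (flux a₀ W p' Γ' q) ∂(lm W U n) = 0 :=
  (h.sol n).grad.2 _ (h'.sol n).perp

include hD

theorem USol.inner_addInt_flux :
    ∫ q, inner ℝ (addInt W Γ q) (flux a₀ W p' Γ' q) ∂(lm W U n) = 0 :=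
  ((h.sol (n + 1)).grad.addInt hD.meas hD.measU hD.fin).2 _ (h'.sol n).perp

theorem USol.inner_flux_addInt :
    ∫ q, inner ℝ (Γ q) (addInt W (flux a₀ W p' Γ') q) ∂(lm W U n) = 0 :=
  (h.sol n).grad.2 _ ((h'.sol (n + 1)).perp.addInt hD.meas hD.isOpen hD.sub hD.fin hD.pos)

theorem USol.inner_addInt_flux_addInt :
    ∫ q, inner ℝ (addInt W Γ q) (addInt W (flux a₀ W p' Γ') q) ∂(lm W U n) = 0 :=
  ((h.sol (n + 1)).grad.addInt hD.meas hD.measU hD.fin).2 _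
    ((h'.sol (n + 1)).perp.addInt hD.meas hD.isOpen hD.sub hD.fin hD.pos)

theorem USol.inner_addInt_addInt_flux :
    ∫ q, inner ℝ (addInt W (addInt W Γ) q) (flux a₀ W p' Γ' q) ∂(lm W U n) = 0 :=
  (((h.sol (n + 2)).grad.addInt hD.meas hD.measU hD.fin).addInt hD.meas hD.measU hD.fin).2 _
    (h'.sol n).perp

theorem USol.inner_flux_addInt_addInt :
    ∫ q, inner ℝ (Γ q) (addInt W (addInt W (flux a₀ W p' Γ')) q) ∂(lm W U n) = 0 :=
  (h.sol n).grad.2 _ ((((h'.sol (n + 2)).perp.addInt hD.meas hD.isOpen hD.sub hD.fin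
    hD.pos)).addInt hD.meas hD.isOpen hD.sub hD.fin hD.pos)

/-- Orthogonality when at most one particle is added. -/
theorem USol.orth_one :
    ∫ p, inner ℝ (Γ p.1) (flux a₀ W p' Γ' p.1) ∂((lm W U n).prod (volume.restrict W)) = 0 ∧
    ∫ p, inner ℝ (Γ (sh p)) (flux a₀ W p' Γ' p.1) ∂((lm W U n).prod (volume.restrict W)) = 0 ∧
    ∫ p, inner ℝ (Γ p.1) (flux a₀ W p' Γ' (sh p)) ∂((lm W U n).prod (volume.restrict W)) = 0 ∧
    ∫ p, inner ℝ (Γ (sh p)) (flux a₀ W p' Γ' (sh p)) ∂((lm W U n).prod (volume.restrict W)) =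
      0 := by
  have : IsFiniteMeasure (volume.restrict W) := isFiniteMeasure_restrict.2 hD.fin
  refine ⟨?_, ?_, ?_, ?_⟩
  · rw [integral_fun_fst (fun q => inner ℝ (Γ q) (flux a₀ W p' Γ' q)), h.inner_flux h', smul_zero]
  · rw [← integral_inner_addInt hD.fin (h.memLp (n + 1)) (h'.memLp_flux n)]
    exact h.inner_addInt_flux hD h' n
  · simp only [real_inner_comm (flux a₀ W p' Γ' _)]
    rw [← integral_inner_addInt hD.fin (h'.memLp_flux (n + 1)) (h.memLp n)]
    simp only [real_inner_comm (Γ _)]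
    exact h.inner_flux_addInt hD h' n
  · have := (measurePreserving_sh (W := W) (U := U) n)
    rw [← h.inner_flux h' (n + 1), ← this.map_eq]
    refine (integral_map (f := fun q => inner ℝ (Γ q) (flux a₀ W p' Γ' q)) this.aemeasurable
      ?_).symm
    rw [this.map_eq]
    exact ((h.memLp _).integrable_inner' (h'.memLp_flux _)).1

/-- Different particles on the two sides are integrated separately, giving a gradient on one side
and an orthogonal field on the other; two particles on one side are integrated one after the other.
-/
theorem USol.orth_two :
    (∫ ω, inner ℝ (Γ (sh ω.1)) (flux a₀ W p' Γ' (sh (ω.1.1, ω.2)))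
      ∂(((lm W U n).prod (volume.restrict W)).prod (volume.restrict W)) = 0) ∧
    (∫ ω, inner ℝ (Γ ω.1.1) (flux a₀ W p' Γ' (sh (sh ω.1, ω.2)))
      ∂(((lm W U n).prod (volume.restrict W)).prod (volume.restrict W)) = 0) ∧
    (∫ ω, inner ℝ (Γ (sh (sh ω.1, ω.2))) (flux a₀ W p' Γ' ω.1.1)
      ∂(((lm W U n).prod (volume.restrict W)).prod (volume.restrict W)) = 0) := by
  have : IsFiniteMeasure (volume.restrict W) := isFiniteMeasure_restrict.2 hD.fin
  refine ⟨?_, ?_, ?_⟩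
  · refine (integral_inner_mean (memLp_comp_sh (h.memLp (n + 1)))
      (memLp_comp_sh (h'.memLp_flux (n + 1)))).trans ?_
    exact h.inner_addInt_flux_addInt hD h' n
  · have h2 := memLp_comp_sh_sh (h'.memLp_flux (n + 2))
    rw [integral_inner_right_right h2 (h.memLp n)]
    exact h.inner_flux_addInt_addInt hD h' n
  · have h2 := memLp_comp_sh_sh (h.memLp (n + 2))
    simp only [real_inner_comm (flux a₀ W p' Γ' _)]
    rw [integral_inner_right_right h2 (h'.memLp_flux n), ← h.inner_addInt_addInt_flux hD h' n]
    exact integral_congr_ae (Eventually.of_forall fun q => real_inner_comm _ _)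

end orth

end domain

end Config
end

/-! ### Orthogonality with two additional particles. -/

noncomputable section

theorem MeasureTheory.MeasurePreserving.integral_comp_of_aestronglyMeasurable {α β E : Type*}
    [MeasurableSpace α] [MeasurableSpace β] [NormedAddCommGroup E] [NormedSpace ℝ E]
    {m : Measure α} {m' : Measure β} {φ : α → β} (hφ : MeasurePreserving φ m m') {g : β → E}
    (hg : AEStronglyMeasurable g m') : ∫ x, g (φ x) ∂m = ∫ y, g y ∂m' := by
  have h := hφ.map_eq
  subst h
  exact (integral_map hφ.aemeasurable hg).symm

/-- The integrand does not depend on the second variable, so confining that variable to measure at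
most `v` out of `w` gains the factor `v / w`. -/
theorem lintegral_indicator_fst_le {α β E : Type*} [MeasurableSpace α] [MeasurableSpace β]
    [NormedAddCommGroup E] {m : Measure α} {ν : Measure β} [SFinite m] [SFinite ν]
    {f : α → E} (hf : AEStronglyMeasurable f m) {S : Set (α × β)} (hS : MeasurableSet S)
    {v w : ℝ} (hv : ∀ p, ν {y | (p, y) ∈ S} ≤ ENNReal.ofReal v) (hw0 : 0 < w)
    (hw : ν Set.univ = ENNReal.ofReal w) :
    ∫⁻ ω, ‖S.indicator (fun ω => f ω.1) ω‖ₑ ^ 2 ∂(m.prod ν) ≤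
      ENNReal.ofReal (v / w) * ∫⁻ ω, ‖f ω.1‖ₑ ^ 2 ∂(m.prod ν) := by
  have h1 : ∀ ω, ‖S.indicator (fun ω => f ω.1) ω‖ₑ ^ 2 =
      S.indicator (fun ω => ‖f ω.1‖ₑ ^ 2) ω := by
    intro ω
    by_cases h : ω ∈ S <;> simp [h]
  have hm : AEMeasurable (fun ω : α × β => ‖f ω.1‖ₑ ^ 2) (m.prod ν) :=
    (hf.comp_fst).enorm.pow_const 2
  simp only [h1]
  rw [lintegral_prod _ (hm.indicator hS), lintegral_prod _ hm]
  have h2 : ∀ p, ∫⁻ y, S.indicator (fun ω => ‖f ω.1‖ₑ ^ 2) (p, y) ∂ν ≤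
      ENNReal.ofReal v * ‖f p‖ₑ ^ 2 := by
    intro p
    have h3 : ∀ y, S.indicator (fun ω => ‖f ω.1‖ₑ ^ 2) (p, y) =
        {y | (p, y) ∈ S}.indicator (fun _ => ‖f p‖ₑ ^ 2) y := fun y => rfl
    have hms : MeasurableSet {y | (p, y) ∈ S} := measurable_prodMk_left hS
    simp only [h3]
    rw [lintegral_indicator_const hms, mul_comm]
    gcongr
    exact hv p
  refine (lintegral_mono h2).trans ?_
  simp only [lintegral_const, hw]
  rw [lintegral_const_mul' _ _ ENNReal.ofReal_ne_top, lintegral_mul_const' _ _ ENNReal.ofReal_ne_top,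
    mul_comm _ (ENNReal.ofReal w), ← mul_assoc, ← ENNReal.ofReal_mul' hw0.le,
    div_mul_cancel₀ _ hw0.ne']

variable {d : ℕ}

namespace Config

section shifts

variable {a₀ : Config d → Matrix (Fin d) (Fin d) ℝ} {U W : Set (Space d)} (hD : Dom U W)
  {p p' : Space d} {Γ Γ' : Config d × Space d → Space d}

theorem sh_sh_comm (q : Config d × Space d) (x y : Space d) :
    sh (sh (q, x), y) = sh (sh (q, y), x) := by
  simp only [sh, add_right_comm]

/-- The maps which add some of the two particles. -/
def shifts (d : ℕ) : Set (((Config d × Space d) × Space d) × Space d → Config d × Space d) :=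
  {fun ω => ω.1.1, fun ω => sh ω.1, fun ω => sh (ω.1.1, ω.2), fun ω => sh (sh ω.1, ω.2)}

/-- Interchanges the two particles. -/
def swapXY (ω : ((Config d × Space d) × Space d) × Space d) :
    ((Config d × Space d) × Space d) × Space d := ((ω.1.1, ω.2), ω.1.2)

/-- The measure space with two additional particles. -/
abbrev lm₂ (W U : Set (Space d)) (n : ℕ) : Measure (((Config d × Space d) × Space d) × Space d) :=
  ((lm W U n).prod (volume.restrict W)).prod (volume.restrict W)

theorem measurePreserving_swapXY (W U : Set (Space d)) (n : ℕ) :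
    MeasurePreserving swapXY (lm₂ W U n) (lm₂ W U n) :=
  measurePreserving_prod_right_comm (lm W U n) (volume.restrict W) (volume.restrict W)

include hD in
theorem memLp_shifts {F : Type*} [NormedAddCommGroup F] [InnerProductSpace ℝ F]
    {A : Config d × Space d → F} (hA : ∀ n, MemLp A 2 (lm W U n)) (n : ℕ)
    {σ : ((Config d × Space d) × Space d) × Space d → Config d × Space d} (hσ : σ ∈ shifts d) :
    MemLp (fun ω => A (σ ω)) 2 (lm₂ W U n) := by
  have : IsFiniteMeasure (volume.restrict W) := isFiniteMeasure_restrict.2 hD.fin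
  have h1 : MemLp (fun ω : ((Config d × Space d) × Space d) × Space d => A (sh ω.1)) 2
      (lm₂ W U n) := (memLp_comp_sh (hA (n + 1))).comp_fst (volume.restrict W)
  rcases hσ with rfl | rfl | rfl | rfl
  · exact ((hA n).comp_fst (volume.restrict W)).comp_fst (volume.restrict W)
  · exact h1
  · have h2 := h1.comp_measurePreserving (measurePreserving_swapXY W U n)
    exact h2
  · exact memLp_comp_sh_sh (hA (n + 2))

include hD in
-- Sixteen pairs. Those without the second particle come from one additional particle, those with a
-- particle common to both sides from the next level, and the exchange of the two particles gives
-- their mirror images.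
theorem USol.orth_shifts (h : USol a₀ U W p Γ) (h' : USol a₀ U W p' Γ') (n : ℕ)
    {σ τ : ((Config d × Space d) × Space d) × Space d → Config d × Space d} (hσ : σ ∈ shifts d)
    (hτ : τ ∈ shifts d) :
    ∫ ω, inner ℝ (Γ (σ ω)) (flux a₀ W p' Γ' (τ ω)) ∂(lm₂ W U n) = 0 := by
  have hfin : IsFiniteMeasure (volume.restrict W) := isFiniteMeasure_restrict.2 hD.fin
  have hm : ∀ σ ∈ shifts d, ∀ τ ∈ shifts d, AEStronglyMeasurable
      (fun ω => inner ℝ (Γ (σ ω)) (flux a₀ W p' Γ' (τ ω))) (lm₂ W U n) := fun σ hσ τ hτ =>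
    ((memLp_shifts hD h.memLp n hσ).integrable_inner' (memLp_shifts hD h'.memLp_flux n hτ)).1
  obtain ⟨-, o2, o3, o4⟩ := h.orth_one hD h' n
  obtain ⟨-, r2, r3, r4⟩ := h.orth_one hD h' (n + 1)
  obtain ⟨t1, t2, t3⟩ := h.orth_two hD h' n
  have hp := measurePreserving_sh_fst (W := W) (U := U) n
  have hs := measurePreserving_swapXY W U n
  have i0 : (fun ω : ((Config d × Space d) × Space d) × Space d => ω.1.1) ∈ shifts d := .inl rfl
  have ix : (fun ω : ((Config d × Space d) × Space d) × Space d => sh ω.1) ∈ shifts d :=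
    .inr (.inl rfl)
  have iy : (fun ω : ((Config d × Space d) × Space d) × Space d => sh (ω.1.1, ω.2)) ∈ shifts d :=
    .inr (.inr (.inl rfl))
  have ixy : (fun ω : ((Config d × Space d) × Space d) × Space d => sh (sh ω.1, ω.2)) ∈ shifts d :=
    .inr (.inr (.inr rfl))
  have e00 : ∫ ω, inner ℝ (Γ ω.1.1) (flux a₀ W p' Γ' ω.1.1) ∂(lm₂ W U n) = 0 := by
    rw [integral_fun_fst (fun p : (Config d × Space d) × Space d =>
      inner ℝ (Γ p.1) (flux a₀ W p' Γ' p.1)), (h.orth_one hD h' n).1, smul_zero]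
  have ex0 : ∫ ω, inner ℝ (Γ (sh ω.1)) (flux a₀ W p' Γ' ω.1.1) ∂(lm₂ W U n) = 0 := by
    rw [integral_fun_fst (fun p : (Config d × Space d) × Space d =>
      inner ℝ (Γ (sh p)) (flux a₀ W p' Γ' p.1)), o2, smul_zero]
  have e0x : ∫ ω, inner ℝ (Γ ω.1.1) (flux a₀ W p' Γ' (sh ω.1)) ∂(lm₂ W U n) = 0 := by
    rw [integral_fun_fst (fun p : (Config d × Space d) × Space d =>
      inner ℝ (Γ p.1) (flux a₀ W p' Γ' (sh p))), o3, smul_zero]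
  have exx : ∫ ω, inner ℝ (Γ (sh ω.1)) (flux a₀ W p' Γ' (sh ω.1)) ∂(lm₂ W U n) = 0 := by
    rw [integral_fun_fst (fun p : (Config d × Space d) × Space d =>
      inner ℝ (Γ (sh p)) (flux a₀ W p' Γ' (sh p))), o4, smul_zero]
  have hm1 := (memLp_comp_sh (h.memLp (n + 2))).integrable_inner'
    ((h'.memLp_flux (n + 1)).comp_fst (volume.restrict W)) |>.1
  have hm2 := ((h.memLp (n + 1)).comp_fst (volume.restrict W)).integrable_inner'
    (memLp_comp_sh (h'.memLp_flux (n + 2))) |>.1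
  have hm3 := (memLp_comp_sh (h.memLp (n + 2))).integrable_inner'
    (memLp_comp_sh (h'.memLp_flux (n + 2))) |>.1
  have exyx := (hp.integral_comp_of_aestronglyMeasurable hm1).trans r2
  have exxy := (hp.integral_comp_of_aestronglyMeasurable hm2).trans r3
  have exyxy := (hp.integral_comp_of_aestronglyMeasurable hm3).trans r4
  rcases hσ with rfl | rfl | rfl | rfl <;> rcases hτ with rfl | rfl | rfl | rfl
  · exact e00
  · exact e0x
  · exact (hs.integral_comp_of_aestronglyMeasurable (hm _ i0 _ ix)).trans e0x
  · exact t2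
  · exact ex0
  · exact exx
  · exact t1
  · exact exxy
  · exact (hs.integral_comp_of_aestronglyMeasurable (hm _ ix _ i0)).trans ex0
  · exact (hs.integral_comp_of_aestronglyMeasurable (hm _ ix _ iy)).trans t1
  · exact (hs.integral_comp_of_aestronglyMeasurable (hm _ ix _ ix)).trans exx
  · refine Eq.trans (integral_congr_ae (Eventually.of_forall fun ω => ?_))
      ((hs.integral_comp_of_aestronglyMeasurable (hm _ ix _ ixy)).trans exxy)
    simp only [swapXY]
    rw [← sh_sh_comm]
  · exact t3
  · exact exyx
  · refine Eq.trans (integral_congr_ae (Eventually.of_forall fun ω => ?_))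
      ((hs.integral_comp_of_aestronglyMeasurable (hm _ ixy _ ix)).trans exyx)
    simp only [swapXY]
    rw [← sh_sh_comm]
  · exact exyxy

end shifts

end Config
end

/-! ### The second difference of the pairings. -/

noncomputable section

theorem Quad.swap {H : Type*} [NormedAddCommGroup H] [InnerProductSpace ℝ H] {q g₀ gx gy gxy : H}
    {a₀ ax ay axy Px Py Pxy : H →L[ℝ] H} {L s : ℝ}
    (h : Quad q g₀ gx gy gxy a₀ ax ay axy Px Py Pxy L s)
    (h' : inner ℝ (gy - g₀) (ax gx - a₀ gx) ^ 2 ≤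
      inner ℝ (gy - g₀) (gx - g₀) * inner ℝ (ay gy - a₀ gy) (ax gx - a₀ gx)) :
    Quad q g₀ gy gx gxy a₀ ay ax axy Py Px Pxy L s where
  hL := h.hL
  hs := h.hs
  coercive₀ := h.coercive₀
  coercive_x := h.coercive_y
  coercive_y := h.coercive_x
  coercive_xy := h.coercive_xy
  symm₀ := h.symm₀
  symm_x := h.symm_y
  symm_y := h.symm_x
  orth := fun g hg f hf => h.orth g (by
    simp only [Set.mem_insert_iff, Set.mem_singleton_iff] at hg ⊢; tauto) f (by
    simp only [Set.mem_insert_iff, Set.mem_singleton_iff] at hf ⊢; tauto)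
  norm_Px := h.norm_Py
  norm_Py := h.norm_Px
  norm_Pxy := h.norm_Pxy
  norm_Pxy_x := h.norm_Pxy_y
  norm_Pxy_y := h.norm_Pxy_x
  bound_x := h.bound_y
  bound_x' := h.bound_y'
  bound_y := h.bound_x
  bound_y' := h.bound_x'
  bound_xy := fun u v => by
    rw [show axy v - ay v - ax v + a₀ v = axy v - ax v - ay v + a₀ v by abel]
    exact h.bound_xy u v
  bound_mul := fun u v => by
    rw [real_inner_comm, mul_comm ‖Pxy u‖]
    exact h.bound_mul v u
  loc_x := h.loc_y
  loc_y := h.loc_x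
  loc_xy := h.loc_xy
  loc_x' := h.loc_y'
  loc_y' := h.loc_x'
  mean_nonneg := by rw [real_inner_comm]; exact h.mean_nonneg
  mean_coercive := by
    rw [real_inner_comm, ← h.symm₀, real_inner_comm _ (a₀ (gy - g₀))]
    exact h.mean_coercive
  mean_schwarz_x := h'

variable {d : ℕ}

namespace Config

section quad

variable {Λ : ℝ} {a₀ : Config d → Matrix (Fin d) (Fin d) ℝ} (ha : IsCoefficient Λ a₀)
  (hΛ : 0 ≤ Λ) {U W : Set (Space d)} (hD : Dom U W) {p : Space d}
  {Γ : Config d × Space d → Space d}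

/-- The quadratic functional of the solution with `n` particles. -/
def pairing (W U : Set (Space d)) (p : Space d) (Γ : Config d × Space d → Space d) (n : ℕ) : ℝ :=
  ∫ q, inner ℝ p (Γ q) ∂(lm W U n)

/-- The constant in the bound of the second difference. -/
def quadConst (L : ℝ) : ℝ :=
  2 * (L ^ 2 * (2 * L ^ 2 + 2 * L) + L ^ 2 * (L + 1) + L ^ 2 * (L + 1) ^ 2) +
    L * (2 * L ^ 2 + 3 * L + 1)

theorem measurableSet_nearX :
    MeasurableSet {ω : ((Config d × Space d) × Space d) × Space d |
      ω.1.2 ∈ Metric.ball ω.1.1.2 (1 / 2)} :=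
  measurableSet_lt ((measurable_snd.comp measurable_fst).dist
    (measurable_snd.comp (measurable_fst.comp measurable_fst))) measurable_const

theorem measurableSet_nearY :
    MeasurableSet {ω : ((Config d × Space d) × Space d) × Space d |
      ω.2 ∈ Metric.ball ω.1.1.2 (1 / 2)} :=
  measurableSet_lt (measurable_snd.dist
    (measurable_snd.comp (measurable_fst.comp measurable_fst))) measurable_const

theorem restrict_ball_le (W : Set (Space d)) (z : Space d) :
    volume.restrict W (Metric.ball z (1 / 2)) ≤
      ENNReal.ofReal (volume.real (Metric.ball (0 : Space d) (1 / 2))) := by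
  refine (Measure.restrict_apply_le _ _).trans ?_
  rw [Measure.addHaar_ball_center, measureReal_def,
    ENNReal.ofReal_toReal measure_ball_lt_top.ne]

theorem Dom.restrict_univ (hD : Dom U W) :
    volume.restrict W Set.univ = ENNReal.ofReal (volume.real W) := by
  rw [Measure.restrict_apply_univ, measureReal_def, ENNReal.ofReal_toReal hD.fin]

theorem Dom.lintegral_nearY_le (hD : Dom U W) {n : ℕ} {F : Type*} [NormedAddCommGroup F]
    {f : (Config d × Space d) × Space d → F}
    (hf : AEStronglyMeasurable f ((lm W U n).prod (volume.restrict W))) :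
    ∫⁻ ω, ‖{ω : ((Config d × Space d) × Space d) × Space d |
      ω.2 ∈ Metric.ball ω.1.1.2 (1 / 2)}.indicator (fun ω => f ω.1) ω‖ₑ ^ 2 ∂(lm₂ W U n) ≤
      ENNReal.ofReal (volume.real (Metric.ball (0 : Space d) (1 / 2)) / volume.real W) *
        ∫⁻ ω, ‖f ω.1‖ₑ ^ 2 ∂(lm₂ W U n) :=
  lintegral_indicator_fst_le hf measurableSet_nearY (fun p => restrict_ball_le W p.1.2) hD.pos'
    hD.restrict_univ

theorem Dom.lintegral_nearX_le (hD : Dom U W) {n : ℕ} {F : Type*} [NormedAddCommGroup F]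
    {f : (Config d × Space d) × Space d → F}
    (hf : AEStronglyMeasurable f ((lm W U n).prod (volume.restrict W))) :
    ∫⁻ ω, ‖{ω : ((Config d × Space d) × Space d) × Space d |
      ω.1.2 ∈ Metric.ball ω.1.1.2 (1 / 2)}.indicator (fun ω => f (ω.1.1, ω.2)) ω‖ₑ ^ 2
        ∂(lm₂ W U n) ≤
      ENNReal.ofReal (volume.real (Metric.ball (0 : Space d) (1 / 2)) / volume.real W) *
        ∫⁻ ω, ‖f (ω.1.1, ω.2)‖ₑ ^ 2 ∂(lm₂ W U n) := by
  have hs := measurePreserving_swapXY W U n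
  have h1 := hD.lintegral_nearY_le hf
  have h2 : AEMeasurable (fun ω : ((Config d × Space d) × Space d) × Space d => ‖f ω.1‖ₑ ^ 2)
      (lm₂ W U n) := hf.comp_fst.enorm.pow_const 2
  have h3 : AEMeasurable (fun ω => ‖{ω : ((Config d × Space d) × Space d) × Space d |
      ω.2 ∈ Metric.ball ω.1.1.2 (1 / 2)}.indicator (fun ω => f ω.1) ω‖ₑ ^ 2) (lm₂ W U n) :=
    (hf.comp_fst.indicator measurableSet_nearY).enorm.pow_const 2
  rw [← hs.map_eq] at h2 h3
  have e2 := lintegral_map' h2 hs.aemeasurable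
  have e3 := lintegral_map' h3 hs.aemeasurable
  rw [hs.map_eq] at e2 e3
  rw [e2, e3] at h1
  exact h1

include ha in
theorem redCoeff_sub_sh {q : Config d × Space d} {x : Space d}
    (hx : x ∉ Metric.ball q.2 (1 / 2)) : redCoeff a₀ W (sh (q, x)) - redCoeff a₀ W q = 0 :=
  sub_eq_zero.2 (redCoeff_add_point_of_notMem ha hx)

include ha hΛ in
theorem norm_redCoeff_sub_le (q q' : Config d × Space d) (v : Space d) :
    ‖(redCoeff a₀ W q - redCoeff a₀ W q') v‖ ≤ 2 * Λ * ‖v‖ := by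
  rw [sub_apply, two_mul, add_mul]
  exact (norm_sub_le _ _).trans (add_le_add (norm_redCoeff_le ha hΛ _ _)
    (norm_redCoeff_le ha hΛ _ _))

set_option maxHeartbeats 1000000 in
include ha hΛ hD in
-- The abstract estimate in the `L²` space of `lm₂`. The constant field `p` has squared norm `‖p‖²
-- |U| |W|^(n+2)`, and `s ^ 4` removes two powers of `|W|`.
theorem USol.quad (h : USol a₀ U W p Γ) (n : ℕ) :
    |pairing W U p Γ (n + 2) - 2 * volume.real W * pairing W U p Γ (n + 1) +
      volume.real W ^ 2 * pairing W U p Γ n| ≤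
      quadConst (4 * Λ) * (volume.real (Metric.ball (0 : Space d) (1 / 2)) ^ 2 * ‖p‖ ^ 2 *
        volume.real U * volume.real W ^ n) := by
  have : IsFiniteMeasure (volume.restrict W) := isFiniteMeasure_restrict.2 hD.fin
  have : IsFiniteMeasure (lm W U n) := isFiniteMeasure_lm hD.fin hD.fin' n
  let Ω := ((Config d × Space d) × Space d) × Space d
  have i0 : (fun ω : Ω => ω.1.1) ∈ shifts d := .inl rfl
  have ix : (fun ω : Ω => sh ω.1) ∈ shifts d := .inr (.inl rfl)
  have iy : (fun ω : Ω => sh (ω.1.1, ω.2)) ∈ shifts d := .inr (.inr (.inl rfl))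
  have ixy : (fun ω : Ω => sh (sh ω.1, ω.2)) ∈ shifts d := .inr (.inr (.inr rfl))
  have m0 : Measurable (fun ω : Ω => ω.1.1) := measurable_fst.comp measurable_fst
  have mx : Measurable (fun ω : Ω => sh ω.1) := measurable_sh.comp measurable_fst
  have my : Measurable (fun ω : Ω => sh (ω.1.1, ω.2)) :=
    measurable_sh.comp (m0.prodMk measurable_snd)
  have mxy : Measurable (fun ω : Ω => sh (sh ω.1, ω.2)) :=
    measurable_sh.comp (mx.prodMk measurable_snd)
  have g0 := memLp_shifts hD h.memLp n i0
  have gx := memLp_shifts hD h.memLp n ix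
  have gy := memLp_shifts hD h.memLp n iy
  have gxy := memLp_shifts hD h.memLp n ixy
  have hb := isBddField_redCoeff ha hD.meas hΛ
  have b0 := hb.comp m0
  have bx := hb.comp mx
  have by' := hb.comp my
  have bxy := hb.comp mxy
  have hq : MemLp (fun _ : Ω => p) 2 (lm₂ W U n) := memLp_const p
  set v := volume.real (Metric.ball (0 : Space d) (1 / 2))
  set w := volume.real W
  have hw : 0 < w := hD.pos'
  have hv : 0 ≤ v := measureReal_nonneg
  -- `s ^ 2` is the fraction of `W` occupied by a ball of radius `1/2`.
  let s := Real.sqrt (v / w)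
  have hs : s ^ 2 = v / w := Real.sq_sqrt (by positivity)
  let D : (Config d × Space d) × Space d → Space d := fun p => Γ (sh p) - Γ p.1
  have hDm : MemLp D 2 ((lm W U n).prod (volume.restrict W)) :=
    (memLp_comp_sh (h.memLp (n + 1))).sub ((h.memLp n).comp_fst _)
  let J : (Config d × Space d) × Space d → Space d := fun p =>
    (redCoeff a₀ W (sh p) - redCoeff a₀ W p.1) (Γ (sh p))
  have hJm : MemLp J 2 ((lm W U n).prod (volume.restrict W)) :=
    ((hb.comp measurable_sh).sub (hb.comp measurable_fst)).memLp
      (memLp_comp_sh (h.memLp (n + 1)))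
  have eDx : gx.toLp - g0.toLp = (hDm.comp_fst (volume.restrict W)).toLp := by
    rw [← MemLp.toLp_sub]; rfl
  have eDy : gy.toLp - g0.toLp = hDm.comp_right_comm.toLp := by
    rw [← MemLp.toLp_sub]; rfl
  have eJx : mulOp _ bx gx.toLp - mulOp _ b0 gx.toLp =
      (hJm.comp_fst (volume.restrict W)).toLp := by
    rw [mulOp_sub, mulOp_toLp]
  have eJy : mulOp _ by' gy.toLp - mulOp _ b0 gy.toLp = hJm.comp_right_comm.toLp := by
    rw [mulOp_sub, mulOp_toLp]
  have hflux : ∀ {σ : Ω → Config d × Space d} (hσ : σ ∈ shifts d) (hg : MemLp (fun ω => Γ (σ ω)) 2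
      (lm₂ W U n)) (hbσ : IsBddField fun ω => redCoeff a₀ W (σ ω)),
      mulOp _ hbσ hg.toLp - hq.toLp = (memLp_shifts hD h.memLp_flux n hσ).toLp := by
    intro σ hσ hg hbσ
    rw [mulOp_toLp, ← MemLp.toLp_sub]; rfl
  -- A single difference of coefficients is bounded by `2 * Λ`; the larger constant is the one that
  -- the mixed difference needs.
  have hN : ∀ q q' : Config d × Space d, ∀ u : Space d,
      ‖(redCoeff a₀ W q - redCoeff a₀ W q') u‖ ≤ 4 * Λ * ‖u‖ := fun q q' u =>
    (norm_redCoeff_sub_le ha hΛ q q' u).trans (by gcongr; norm_num)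
  have zx : ∀ ω : Ω, ω ∉ {ω : Ω | ω.1.2 ∈ Metric.ball ω.1.1.2 (1 / 2)} →
      redCoeff a₀ W (sh ω.1) - redCoeff a₀ W ω.1.1 = 0 := fun ω hω => redCoeff_sub_sh ha hω
  have zy : ∀ ω : Ω, ω ∉ {ω : Ω | ω.2 ∈ Metric.ball ω.1.1.2 (1 / 2)} →
      redCoeff a₀ W (sh (ω.1.1, ω.2)) - redCoeff a₀ W ω.1.1 = 0 := fun ω hω =>
    redCoeff_sub_sh ha hω
  have zy' : ∀ ω : Ω, ω ∉ {ω : Ω | ω.2 ∈ Metric.ball ω.1.1.2 (1 / 2)} →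
      redCoeff a₀ W (sh (sh ω.1, ω.2)) - redCoeff a₀ W (sh ω.1) = 0 := fun ω hω =>
    redCoeff_sub_sh ha hω
  have zx' : ∀ ω : Ω, ω ∉ {ω : Ω | ω.1.2 ∈ Metric.ball ω.1.1.2 (1 / 2)} →
      redCoeff a₀ W (sh (sh ω.1, ω.2)) - redCoeff a₀ W (sh (ω.1.1, ω.2)) = 0 := fun ω hω => by
    rw [show ω.1 = (ω.1.1, ω.1.2) from rfl, sh_sh_comm]
    exact redCoeff_sub_sh ha hω
  have key : Quad hq.toLp g0.toLp gx.toLp gy.toLp gxy.toLp (mulOp _ b0) (mulOp _ bx) (mulOp _ by')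
      (mulOp _ bxy) (cut _ measurableSet_nearX) (cut _ measurableSet_nearY)
      (cut _ (measurableSet_nearX.inter measurableSet_nearY)) (4 * Λ) s := by
    refine
    { hL := by positivity
      hs := Real.sqrt_nonneg _
      coercive₀ := le_inner_mulOp _ fun ω => redCoeff_lower ha _
      coercive_x := le_inner_mulOp _ fun ω => redCoeff_lower ha _
      coercive_y := le_inner_mulOp _ fun ω => redCoeff_lower ha _
      coercive_xy := le_inner_mulOp _ fun ω => redCoeff_lower ha _
      symm₀ := inner_mulOp_symm _ fun ω => redCoeff_symm ha _
      symm_x := inner_mulOp_symm _ fun ω => redCoeff_symm ha _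
      symm_y := inner_mulOp_symm _ fun ω => redCoeff_symm ha _
      orth := ?_
      norm_Px := norm_cut_le _
      norm_Py := norm_cut_le _
      norm_Pxy := norm_cut_le _
      norm_Pxy_x := norm_cut_le_norm_cut _ _ Set.inter_subset_left
      norm_Pxy_y := norm_cut_le_norm_cut _ _ Set.inter_subset_right
      bound_x := ?_
      bound_x' := ?_
      bound_y := ?_
      bound_y' := ?_
      bound_xy := ?_
      bound_mul := ?_
      loc_x := ?_
      loc_y := ?_
      loc_xy := ?_
      loc_x' := ?_
      loc_y' := ?_
      mean_nonneg := ?_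
      mean_coercive := ?_
      mean_schwarz_x := ?_ }
    · have h1 : ∀ g ∈ ({g0.toLp, gx.toLp, gy.toLp, gxy.toLp} : Set (Lp (Space d) 2 (lm₂ W U n))),
          ∃ σ, ∃ hσ : σ ∈ shifts d, g = (memLp_shifts hD h.memLp n hσ).toLp := by
        rintro g (rfl | rfl | rfl | rfl)
        exacts [⟨_, i0, rfl⟩, ⟨_, ix, rfl⟩, ⟨_, iy, rfl⟩, ⟨_, ixy, rfl⟩]
      have h2 : ∀ f ∈ ({mulOp _ b0 g0.toLp - hq.toLp, mulOp _ bx gx.toLp - hq.toLp,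
          mulOp _ by' gy.toLp - hq.toLp, mulOp _ bxy gxy.toLp - hq.toLp} :
            Set (Lp (Space d) 2 (lm₂ W U n))),
          ∃ σ, ∃ hσ : σ ∈ shifts d, f = (memLp_shifts hD h.memLp_flux n hσ).toLp := by
        rintro g (rfl | rfl | rfl | rfl)
        exacts [⟨_, i0, hflux i0 g0 b0⟩, ⟨_, ix, hflux ix gx bx⟩, ⟨_, iy, hflux iy gy by'⟩,
          ⟨_, ixy, hflux ixy gxy bxy⟩]
      intro g hg f hf
      obtain ⟨σ, hσ, rfl⟩ := h1 g hg
      obtain ⟨τ, hτ, rfl⟩ := h2 f hf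
      rw [inner_toLp]
      exact h.orth_shifts hD h n hσ hτ
    · intro u u'
      rw [mulOp_sub]
      exact abs_inner_mulOp_le _ _ zx (fun ω => hN _ _) u u'
    · intro u u'
      rw [mulOp_sub]
      exact abs_inner_mulOp_le _ _ zx' (fun ω => hN _ _) u u'
    · intro u u'
      rw [mulOp_sub]
      exact abs_inner_mulOp_le _ _ zy (fun ω => hN _ _) u u'
    · intro u u'
      rw [mulOp_sub]
      exact abs_inner_mulOp_le _ _ zy' (fun ω => hN _ _) u u'
    · intro u u'
      rw [sub_add, mulOp_sub, mulOp_sub, mulOp_sub]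
      refine abs_inner_mulOp_le _ _ (fun ω hω => ?_) (fun ω x => ?_) u u'
      · by_cases hy : ω ∈ {ω : Ω | ω.2 ∈ Metric.ball ω.1.1.2 (1 / 2)}
        · have hx : ω ∉ {ω : Ω | ω.1.2 ∈ Metric.ball ω.1.1.2 (1 / 2)} := fun hx => hω ⟨hx, hy⟩
          have e1 := zx' ω hx
          have e2 := zx ω hx
          rw [sub_eq_zero] at e1 e2
          rw [e1, e2, sub_self]
        · rw [zy ω hy, zy' ω hy, sub_self]
      · rw [sub_apply]
        refine (norm_sub_le _ _).trans ?_
        have e1 := norm_redCoeff_sub_le (W := W) ha hΛ (sh (sh ω.1, ω.2)) (sh ω.1) x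
        have e2 := norm_redCoeff_sub_le (W := W) ha hΛ (sh (ω.1.1, ω.2)) ω.1.1 x
        linarith
    · intro u u'
      rw [mulOp_sub, mulOp_sub]
      exact abs_inner_mulOp_mulOp_le _ _ measurableSet_nearX measurableSet_nearY _ zx zy
        (by positivity) (fun ω => hN _ _) (fun ω => hN _ _) u u'
    · rw [cut_toLp]
      refine norm_toLp_le_of_lintegral_le _ _ (Real.sqrt_nonneg _) ?_
      rw [hs]
      exact hD.lintegral_nearX_le (f := fun p => Γ p.1) ((h.memLp n).comp_fst _).1
    · rw [cut_toLp]
      refine norm_toLp_le_of_lintegral_le _ _ (Real.sqrt_nonneg _) ?_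
      rw [hs]
      exact hD.lintegral_nearY_le (f := fun p => Γ p.1) ((h.memLp n).comp_fst _).1
    · rw [cut_toLp]
      refine norm_toLp_le_of_lintegral_le _ _ (by positivity) ?_
      have hB : MeasurableSet {p : (Config d × Space d) × Space d |
          p.2 ∈ Metric.ball p.1.2 (1 / 2)} :=
        measurableSet_lt (measurable_snd.dist (measurable_snd.comp measurable_fst))
          measurable_const
      -- The cut-off in `y` acts on a field already cut off in `x`, so each of them gains a factor
      -- `v / w`.
      have e1 := hD.lintegral_nearY_le (f := {p : (Config d × Space d) × Space d |
          p.2 ∈ Metric.ball p.1.2 (1 / 2)}.indicator fun p => Γ p.1)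
        (((h.memLp n).comp_fst (volume.restrict W)).1.indicator hB)
      have e2 := hD.lintegral_nearX_le (f := fun p => Γ p.1) ((h.memLp n).comp_fst _).1
      rw [hs, pow_two (v / w), ENNReal.ofReal_mul (by positivity), mul_assoc]
      refine le_trans (le_of_eq ?_) (e1.trans (mul_le_mul_right (le_trans (le_of_eq ?_) e2) _))
      · refine lintegral_congr fun ω => ?_
        congr 2
        rw [Set.inter_comm, ← Set.indicator_indicator]
        rfl
      · rfl
    · rw [eDy, cut_toLp]
      refine norm_toLp_le_of_lintegral_le _ _ (Real.sqrt_nonneg _) ?_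
      rw [hs]
      exact hD.lintegral_nearX_le hDm.1
    · rw [eDx, cut_toLp]
      refine norm_toLp_le_of_lintegral_le _ _ (Real.sqrt_nonneg _) ?_
      rw [hs]
      exact hD.lintegral_nearY_le hDm.1
    -- After averaging, both arguments are the same field, so the pairing is the square of a norm.
    · rw [eDx, eDy, inner_toLp, integral_inner_mean hDm hDm]
      exact integral_nonneg fun q => real_inner_self_nonneg
    -- The unperturbed coefficient involves neither additional particle, hence it commutes with the
    -- average.
    · rw [eDx, eDy, mulOp_toLp, inner_toLp, inner_toLp, integral_inner_mean hDm hDm]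
      have hA : MemLp (fun p : (Config d × Space d) × Space d => redCoeff a₀ W p.1 (D p)) 2
          ((lm W U n).prod (volume.restrict W)) := (hb.comp measurable_fst).memLp hDm
      refine le_trans ?_ (le_of_eq (integral_inner_mean hDm hA).symm)
      refine integral_mono_ae (hDm.integral_right.integrable_inner' hDm.integral_right)
        (hDm.integral_right.integrable_inner' hA.integral_right) ?_
      filter_upwards [hDm.ae_slice] with q hq
      rw [(redCoeff a₀ W q).integral_comp_comm (hq.integrable (by norm_num)),
        real_inner_self_eq_norm_sq]
      exact redCoeff_lower ha _ _
    · rw [eDx, eDy, eJx, eJy, inner_toLp, inner_toLp, inner_toLp, integral_inner_mean hDm hDm,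
        integral_inner_mean hDm hJm, integral_inner_mean hJm hJm]
      exact sq_integral_inner_le hDm.integral_right hJm.integral_right
  have key' := key.swap (by
    rw [eDx, eDy, eJx, eJy, inner_toLp, inner_toLp, inner_toLp, integral_inner_mean' hDm hDm,
      integral_inner_mean' hDm hJm, integral_inner_mean' hJm hJm]
    exact sq_integral_inner_le hDm.integral_right hJm.integral_right)
  have hI : ∀ k, Integrable (fun q => inner ℝ p (Γ q)) (lm W U k) := fun k => by
    have : IsFiniteMeasure (lm W U k) := isFiniteMeasure_lm hD.fin hD.fin' k
    exact (memLp_const p).integrable_inner' (h.memLp k)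
  have hsh := measurePreserving_sh (W := W) (U := U) n
  have hsw := measurePreserving_swapXY W U n
  have hp := measurePreserving_sh_fst (W := W) (U := U) n
  -- Each additional particle on which the integrand does not depend contributes a factor `w`.
  have p0 : inner ℝ hq.toLp g0.toLp = w ^ 2 * pairing W U p Γ n := by
    rw [inner_toLp]
    refine (integral_fun_fst (fun p' : (Config d × Space d) × Space d =>
      inner ℝ p (Γ p'.1))).trans ?_
    rw [integral_fun_fst (fun q => inner ℝ p (Γ q)), measureReal_restrict_apply_univ, smul_eq_mul,
      smul_eq_mul, pow_two, mul_assoc]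
    rfl
  have px : inner ℝ hq.toLp gx.toLp = w * pairing W U p Γ (n + 1) := by
    rw [inner_toLp]
    refine (integral_fun_fst (fun p' : (Config d × Space d) × Space d =>
      inner ℝ p (Γ (sh p')))).trans ?_
    rw [measureReal_restrict_apply_univ, smul_eq_mul,
      hsh.integral_comp_of_aestronglyMeasurable (hI (n + 1)).1]
    rfl
  have py : inner ℝ hq.toLp gy.toLp = w * pairing W U p Γ (n + 1) := by
    rw [← px, inner_toLp, inner_toLp]
    exact hsw.integral_comp_of_aestronglyMeasurable
      (g := fun ω : Ω => inner ℝ p (Γ (sh ω.1))) (hq.integrable_inner' gx).1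
  have pxy : inner ℝ hq.toLp gxy.toLp = pairing W U p Γ (n + 2) := by
    have hsh' := measurePreserving_sh (W := W) (U := U) (n + 1)
    rw [inner_toLp]
    refine (hp.integral_comp_of_aestronglyMeasurable
      (g := fun p' : (Config d × Space d) × Space d => inner ℝ p (Γ (sh p')))
      (hsh'.integrable_comp_of_integrable (hI (n + 2))).1).trans ?_
    exact hsh'.integral_comp_of_aestronglyMeasurable (hI (n + 2)).1
  have pq : ‖hq.toLp‖ ^ 2 = ‖p‖ ^ 2 * (volume.real U * w ^ (n + 2)) := by
    rw [← real_inner_self_eq_norm_sq, inner_toLp, real_inner_self_eq_norm_sq]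
    rw [integral_const, smul_eq_mul, mul_comm, measureReal_def, ← Set.univ_prod_univ,
      Measure.prod_prod, ← Set.univ_prod_univ, Measure.prod_prod, ← Set.univ_prod_univ,
      Measure.prod_prod, level_univ, Measure.restrict_apply_univ, Measure.restrict_apply_univ]
    simp only [ENNReal.toReal_mul, ENNReal.toReal_pow, ← measureReal_def]
    ring
  have fin := key.abs_second_difference key'
  have e1 : pairing W U p Γ (n + 2) - 2 * w * pairing W U p Γ (n + 1) + w ^ 2 * pairing W U p Γ n =
      inner ℝ hq.toLp (gxy.toLp - gx.toLp - gy.toLp + g0.toLp) := by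
    rw [inner_add_right, inner_sub_right, inner_sub_right, p0, px, py, pxy]
    ring
  rw [e1]
  refine fin.trans (le_of_eq ?_)
  rw [pq, show s ^ 4 = (s ^ 2) ^ 2 by ring, hs, quadConst]
  field_simp
  ring

include ha hΛ hD in
-- By cross orthogonality, `p · Γ` with the additional particle integrates like `a Γ` without it
-- against `Γ` with it, and `p · Γ` without it like `Γ` against the perturbed flux. Their difference
-- only sees the change of the coefficient.
theorem USol.pairing_succ_sub (h : USol a₀ U W p Γ) (n : ℕ) :
    pairing W U p Γ (n + 1) - volume.real W * pairing W U p Γ n =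
      ∫ ω, inner ℝ (Γ ω.1) ((redCoeff a₀ W ω.1 - redCoeff a₀ W (sh ω)) (Γ (sh ω)))
        ∂((lm W U n).prod (volume.restrict W)) := by
  have : IsFiniteMeasure (volume.restrict W) := isFiniteMeasure_restrict.2 hD.fin
  have : IsFiniteMeasure (lm W U n) := isFiniteMeasure_lm hD.fin hD.fin' n
  obtain ⟨-, o2, o3, -⟩ := h.orth_one hD h n
  have hb := isBddField_redCoeff ha hD.meas hΛ
  have g0 : MemLp (fun ω : (Config d × Space d) × Space d => Γ ω.1) 2
    ((lm W U n).prod (volume.restrict W)) := (h.memLp n).comp_fst _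
  have gx := memLp_comp_sh (h.memLp (n + 1))
  have hp : MemLp (fun _ : (Config d × Space d) × Space d => p) 2
    ((lm W U n).prod (volume.restrict W)) := memLp_const p
  have f0 : MemLp (fun ω : (Config d × Space d) × Space d => redCoeff a₀ W ω.1 (Γ ω.1)) 2
    ((lm W U n).prod (volume.restrict W)) := (hb.comp measurable_fst).memLp g0
  have fx : MemLp (fun ω : (Config d × Space d) × Space d => redCoeff a₀ W (sh ω) (Γ (sh ω))) 2
    ((lm W U n).prod (volume.restrict W)) := (hb.comp measurable_sh).memLp gx
  have e1 : ∫ ω, inner ℝ (redCoeff a₀ W ω.1 (Γ ω.1)) (Γ (sh ω))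
      ∂((lm W U n).prod (volume.restrict W)) = pairing W U p Γ (n + 1) := by
    simp only [flux, inner_sub_right] at o2
    rw [integral_sub (gx.integrable_inner' f0) (gx.integrable_inner' hp), sub_eq_zero] at o2
    simp only [real_inner_comm (Γ (sh _))]
    rw [o2]
    simp only [real_inner_comm p]
    refine (measurePreserving_sh n).integral_comp_of_aestronglyMeasurable
      (g := fun q => inner ℝ p (Γ q)) ?_
    have : IsFiniteMeasure (lm W U (n + 1)) := isFiniteMeasure_lm hD.fin hD.fin' (n + 1)
    exact ((memLp_const p).integrable_inner' (h.memLp (n + 1))).1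
  have e2 : ∫ ω, inner ℝ (Γ ω.1) (redCoeff a₀ W (sh ω) (Γ (sh ω)))
      ∂((lm W U n).prod (volume.restrict W)) = volume.real W * pairing W U p Γ n := by
    simp only [flux, inner_sub_right] at o3
    rw [integral_sub (g0.integrable_inner' fx) (g0.integrable_inner' hp), sub_eq_zero] at o3
    rw [o3]
    simp only [real_inner_comm p]
    rw [integral_fun_fst (fun q => inner ℝ p (Γ q)), measureReal_restrict_apply_univ, smul_eq_mul]
    rfl
  rw [← e1, ← e2, ← integral_sub (f0.integrable_inner' gx) (g0.integrable_inner' fx)]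
  refine integral_congr_ae (Eventually.of_forall fun ω => ?_)
  simp only [sub_apply, inner_sub_right, redCoeff_symm ha]

end quad

end Config
end

/-! ### Symmetry of the pairings and two-sided bounds. -/

noncomputable section

variable {d : ℕ}

namespace Config

/-- The function `∑_{x ∈ μ ∩ U} p · x`. -/
def linFun (U : Set (Space d)) (hU : MeasurableSet U) (p : Space d) (μ : Config d) : ℝ :=
  ∫ x, inner ℝ p x ∂(kernel U hU μ)

section bounds

variable {Λ : ℝ} {a₀ : Config d → Matrix (Fin d) (Fin d) ℝ} (ha : IsCoefficient Λ a₀)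
  (hΛ : 0 ≤ Λ) {U W : Set (Space d)} (hD : Dom U W) {p p' : Space d}
  {Γ Γ' : Config d × Space d → Space d}

theorem smoothOn_linFun (hU : MeasurableSet U) (p : Space d) : SmoothOn U (linFun U hU p) := by
  intro μ n
  have h1 : ∀ x ∈ (Set.univ.pi fun _ : Fin n => U), linFun U hU p ((points x).add (μ.res Uᶜ)) =
      ∑ i, inner ℝ p (x i) := by
    intro x hx
    have hη : (μ.res Uᶜ).1 U = 0 := by
      rw [res_apply _ hU]; simp
    rw [linFun, kernel_add_of_eq_zero hU hη, kernel_points hU fun i => hx i (Set.mem_univ i),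
      integral_sum_dirac]
  refine ContDiffOn.congr ?_ h1
  refine ContDiff.contDiffOn (ContDiff.sum fun i _ => ?_)
  exact contDiff_const.inner ℝ (contDiff_apply ℝ (Space d) i)

theorem rgrad_linFun (hU : IsOpen U) (p : Space d) {μ : Config d} (hμ : μ.1 U ≠ ⊤) {z : Space d}
    (hz : z ∈ U) : rgrad (linFun U hU.measurableSet p) μ z = p := by
  refine rgrad_eq_of_hasFDerivAt ?_
  have h1 : (fun z => linFun U hU.measurableSet p (μ.add (point z))) =ᶠ[𝓝 z]
      fun z => linFun U hU.measurableSet p μ + innerSL ℝ p z := by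
    filter_upwards [hU.mem_nhds hz] with y hy
    rw [linFun, kernel_add_point _ hμ hy, integral_add_measure (integrable_kernel _ hμ _)
      (integrable_dirac (by simp)), integral_dirac]
    rfl
  exact (((innerSL ℝ p).hasFDerivAt).const_add _).congr_of_eventuallyEq h1

theorem Dom.levelTest_linFun (hD : Dom U W) (p : Space d) (n : ℕ) :
    LevelTest W U n (linFun U hD.measU p) := by
  have : IsFiniteMeasure (level W (n + 1)) := isFiniteMeasure_level hD.fin _
  have : IsFiniteMeasure (lm W U n) := isFiniteMeasure_lm hD.fin hD.fin' n
  obtain ⟨R, hR⟩ := hD.bdd.exists_norm_le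
  refine ⟨smoothOn_linFun _ p, ?_, ?_⟩
  · have hm : StronglyMeasurable (linFun U hD.measU p) :=
      StronglyMeasurable.integral_kernel_prod_right' (κ := kernel U hD.measU)
        (f := fun q : Config d × Space d => inner ℝ p q.2)
        (measurable_const.inner measurable_snd).stronglyMeasurable
    -- At most `n + 1` particles lie in `U`, each contributing at most `‖p‖ * R`.
    refine MemLp.of_bound hm.aestronglyMeasurable (‖p‖ * R * (n + 1)) ?_
    filter_upwards [ae_level hD.meas (n + 1)] with μ hμ
    have hU : μ.1 U ≤ ((n + 1 : ℕ) : ℝ≥0∞) := (measure_mono hD.sub).trans hμ.1.le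
    have hU' : μ.1 U ≠ ⊤ := (hU.trans_lt (ENNReal.natCast_lt_top _)).ne
    rw [linFun, kernel_apply _ hU']
    have : IsFiniteMeasure (μ.1.restrict U) := isFiniteMeasure_restrict.2 hU'
    refine (norm_integral_le_of_norm_le_const (C := ‖p‖ * R) ?_).trans ?_
    · filter_upwards [ae_restrict_mem hD.measU] with x hx
      exact (norm_inner_le_norm _ _).trans (mul_le_mul_of_nonneg_left (hR x hx) (norm_nonneg _))
    · rcases U.eq_empty_or_nonempty with rfl | ⟨x, hx⟩
      · exact absurd measure_empty hD.pos
      · have hR0 : 0 ≤ R := (norm_nonneg x).trans (hR x hx)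
        gcongr
        rw [measureReal_restrict_apply_univ, measureReal_def]
        refine (ENNReal.toReal_mono (ENNReal.natCast_ne_top _) hU).trans (le_of_eq ?_)
        rw [ENNReal.toReal_natCast, Nat.cast_add, Nat.cast_one]
  · refine (memLp_congr_ae ?_).2 (memLp_const p)
    filter_upwards [ae_lm hD.meas hD.measU n] with q hq
    refine rgrad_linFun hD.isOpen p ?_ hq.2.2
    refine ((measure_mono hD.sub).trans_lt ?_).ne
    rw [hq.1]
    exact ENNReal.natCast_lt_top _

/-- Constant fields are gradients of linear functions; this is what makes the lower bound on the
pairing possible. -/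
theorem Dom.grad_const (hD : Dom U W) (p : Space d) (n : ℕ) :
    Grad (level W (n + 1)) (level W n) U fun _ => p := by
  refine (hD.levelTest_linFun p n).grad.congr ?_
  filter_upwards [ae_lm hD.meas hD.measU n] with q hq
  refine rgrad_linFun hD.isOpen p ?_ hq.2.2
  refine ((measure_mono hD.sub).trans_lt ?_).ne
  rw [hq.1]
  exact ENNReal.natCast_lt_top _

theorem Dom.lm_real (hD : Dom U W) (n : ℕ) :
    (lm W U n).real Set.univ = volume.real U * volume.real W ^ n := by
  rw [measureReal_def, ← Set.univ_prod_univ, Measure.prod_prod, level_univ,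
    Measure.restrict_apply_univ, ENNReal.toReal_mul, ENNReal.toReal_pow, mul_comm]
  rfl

include ha hΛ hD

/-- The equation tested with another solution. The right-hand side is a symmetric form, which yields
both the symmetry and the positivity of the pairing. -/
theorem USol.pairing_eq (h : USol a₀ U W p Γ) (h' : USol a₀ U W p' Γ') (n : ℕ) :
    pairing W U p Γ' n = ∫ q, inner ℝ (redCoeff a₀ W q (Γ q)) (Γ' q) ∂(lm W U n) := by
  have : IsFiniteMeasure (lm W U n) := isFiniteMeasure_lm hD.fin hD.fin' n
  have h1 := h'.inner_flux h n
  have h2 := (isBddField_redCoeff (W := W) ha hD.meas hΛ).memLp (h.memLp n)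
  simp only [flux, inner_sub_right] at h1
  rw [integral_sub ((h'.memLp n).integrable_inner' h2)
    ((h'.memLp n).integrable_inner' (memLp_const p)), sub_eq_zero] at h1
  simp only [pairing, real_inner_comm (Γ' _)]
  exact h1.symm

theorem USol.pairing_comm (h : USol a₀ U W p Γ) (h' : USol a₀ U W p' Γ') (n : ℕ) :
    pairing W U p Γ' n = pairing W U p' Γ n := by
  rw [h.pairing_eq ha hΛ hD h' n, h'.pairing_eq ha hΛ hD h n]
  refine integral_congr_ae (Eventually.of_forall fun q => ?_)
  change inner ℝ (redCoeff a₀ W q (Γ q)) (Γ' q) = inner ℝ (redCoeff a₀ W q (Γ' q)) (Γ q)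
  rw [redCoeff_symm ha, real_inner_comm]

theorem USol.integral_norm_sq_le (h : USol a₀ U W p Γ) (n : ℕ) :
    ∫ q, inner ℝ (Γ q) (Γ q) ∂(lm W U n) ≤ pairing W U p Γ n := by
  rw [h.pairing_eq ha hΛ hD h n]
  refine integral_mono ((h.memLp n).integrable_inner' (h.memLp n))
    (((isBddField_redCoeff ha hD.meas hΛ).memLp (h.memLp n)).integrable_inner' (h.memLp n))
    fun q => ?_
  simp only [real_inner_self_eq_norm_sq, real_inner_comm (Γ q)]
  exact redCoeff_lower ha _ _

theorem USol.pairing_nonneg (h : USol a₀ U W p Γ) (n : ℕ) : 0 ≤ pairing W U p Γ n :=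
  (integral_nonneg fun _ => real_inner_self_nonneg).trans (h.integral_norm_sq_le ha hΛ hD n)

theorem USol.pairing_le (h : USol a₀ U W p Γ) (n : ℕ) :
    pairing W U p Γ n ≤ ‖p‖ ^ 2 * (volume.real U * volume.real W ^ n) := by
  have : IsFiniteMeasure (lm W U n) := isFiniteMeasure_lm hD.fin hD.fin' n
  have h1 := sq_integral_inner_le (memLp_const (μ := lm W U n) (p := 2) p) (h.memLp n)
  have h2 := h.integral_norm_sq_le ha hΛ hD n
  have h3 := h.pairing_nonneg ha hΛ hD n
  rw [integral_const, hD.lm_real, real_inner_self_eq_norm_sq, smul_eq_mul] at h1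
  refine le_of_sq_le_mul h3 (by positivity) (h1.trans ?_)
  rw [mul_comm, mul_comm (‖p‖ ^ 2)]
  gcongr

/-- As `p` is a gradient, the integral of `p · a Γ` is `‖p‖²` times the mass. The bound follows by
expanding `0 ≤ (p - Λ Γ) · a (p - Λ Γ)` and using `p · a p ≤ Λ ‖p‖²`. -/
theorem USol.le_pairing (hpos : 0 < Λ) (h : USol a₀ U W p Γ) (n : ℕ) :
    ‖p‖ ^ 2 * (volume.real U * volume.real W ^ n) ≤ Λ * pairing W U p Γ n := by
  have : IsFiniteMeasure (lm W U n) := isFiniteMeasure_lm hD.fin hD.fin' n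
  have hb := isBddField_redCoeff (W := W) ha hD.meas hΛ
  have hp : MemLp (fun _ : Config d × Space d => p) 2 (lm W U n) := memLp_const p
  have hΓ := h.memLp n
  have aΓ := hb.memLp hΓ
  have ap := hb.memLp hp
  have e1 : ∫ q, inner ℝ p (redCoeff a₀ W q (Γ q)) ∂(lm W U n) =
      ‖p‖ ^ 2 * (volume.real U * volume.real W ^ n) := by
    have h1 := (hD.grad_const p n).2 _ (h.sol n).perp
    simp only [inner_sub_right] at h1
    rw [integral_sub (hp.integrable_inner' aΓ) (hp.integrable_inner' hp), sub_eq_zero] at h1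
    rw [h1, integral_const, hD.lm_real, real_inner_self_eq_norm_sq, smul_eq_mul, mul_comm]
  have e2 : ∫ q, inner ℝ p (redCoeff a₀ W q p) ∂(lm W U n) ≤
      Λ * (‖p‖ ^ 2 * (volume.real U * volume.real W ^ n)) := by
    refine (integral_mono (hp.integrable_inner' ap) (integrable_const (Λ * ‖p‖ ^ 2))
      fun q => redCoeff_inner_le ha q p).trans (le_of_eq ?_)
    rw [integral_const, hD.lm_real, smul_eq_mul]
    ring
  have e3 : 0 ≤ ∫ q, (inner ℝ p (redCoeff a₀ W q p) - 2 * Λ * inner ℝ p (redCoeff a₀ W q (Γ q)) +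
      Λ ^ 2 * inner ℝ (redCoeff a₀ W q (Γ q)) (Γ q)) ∂(lm W U n) := by
    refine integral_nonneg fun q => ?_
    have h1 := (sq_nonneg _).trans (redCoeff_lower (W := W) ha q (p - Λ • Γ q))
    have h2 : inner ℝ (Γ q) (redCoeff a₀ W q p) = inner ℝ p (redCoeff a₀ W q (Γ q)) := by
      rw [← redCoeff_symm ha, real_inner_comm]
    simp only [map_sub, map_smul, inner_sub_left, inner_sub_right, inner_smul_left,
      inner_smul_right, conj_trivial, h2] at h1
    simp only [Pi.zero_apply, real_inner_comm (Γ q)]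
    linarith
  rw [integral_add, integral_sub, integral_const_mul, integral_const_mul, e1,
    ← h.pairing_eq ha hΛ hD h n] at e3
  · refine le_of_mul_le_mul_left ?_ hpos
    linarith
  · exact hp.integrable_inner' ap
  · exact (hp.integrable_inner' aΓ).const_mul _
  · exact (hp.integrable_inner' ap).sub ((hp.integrable_inner' aΓ).const_mul _)
  · exact (aΓ.integrable_inner' hΓ).const_mul _

end bounds

end Config
end

/-! ### From the levels to the Poisson law. -/

noncomputable section

theorem MeasureTheory.Measure.restrict_sum_smul {α : Type*} [MeasurableSpace α] {m : ℕ → Measure α}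
    {c : ℕ → ℝ≥0∞} {N : α → ℝ≥0∞} (hN : Measurable N) (h : ∀ k : ℕ, ∀ᵐ x ∂(m k), N x = (k : ℝ≥0∞)) (n : ℕ) :
    (Measure.sum fun k => c k • m k).restrict {x | N x = n} = c n • m n := by
  have hS : MeasurableSet {x | N x = n} := hN (measurableSet_singleton _)
  rw [Measure.restrict_sum _ hS]
  ext s hs
  rw [Measure.sum_apply _ hs, tsum_eq_single n]
  · rw [Measure.restrict_smul, Measure.restrict_eq_self_of_ae_mem (s := {x | N x = n}) (h n)]
  · intro k hk
    rw [Measure.restrict_smul, Measure.restrict_eq_zero.2]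
    · simp
    · refine measure_mono_null (fun x hx => ?_) (ae_iff.1 (h k))
      simp only [Set.mem_ofPred_eq] at hx ⊢
      rw [hx, Nat.cast_inj]
      exact fun h => hk h.symm

variable {d : ℕ}

namespace Config

section mixed

variable {ρ : ℝ} {U W : Set (Space d)}

theorem poissonOn_prod (ρ : ℝ) (W U : Set (Space d)) :
    (poissonOn ρ W).prod (volume.restrict U) =
      Measure.sum fun n => ENNReal.ofReal (weight ρ W n) • lm W U n := by
  have : ∀ n, SFinite (ENNReal.ofReal (weight ρ W n) • level W n) := fun n => inferInstance
  rw [poissonOn, Measure.prod_sum_left]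
  congr 1
  funext n
  rw [Measure.prod_smul_left]

theorem poissonOn_prod_restrict_count (hW : MeasurableSet W) (hU : MeasurableSet U) (n : ℕ) :
    ((poissonOn ρ W).prod (volume.restrict U)).restrict {q | q.1.1 W = n} =
      ENNReal.ofReal (weight ρ W n) • lm W U n := by
  rw [poissonOn_prod]
  exact Measure.restrict_sum_smul ((measurable_eval hW).comp measurable_fst)
    (fun k => (ae_lm hW hU k).mono fun _ h => h.1) n

theorem integral_poissonOn_prod_eq_zero {F : Config d × Space d → ℝ}
    (h : ∀ n, ∫ q, F q ∂(lm W U n) = 0) :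
    ∫ q, F q ∂((poissonOn ρ W).prod (volume.restrict U)) = 0 := by
  by_cases hF : Integrable F ((poissonOn ρ W).prod (volume.restrict U))
  · rw [poissonOn_prod] at hF ⊢
    rw [integral_sum_measure hF]
    simp [h, integral_smul_measure]
  · exact integral_undef hF

theorem hasSum_integral_poissonOn_prod (hρ : 0 ≤ ρ) {F : Config d × Space d → ℝ}
    (hF : Integrable F ((poissonOn ρ W).prod (volume.restrict U))) :
    HasSum (fun n => weight ρ W n * ∫ q, F q ∂(lm W U n))
      (∫ q, F q ∂((poissonOn ρ W).prod (volume.restrict U))) := by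
  rw [poissonOn_prod] at hF ⊢
  refine (hasSum_integral_measure hF).congr_fun fun n => ?_
  rw [integral_smul_measure, ENNReal.toReal_ofReal (weight_nonneg hρ W n), smul_eq_mul]

theorem memLp_lm_of_poissonOn (hρ : 0 < ρ) (hW : MeasurableSet W) (hU : MeasurableSet U)
    {F : Type*} [NormedAddCommGroup F]
    {A : Config d × Space d → F} (hA : MemLp A 2 ((poissonOn ρ W).prod (volume.restrict U)))
    (n : ℕ) : MemLp A 2 (lm W U n) := by
  have h1 := hA.restrict {q : Config d × Space d | q.1.1 W = (n : ℝ≥0∞)}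
  rw [poissonOn_prod_restrict_count hW hU] at h1
  refine h1.of_measure_le_smul (c := (ENNReal.ofReal (weight ρ W n))⁻¹) ?_ ?_
  · simpa using weight_pos hρ W n
  · rw [smul_smul, ENNReal.inv_mul_cancel (by simpa using weight_pos hρ W n) ENNReal.ofReal_ne_top,
      one_smul]

/-- Adds a configuration outside of `W`. -/
def addOut (p : (Config d × Space d) × Config d) : Config d × Space d := (p.1.1.add p.2, p.1.2)

/-- Restricts the configuration to `W`. -/
def resFst (W : Set (Space d)) (q : Config d × Space d) : Config d × Space d := (q.1.res W, q.2)

theorem measurable_resFst (hW : MeasurableSet W) :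
    Measurable (resFst W : Config d × Space d → _) :=
  ((measurable_res hW).comp measurable_fst).prodMk measurable_snd

theorem measurePreserving_addOut (ρ : ℝ) (W U : Set (Space d)) (κ : Measure (Config d))
    [SFinite κ] : MeasurePreserving addOut
      (((poissonOn ρ W).prod (volume.restrict U)).prod κ)
      ((mixed ρ W κ).prod (volume.restrict U)) := by
  have h1 : MeasurePreserving (fun p : Config d × Config d => p.1.add p.2)
      ((poissonOn ρ W).prod κ) (mixed ρ W κ) := ⟨measurable_add', rfl⟩
  have : SFinite (mixed ρ W κ) := by rw [mixed]; infer_instance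
  have h2 := (h1.prod (MeasurePreserving.id (volume.restrict U))).comp
    (measurePreserving_prod_right_comm (poissonOn ρ W) (volume.restrict U) κ)
  exact h2

variable {κ : Measure (Config d)} [IsProbabilityMeasure κ]

instance instSFiniteMixed (ρ : ℝ) (W : Set (Space d)) : SFinite (mixed ρ W κ) := by
  rw [mixed]; infer_instance

theorem res_eq_self {μ : Config d} (hW : MeasurableSet W) (h : μ.1 Wᶜ = 0) : μ.res W = μ :=
  ext_val (Measure.restrict_eq_self_of_ae_mem (ae_iff.2 h))

theorem res_eq_empty {μ : Config d} (h : μ.1 W = 0) : μ.res W = empty :=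
  ext_val (Measure.restrict_eq_zero.2 h)

theorem ae_res_add (ρ : ℝ) (hW : MeasurableSet W) (hκ : ∀ᵐ η ∂κ, η.1 W = 0) :
    ∀ᵐ p ∂((poissonOn ρ W).prod κ), (p.1.add p.2).res W = p.1 := by
  filter_upwards [Measure.quasiMeasurePreserving_fst.ae (ae_poissonOn hW),
    Measure.quasiMeasurePreserving_snd.ae hκ] with p hp1 hp2
  simp only [res_add, res_eq_self hW hp1.2, res_eq_empty hp2, add_empty]

theorem measurePreserving_res (ρ : ℝ) (hW : MeasurableSet W) (hκ : ∀ᵐ η ∂κ, η.1 W = 0) :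
    MeasurePreserving (fun μ : Config d => μ.res W) (mixed ρ W κ) (poissonOn ρ W) := by
  refine ⟨measurable_res hW, ?_⟩
  rw [mixed, Measure.map_map (measurable_res hW) measurable_add',
    Measure.map_congr (f := (fun μ : Config d => μ.res W) ∘ fun p : Config d × Config d => p.1.add p.2)
      (g := Prod.fst) (ae_res_add ρ hW hκ)]
  exact measurePreserving_fst.map_eq

theorem measurePreserving_resFst (ρ : ℝ) (hW : MeasurableSet W) (U : Set (Space d))
    (hκ : ∀ᵐ η ∂κ, η.1 W = 0) :
    MeasurePreserving (resFst W) ((mixed ρ W κ).prod (volume.restrict U))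
      ((poissonOn ρ W).prod (volume.restrict U)) :=
  (measurePreserving_res ρ hW hκ).prod (MeasurePreserving.id _)

theorem ae_resFst_addOut (ρ : ℝ) (hW : MeasurableSet W) (U : Set (Space d))
    (hκ : ∀ᵐ η ∂κ, η.1 W = 0) :
    ∀ᵐ p ∂(((poissonOn ρ W).prod (volume.restrict U)).prod κ), resFst W (addOut p) = p.1 := by
  filter_upwards [(measurePreserving_prod_right_comm (poissonOn ρ W) (volume.restrict U)
    κ).quasiMeasurePreserving.ae (Measure.quasiMeasurePreserving_fst.ae (ae_res_add ρ hW hκ))]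
    with p hp
  exact Prod.ext hp rfl

/-- A field that ignores the outside of `W` only sees the average of the other field over the outer
configuration. -/
theorem integral_inner_resFst (hW : MeasurableSet W)
    (hκ : ∀ᵐ η ∂κ, η.1 W = 0) {A B : Config d × Space d → Space d}
    (hA : MemLp A 2 ((poissonOn ρ W).prod (volume.restrict U)))
    (hB : MemLp B 2 ((mixed ρ W κ).prod (volume.restrict U))) :
    ∫ q, inner ℝ (A (resFst W q)) (B q) ∂((mixed ρ W κ).prod (volume.restrict U)) =
      ∫ q, inner ℝ (A q) (∫ η, B (addOut (q, η)) ∂κ)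
        ∂((poissonOn ρ W).prod (volume.restrict U)) := by
  have h1 := measurePreserving_addOut ρ W U κ
  have h2 := measurePreserving_resFst ρ hW U hκ
  have hA' : MemLp (fun q => A (resFst W q)) 2 ((mixed ρ W κ).prod (volume.restrict U)) :=
    hA.comp_measurePreserving h2
  have hB' : MemLp (fun p => B (addOut p)) 2
    (((poissonOn ρ W).prod (volume.restrict U)).prod κ) := hB.comp_measurePreserving h1
  rw [← h1.integral_comp_of_aestronglyMeasurable (hA'.integrable_inner' hB).1,
    ← integral_inner_right hB' hA]
  refine integral_congr_ae ?_
  filter_upwards [ae_resFst_addOut ρ hW U hκ] with p hp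
  simp only [hp]

theorem lintegral_poissonOn_prod (ρ : ℝ) (W U : Set (Space d)) (F : Config d × Space d → ℝ≥0∞) :
    ∫⁻ q, F q ∂((poissonOn ρ W).prod (volume.restrict U)) =
      ∑' n, ENNReal.ofReal (weight ρ W n) * ∫⁻ q, F q ∂(lm W U n) := by
  rw [poissonOn_prod, lintegral_sum_measure]
  simp only [lintegral_smul_measure, smul_eq_mul]

theorem tsum_weight_mul_pow (hρ : 0 ≤ ρ) (hv : volume W ≠ ⊤) :
    ∑' n, ENNReal.ofReal (weight ρ W n) * volume W ^ n = 1 := by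
  have := isProbabilityMeasure_poissonOn hρ hv
  have h1 := lintegral_poissonOn ρ W fun _ => 1
  simp only [lintegral_one, measure_univ, level_univ] at h1
  exact h1.symm

theorem redCoeff_resFst (hW : MeasurableSet W) (a₀ : Config d → Matrix (Fin d) (Fin d) ℝ)
    (q : Config d × Space d) : redCoeff a₀ W (resFst W q) = redCoeff a₀ W q := by
  have h1 : ((q.1.res W).add (point q.2)).res W = (q.1.add (point q.2)).res W := by
    rw [res_add, res_add, res_res hW, Set.inter_self]
  have h2 : ((q.1.res W).add (point q.2)).1 W = (q.1.add (point q.2)).1 W := by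
    rw [add_apply, add_apply, res_apply _ hW, Set.inter_self]
  simp only [redCoeff, resFst, shiftIn, h1, h2]

theorem SmoothOn.comp_add {φ : Config d → ℝ} (hφ : SmoothOn U φ) (hU : MeasurableSet U)
    {η : Config d} (hη : η.1 U = 0) : SmoothOn U fun μ => φ (μ.add η) := by
  intro μ n
  have h1 : ∀ x : Fin n → Space d, φ (((points x).add (μ.res Uᶜ)).add η) =
      φ ((points x).add ((μ.add η).res Uᶜ)) := fun x => by
    rw [res_add, res_eq_self (μ := η) hU.compl (by rwa [compl_compl]), add_assoc]
  simp only [h1]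
  exact hφ _ n

theorem SmoothOn.comp_res {φ : Config d → ℝ} (hφ : SmoothOn U φ) (hU : MeasurableSet U)
    (hW : MeasurableSet W) (hUW : U ⊆ W) : SmoothOn U fun μ => φ (μ.res W) := by
  intro μ n
  refine (hφ (μ.res W) n).congr fun x hx => ?_
  change φ (((points x).add (μ.res Uᶜ)).res W) = _
  rw [res_add, res_points_of_mem fun i => hUW (hx i (Set.mem_univ i)), res_res hW,
    res_res hU.compl, Set.inter_comm]

theorem rgrad_comp_res {φ : Config d → ℝ} (hU : IsOpen U) (hUW : U ⊆ W) (hφ : SmoothOn U φ)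
    {μ : Config d} (hμ : (μ.res W).1 U ≠ ⊤) {z : Space d} (hz : z ∈ U) :
    rgrad (fun μ => φ (μ.res W)) μ z = rgrad φ (μ.res W) z := by
  refine rgrad_eq_of_hasFDerivAt ((hφ.hasFDerivAt hU hμ hz).congr_of_eventuallyEq ?_)
  filter_upwards [hU.mem_nhds hz] with y hy
  rw [res_add, res_point_of_mem (hUW hy)]

/-- The function `φ` of the particles in `W`, if there are `n + 1` of them. -/
def liftFun (W : Set (Space d)) (n : ℕ) (φ : Config d → ℝ) (μ : Config d) : ℝ :=
  {μ : Config d | μ.1 W = ((n + 1 : ℕ) : ℝ≥0∞)}.indicator 1 μ * φ (μ.res W)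

theorem memLp_indicator_count (hD : Dom U W) {n : ℕ} {φ : Config d → ℝ}
    (hφ : LevelTest W U n φ) : MemLp ({q : Config d × Space d | q.1.1 W = (n : ℝ≥0∞)}.indicator
      fun q => rgrad φ q.1 q.2) 2 ((poissonOn ρ W).prod (volume.restrict U)) := by
  have hS : MeasurableSet {q : Config d × Space d | q.1.1 W = (n : ℝ≥0∞)} :=
    ((measurable_eval hD.meas).comp measurable_fst) (measurableSet_singleton _)
  rw [memLp_indicator_iff_restrict hS, poissonOn_prod_restrict_count hD.meas hD.measU]
  exact hφ.memLp_rgrad.smul_measure ENNReal.ofReal_ne_top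

section sol

variable {Λ : ℝ} {a₀ : Config d → Matrix (Fin d) (Fin d) ℝ} (ha : IsCoefficient Λ a₀)
  (hΛ : 0 ≤ Λ) (hD : Dom U W) (hρ : 0 < ρ) {p : Space d} {Γ : Config d × Space d → Space d}
  (hκ : ∀ᵐ η ∂κ, η.1 W = 0)

include ha hΛ hD

theorem USol.lintegral_le (h : USol a₀ U W p Γ) (n : ℕ) :
    ∫⁻ q, ‖Γ q‖ₑ ^ 2 ∂(lm W U n) ≤ ENNReal.ofReal (‖p‖ ^ 2) * volume U * volume W ^ n := by
  have h1 := (h.integral_norm_sq_le ha hΛ hD n).trans (h.pairing_le ha hΛ hD n)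
  have h2 := ENNReal.ofReal_le_ofReal h1
  rw [ofReal_integral_eq_lintegral_ofReal ((h.memLp n).integrable_inner' (h.memLp n))
    (Eventually.of_forall fun _ => real_inner_self_nonneg), ENNReal.ofReal_mul (by positivity),
    ENNReal.ofReal_mul (by positivity), ENNReal.ofReal_pow measureReal_nonneg, measureReal_def,
    measureReal_def, ENNReal.ofReal_toReal hD.fin, ENNReal.ofReal_toReal hD.fin', ← mul_assoc] at h2
  refine le_trans (le_of_eq (lintegral_congr fun q => ?_)) h2
  rw [real_inner_self_eq_norm_sq, ENNReal.ofReal_pow (norm_nonneg _), ofReal_norm]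

theorem USol.memLp_poissonOn (hρ : 0 ≤ ρ) (h : USol a₀ U W p Γ) :
    MemLp Γ 2 ((poissonOn ρ W).prod (volume.restrict U)) := by
  refine ⟨h.measurable.aestronglyMeasurable, ?_⟩
  rw [← ENNReal.pow_lt_top_iff (n := 2) |>.trans (or_iff_left (by norm_num)),
    ← lintegral_enorm_sq_eq, lintegral_poissonOn_prod]
  refine (ENNReal.tsum_le_tsum fun n =>
    mul_le_mul_right (h.lintegral_le ha hΛ hD n) _).trans_lt ?_
  simp only [mul_left_comm _ (ENNReal.ofReal (‖p‖ ^ 2) * volume U)]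
  rw [ENNReal.tsum_mul_left, tsum_weight_mul_pow hρ hD.fin, mul_one]
  exact ENNReal.mul_lt_top ENNReal.ofReal_lt_top hD.fin'.lt_top

/-- The additional particle raises the level by one. The bound at level `n + 1` has one more factor
`volume W`, which does not affect summability against the weights. -/
theorem USol.memLp_poissonOn_sh (hρ : 0 ≤ ρ) (h : USol a₀ U W p Γ) :
    MemLp (fun ω => Γ (sh ω)) 2
      (((poissonOn ρ W).prod (volume.restrict U)).prod (volume.restrict W)) := by
  have hm : Measurable fun ω => Γ (sh ω) := h.measurable.comp measurable_sh
  refine ⟨hm.aestronglyMeasurable, ?_⟩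
  rw [← ENNReal.pow_lt_top_iff (n := 2) |>.trans (or_iff_left (by norm_num)),
    ← lintegral_enorm_sq_eq, lintegral_prod _ (hm.enorm.pow_const 2).aemeasurable,
    lintegral_poissonOn_prod]
  have h1 : ∀ n, ∫⁻ q, ∫⁻ x in W, ‖Γ (sh (q, x))‖ₑ ^ 2 ∂volume ∂(lm W U n) ≤
      ENNReal.ofReal (‖p‖ ^ 2) * volume U * volume W * volume W ^ n := fun n => by
    rw [← lintegral_prod (μ := lm W U n) (ν := volume.restrict W) (fun ω => ‖Γ (sh ω)‖ₑ ^ 2)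
      (hm.enorm.pow_const 2).aemeasurable, (measurePreserving_sh n).lintegral_comp
      (f := fun q => ‖Γ q‖ₑ ^ 2) (h.measurable.enorm.pow_const 2), mul_assoc _ (volume W),
      ← pow_succ']
    exact h.lintegral_le ha hΛ hD (n + 1)
  refine (ENNReal.tsum_le_tsum fun n => mul_le_mul_right (h1 n) _).trans_lt ?_
  simp only [mul_left_comm _ (ENNReal.ofReal (‖p‖ ^ 2) * volume U * volume W)]
  rw [ENNReal.tsum_mul_left, tsum_weight_mul_pow hρ hD.fin, mul_one]
  exact ENNReal.mul_lt_top (ENNReal.mul_lt_top ENNReal.ofReal_lt_top hD.fin'.lt_top) hD.fin.lt_top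

include hρ hκ

omit ha hΛ in
theorem IsTest.ae_levelTest {φ : Config d → ℝ} (hφ : IsTest (mixed ρ W κ) (mixed ρ W κ) U φ) :
    ∀ᵐ η ∂κ, ∀ n, LevelTest W U n fun μ => φ (μ.add η) := by
  have h1 : MemLp (fun p : Config d × Config d => φ (p.1.add p.2)) 2 ((poissonOn ρ W).prod κ) :=
    (memLp_map_measure_iff hφ.memLp.1 measurable_add'.aemeasurable).1 hφ.memLp
  have h2 := hφ.memLp_rgrad.comp_measurePreserving (measurePreserving_addOut ρ W U κ)
  filter_upwards [h1.ae_slice_right, h2.ae_slice_right, hκ] with η h3 h4 h5 n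
  refine ⟨hφ.smoothOn.comp_add hD.measU (measure_mono_null hD.sub h5), memLp_level hρ h3 _, ?_⟩
  simp only [rgrad_comp_add]
  exact memLp_lm_of_poissonOn hρ hD.meas hD.measU h4 n

/-- With the outer configuration frozen, a test function under the mixed law is a test function on
every level, where the equation holds. -/
theorem USol.perp_mixed (h : USol a₀ U W p Γ) : Perp (mixed ρ W κ) (mixed ρ W κ) U
    fun q => redCoeff a₀ W q (Γ (resFst W q)) - p := by
  have := isProbabilityMeasure_poissonOn hρ.le hD.fin
  have : IsFiniteMeasure (volume.restrict U) := isFiniteMeasure_restrict.2 hD.fin'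
  have e1 := measurePreserving_addOut ρ W U κ
  have hF : MemLp (flux a₀ W p Γ) 2 ((poissonOn ρ W).prod (volume.restrict U)) :=
    ((isBddField_redCoeff ha hD.meas hΛ).memLp (h.memLp_poissonOn ha hΛ hD hρ.le)).sub
      (memLp_const p)
  have hF' : MemLp (fun q => flux a₀ W p Γ (resFst W q)) 2
      ((mixed ρ W κ).prod (volume.restrict U)) :=
    hF.comp_measurePreserving (measurePreserving_resFst ρ hD.meas U hκ)
  have e : (fun q => redCoeff a₀ W q (Γ (resFst W q)) - p) =
      fun q => flux a₀ W p Γ (resFst W q) := by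
    funext q
    rw [flux, redCoeff_resFst hD.meas]
  rw [e]
  refine ⟨hF', fun φ hφ => ?_⟩
  have h1 := hφ.memLp_rgrad.integrable_inner' hF'
  rw [← e1.integral_comp_of_aestronglyMeasurable h1.1]
  have h2 : (fun ω => inner ℝ (rgrad φ (addOut ω).1 (addOut ω).2)
      (flux a₀ W p Γ (resFst W (addOut ω)))) =ᵐ[((poissonOn ρ W).prod (volume.restrict U)).prod κ]
      fun ω => inner ℝ (rgrad φ (addOut ω).1 (addOut ω).2) (flux a₀ W p Γ ω.1) := by
    filter_upwards [ae_resFst_addOut ρ hD.meas U hκ] with ω hω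
    rw [hω]
  rw [integral_congr_ae h2, integral_prod_symm _
    (((integrable_congr h2).1 (e1.integrable_comp_of_integrable h1)))]
  refine integral_eq_zero_of_ae ?_
  filter_upwards [IsTest.ae_levelTest hD hρ hκ hφ] with η hη
  refine integral_poissonOn_prod_eq_zero fun n => ?_
  have h3 := (h.sol n).perp.2 _ (hη n)
  simp only [rgrad_comp_add] at h3
  exact h3

omit ha hΛ in
-- The indicator of the particle number is unchanged by moving particles, so it commutes with the
-- gradient. The tagged particle is counted too: `n + 1` particles for the function are `n` for its
-- gradient.
theorem LevelTest.isTest_mixed {n : ℕ} {φ : Config d → ℝ} (hφ : LevelTest W U n φ) :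
    IsTest (mixed ρ W κ) (mixed ρ W κ) U (liftFun W n φ) ∧
    (fun q : Config d × Space d => rgrad (liftFun W n φ) q.1 q.2)
      =ᵐ[(mixed ρ W κ).prod (volume.restrict U)] fun q =>
        {q : Config d × Space d | q.1.1 W = (n : ℝ≥0∞)}.indicator (fun q => rgrad φ q.1 q.2)
          (resFst W q) := by
  have hinv : Inv U fun μ : Config d =>
      {μ : Config d | μ.1 W = ((n + 1 : ℕ) : ℝ≥0∞)}.indicator (1 : Config d → ℝ) μ := by
    intro μ z z' hz hz'
    simp only [Set.indicator, Set.mem_ofPred_eq, add_apply, point_apply _ hD.meas, hD.sub hz,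
      hD.sub hz', if_true, Pi.one_apply]
  have hsm := hφ.smoothOn.comp_res hD.measU hD.meas hD.sub
  have hae : (fun q : Config d × Space d => rgrad (liftFun W n φ) q.1 q.2)
      =ᵐ[(mixed ρ W κ).prod (volume.restrict U)] fun q =>
        {q : Config d × Space d | q.1.1 W = (n : ℝ≥0∞)}.indicator (fun q => rgrad φ q.1 q.2)
          (resFst W q) := by
    filter_upwards [((mixed_mecke hρ.le hD.meas hκ).mono hD.measU hD.sub).ae_fin_mem] with q hq
    have h1 : (q.1.res W).1 U ≠ ⊤ := by
      rw [res_apply _ hD.measU]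
      exact ((measure_mono Set.inter_subset_left).trans_lt hq.1.lt_top).ne
    refine (rgrad_inv_mul hD.isOpen hq.1 hq.2 hinv hsm).trans ?_
    rw [rgrad_comp_res hD.isOpen hD.sub hφ.smoothOn h1 hq.2]
    have h2 : (q.1.add (point q.2)).1 W = q.1.1 W + 1 := by
      rw [add_apply, point_apply _ hD.meas, Set.indicator_of_mem (hD.sub hq.2), Pi.one_apply]
    have h3 : (resFst W q).1.1 W = q.1.1 W := by
      rw [resFst, res_apply _ hD.meas, Set.inter_self]
    simp only [Set.indicator, Set.mem_ofPred_eq, h2, h3, Nat.cast_add, Nat.cast_one,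
      ENNReal.add_left_inj ENNReal.one_ne_top, Pi.one_apply, ite_smul, one_smul, zero_smul]
    rfl
  refine ⟨⟨hinv.smoothOn.mul hsm, ?_, ?_⟩, hae⟩
  · have h1 : MemLp ({μ : Config d | μ.1 W = ((n + 1 : ℕ) : ℝ≥0∞)}.indicator φ) 2
        (poissonOn ρ W) := by
      have hS : MeasurableSet {μ : Config d | μ.1 W = ((n + 1 : ℕ) : ℝ≥0∞)} :=
        measurable_eval hD.meas (measurableSet_singleton _)
      rw [memLp_indicator_iff_restrict hS, poissonOn_restrict ρ hD.meas]
      exact hφ.memLp.smul_measure ENNReal.ofReal_ne_top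
    have h2 := h1.comp_measurePreserving (measurePreserving_res ρ hD.meas hκ)
    refine (memLp_congr_ae (Eventually.of_forall fun μ => ?_)).1 h2
    have h3 : (μ.res W).1 W = μ.1 W := by rw [res_apply _ hD.meas, Set.inter_self]
    simp only [Function.comp_apply, liftFun, Set.indicator, Set.mem_ofPred_eq, h3, Pi.one_apply,
      ite_mul, one_mul, zero_mul]
  · rw [memLp_congr_ae hae]
    exact (memLp_indicator_count hD hφ).comp_measurePreserving
      (measurePreserving_resFst ρ hD.meas U hκ)

/-- By duality: a field orthogonal to gradients under the mixed law, averaged over the outer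
configuration, is orthogonal to gradients on each level, as one sees by testing with `liftFun`. -/
theorem USol.grad_mixed (h : USol a₀ U W p Γ) : Grad (mixed ρ W κ) (mixed ρ W κ) U
    fun q => Γ (resFst W q) := by
  have hΓ := h.memLp_poissonOn ha hΛ hD hρ.le
  refine ⟨hΓ.comp_measurePreserving (measurePreserving_resFst ρ hD.meas U hκ), fun B hB => ?_⟩
  rw [integral_inner_resFst hD.meas hκ hΓ hB.1]
  have hB' := (hB.1.comp_measurePreserving (measurePreserving_addOut ρ W U κ)).integral_right
  refine integral_poissonOn_prod_eq_zero fun n => (h.sol n).grad.2 _ ⟨?_, fun φ hφ => ?_⟩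
  · exact memLp_lm_of_poissonOn hρ hD.meas hD.measU hB' n
  obtain ⟨h1, h2⟩ := LevelTest.isTest_mixed hD hρ hκ hφ
  have h3 := hB.2 _ h1
  have h4 : ∀ᵐ q ∂((mixed ρ W κ).prod (volume.restrict U)),
      inner ℝ (rgrad (liftFun W n φ) q.1 q.2) (B q) =
        inner ℝ ({q : Config d × Space d | q.1.1 W = (n : ℝ≥0∞)}.indicator
          (fun q => rgrad φ q.1 q.2) (resFst W q)) (B q) := by
    filter_upwards [h2] with q hq
    rw [hq]
  rw [integral_congr_ae h4, integral_inner_resFst hD.meas hκ (memLp_indicator_count hD hφ) hB.1]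
    at h3
  have hS : MeasurableSet {q : Config d × Space d | q.1.1 W = (n : ℝ≥0∞)} :=
    ((measurable_eval hD.meas).comp measurable_fst) (measurableSet_singleton _)
  have h5 : ∀ q : Config d × Space d, inner ℝ ({q : Config d × Space d |
      q.1.1 W = (n : ℝ≥0∞)}.indicator (fun q => rgrad φ q.1 q.2) q)
        (∫ η, B (addOut (q, η)) ∂κ) = {q : Config d × Space d | q.1.1 W = (n : ℝ≥0∞)}.indicator
      (fun q => inner ℝ (rgrad φ q.1 q.2) (∫ η, B (addOut (q, η)) ∂κ)) q := by
    intro q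
    by_cases hq : q ∈ {q : Config d × Space d | q.1.1 W = (n : ℝ≥0∞)} <;> simp only [hq,
      Set.indicator_of_mem, Set.indicator_of_notMem, inner_zero_left, not_false_eq_true]
  simp only [h5] at h3
  rw [integral_indicator hS, poissonOn_prod_restrict_count hD.meas hD.measU,
    integral_smul_measure, ENNReal.toReal_ofReal (weight_nonneg hρ.le W n), smul_eq_mul] at h3
  exact (mul_eq_zero.1 h3).resolve_left (weight_pos hρ W n).ne'

theorem USol.isSol_mixed (h : USol a₀ U W p Γ) : IsSol (mixed ρ W κ) (mixed ρ W κ) U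
    (redCoeff a₀ W) p fun q => Γ (resFst W q) :=
  ⟨h.grad_mixed ha hΛ hD hρ hκ, h.perp_mixed ha hΛ hD hρ hκ⟩

end sol

end mixed

end Config
end

/-! ### The space `H¹` and the dual energy in reduced coordinates. -/

noncomputable section

variable {d : ℕ}

namespace Config

/-- The value of a field at a particle, as a function of the other particles. -/
def red (G : Config d → Space d → Space d) (q : Config d × Space d) : Space d :=
  G (q.1.add (point q.2)) q.2

/-- Completion of the square: the linear term is rewritten by the equation for `Γ`, and the energy
becomes its maximal value minus the energy of the distance to `Γ`. -/
theorem IsSol.energy_eq {Q Q' : Measure (Config d)} {U : Set (Space d)} [SFinite Q']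
    [IsFiniteMeasure (Q'.prod (volume.restrict U))]
    {a : Config d × Space d → Space d →L[ℝ] Space d} (ha : IsBddField a)
    (hs : ∀ q v w, inner ℝ (a q v) w = inner ℝ v (a q w)) {p : Space d}
    {Γ A : Config d × Space d → Space d} (h : IsSol Q Q' U a p Γ) (hA : Grad Q Q' U A) :
    ∫ q, (-(1 / 2) * inner ℝ (A q) (a q (A q)) + inner ℝ p (A q)) ∂(Q'.prod (volume.restrict U)) =
      1 / 2 * ∫ q, inner ℝ p (Γ q) ∂(Q'.prod (volume.restrict U)) -
        1 / 2 * ∫ q, inner ℝ (A q - Γ q) (a q (A q - Γ q)) ∂(Q'.prod (volume.restrict U)) := by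
  have hp : MemLp (fun _ : Config d × Space d => p) 2 (Q'.prod (volume.restrict U)) :=
    memLp_const p
  have h1 := hA.2 _ h.perp
  have h2 := h.grad.2 _ h.perp
  have hd : MemLp (fun q => A q - Γ q) 2 (Q'.prod (volume.restrict U)) := hA.1.sub h.grad.1
  have i1 := hA.1.integrable_inner' h.perp.1
  have i2 := h.grad.1.integrable_inner' h.perp.1
  have i3 := hp.integrable_inner' h.grad.1
  have i4 := hd.integrable_inner' (ha.memLp hd)
  have e : ∀ q, -(1 / 2) * inner ℝ (A q) (a q (A q)) + inner ℝ p (A q) =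
      (1 / 2 * inner ℝ p (Γ q) - 1 / 2 * inner ℝ (A q - Γ q) (a q (A q - Γ q))) -
      (inner ℝ (A q) (a q (Γ q) - p) - 1 / 2 * inner ℝ (Γ q) (a q (Γ q) - p)) := by
    intro q
    have h3 : inner ℝ (Γ q) (a q (A q)) = inner ℝ (A q) (a q (Γ q)) := by
      rw [← hs, real_inner_comm]
    simp only [map_sub, inner_sub_left, inner_sub_right, h3, real_inner_comm p]
    ring
  simp only [e]
  have j1 : Integrable (fun q => 1 / 2 * inner ℝ p (Γ q) -
      1 / 2 * inner ℝ (A q - Γ q) (a q (A q - Γ q))) (Q'.prod (volume.restrict U)) :=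
    (i3.const_mul _).sub (i4.const_mul _)
  have j2 : Integrable (fun q => inner ℝ (A q) (a q (Γ q) - p) -
      1 / 2 * inner ℝ (Γ q) (a q (Γ q) - p)) (Q'.prod (volume.restrict U)) :=
    i1.sub (i2.const_mul _)
  rw [integral_sub j1 j2,
    integral_sub (i3.const_mul _) (i4.const_mul _), integral_sub i1 (i2.const_mul _),
    integral_const_mul, integral_const_mul, integral_const_mul, h1, h2]
  ring

theorem Grad.of_tendsto {Q Q' : Measure (Config d)} {U : Set (Space d)}
    {A : Config d × Space d → Space d} {φ : ℕ → Config d → ℝ} (hφ : ∀ k, IsTest Q Q' U (φ k))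
    (hA : AEStronglyMeasurable A (Q'.prod (volume.restrict U)))
    (h : Tendsto (fun k => eLpNorm (fun q => rgrad (φ k) q.1 q.2 - A q) 2
      (Q'.prod (volume.restrict U))) atTop (𝓝 0)) : Grad Q Q' U A := by
  have hsm : ∀ k, AEStronglyMeasurable (fun q => rgrad (φ k) q.1 q.2 - A q)
      (Q'.prod (volume.restrict U)) := fun k => (hφ k).memLp_rgrad.1.sub hA
  have hL : MemLp A 2 (Q'.prod (volume.restrict U)) := by
    obtain ⟨k, hk⟩ := (h.eventually (gt_mem_nhds ENNReal.zero_lt_top)).exists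
    refine (memLp_congr_ae (Eventually.of_forall fun q => ?_)).1
      ((hφ k).memLp_rgrad.sub ⟨hsm k, hk⟩)
    simp
  rw [← mem_closure_gradSet_iff hL]
  refine mem_closure_of_tendsto (b := atTop) (f := fun k => (hφ k).memLp_rgrad.toLp) ?_
    (Eventually.of_forall fun k => Submodule.subset_span ⟨φ k, hφ k, rfl⟩)
  exact (Lp.tendsto_Lp_iff_tendsto_eLpNorm'' _ (fun k => (hφ k).memLp_rgrad) A hL).2 h

section mecke

variable {ρ : ℝ} {U W : Set (Space d)} {P : Measure (Config d)}

theorem tendsto_zero_of_sq {α : Type*} {l : Filter α} {f : α → ℝ≥0∞}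
    (h : Tendsto (fun k => f k ^ 2) l (𝓝 0)) : Tendsto f l (𝓝 0) := by
  have h1 := h.ennrpow_const (1 / 2)
  simp only [← ENNReal.rpow_natCast, ← ENNReal.rpow_mul] at h1
  norm_num at h1
  exact h1

theorem Mecke.h1NormSq_sub_eq [SFinite P] {hU : MeasurableSet U} (hQ : Mecke ρ U hU P)
    {g u : Config d → ℝ} {G : Config d → Space d → Space d} (hg : IsTest P P U g)
    (hm : Measurable (red G)) :
    h1NormSq P U (fun μ => g μ - u μ) (fun μ x => _root_.grad g μ x - G μ x) =
      eLpNorm (fun μ => g μ - u μ) 2 P ^ 2 + ENNReal.ofReal ρ *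
      eLpNorm (fun q => rgrad g q.1 q.2 - red G q) 2 (P.prod (volume.restrict U)) ^ 2 := by
  have e1 : (fun q : Config d × Space d => _root_.grad g (q.1.add (point q.2)) q.2 -
      G (q.1.add (point q.2)) q.2) = fun q => rgrad g q.1 q.2 - red G q := by
    funext q
    rw [grad_add_point]
    rfl
  rw [hQ.h1NormSq_eq, e1]
  rw [e1]
  exact hg.memLp_rgrad.1.aemeasurable.sub hm.aemeasurable

theorem _root_.IsH1.grad_red [SFinite P] (hρ : 0 < ρ) (hU : IsOpen U)
    (hQ : Mecke ρ U hU.measurableSet P) {u : Config d → ℝ} {G : Config d → Space d → Space d}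
    (h : IsH1 P U u G) : Grad P P U (red G) := by
  obtain ⟨g, hg, hlim⟩ := h.approx
  have hm : Measurable (red G) := h.measurable_grad.comp measurable_reduce
  have ht : ∀ k, IsTest P P U (g k) := fun k => (hQ.isTest_iff hρ hU).2 (hg k)
  refine Grad.of_tendsto ht hm.aestronglyMeasurable (tendsto_zero_of_sq ?_)
  simp only [hQ.h1NormSq_sub_eq (ht _) hm] at hlim
  have h0 : ENNReal.ofReal ρ ≠ 0 := by simpa using hρ
  have h1 : Tendsto (fun k => ENNReal.ofReal ρ * eLpNorm (fun q => rgrad (g k) q.1 q.2 - red G q) 2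
      (P.prod (volume.restrict U)) ^ 2) atTop (𝓝 0) :=
    tendsto_of_tendsto_of_tendsto_of_le_of_le tendsto_const_nhds hlim (fun _ => zero_le)
      fun k => le_add_self
  have h2 := ENNReal.Tendsto.const_mul (a := (ENNReal.ofReal ρ)⁻¹) h1
    (Or.inr (ENNReal.inv_ne_top.2 h0))
  simp only [← mul_assoc, ENNReal.inv_mul_cancel h0 ENNReal.ofReal_ne_top, one_mul,
    mul_zero] at h2
  exact h2

theorem isH1_of_tendsto [SFinite P] (hρ : 0 < ρ) (hU : IsOpen U)
    (hQ : Mecke ρ U hU.measurableSet P) {u : Config d → ℝ} {G : Config d → Space d → Space d}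
    (hu : AEMeasurable u P) (hG : Measurable (Function.uncurry G)) {φ : ℕ → Config d → ℝ}
    (hφ : ∀ k, IsTest P P U (φ k))
    (h1 : Tendsto (fun k => eLpNorm (fun μ => φ k μ - u μ) 2 P) atTop (𝓝 0))
    (h2 : Tendsto (fun k => eLpNorm (fun q => rgrad (φ k) q.1 q.2 - red G q) 2
      (P.prod (volume.restrict U))) atTop (𝓝 0)) : IsH1 P U u G := by
  have hm : Measurable (red G) := hG.comp measurable_reduce
  refine ⟨hu, hG, φ, fun k => (hQ.isTest_iff hρ hU).1 (hφ k), ?_⟩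
  simp only [hQ.h1NormSq_sub_eq (hφ _) hm]
  have h3 := (ENNReal.Tendsto.pow (n := 2) h1).add
    (ENNReal.Tendsto.const_mul (a := ENNReal.ofReal ρ) (ENNReal.Tendsto.pow (n := 2) h2)
      (Or.inr ENNReal.ofReal_ne_top))
  simpa using h3

variable {Λ : ℝ} {a₀ : Config d → Matrix (Fin d) (Fin d) ℝ} (ha : IsCoefficient Λ a₀)
  (hΛ : 0 ≤ Λ) (hD : Dom U W)

include ha hD in
theorem ae_redCoeff_eq (hW : ∀ᵐ μ ∂P, μ.1 W ≠ ⊤) [SFinite P] :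
    ∀ᵐ q ∂(P.prod (volume.restrict U)), redCoeff a₀ W q =
      Matrix.toEuclideanCLM (n := Fin d) (𝕜 := ℝ) (coeff a₀ (q.1.add (point q.2)) q.2) := by
  filter_upwards [Measure.quasiMeasurePreserving_fst.ae hW,
    Measure.quasiMeasurePreserving_snd.ae (ae_restrict_mem hD.measU)] with q h1 h2
  exact redCoeff_eq ha (hD.ball _ h2) h1

include ha hΛ hD in
-- The factor `ρ` of the Mecke formula cancels the one in the normalization, so the density only
-- enters through the law.
theorem dualEnergy_eq [IsFiniteMeasure P] (hρ : 0 < ρ) (hW : ∀ᵐ μ ∂P, μ.1 W ≠ ⊤)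
    (hQ : Mecke ρ U hD.measU P) {G : Config d → Space d → Space d}
    (hG : MemLp (red G) 2 (P.prod (volume.restrict U))) (p : Space d) :
    dualEnergy P a₀ ρ U p G = (volume.real U)⁻¹ *
      ∫ q, (-(1 / 2) * inner ℝ (red G q) (redCoeff a₀ W q (red G q)) + inner ℝ p (red G q))
        ∂(P.prod (volume.restrict U)) := by
  have : IsFiniteMeasure (volume.restrict U) := isFiniteMeasure_restrict.2 hD.fin'
  have h1 : (fun q => -(1 / 2) * inner ℝ (red G q) (redCoeff a₀ W q (red G q)) +
      inner ℝ p (red G q)) =ᵐ[P.prod (volume.restrict U)] fun q : Config d × Space d =>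
      -(1 / 2) * bil (coeff a₀ (q.1.add (point q.2)) q.2) (G (q.1.add (point q.2)) q.2)
        (G (q.1.add (point q.2)) q.2) + inner ℝ p (G (q.1.add (point q.2)) q.2) := by
    filter_upwards [ae_redCoeff_eq ha hD hW] with q hq
    rw [hq, bil_eq_inner]
    rfl
  have hi : Integrable (fun q => -(1 / 2) * inner ℝ (red G q) (redCoeff a₀ W q (red G q)) +
      inner ℝ p (red G q)) (P.prod (volume.restrict U)) :=
    ((hG.integrable_inner' ((isBddField_redCoeff ha hD.meas hΛ).memLp hG)).const_mul _).add
      ((memLp_const p).integrable_inner' hG)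
  rw [dualEnergy, integral_const_mul, hQ.integral_eq (F := fun μ x => -(1 / 2) *
    bil (coeff a₀ μ x) (G μ x) (G μ x) + inner ℝ p (G μ x)) hρ.le ((integrable_congr h1).1 hi),
    integral_congr_ae h1]
  field_simp

end mecke

end Config
end

/-! ### Existence of potentials in `H¹`. -/

noncomputable section

variable {d : ℕ}

namespace Config

section law

variable {ρ : ℝ} {U W : Set (Space d)} {P : Measure (Config d)}

theorem _root_.IsPoissonLaw.exists_mixed (hP : IsPoissonLaw ρ P) (hρ : 0 ≤ ρ)
    (hW : MeasurableSet W) (hv : volume W ≠ ⊤) :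
    ∃ κ : Measure (Config d), IsProbabilityMeasure κ ∧ (∀ᵐ η ∂κ, η.1 W = 0) ∧
      P = mixed ρ W κ := by
  have := hP.isProbabilityMeasure
  refine ⟨P.map fun μ => μ.res Wᶜ,
    Measure.isProbabilityMeasure_map (measurable_res hW.compl).aemeasurable, ?_,
    hP.eq_mixed hρ hW hv⟩
  have hS : MeasurableSet {η : Config d | η.1 W = 0} :=
    measurable_eval hW (measurableSet_singleton _)
  rw [ae_map_iff (measurable_res hW.compl).aemeasurable hS]
  refine Eventually.of_forall fun μ => ?_
  rw [res_apply _ hW, Set.inter_compl_self, measure_empty]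

theorem _root_.IsPoissonLaw.mecke (hP : IsPoissonLaw ρ P) (hρ : 0 ≤ ρ)
    (hW : MeasurableSet W) (hv : volume W ≠ ⊤) : Mecke ρ W hW P := by
  obtain ⟨κ, _, hκ, e⟩ := hP.exists_mixed hρ hW hv
  rw [e]
  exact mixed_mecke hρ hW hκ

theorem IsTest.lintegral_le_of_condExp (hP : IsPoissonLaw ρ P) (hρ : 0 < ρ) (hD : Dom U W)
    {f : Config d → ℝ} (hf : IsTest P P U f) (h : P[f | outerAlgebra U] =ᵐ[P] 0) :
    ∫⁻ μ, ‖f μ‖ₑ ^ 2 ∂P ≤ ENNReal.ofReal ρ * (ENNReal.ofReal (Metric.diam U) ^ 2 * 2 ^ d) *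
      ∫⁻ q, ‖rgrad f q.1 q.2‖ₑ ^ 2 ∂(P.prod (volume.restrict U)) := by
  have := hP.isProbabilityMeasure
  obtain ⟨κ, _, hκ, e⟩ := hP.exists_mixed hρ.le hD.measU hD.fin'
  subst e
  refine poincare hρ hD.isOpen hD.convex hD.pos hD.fin' (fun x hx y hy => ?_) hκ hf ?_
  · rw [← dist_eq_norm]
    exact Metric.dist_le_diam_of_mem hD.bdd hy hx
  · exact integral_level_eq_zero_of_condExp hρ hD.measU hκ (hf.memLp.integrable (by norm_num)) h

theorem outerAlgebra_le (hU : MeasurableSet U) :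
    outerAlgebra U ≤ (inferInstance : MeasurableSpace (Config d)) :=
  ((measurable_eval hU).prodMk (measurable_res hU.compl)).comap_le

/-- Moving a particle inside `U` changes neither the number of particles in `U` nor the outside, and
a function measurable for the generated `σ`-algebra cannot tell such configurations apart. The
conclusion is pointwise, as smoothness demands. -/
theorem inv_of_measurable_outerAlgebra (hU : MeasurableSet U) {h : Config d → ℝ}
    (hh : Measurable[outerAlgebra U] h) : Inv U h := by
  intro μ z z' hz hz'
  obtain ⟨t, -, ht⟩ := hh (measurableSet_singleton (h (μ.add (point z'))))
  have e : ∀ y ∈ U, ((μ.add (point y)).1 U, (μ.add (point y)).res Uᶜ) =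
      (μ.1 U + 1, μ.res Uᶜ) := fun y hy => by
    rw [add_apply, point_apply _ hU, Set.indicator_of_mem hy, res_add,
      res_point_of_notMem (by simpa using hy), add_empty, Pi.one_apply]
  have h1 : μ.add (point z') ∈ h ⁻¹' {h (μ.add (point z'))} := rfl
  have h2 : μ.add (point z) ∈ h ⁻¹' {h (μ.add (point z'))} := by
    rw [← ht] at h1 ⊢
    rw [Set.mem_preimage, e _ hz'] at h1
    rw [Set.mem_preimage, e _ hz]
    exact h1
  exact h2

theorem IsTest.sub_inv {Q Q' : Measure (Config d)} (hU : IsOpen U)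
    (hfin : ∀ᵐ q ∂(Q'.prod (volume.restrict U)), q.1.1 U ≠ ⊤ ∧ q.2 ∈ U) {φ h : Config d → ℝ}
    (hφ : IsTest Q Q' U φ) (hh : Inv U h) (hL : MemLp h 2 Q) :
    IsTest Q Q' U (fun μ => φ μ - h μ) ∧ (fun q : Config d × Space d =>
      rgrad (fun μ => φ μ - h μ) q.1 q.2) =ᵐ[Q'.prod (volume.restrict U)]
        fun q => rgrad φ q.1 q.2 := by
  have e : (fun q : Config d × Space d => rgrad (fun μ => φ μ - h μ) q.1 q.2)
      =ᵐ[Q'.prod (volume.restrict U)] fun q => rgrad φ q.1 q.2 := by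
    filter_upwards [hfin] with q hq
    rw [rgrad_sub hU hq.1 hq.2 hφ.smoothOn hh.smoothOn, rgrad_inv hU hq.2 hh, sub_zero]
  exact ⟨⟨hφ.smoothOn.sub hh.smoothOn, hφ.memLp.sub hL, (memLp_congr_ae e).2 hφ.memLp_rgrad⟩, e⟩

/-- Approximating test functions have convergent gradients but need not converge themselves.
Subtracting their conditional expectations leaves the gradients unchanged, and the Poincaré
inequality makes the corrected functions a Cauchy sequence in `L²`. -/
theorem exists_isH1 (hP : IsPoissonLaw ρ P) (hρ : 0 < ρ) (hD : Dom U W)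
    {A : Config d × Space d → Space d} (hA : Grad P P U A) (hAm : Measurable A) :
    ∃ u G, IsH1 P U u G ∧ red G =ᵐ[P.prod (volume.restrict U)] A ∧
      P[u | outerAlgebra U] =ᵐ[P] 0 := by
  have := hP.isProbabilityMeasure
  have hQ := hP.mecke hρ.le hD.measU hD.fin'
  have hfin := hQ.ae_fin_mem
  obtain ⟨φ, hφ, hlim⟩ := hA.exists_tendsto hD.isOpen hfin
  have hle := outerAlgebra_le hD.measU
  let h : ℕ → Config d → ℝ := fun k => P[φ k | outerAlgebra U]
  have hsm : ∀ k, StronglyMeasurable[outerAlgebra U] (h k) := fun k => stronglyMeasurable_condExp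
  have hL : ∀ k, MemLp (h k) 2 P := fun k => MemLp.condExp (by norm_num) (hφ k).memLp
  have key := fun k => (hφ k).sub_inv hD.isOpen hfin
    (inv_of_measurable_outerAlgebra hD.measU (hsm k).measurable) (hL k)
  let ψ : ℕ → Config d → ℝ := fun k μ => φ k μ - h k μ
  have hψ : ∀ k, IsTest P P U (ψ k) := fun k => (key k).1
  have hg : ∀ k, (fun q : Config d × Space d => rgrad (ψ k) q.1 q.2)
      =ᵐ[P.prod (volume.restrict U)] fun q => rgrad (φ k) q.1 q.2 := fun k => (key k).2
  have hc : ∀ k, P[ψ k | outerAlgebra U] =ᵐ[P] 0 := by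
    intro k
    have i1 := (hφ k).memLp.integrable (by norm_num)
    have i2 := (hL k).integrable (by norm_num)
    filter_upwards [condExp_sub i1 i2 (outerAlgebra U)] with μ hμ
    have h2 : P[h k | outerAlgebra U] = h k := condExp_of_stronglyMeasurable hle (hsm k) i2
    change (P[φ k - h k | outerAlgebra U]) μ = 0
    rw [hμ, h2]
    exact sub_self _
  have hlim' : Tendsto (fun k => eLpNorm (fun q => rgrad (ψ k) q.1 q.2 - A q) 2
      (P.prod (volume.restrict U))) atTop (𝓝 0) := by
    refine hlim.congr fun k => eLpNorm_congr_ae ?_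
    filter_upwards [hg k] with q hq
    rw [hq]
  let C : ℝ≥0∞ := ENNReal.ofReal ρ * (ENNReal.ofReal (Metric.diam U) ^ 2 * 2 ^ d)
  have hC : C ≠ ⊤ := ENNReal.mul_ne_top ENNReal.ofReal_ne_top
    (ENNReal.mul_ne_top (ENNReal.pow_ne_top ENNReal.ofReal_ne_top)
      (ENNReal.pow_ne_top ENNReal.ofNat_ne_top))
  let K : ℝ := Real.sqrt C.toReal
  let g : ℕ → Lp (Space d) 2 (P.prod (volume.restrict U)) := fun k => (hψ k).memLp_rgrad.toLp
  let Ψ : ℕ → Lp ℝ 2 P := fun k => (hψ k).memLp.toLp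
  have hgl : Tendsto g atTop (𝓝 hA.1.toLp) :=
    (Lp.tendsto_Lp_iff_tendsto_eLpNorm'' _ (fun k => (hψ k).memLp_rgrad) A hA.1).2 hlim'
  -- The Poincaré inequality for the difference of two approximants, whose conditional expectation
  -- vanishes.
  have hdist : ∀ k l, dist (Ψ k) (Ψ l) ≤ K * dist (g k) (g l) := by
    intro k l
    have t1 := (hψ k).add hD.isOpen hfin ((hψ l).const_mul hD.isOpen hfin (-1))
    have t2 : P[fun μ => ψ k μ + -1 * ψ l μ | outerAlgebra U] =ᵐ[P] 0 := by
      have i1 := (hψ k).memLp.integrable (by norm_num)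
      have i2 := (hψ l).memLp.integrable (by norm_num)
      filter_upwards [condExp_sub i1 i2 (outerAlgebra U), hc k, hc l] with μ h1 h2 h3
      have e : (fun μ => ψ k μ + -1 * ψ l μ) = ψ k - ψ l := by
        funext μ
        simp only [Pi.sub_apply]
        ring
      rw [e, h1, Pi.sub_apply, h2, h3]
      simp
    have t3 := t1.lintegral_le_of_condExp hP hρ hD t2
    have e1 : (hψ k).memLp.toLp - (hψ l).memLp.toLp = t1.memLp.toLp := by
      rw [← MemLp.toLp_sub]
      refine MemLp.toLp_congr _ _ (Eventually.of_forall fun μ => ?_)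
      simp only [Pi.sub_apply]
      ring
    have e2 : (hψ k).memLp_rgrad.toLp - (hψ l).memLp_rgrad.toLp = t1.memLp_rgrad.toLp := by
      rw [← MemLp.toLp_sub]
      refine MemLp.toLp_congr _ _ ?_
      filter_upwards [hfin] with q hq
      rw [rgrad_add hD.isOpen hq.1 hq.2 (hψ k).smoothOn ((hψ l).smoothOn.const_mul _),
        rgrad_const_mul hD.isOpen hq.1 hq.2 (hψ l).smoothOn, neg_one_smul, Pi.sub_apply,
        sub_eq_add_neg]
    rw [dist_eq_norm, dist_eq_norm]
    change ‖(hψ k).memLp.toLp - (hψ l).memLp.toLp‖ ≤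
      K * ‖(hψ k).memLp_rgrad.toLp - (hψ l).memLp_rgrad.toLp‖
    rw [e1, e2, Lp.norm_toLp, Lp.norm_toLp]
    rw [lintegral_enorm_sq_eq, lintegral_enorm_sq_eq] at t3
    have t4 := ENNReal.toReal_mono (ENNReal.mul_ne_top hC
      (ENNReal.pow_ne_top t1.memLp_rgrad.2.ne)) t3
    rw [ENNReal.toReal_mul, ENNReal.toReal_pow, ENNReal.toReal_pow] at t4
    refine abs_le_of_sq_le_sq' ?_ (by positivity) |>.2
    rw [mul_pow, Real.sq_sqrt ENNReal.toReal_nonneg]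
    exact t4
  have hcau : CauchySeq Ψ := by
    rw [Metric.cauchySeq_iff]
    intro ε hε
    have hK : 0 ≤ K := Real.sqrt_nonneg _
    obtain ⟨N, hN⟩ := Metric.cauchySeq_iff.1 hgl.cauchySeq (ε / (K + 1)) (by positivity)
    refine ⟨N, fun k hk l hl => (hdist k l).trans_lt ?_⟩
    have h1 := hN k hk l hl
    calc K * dist (g k) (g l) ≤ (K + 1) * dist (g k) (g l) := by gcongr; linarith
      _ < (K + 1) * (ε / (K + 1)) := by gcongr
      _ = ε := by field_simp
  obtain ⟨u, hu⟩ := cauchySeq_tendsto_of_complete hcau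
  have hu' : Tendsto (fun k => eLpNorm (fun μ => ψ k μ - u μ) 2 P) atTop (𝓝 0) := by
    have h1 := (Lp.tendsto_Lp_iff_tendsto_eLpNorm'' _ (fun k => (hψ k).memLp) u (Lp.memLp u)).1
      (by rwa [Lp.toLp_coeFn])
    exact h1
  -- `A` is given in reduced coordinates, so the particle has to be removed before it is evaluated.
  let G : Config d → Space d → Space d := fun μ z => A (remIn U hD.measU (μ, z), z)
  have hGm : Measurable (Function.uncurry G) :=
    hAm.comp ((measurable_remIn hD.measU).prodMk measurable_snd)
  have hGA : red G =ᵐ[P.prod (volume.restrict U)] A := by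
    filter_upwards [hfin] with q hq
    simp only [red, G, remIn_add_point hD.measU hq.1 hq.2]
  refine ⟨u, G, isH1_of_tendsto hρ hD.isOpen hQ (Lp.aestronglyMeasurable u).aemeasurable hGm hψ hu'
    ?_, hGA, ?_⟩
  · refine hlim'.congr fun k => eLpNorm_congr_ae ?_
    filter_upwards [hGA] with q hq
    rw [hq]
  · have iu := (Lp.memLp u).integrable (by norm_num)
    -- The conditional expectation contracts `L²` and annihilates the approximants, so the
    -- normalization survives in the limit.
    have h1 : ∀ k, eLpNorm (P[u | outerAlgebra U]) 2 P ≤ eLpNorm (fun μ => ψ k μ - u μ) 2 P := by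
      intro k
      have i1 := (hψ k).memLp.integrable (by norm_num)
      have e1 : P[u | outerAlgebra U] =ᵐ[P] -P[ψ k - (u : Config d → ℝ) | outerAlgebra U] := by
        filter_upwards [condExp_sub i1 iu (outerAlgebra U), hc k] with μ h1 h2
        rw [Pi.neg_apply, h1, Pi.sub_apply, h2]
        simp
      rw [eLpNorm_congr_ae e1, eLpNorm_neg]
      exact eLpNorm_condExp_le_eLpNorm _ (by norm_num)
    have h2 := ge_of_tendsto' hu' h1
    exact (eLpNorm_eq_zero_iff integrable_condExp.1 two_ne_zero).1 (le_zero_iff.1 h2)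

end law

end Config
end

/-! ### Maximizers of the dual problem under a Poisson law. -/

noncomputable section

variable {d : ℕ}

namespace Config

/-- The expectation of `c_N`, with `N` the number of particles in `W`, up to normalization. -/
def avg (W : Set (Space d)) (c : ℕ → ℝ) (ρ : ℝ) : ℝ := ∑' n, weight ρ W n * c n

section law

variable {Λ : ℝ} {a₀ : Config d → Matrix (Fin d) (Fin d) ℝ} (ha : IsCoefficient Λ a₀)
  (hΛ : 0 ≤ Λ) {U W : Set (Space d)} (hD : Dom U W) {ρ : ℝ} (hρ : 0 < ρ)
  {P : Measure (Config d)} (hP : IsPoissonLaw ρ P) {p p' : Space d}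
  {Γ : Config d × Space d → Space d}

include hD hρ hP in
theorem measurePreserving_resFst_law : MeasurePreserving (resFst W) (P.prod (volume.restrict U))
    ((poissonOn ρ W).prod (volume.restrict U)) := by
  obtain ⟨κ, _, hκ, e⟩ := hP.exists_mixed hρ.le hD.meas hD.fin
  subst e
  exact measurePreserving_resFst ρ hD.meas U hκ

include ha hΛ hD hρ hP

theorem USol.isSol_law (h : USol a₀ U W p Γ) :
    IsSol P P U (redCoeff a₀ W) p fun q => Γ (resFst W q) := by
  obtain ⟨κ, _, hκ, e⟩ := hP.exists_mixed hρ.le hD.meas hD.fin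
  subst e
  exact h.isSol_mixed ha hΛ hD hρ hκ

theorem USol.integral_inner_law (h : USol a₀ U W p Γ) (p' : Space d) :
    ∫ q, inner ℝ p' (Γ (resFst W q)) ∂(P.prod (volume.restrict U)) =
      avg W (pairing W U p' Γ) ρ := by
  have := isProbabilityMeasure_poissonOn hρ.le hD.fin
  have : IsFiniteMeasure (volume.restrict U) := isFiniteMeasure_restrict.2 hD.fin'
  have h1 : Integrable (fun q => inner ℝ p' (Γ q))
      ((poissonOn ρ W).prod (volume.restrict U)) :=
    (memLp_const p').integrable_inner' (h.memLp_poissonOn ha hΛ hD hρ.le)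
  rw [(measurePreserving_resFst_law hD hρ hP).integral_comp_of_aestronglyMeasurable
    (g := fun q => inner ℝ p' (Γ q)) h1.1]
  exact (hasSum_integral_poissonOn_prod hρ.le h1).tsum_eq.symm

theorem USol.dualEnergy_eq (h : USol a₀ U W p Γ) {u : Config d → ℝ}
    {G : Config d → Space d → Space d} (hG : IsH1 P U u G) :
    dualEnergy P a₀ ρ U p G = 1 / 2 * ((volume.real U)⁻¹ * avg W (pairing W U p Γ) ρ) -
      (volume.real U)⁻¹ * (1 / 2 * ∫ q, inner ℝ (red G q - Γ (resFst W q))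
        (redCoeff a₀ W q (red G q - Γ (resFst W q))) ∂(P.prod (volume.restrict U))) := by
  have := hP.isProbabilityMeasure
  have : IsFiniteMeasure (volume.restrict U) := isFiniteMeasure_restrict.2 hD.fin'
  have hQ := hP.mecke hρ.le hD.measU hD.fin'
  have hg := hG.grad_red hρ hD.isOpen hQ
  rw [Config.dualEnergy_eq ha hΛ hD hρ (hP.ae_ne_top hD.meas hD.fin) hQ hg.1,
    (h.isSol_law ha hΛ hD hρ hP).energy_eq (isBddField_redCoeff ha hD.meas hΛ)
      (redCoeff_symm ha) hg, h.integral_inner_law ha hΛ hD hρ hP]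
  ring

theorem USol.dualEnergy_le (h : USol a₀ U W p Γ) {u : Config d → ℝ}
    {G : Config d → Space d → Space d} (hG : IsH1 P U u G) :
    dualEnergy P a₀ ρ U p G ≤ 1 / 2 * ((volume.real U)⁻¹ * avg W (pairing W U p Γ) ρ) := by
  rw [h.dualEnergy_eq ha hΛ hD hρ hP hG, sub_le_self_iff]
  have : 0 ≤ ∫ q, inner ℝ (red G q - Γ (resFst W q))
      (redCoeff a₀ W q (red G q - Γ (resFst W q))) ∂(P.prod (volume.restrict U)) :=
    integral_nonneg fun q => (sq_nonneg _).trans (redCoeff_lower ha _ _)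
  positivity

theorem USol.exists_isOptimizer (h : USol a₀ U W p Γ) : ∃ ψ G,
    IsOptimizer P a₀ ρ U p ψ G ∧ P[ψ | outerAlgebra U] =ᵐ[P] 0 ∧
    dualEnergy P a₀ ρ U p G = 1 / 2 * ((volume.real U)⁻¹ * avg W (pairing W U p Γ) ρ) := by
  obtain ⟨u, G, h1, h2, h3⟩ := exists_isH1 hP hρ hD (h.isSol_law ha hΛ hD hρ hP).grad
    (h.measurable.comp (measurable_resFst hD.meas))
  have e : dualEnergy P a₀ ρ U p G =
      1 / 2 * ((volume.real U)⁻¹ * avg W (pairing W U p Γ) ρ) := by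
    rw [h.dualEnergy_eq ha hΛ hD hρ hP h1, integral_eq_zero_of_ae, mul_zero, mul_zero, sub_zero]
    filter_upwards [h2] with q hq
    rw [hq, sub_self, map_zero, inner_zero_left, Pi.zero_apply]
  refine ⟨u, G, ⟨h1, fun v H hv => ?_⟩, h3, e⟩
  rw [e]
  exact h.dualEnergy_le ha hΛ hD hρ hP hv

theorem USol.isGreatest (h : USol a₀ U W p Γ) :
    IsGreatest {e | ∃ u G, IsH1 P U u G ∧ dualEnergy P a₀ ρ U p G = e}
      (1 / 2 * ((volume.real U)⁻¹ * avg W (pairing W U p Γ) ρ)) := by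
  obtain ⟨u, G, h1, -, h2⟩ := h.exists_isOptimizer ha hΛ hD hρ hP
  refine ⟨⟨u, G, h1.1, h2⟩, ?_⟩
  rintro e ⟨u, G, h3, rfl⟩
  exact h.dualEnergy_le ha hΛ hD hρ hP h3

/-- Strict concavity: maximality forces the energy of the distance to `Γ` to vanish, and the
coefficient is at least the identity. Hence the gradient of an optimizer is unique, and expressions
in it do not depend on the optimizer. -/
theorem USol.red_eq (h : USol a₀ U W p Γ) {ψ : Config d → ℝ} {G : Config d → Space d → Space d}
    (hG : IsOptimizer P a₀ ρ U p ψ G) :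
    red G =ᵐ[P.prod (volume.restrict U)] fun q => Γ (resFst W q) := by
  have := hP.isProbabilityMeasure
  have hQ := hP.mecke hρ.le hD.measU hD.fin'
  obtain ⟨u, G', h1, -, h2⟩ := h.exists_isOptimizer ha hΛ hD hρ hP
  have h3 := hG.2 u G' h1.1
  have hU : 0 < volume.real U := ENNReal.toReal_pos hD.pos hD.fin'
  rw [h2, h.dualEnergy_eq ha hΛ hD hρ hP hG.1] at h3
  have hd : MemLp (fun q => red G q - Γ (resFst W q)) 2 (P.prod (volume.restrict U)) :=
    (hG.1.grad_red hρ hD.isOpen hQ).1.sub (h.isSol_law ha hΛ hD hρ hP).grad.1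
  have h4 : ∫ q, inner ℝ (red G q - Γ (resFst W q))
      (redCoeff a₀ W q (red G q - Γ (resFst W q))) ∂(P.prod (volume.restrict U)) ≤ 0 := by
    by_contra hc
    rw [not_le] at hc
    have : 0 < (volume.real U)⁻¹ * (1 / 2 * ∫ q, inner ℝ (red G q - Γ (resFst W q))
      (redCoeff a₀ W q (red G q - Γ (resFst W q))) ∂(P.prod (volume.restrict U))) := by
        positivity
    linarith
  have h5 : ∀ q, 0 ≤ inner ℝ (red G q - Γ (resFst W q))
      (redCoeff a₀ W q (red G q - Γ (resFst W q))) := fun q =>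
    (sq_nonneg _).trans (redCoeff_lower ha _ _)
  have h6 := (integral_eq_zero_iff_of_nonneg h5
    (hd.integrable_inner' ((isBddField_redCoeff ha hD.meas hΛ).memLp hd))).1
    (le_antisymm h4 (integral_nonneg h5))
  filter_upwards [h6] with q hq
  have h7 := (redCoeff_lower ha q (red G q - Γ (resFst W q))).trans_eq hq
  exact sub_eq_zero.1 (norm_eq_zero.1 (pow_eq_zero_iff (two_ne_zero) |>.1
    (le_antisymm h7 (sq_nonneg _))))

end law

end Config
end

/-! ### The first-order coefficient. -/

noncomputable section

variable {d : ℕ}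

namespace Config

theorem resFst_sh {W : Set (Space d)} {ω : (Config d × Space d) × Space d} (hx : ω.2 ∈ W) :
    resFst W (sh ω) = sh (resFst W ω.1, ω.2) := by
  rw [resFst, sh, sh, resFst, res_add, res_point_of_mem hx]

/-- The integrand of the first order expansion, in terms of the other particles. -/
def firstField (a₀ : Config d → Matrix (Fin d) (Fin d) ℝ) (W : Set (Space d))
    (Γ : Config d × Space d → Space d) (ω : (Config d × Space d) × Space d) : ℝ :=
  inner ℝ (Γ ω.1) ((redCoeff a₀ W ω.1 - redCoeff a₀ W (sh ω)) (Γ (sh ω)))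

section law

variable {Λ : ℝ} {a₀ : Config d → Matrix (Fin d) (Fin d) ℝ} (ha : IsCoefficient Λ a₀)
  (hΛ : 0 ≤ Λ) {U W : Set (Space d)} (hD : Dom U W) {ρ : ℝ} (hρ : 0 < ρ)
  {P : Measure (Config d)} (hP : IsPoissonLaw ρ P) {p p' : Space d}
  {Γ : Config d × Space d → Space d}

include hD hρ hP in
-- Allows the almost everywhere identification of the optimizer's gradient to be used after one more
-- particle has been added.
theorem quasiMeasurePreserving_sh_law : Measure.QuasiMeasurePreserving sh
    ((P.prod (volume.restrict U)).prod (volume.restrict W)) (P.prod (volume.restrict U)) := by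
  have := hP.isProbabilityMeasure
  have h1 := (hP.mecke hρ.le hD.meas hD.fin).quasiMeasurePreserving hρ
  have h2 := (QuasiMeasurePreserving.prodMap h1
    (Measure.QuasiMeasurePreserving.id (volume.restrict U))).comp
    (measurePreserving_prod_right_comm P (volume.restrict U)
      (volume.restrict W)).quasiMeasurePreserving
  exact h2

theorem firstIntegrand_eq_inner (a₀ : Config d → Matrix (Fin d) (Fin d) ℝ)
    (G : Config d → Space d → Space d) (q : Config d × Space d) (x : Space d) :
    firstIntegrand a₀ G x (q.1.add (point q.2)) q.2 = inner ℝ (red G q)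
      ((Matrix.toEuclideanCLM (n := Fin d) (𝕜 := ℝ) (coeff a₀ (q.1.add (point q.2)) q.2) -
        Matrix.toEuclideanCLM (n := Fin d) (𝕜 := ℝ) (coeff a₀ ((sh (q, x)).1.add (point q.2)) q.2))
          (red G (sh (q, x)))) := by
  rw [firstIntegrand, bil_eq_inner, map_sub, add_right_comm]
  rfl

include ha in
theorem firstIntegrand_eq_zero (G : Config d → Space d → Space d) {x z : Space d}
    (hx : x ∉ Metric.ball z (1 / 2)) (μ : Config d) : firstIntegrand a₀ G x μ z = 0 := by
  rw [firstIntegrand, coeff, coeff, coeff_add_point_of_notMem ha hx, sub_self, bil_eq_inner,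
    map_zero]
  simp

include ha hΛ hD hρ hP

theorem USol.ae_firstIntegrand (h : USol a₀ U W p Γ) {ψ : Config d → ℝ}
    {G : Config d → Space d → Space d} (hG : IsOptimizer P a₀ ρ U p ψ G) :
    ∀ᵐ ω ∂((P.prod (volume.restrict U)).prod (volume.restrict W)),
      firstIntegrand a₀ G ω.2 (ω.1.1.add (point ω.1.2)) ω.1.2 =
        firstField a₀ W Γ (resFst W ω.1, ω.2) := by
  have := hP.isProbabilityMeasure
  have h1 := h.red_eq ha hΛ hD hρ hP hG
  have h2 := ae_redCoeff_eq (P := P) ha hD (hP.ae_ne_top hD.meas hD.fin)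
  have hq := quasiMeasurePreserving_sh_law hD hρ hP
  filter_upwards [Measure.quasiMeasurePreserving_fst.ae h1, Measure.quasiMeasurePreserving_fst.ae h2,
    hq.ae h1, hq.ae h2, Measure.quasiMeasurePreserving_snd.ae (ae_restrict_mem hD.meas)]
    with ω e1 e2 e3 e4 e5
  have e6 : redCoeff a₀ W (sh (resFst W ω.1, ω.2)) = redCoeff a₀ W (sh ω) := by
    rw [← resFst_sh e5, redCoeff_resFst hD.meas]
  rw [firstIntegrand_eq_inner, firstField, redCoeff_resFst hD.meas, e6, e2, e4, ← resFst_sh e5,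
    e1, ← e3]
  rfl

theorem USol.integrable_firstField (h : USol a₀ U W p Γ) : Integrable (firstField a₀ W Γ)
    (((poissonOn ρ W).prod (volume.restrict U)).prod (volume.restrict W)) := by
  have : IsFiniteMeasure (volume.restrict W) := isFiniteMeasure_restrict.2 hD.fin
  have hb := isBddField_redCoeff (W := W) ha hD.meas hΛ
  exact ((h.memLp_poissonOn ha hΛ hD hρ.le).comp_fst _).integrable_inner'
    (((hb.comp measurable_fst).sub (hb.comp measurable_sh)).memLp
      (h.memLp_poissonOn_sh ha hΛ hD hρ.le))

theorem USol.integrable_firstField_law (h : USol a₀ U W p Γ) :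
    Integrable (fun ω => firstField a₀ W Γ (resFst W ω.1, ω.2))
      ((P.prod (volume.restrict U)).prod (volume.restrict W)) ∧
    ∫ ω, firstField a₀ W Γ (resFst W ω.1, ω.2)
      ∂((P.prod (volume.restrict U)).prod (volume.restrict W)) =
      avg W (fun n => pairing W U p Γ (n + 1) - volume.real W * pairing W U p Γ n) ρ := by
  have := hP.isProbabilityMeasure
  have : IsFiniteMeasure (volume.restrict W) := isFiniteMeasure_restrict.2 hD.fin
  have hb := isBddField_redCoeff (W := W) ha hD.meas hΛ
  have h0 := h.integrable_firstField ha hΛ hD hρ hP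
  have hm := (measurePreserving_resFst_law hD hρ hP).prod (MeasurePreserving.id (volume.restrict W))
  have h1 := hm.integrable_comp_of_integrable h0
  refine ⟨h1, ?_⟩
  have h2 := hm.integral_comp_of_aestronglyMeasurable h0.1
  refine h2.trans ?_
  rw [integral_prod _ h0, ← (hasSum_integral_poissonOn_prod hρ.le h0.integral_prod_left).tsum_eq]
  refine tsum_congr fun n => ?_
  beta_reduce
  rw [h.pairing_succ_sub ha hΛ hD n, ← integral_prod]
  · rfl
  · exact ((h.memLp n).comp_fst _).integrable_inner'
      (((hb.comp measurable_fst).sub (hb.comp measurable_sh)).memLp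
        (memLp_comp_sh (h.memLp (n + 1))))

theorem USol.lintegral_firstIntegrand_lt_top (h : USol a₀ U W p Γ) {ψ : Config d → ℝ}
    {G : Config d → Space d → Space d} (hG : IsOptimizer P a₀ ρ U p ψ G) :
    ∫⁻ x₁ : Space d, ∫⁻ μ, ∫⁻ z in U, ‖firstIntegrand a₀ G x₁ μ z‖ₑ ∂μ.1 ∂P < ⊤ := by
  have := hP.isProbabilityMeasure
  have hQ := hP.mecke hρ.le hD.measU hD.fin'
  obtain ⟨h1, -⟩ := h.integrable_firstField_law ha hΛ hD hρ hP
  have h2 := h.ae_firstIntegrand ha hΛ hD hρ hP hG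
  have h3 := Measure.ae_ae_of_ae_prod (Measure.measurePreserving_swap.quasiMeasurePreserving.ae h2)
  have h4 := h1.swap.prod_right_ae
  -- A particle outside `W` is at distance at least `1/2` from every point of `U` and does not
  -- change the coefficient.
  have e1 : ∫⁻ x₁ : Space d, ∫⁻ μ, ∫⁻ z in U, ‖firstIntegrand a₀ G x₁ μ z‖ₑ ∂μ.1 ∂P =
      ∫⁻ x₁ in W, ∫⁻ μ, ∫⁻ z in U, ‖firstIntegrand a₀ G x₁ μ z‖ₑ ∂μ.1 ∂P := by
    rw [← lintegral_indicator hD.meas]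
    refine lintegral_congr fun x => ?_
    by_cases hx : x ∈ W
    · rw [Set.indicator_of_mem hx]
    · rw [Set.indicator_of_notMem hx]
      refine (lintegral_congr fun μ => ?_).trans lintegral_zero
      refine (setLIntegral_congr_fun hD.measU fun z hz => ?_).trans lintegral_zero
      simp only [firstIntegrand_eq_zero ha G (fun hx' => hx (hD.ball z hz hx')) μ, enorm_zero]
  have e2 : ∫⁻ x₁ in W, ∫⁻ μ, ∫⁻ z in U, ‖firstIntegrand a₀ G x₁ μ z‖ₑ ∂μ.1 ∂P =
      ∫⁻ x₁ in W, ENNReal.ofReal ρ * ∫⁻ q, ‖firstField a₀ W Γ (resFst W q, x₁)‖ₑ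
        ∂(P.prod (volume.restrict U)) := by
    refine lintegral_congr_ae ?_
    filter_upwards [h3, h4] with x hx hx'
    have e3 : (fun q : Config d × Space d => ‖firstIntegrand a₀ G x (q.1.add (point q.2)) q.2‖ₑ)
        =ᵐ[P.prod (volume.restrict U)] fun q => ‖firstField a₀ W Γ (resFst W q, x)‖ₑ := by
      filter_upwards [hx] with q hq
      exact congrArg enorm hq
    rw [hQ.lintegral_eq (F := fun μ z => ‖firstIntegrand a₀ G x μ z‖ₑ), lintegral_congr_ae e3]
    exact (hx'.1.enorm.congr e3.symm)
  rw [e1, e2, lintegral_const_mul' _ _ ENNReal.ofReal_ne_top,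
    ← lintegral_prod_symm (fun ω : (Config d × Space d) × Space d =>
      ‖firstField a₀ W Γ (resFst W ω.1, ω.2)‖ₑ) h1.1.enorm]
  exact ENNReal.mul_lt_top ENNReal.ofReal_lt_top h1.2

/-- Identifies the explicit formula with the average of the first differences of the pairings, which
is the derivative in `ρ` of the finite-volume quantity. -/
theorem USol.firstCoeff_eq (h : USol a₀ U W p Γ) {ψ : Config d → ℝ}
    {G : Config d → Space d → Space d} (hG : IsOptimizer P a₀ ρ U p ψ G) :
    firstCoeff P a₀ ρ U G = (volume.real U)⁻¹ *
      avg W (fun n => pairing W U p Γ (n + 1) - volume.real W * pairing W U p Γ n) ρ := by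
  have := hP.isProbabilityMeasure
  have hQ := hP.mecke hρ.le hD.measU hD.fin'
  obtain ⟨h1, h1'⟩ := h.integrable_firstField_law ha hΛ hD hρ hP
  have h2 := h.ae_firstIntegrand ha hΛ hD hρ hP hG
  have h3 := Measure.ae_ae_of_ae_prod (Measure.measurePreserving_swap.quasiMeasurePreserving.ae h2)
  have h4 := h1.swap.prod_right_ae
  have e1 : firstCoeff P a₀ ρ U G = ∫ x₁ in W, ∫ μ, (ρ * volume.real U)⁻¹ *
      ∫ z in U, firstIntegrand a₀ G x₁ μ z ∂μ.1 ∂P := by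
    refine (setIntegral_eq_integral_of_forall_compl_eq_zero fun x hx => ?_).symm
    refine integral_eq_zero_of_ae (Eventually.of_forall fun μ => ?_)
    have : ∫ z in U, firstIntegrand a₀ G x μ z ∂μ.1 = 0 :=
      setIntegral_eq_zero_of_forall_eq_zero fun z hz =>
        firstIntegrand_eq_zero ha G (fun hx' => hx (hD.ball z hz hx')) μ
    simp only [this, mul_zero, Pi.zero_apply]
  have e2 : ∫ x₁ in W, ∫ μ, (ρ * volume.real U)⁻¹ *
      ∫ z in U, firstIntegrand a₀ G x₁ μ z ∂μ.1 ∂P = ∫ x₁ in W, (volume.real U)⁻¹ *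
        ∫ q, firstField a₀ W Γ (resFst W q, x₁) ∂(P.prod (volume.restrict U)) := by
    refine integral_congr_ae ?_
    filter_upwards [h3, h4] with x hx hx'
    have e3 : (fun q : Config d × Space d => firstIntegrand a₀ G x (q.1.add (point q.2)) q.2)
        =ᵐ[P.prod (volume.restrict U)] fun q => firstField a₀ W Γ (resFst W q, x) := hx
    rw [integral_const_mul, hQ.integral_eq (F := fun μ z => firstIntegrand a₀ G x μ z) hρ.le
      ((integrable_congr e3).2 hx'), integral_congr_ae e3]
    field_simp
  rw [e1, e2, integral_const_mul, ← h1', integral_prod_symm _ h1]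

end law

end Config
end

/-! ### Exponential generating series in the density. -/

noncomputable section

section series

/-- The exponential generating series of `c`. -/
def genSeries (c : ℕ → ℝ) (x : ℝ) : ℝ := ∑' n, x ^ n / n.factorial * c n

variable {c : ℕ → ℝ} {K w : ℝ}

theorem hasSum_pow_div_factorial (x w : ℝ) :
    HasSum (fun n => x ^ n / n.factorial * w ^ n) (Real.exp (x * w)) := by
  have h := NormedSpace.expSeries_div_hasSum_exp (𝔸 := ℝ) (x * w)
  rw [← Real.exp_eq_exp_ℝ] at h
  refine h.congr_fun fun n => ?_
  rw [mul_pow]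
  ring

theorem summable_genSeries (hc : ∀ n, |c n| ≤ K * w ^ n) (x : ℝ) :
    Summable fun n => x ^ n / n.factorial * c n := by
  refine Summable.of_norm_bounded ((hasSum_pow_div_factorial |x| w).summable.mul_left K)
    fun n => ?_
  rw [Real.norm_eq_abs, abs_mul, abs_div, abs_pow, Nat.abs_cast]
  calc |x| ^ n / n.factorial * |c n| ≤ |x| ^ n / n.factorial * (K * w ^ n) := by
        gcongr
        exact hc n
    _ = _ := by ring

/-- Termwise differentiation shifts the coefficients; on bounded sets the differentiated series is
dominated by an exponential series. -/
theorem hasDerivAt_genSeries (hc : ∀ n, |c n| ≤ K * w ^ n) (hw : 0 ≤ w) (x : ℝ) :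
    HasDerivAt (genSeries c) (genSeries (fun n => c (n + 1)) x) x := by
  have hK : 0 ≤ K := by simpa using (abs_nonneg _).trans (hc 0)
  let R := |x| + 1
  -- The factor `n` makes the term `n = 0` vanish, in spite of the truncated exponent `n - 1`.
  let g' : ℕ → ℝ → ℝ := fun n y => n * y ^ (n - 1) / n.factorial * c n
  have hg' : ∀ n y, g' (n + 1) y = y ^ n / n.factorial * c (n + 1) := by
    intro n y
    simp only [g', Nat.add_sub_cancel, Nat.factorial_succ, Nat.cast_mul]
    have : ((n + 1 : ℕ) : ℝ) ≠ 0 := by positivity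
    field_simp
  let u : ℕ → ℝ := fun n => n * R ^ (n - 1) / n.factorial * (K * w ^ n)
  have hu : Summable u := by
    rw [← summable_nat_add_iff 1]
    refine ((hasSum_pow_div_factorial R w).summable.mul_left (K * w)).congr fun n => ?_
    simp only [u, Nat.add_sub_cancel, Nat.factorial_succ, Nat.cast_mul]
    have : ((n + 1 : ℕ) : ℝ) ≠ 0 := by positivity
    field_simp
    ring
  have hb : ∀ n y, y ∈ Metric.ball (0 : ℝ) R → ‖g' n y‖ ≤ u n := by
    intro n y hy
    rw [mem_ball_zero_iff, Real.norm_eq_abs] at hy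
    simp only [g', u]
    rw [Real.norm_eq_abs, abs_mul, abs_div, abs_mul, abs_pow, Nat.abs_cast, Nat.abs_cast]
    gcongr
    exact hc n
  have h1 := hasDerivAt_tsum_of_isPreconnected (g := fun n y => y ^ n / n.factorial * c n)
    (g' := g') (y₀ := 0) (y := x) hu Metric.isOpen_ball (convex_ball (0 : ℝ) R).isPreconnected
    (fun n y _ => ((hasDerivAt_pow n y).div_const _).mul_const _) hb
    (by simp [R]; positivity) (summable_genSeries hc 0) (by simp [R])
  have h2 : ∑' n, g' n x = genSeries (fun n => c (n + 1)) x := by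
    have hs : Summable fun n => g' n x :=
      Summable.of_norm_bounded hu fun n => hb n x (by simp [R])
    rw [hs.tsum_eq_zero_add, genSeries]
    simp only [hg']
    simp [g']
  rw [← h2]
  exact h1

/-- The mean value inequality, applied to `f'` and then to `f` minus its linear part. -/
theorem abs_sub_sub_le_of_deriv {f f' f'' : ℝ → ℝ} {K : ℝ}
    (h1 : ∀ x, 0 < x → HasDerivAt f (f' x) x) (h2 : ∀ x, 0 < x → HasDerivAt f' (f'' x) x)
    (hK : ∀ x, 0 < x → |f'' x| ≤ K) {x h : ℝ} (hx : 0 < x) (hxh : 0 < x + h) :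
    |f (x + h) - (f x + h * f' x)| ≤ K * h ^ 2 := by
  have hL : ∀ y ∈ Set.uIcc x (x + h), 0 < y := fun y hy =>
    (lt_min hx hxh).trans_le hy.1
  have hI : Convex ℝ (Set.uIcc x (x + h)) := convex_uIcc _ _
  have a1 : ∀ y ∈ Set.uIcc x (x + h), |f' y - f' x| ≤ K * |h| := by
    intro y hy
    have h3 := hI.norm_image_sub_le_of_norm_hasDerivWithin_le (f := f') (f' := f'') (C := K)
      (fun z hz => (h2 z (hL z hz)).hasDerivWithinAt) (fun z hz => hK z (hL z hz))
      Set.left_mem_uIcc hy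
    refine h3.trans (mul_le_mul_of_nonneg_left ?_ ((abs_nonneg _).trans (hK x hx)))
    have := Set.abs_sub_left_of_mem_uIcc hy
    rwa [add_sub_cancel_left] at this
  have h4 := hI.norm_image_sub_le_of_norm_hasDerivWithin_le (f := fun y => f y - y * f' x)
    (f' := fun y => f' y - f' x) (C := K * |h|)
    (fun z hz => ((h1 z (hL z hz)).sub (by
      simpa using (hasDerivAt_id z).mul_const (f' x))).hasDerivWithinAt) a1
    Set.left_mem_uIcc Set.right_mem_uIcc
  rw [Real.norm_eq_abs, Real.norm_eq_abs, add_sub_cancel_left, mul_assoc, ← pow_two, sq_abs] at h4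
  refine le_trans (le_of_eq ?_) h4
  congr 1
  ring

end series

variable {d : ℕ}

namespace Config

section avg

variable {W : Set (Space d)} {c : ℕ → ℝ} {K : ℝ}

theorem avg_eq (W : Set (Space d)) (c : ℕ → ℝ) (ρ : ℝ) :
    avg W c ρ = Real.exp (-(ρ * volume.real W)) * genSeries c ρ := by
  rw [avg, genSeries, ← tsum_mul_left]
  simp only [weight, mul_assoc]

theorem summable_weight_mul (hc : ∀ n, |c n| ≤ K * volume.real W ^ n) (ρ : ℝ) :
    Summable fun n => weight ρ W n * c n := by
  simp only [weight, mul_assoc]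
  exact (summable_genSeries hc ρ).mul_left _

/-- The series contributes the shifted coefficients, the exponential prefactor `-|W|` times the
original ones. The class of admissible `c` is stable under this, so the lemma can be iterated. -/
theorem hasDerivAt_avg (hc : ∀ n, |c n| ≤ K * volume.real W ^ n) (ρ : ℝ) :
    HasDerivAt (avg W c) (avg W (fun n => c (n + 1) - volume.real W * c n) ρ) ρ := by
  have e : avg W c = fun ρ => Real.exp (-(ρ * volume.real W)) * genSeries c ρ :=
    funext (avg_eq W c)
  have hc' : ∀ n, |c (n + 1)| ≤ (K * volume.real W) * volume.real W ^ n := fun n => by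
    rw [mul_assoc, ← pow_succ']
    exact hc (n + 1)
  have h1 : HasDerivAt (fun ρ => Real.exp (-(ρ * volume.real W)))
      (Real.exp (-(ρ * volume.real W)) * -volume.real W) ρ := by
    have := ((hasDerivAt_id ρ).mul_const (volume.real W)).neg.exp
    simpa using this
  rw [e]
  refine (h1.mul (hasDerivAt_genSeries hc measureReal_nonneg ρ)).congr_deriv ?_
  have h2 : genSeries (fun n => c (n + 1) - volume.real W * c n) ρ =
      genSeries (fun n => c (n + 1)) ρ - volume.real W * genSeries c ρ := by
    rw [genSeries, genSeries, genSeries, ← tsum_mul_left,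
      ← (summable_genSeries hc' ρ).tsum_sub ((summable_genSeries hc ρ).mul_left _)]
    refine tsum_congr fun n => ?_
    ring
  rw [avg_eq, h2]
  ring

theorem hasSum_weight_mul_pow (ρ : ℝ) (W : Set (Space d)) :
    HasSum (fun n => weight ρ W n * volume.real W ^ n) 1 := by
  have h := (hasSum_pow_div_factorial ρ (volume.real W)).mul_left
    (Real.exp (-(ρ * volume.real W)))
  rw [← Real.exp_add, neg_add_cancel, Real.exp_zero] at h
  refine h.congr_fun fun n => ?_
  rw [weight]
  ring

theorem avg_mono {c c' : ℕ → ℝ} {K' ρ : ℝ} (hρ : 0 ≤ ρ) (hc : ∀ n, |c n| ≤ K * volume.real W ^ n)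
    (hc' : ∀ n, |c' n| ≤ K' * volume.real W ^ n) (h : ∀ n, c n ≤ c' n) :
    avg W c ρ ≤ avg W c' ρ :=
  (summable_weight_mul hc ρ).tsum_le_tsum
    (fun n => mul_le_mul_of_nonneg_left (h n) (weight_nonneg hρ W n)) (summable_weight_mul hc' ρ)

theorem avg_pow (W : Set (Space d)) (K ρ : ℝ) :
    avg W (fun n => K * volume.real W ^ n) ρ = K := by
  have h := ((hasSum_weight_mul_pow ρ W).mul_left K).tsum_eq
  rw [mul_one] at h
  rw [avg]
  refine Eq.trans (tsum_congr fun n => ?_) h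
  ring

theorem abs_avg_le {ρ : ℝ} (hρ : 0 ≤ ρ) (hc : ∀ n, |c n| ≤ K * volume.real W ^ n) :
    |avg W c ρ| ≤ K := by
  have hK : 0 ≤ K := by simpa using (abs_nonneg _).trans (hc 0)
  have h0 : ∀ (s : ℝ), |s| = K → ∀ n, |s * volume.real W ^ n| ≤ K * volume.real W ^ n :=
    fun s hs n => by
    rw [abs_mul, hs, abs_of_nonneg (by positivity : (0 : ℝ) ≤ volume.real W ^ n)]
  have h1 := avg_mono hρ hc (h0 K (abs_of_nonneg hK)) fun n => (abs_le.1 (hc n)).2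
  have h2 := avg_mono hρ (h0 (-K) (by rw [abs_neg, abs_of_nonneg hK])) hc fun n => by
    rw [neg_mul]
    exact (abs_le.1 (hc n)).1
  rw [avg_pow] at h1 h2
  exact abs_le.2 ⟨h2, h1⟩

end avg

end Config
end

/-! ### Translations, restriction to smaller domains and subadditivity. -/

noncomputable section

variable {d : ℕ}

namespace Config

theorem points_append {n k : ℕ} (x : Fin n → Space d) (y : Fin k → Space d) :
    points (Fin.append x y) = (points x).add (points y) := by
  refine ext_val ?_
  change ∑ i, Measure.dirac (Fin.append x y i) = _
  rw [Fin.sum_univ_add]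
  simp [add, points_val]

theorem shift_add (μ ν : Config d) (x : Space d) :
    (μ.add ν).shift x = (μ.shift x).add (ν.shift x) :=
  ext_val (Measure.map_add _ _ (measurable_id.sub_const x))

theorem shift_point (z x : Space d) : (point z).shift x = point (z - x) :=
  ext_val (Measure.map_dirac' (measurable_id.sub_const x) z)

theorem shift_points {n : ℕ} (y : Fin n → Space d) (x : Space d) :
    (points y).shift x = points fun i => y i - x := by
  refine ext_val ?_
  have hm : Measurable fun y : Space d => y - x := measurable_id.sub_const x
  change (Measure.map (fun y => y - x) (∑ i, Measure.dirac (y i))) = _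
  rw [← Measure.sum_fintype, Measure.map_sum hm.aemeasurable, Measure.sum_fintype]
  simp only [Measure.map_dirac' hm]
  rfl

theorem shift_shift (μ : Config d) (x y : Space d) : (μ.shift x).shift y = μ.shift (x + y) := by
  refine ext_val ?_
  refine (Measure.map_map (measurable_id.sub_const y) (measurable_id.sub_const x)).trans ?_
  change Measure.map _ μ.1 = Measure.map _ μ.1
  congr 1
  ext1 z
  simp [sub_sub]

theorem shift_res (μ : Config d) (x : Space d) {U : Set (Space d)} (hU : MeasurableSet U) :
    (μ.res ((fun y => y - x) ⁻¹' U)).shift x = (μ.shift x).res U :=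
  ext_val (Measure.restrict_map (measurable_id.sub_const x) hU).symm

/-- The indicator function of the event that there are finitely many particles in `V`. -/
def finInd (V : Set (Space d)) : Config d → ℝ := {μ | μ.1 V ≠ ⊤}.indicator 1

theorem inv_finInd {V : Set (Space d)} (hV : MeasurableSet V) : Inv V (finInd V) := by
  intro μ z z' _ _
  have h : ∀ z, (μ.add (point z)).1 V = ⊤ ↔ μ.1 V = ⊤ := fun z => by
    rw [add_apply, point_apply z hV, ENNReal.add_eq_top]
    by_cases hz : z ∈ V <;> simp [hz]
  simp only [finInd, Set.indicator, Set.mem_ofPred_eq, ne_eq, h, Pi.one_apply]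

/-- Frozen particles in `V \ U` are coordinates of a smooth function on a power of `V`, provided
there are finitely many. Otherwise smoothness on `V` says nothing, and the factor `finInd` sets the
function to zero. -/
theorem SmoothOn.mono {U V : Set (Space d)} (hU : MeasurableSet U) (hV : MeasurableSet V)
    (hUV : U ⊆ V) {φ : Config d → ℝ} (hφ : SmoothOn V φ) :
    SmoothOn U fun μ => finInd V μ * φ μ := by
  intro μ n
  have hc : ∀ x ∈ Set.univ.pi fun _ : Fin n => U,
      (((points x).add (μ.res Uᶜ)).1 V = ⊤ ↔ μ.1 (V ∩ Uᶜ) = ⊤) := fun x hx => by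
    rw [add_apply, points_apply_of_mem hV fun i => hUV (hx i (Set.mem_univ i)),
      res_apply _ hV, ENNReal.add_eq_top]
    simp
  by_cases h : μ.1 (V ∩ Uᶜ) = ⊤
  · refine (contDiffOn_const (c := (0 : ℝ))).congr fun x hx => ?_
    simp [finInd, (hc x hx).2 h]
  · obtain ⟨k, y, hy, hμy, -⟩ := exists_points (hV.inter hU.compl) h
    have h1 : μ.res Uᶜ = (points y).add (μ.res Vᶜ) := by
      rw [← hμy, ← res_res hV, ← Set.inter_eq_left.2 (Set.compl_subset_compl.2 hUV),
        ← res_res hV.compl, res_add_res_compl hV]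
    have h2 : ContDiff ℝ (⊤ : ℕ∞) fun x : Fin n → Space d => Fin.append x y := by
      refine contDiff_pi.2 fun i => ?_
      refine Fin.addCases (fun i => ?_) (fun i => ?_) i
      · simpa using contDiff_apply ℝ (Space d) i
      · simpa using contDiff_const
    refine ((hφ μ (n + k)).comp h2.contDiffOn fun x hx => ?_).congr fun x hx => ?_
    · refine Set.mem_univ_pi.2 fun i => ?_
      refine Fin.addCases (fun i => ?_) (fun i => ?_) i
      · simpa using hUV (hx i (Set.mem_univ i))
      · simpa using (hy i).1
    · simp only [Function.comp_apply, points_append, add_assoc, ← h1]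
      simp [finInd, (hc x hx).not.2 h]

theorem IsTest.mono {P : Measure (Config d)} [SFinite P] {U V : Set (Space d)} (hU : IsOpen U)
    (hV : IsOpen V) (hUV : U ⊆ V) (hfin : ∀ᵐ μ ∂P, μ.1 V ≠ ⊤) {φ : Config d → ℝ}
    (hφ : IsTest P P V φ) : IsTest P P U (fun μ => finInd V μ * φ μ) ∧
      (fun q : Config d × Space d => rgrad (fun μ => finInd V μ * φ μ) q.1 q.2)
        =ᵐ[P.prod (volume.restrict U)] fun q => rgrad φ q.1 q.2 := by
  have hrg : (fun q : Config d × Space d => rgrad (fun μ => finInd V μ * φ μ) q.1 q.2)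
      =ᵐ[P.prod (volume.restrict U)] fun q => rgrad φ q.1 q.2 := by
    filter_upwards [Measure.quasiMeasurePreserving_fst.ae hfin,
      Measure.quasiMeasurePreserving_snd.ae (ae_restrict_mem hU.measurableSet)] with q h1 h2
    rw [rgrad_inv_mul hV h1 (hUV h2) (inv_finInd hV.measurableSet) hφ.smoothOn]
    have : (q.1.add (point q.2)).1 V ≠ ⊤ := by
      rw [add_apply, point_apply _ hV.measurableSet]
      simp [hUV h2, h1]
    simp [finInd, this]
  refine ⟨⟨hφ.smoothOn.mono hU.measurableSet hV.measurableSet hUV, ?_, ?_⟩, hrg⟩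
  · refine hφ.memLp.ae_eq ?_
    filter_upwards [hfin] with μ h
    simp [finInd, h]
  · refine (hφ.memLp_rgrad.mono_measure ?_).ae_eq hrg.symm
    exact Measure.prod_mono le_rfl (Measure.restrict_mono hUV le_rfl)

/-- The translation of a configuration with a marked point by `x`. -/
def tr (x : Space d) (q : Config d × Space d) : Config d × Space d := (q.1.shift (-x), q.2 + x)

theorem rgrad_comp_shift (φ : Config d → ℝ) (x : Space d) (q : Config d × Space d) :
    rgrad (fun μ => φ (μ.shift (-x))) q.1 q.2 = rgrad φ (tr x q).1 (tr x q).2 := by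
  simp only [rgrad, tr, shift_add, shift_point, sub_neg_eq_add, _root_.add_right_comm]

theorem measurePreserving_shift {ρ : ℝ} (hρ : 0 ≤ ρ) {P : Measure (Config d)}
    (hP : IsPoissonLaw ρ P) (x : Space d) : MeasurePreserving (fun μ => μ.shift x) P P :=
  ⟨measurable_shift x, hP.map_shift hρ x⟩

theorem measurePreserving_tr {ρ : ℝ} (hρ : 0 ≤ ρ) {P : Measure (Config d)}
    (hP : IsPoissonLaw ρ P) {U : Set (Space d)} (x : Space d) :
    MeasurePreserving (tr x) (P.prod (volume.restrict U))
      (P.prod (volume.restrict ((fun y => y - x) ⁻¹' U))) := by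
  have := hP.isProbabilityMeasure
  have h := (measurePreserving_add_right (volume : Measure (Space d)) x).restrict_preimage_emb
    (MeasurableEquiv.addRight x).measurableEmbedding ((fun y => y - x) ⁻¹' U)
  rw [← Set.preimage_comp] at h
  simp only [Function.comp_def, add_sub_cancel_right, Set.preimage_id'] at h
  exact (measurePreserving_shift hρ hP (-x)).prod h

theorem IsTest.comp_shift {ρ : ℝ} (hρ : 0 ≤ ρ) {P : Measure (Config d)}
    (hP : IsPoissonLaw ρ P) {U : Set (Space d)} (hU : MeasurableSet U) {x : Space d}
    {φ : Config d → ℝ} (hφ : IsTest P P ((fun y => y - x) ⁻¹' U) φ) :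
    IsTest P P U fun μ => φ (μ.shift (-x)) := by
  refine ⟨fun μ n => ?_, hφ.memLp.comp_measurePreserving (measurePreserving_shift hρ hP _), ?_⟩
  · have h1 : ContDiff ℝ (⊤ : ℕ∞) fun (y : Fin n → Space d) i => y i - -x :=
      contDiff_pi.2 fun i => (contDiff_apply ℝ (Space d) i).sub contDiff_const
    refine ((hφ.smoothOn (μ.shift (-x)) n).comp h1.contDiffOn fun y hy => ?_).congr fun y _ => ?_
    · exact Set.mem_univ_pi.2 fun i => by simpa using hy i (Set.mem_univ i)
    · have h2 := shift_res μ (-x) (hU.preimage (measurable_id.sub_const x)).compl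
      simp only [Set.preimage_compl, ← Set.preimage_comp, Function.comp_def, id_eq,
        sub_neg_eq_add, add_sub_cancel_right, Set.preimage_id'] at h2
      simp only [Function.comp_apply, shift_add, shift_points, h2, id_eq]
  · simp only [rgrad_comp_shift φ x]
    exact hφ.memLp_rgrad.comp_measurePreserving (measurePreserving_tr hρ hP x)

/-- The density of the dual energy, at a configuration with a marked point. -/
def dens (a₀ : Config d → Matrix (Fin d) (Fin d) ℝ) (p : Space d) (φ : Config d → ℝ)
    (q : Config d × Space d) : ℝ :=
  -(1 / 2) * inner ℝ (rgrad φ q.1 q.2) (Matrix.toEuclideanCLM (n := Fin d) (𝕜 := ℝ)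
    (coeff a₀ (q.1.add (point q.2)) q.2) (rgrad φ q.1 q.2)) + inner ℝ p (rgrad φ q.1 q.2)

/-- Stationarity: the coefficient field is translated together with the configuration. -/
theorem dens_comp_shift (a₀ : Config d → Matrix (Fin d) (Fin d) ℝ) (p : Space d)
    (φ : Config d → ℝ) (x : Space d) (q : Config d × Space d) :
    dens a₀ p (fun μ => φ (μ.shift (-x))) q = dens a₀ p φ (tr x q) := by
  have h : coeff a₀ ((tr x q).1.add (point (tr x q).2)) (tr x q).2 =
      coeff a₀ (q.1.add (point q.2)) q.2 := by
    have h1 : (tr x q).1.add (point (tr x q).2) = (q.1.add (point q.2)).shift (-x) := by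
      simp [tr, shift_add, shift_point]
    rw [h1, coeff, coeff, shift_shift, tr, _root_.add_comm, add_neg_cancel_right]
  simp only [dens, rgrad_comp_shift, h]

section law

variable {Λ : ℝ} {a₀ : Config d → Matrix (Fin d) (Fin d) ℝ} (ha : IsCoefficient Λ a₀)
  (hΛ : 0 ≤ Λ) {U W : Set (Space d)} (hD : Dom U W) {ρ : ℝ} (hρ : 0 < ρ)
  {P : Measure (Config d)} (hP : IsPoissonLaw ρ P) {p : Space d}
  {Γ : Config d × Space d → Space d}

include ha hΛ hD hρ hP

theorem USol.dens_eq (h : USol a₀ U W p Γ) {φ : Config d → ℝ} (hφ : IsTest P P U φ) :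
    Integrable (dens a₀ p φ) (P.prod (volume.restrict U)) ∧
    ∫ q, dens a₀ p φ q ∂(P.prod (volume.restrict U)) =
      1 / 2 * avg W (pairing W U p Γ) ρ - 1 / 2 * ∫ q,
        inner ℝ (rgrad φ q.1 q.2 - Γ (resFst W q)) (redCoeff a₀ W q
          (rgrad φ q.1 q.2 - Γ (resFst W q))) ∂(P.prod (volume.restrict U)) := by
  have := hP.isProbabilityMeasure
  have : IsFiniteMeasure (volume.restrict U) := ⟨by simpa using hD.fin'.lt_top⟩
  have hb := isBddField_redCoeff ha hD.meas hΛ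
  have hae : dens a₀ p φ =ᵐ[P.prod (volume.restrict U)] fun q =>
      -(1 / 2) * inner ℝ (rgrad φ q.1 q.2) (redCoeff a₀ W q (rgrad φ q.1 q.2)) +
        inner ℝ p (rgrad φ q.1 q.2) := by
    filter_upwards [ae_redCoeff_eq ha hD (hP.ae_ne_top hD.meas hD.fin)] with q hq
    rw [dens, hq]
  refine ⟨(integrable_congr hae).2 ?_, ?_⟩
  · exact ((hφ.memLp_rgrad.integrable_inner' (hb.memLp hφ.memLp_rgrad)).const_mul _).add
      ((memLp_const p).integrable_inner' hφ.memLp_rgrad)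
  · rw [integral_congr_ae hae,
      (h.isSol_law ha hΛ hD hρ hP).energy_eq hb (redCoeff_symm ha) hφ.grad,
      h.integral_inner_law ha hΛ hD hρ hP]

theorem USol.integral_dens_le (h : USol a₀ U W p Γ) {φ : Config d → ℝ} (hφ : IsTest P P U φ) :
    ∫ q, dens a₀ p φ q ∂(P.prod (volume.restrict U)) ≤ 1 / 2 * avg W (pairing W U p Γ) ρ := by
  rw [(h.dens_eq ha hΛ hD hρ hP hφ).2, sub_le_self_iff]
  exact mul_nonneg (by norm_num) (integral_nonneg fun q =>
    (sq_nonneg _).trans (redCoeff_lower ha q _))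

/-- Test functions need not attain the maximum, but their gradients approximate `Γ`, and the loss is
at most `Λ/2` times the squared distance. -/
theorem USol.exists_dens_ge (h : USol a₀ U W p Γ) {ε : ℝ} (hε : 0 < ε) :
    ∃ φ, IsTest P P U φ ∧ 1 / 2 * avg W (pairing W U p Γ) ρ - ε ≤
      ∫ q, dens a₀ p φ q ∂(P.prod (volume.restrict U)) := by
  have := hP.isProbabilityMeasure
  have hsol := h.isSol_law ha hΛ hD hρ hP
  obtain ⟨φ, hφ, hlim⟩ := hsol.grad.exists_tendsto hD.isOpen
    (hP.mecke hρ.le hD.measU hD.fin').ae_fin_mem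
  have hlim' : Tendsto (fun k => 1 / 2 * (Λ * ∫ q, ‖rgrad (φ k) q.1 q.2 - Γ (resFst W q)‖ ^ 2
      ∂(P.prod (volume.restrict U)))) atTop (𝓝 (1 / 2 * (Λ * 0))) := by
    refine (Tendsto.const_mul Λ ?_).const_mul _
    have h1 := (ENNReal.tendsto_toReal (by simp)).comp
      ((ENNReal.continuous_pow 2).tendsto _ |>.comp hlim)
    simp only [Function.comp_def, ne_eq, OfNat.ofNat_ne_zero, not_false_eq_true, zero_pow,
      ENNReal.toReal_zero] at h1
    refine h1.congr fun k => ?_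
    rw [← lintegral_enorm_sq_eq]
    refine Eq.symm ((integral_eq_lintegral_of_nonneg_ae
      (Eventually.of_forall fun q => sq_nonneg _)
      (((hφ k).memLp_rgrad.sub hsol.grad.1).1.norm.pow 2)).trans ?_)
    refine congrArg _ (lintegral_congr fun q => ?_)
    rw [ENNReal.ofReal_pow (norm_nonneg _), ofReal_norm]
    rfl
  rw [mul_zero, mul_zero] at hlim'
  obtain ⟨k, hk⟩ := (hlim'.eventually_le_const hε).exists
  refine ⟨φ k, hφ k, ?_⟩
  rw [(h.dens_eq ha hΛ hD hρ hP (hφ k)).2]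
  refine sub_le_sub_left (le_trans ?_ hk) _
  have hm := (hφ k).memLp_rgrad.sub hsol.grad.1
  rw [← integral_const_mul Λ]
  refine mul_le_mul_of_nonneg_left ?_ one_half_pos.le
  exact integral_mono (hm.integrable_inner' ((isBddField_redCoeff ha hD.meas hΛ).memLp hm))
    (((memLp_two_iff_integrable_sq_norm hm.1).1 hm).const_mul Λ)
    fun q => redCoeff_inner_le ha q _

omit hD in
/-- If `V` is tiled by translates of `U`, then the dual energy of `V` is at most the sum of those
of the translates. -/
theorem USol.avg_le_of_tiling (hD : Dom U W) (h : USol a₀ U W p Γ) {V W' : Set (Space d)}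
    (hD' : Dom V W') {Γ' : Config d × Space d → Space d} (h' : USol a₀ V W' p Γ') {ι : Type*}
    [Fintype ι] (x : ι → Space d) (hx : ∀ i, (fun y => y - x i) ⁻¹' U ⊆ V)
    (hdis : Pairwise (Function.onFun Disjoint fun i => (fun y => y - x i) ⁻¹' U))
    (hvol : volume V = Fintype.card ι * volume U) :
    avg W' (pairing W' V p Γ') ρ ≤ Fintype.card ι * avg W (pairing W U p Γ) ρ := by
  have := hP.isProbabilityMeasure
  refine le_of_forall_pos_le_add fun ε hε => ?_
  obtain ⟨φ, hφ, hle⟩ := h'.exists_dens_ge ha hΛ hD' hρ hP (half_pos hε)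
  have hm : ∀ i, Measurable fun y : Space d => y - x i := fun i => measurable_id.sub_const _
  have ho : ∀ i, IsOpen ((fun y => y - x i) ⁻¹' U) := fun i =>
    hD.isOpen.preimage (continuous_id.sub continuous_const)
  have hvU : ∀ i, volume ((fun y => y - x i) ⁻¹' U) = volume U := fun i => by
    simpa [sub_eq_add_neg] using measure_preimage_add_right volume (-x i) U
  -- By comparison of volumes, the translates cover `V` up to a null set.
  have hV : (⋃ i, (fun y => y - x i) ⁻¹' U) =ᵐ[volume] V := by
    refine ae_eq_of_subset_of_measure_ge (Set.iUnion_subset hx) ?_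
      (MeasurableSet.iUnion fun i => (ho i).measurableSet).nullMeasurableSet hD'.fin'
    rw [measure_iUnion hdis fun i => (ho i).measurableSet, tsum_fintype]
    simp only [hvU, hvol, Finset.sum_const, Finset.card_univ, nsmul_eq_mul, le_refl]
  have hsum : P.prod (volume.restrict V) =
      Measure.sum fun i => P.prod (volume.restrict ((fun y => y - x i) ⁻¹' U)) := by
    rw [← Measure.prod_sum_right, ← Measure.restrict_iUnion hdis fun i => (ho i).measurableSet,
      Measure.restrict_congr_set hV]
  have hfi := (h'.dens_eq ha hΛ hD' hρ hP hφ).1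
  rw [hsum] at hfi hle
  rw [integral_sum_measure hfi, tsum_fintype] at hle
  -- A competitor on `V`, restricted to a translate and moved back, is a competitor on `U`; the law
  -- is invariant under translations.
  have hterm : ∀ i, ∫ q, dens a₀ p φ q ∂(P.prod (volume.restrict ((fun y => y - x i) ⁻¹' U))) ≤
      1 / 2 * avg W (pairing W U p Γ) ρ := fun i => by
    obtain ⟨hψ, hrg⟩ := hφ.mono (ho i) hD'.isOpen (hx i) (hP.ae_ne_top hD'.measU hD'.fin')
    have h2 : dens a₀ p (fun μ => finInd V μ * φ μ)
        =ᵐ[P.prod (volume.restrict ((fun y => y - x i) ⁻¹' U))] dens a₀ p φ := by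
      filter_upwards [hrg] with q hq
      rw [dens, dens, hq]
    have h3 := h.integral_dens_le ha hΛ hD hρ hP (hψ.comp_shift hρ.le hP hD.measU)
    simp only [dens_comp_shift a₀ p (fun μ => finInd V μ * φ μ) (x i)] at h3
    rw [← integral_congr_ae h2, ← (measurePreserving_tr hρ.le hP (x i)).map_eq,
      integral_map (measurePreserving_tr (U := U) hρ.le hP (x i)).measurable.aemeasurable]
    · exact h3
    · rw [(measurePreserving_tr hρ.le hP (x i)).map_eq]
      refine AEStronglyMeasurable.congr (hfi.1.mono_measure (Measure.le_sum _ i)) h2.symm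
  have := hle.trans (Finset.sum_le_sum fun i _ => hterm i)
  rw [Finset.sum_const, Finset.card_univ, nsmul_eq_mul] at this
  linarith

end law

end Config

end

/-! ### Matrices, cubes and the finite-volume quantities. -/

noncomputable section

variable {d : ℕ}

section matrix

theorem bil_symm {M : Matrix (Fin d) (Fin d) ℝ} (hM : M.IsSymm) (p q : Space d) :
    bil M p q = bil M q p := by
  rw [bil, bil, Matrix.dotProduct_mulVec, ← Matrix.mulVec_transpose, hM.eq, dotProduct_comm]

theorem bil_one (q : Space d) : bil 1 q q = ‖q‖ ^ 2 := by
  rw [bil_eq_inner, map_one]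
  exact real_inner_self_eq_norm_sq q

theorem bil_sub_apply (A B : Matrix (Fin d) (Fin d) ℝ) (p q : Space d) :
    bil (A - B) p q = bil A p q - bil B p q := by
  simp [bil, Matrix.sub_mulVec]

theorem bil_smul_apply (c : ℝ) (A : Matrix (Fin d) (Fin d) ℝ) (p q : Space d) :
    bil (c • A) p q = c * bil A p q := by
  simp [bil, Matrix.smul_mulVec]

theorem posSemidef_of_bil {M : Matrix (Fin d) (Fin d) ℝ} (hM : M.IsSymm)
    (h : ∀ q, 0 ≤ bil M q q) : M.PosSemidef :=
  Matrix.PosSemidef.of_dotProduct_mulVec_nonneg (by simpa [Matrix.IsHermitian] using hM.eq)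
    fun x => by simpa [bil] using h (WithLp.toLp 2 x)

/-- A symmetric map `v` of Euclidean space is given by a symmetric matrix. -/
theorem exists_matrix_of_symm {v : Space d → Space d}
    (hv : ∀ p q, inner ℝ p (v q) = inner ℝ q (v p)) :
    ∃ M : Matrix (Fin d) (Fin d) ℝ, M.IsSymm ∧ ∀ p q, bil M p q = inner ℝ p (v q) := by
  have he : ∀ (j : Fin d) (w : Space d), inner ℝ (EuclideanSpace.single j (1 : ℝ)) w = w j :=
    fun j w => by simp [EuclideanSpace.inner_single_left]
  refine ⟨Matrix.of fun i j => v (EuclideanSpace.single j 1) i, ?_, fun p q => ?_⟩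
  · ext i j
    have := hv (EuclideanSpace.single j 1) (EuclideanSpace.single i 1)
    simp only [he] at this
    exact this
  -- Symmetry alone forces `v` to be linear: the `j`-th coordinate of `v p` is the pairing of `p`
  -- with `v` at the `j`-th basis vector.
  · have h1 : ∀ j, ∑ i, p i * v (EuclideanSpace.single j 1) i = v p j := fun j => by
      rw [← he j (v p), ← hv, PiLp.inner_apply]
      exact Finset.sum_congr rfl fun i _ => by simp [mul_comm]
    rw [hv, PiLp.inner_apply]
    simp only [bil, dotProduct, Matrix.mulVec, Matrix.of_apply, Finset.mul_sum]
    rw [Finset.sum_comm]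
    refine Finset.sum_congr rfl fun j _ => ?_
    simp only [← mul_assoc, ← Finset.sum_mul, h1]
    simp

section dual

variable {M : Matrix (Fin d) (Fin d) ℝ} {Λ : ℝ} (hl : ∀ q, ‖q‖ ^ 2 ≤ Λ * bil M q q)

include hl

theorem isUnit_det_of_bil : IsUnit M.det := by
  refine isUnit_iff_ne_zero.2 fun h => ?_
  obtain ⟨v, hv, h0⟩ := Matrix.exists_mulVec_eq_zero_iff.2 h
  have h1 := hl (WithLp.toLp 2 v)
  rw [bil, h0, dotProduct_zero, mul_zero] at h1
  exact hv (by simpa using pow_eq_zero_iff two_ne_zero |>.1 (h1.antisymm (sq_nonneg _)))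

theorem exists_bil_inv_eq (q : Space d) :
    ∃ w, q = Matrix.toEuclideanCLM (n := Fin d) (𝕜 := ℝ) M w ∧ ∀ p, bil M⁻¹ p q = inner ℝ p w := by
  refine ⟨Matrix.toEuclideanCLM (n := Fin d) (𝕜 := ℝ) M⁻¹ q, ?_, fun p => bil_eq_inner _ p q⟩
  have h := map_mul (Matrix.toEuclideanCLM (n := Fin d) (𝕜 := ℝ)) M M⁻¹
  rw [Matrix.mul_nonsing_inv _ (isUnit_det_of_bil hl), map_one] at h
  exact congrArg (fun T : Space d →L[ℝ] Space d => T q) h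

/-- With `q = M w`, nonnegativity of the form at `w - q` gives `w · q ≥ 2 ‖q‖² - q · M q ≥ ‖q‖²`. -/
theorem posSemidef_inv_sub_one (hM : M.IsSymm) (hΛ : 0 < Λ) (hu : ∀ q, bil M q q ≤ ‖q‖ ^ 2) :
    (M⁻¹ - 1).PosSemidef := by
  refine posSemidef_of_bil (hM.inv.sub Matrix.isSymm_one) fun q => ?_
  obtain ⟨w, hw, h⟩ := exists_bil_inv_eq hl q
  have h0 : 0 ≤ Λ * bil M (w - q) (w - q) := (sq_nonneg _).trans (hl _)
  have h1 := nonneg_of_mul_nonneg_right h0 hΛ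
  have h2 := hu q
  have h3 := bil_symm hM q w
  rw [bil_sub_apply, h, bil_one, ← real_inner_self_eq_norm_sq]
  rw [bil_eq_inner, map_sub, ← hw] at h1
  rw [bil_eq_inner, ← real_inner_self_eq_norm_sq] at h2
  rw [bil_eq_inner, bil_eq_inner, ← hw] at h3
  simp only [inner_sub_left, inner_sub_right] at h1
  have h4 := real_inner_comm w q
  linarith

/-- With `q = M w`, the bound `‖w‖² ≤ Λ w · q` is inserted into `0 ≤ ‖w - Λ q‖²`. -/
theorem posSemidef_smul_one_sub_inv (hM : M.IsSymm) (hΛ : 0 < Λ) :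
    (Λ • (1 : Matrix (Fin d) (Fin d) ℝ) - M⁻¹).PosSemidef := by
  refine posSemidef_of_bil ((Matrix.isSymm_one.smul Λ).sub hM.inv) fun q => ?_
  obtain ⟨w, hw, h⟩ := exists_bil_inv_eq hl q
  have h1 := hl w
  have h2 := norm_sub_sq_real w (Λ • q)
  have h3 := sq_nonneg ‖w - Λ • q‖
  rw [bil_sub_apply, bil_smul_apply, h, bil_one]
  rw [bil_eq_inner, ← hw] at h1
  rw [h2, inner_smul_right, norm_smul, mul_pow, Real.norm_eq_abs, sq_abs] at h3
  rw [real_inner_comm]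
  refine nonneg_of_mul_nonneg_right ?_ hΛ
  nlinarith

end dual

/-- The quadratic forms converge by monotonicity, hence the entries by polarization; the lower bound
passes to the limit, which is therefore invertible, and inversion is continuous there. -/
theorem exists_tendsto_inv_of_antitone {M : ℕ → Matrix (Fin d) (Fin d) ℝ} {Λ : ℝ} (hΛ : 0 < Λ)
    (hM : ∀ m, (M m).IsSymm) (hl : ∀ m q, ‖q‖ ^ 2 ≤ Λ * bil (M m) q q)
    (hmono : ∀ q, Antitone fun m => bil (M m) q q) :
    ∃ A : Matrix (Fin d) (Fin d) ℝ, Tendsto (fun m => (M m)⁻¹) atTop (𝓝 A) ∧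
      ∀ q, Tendsto (fun m => bil (M m) q q) atTop (𝓝 (bil A⁻¹ q q)) := by
  have hc : ∀ q, ∃ l, Tendsto (fun m => bil (M m) q q) atTop (𝓝 l) := fun q =>
    ⟨_, tendsto_atTop_ciInf (hmono q) ⟨0, by
      rintro _ ⟨m, rfl⟩
      exact nonneg_of_mul_nonneg_right ((sq_nonneg _).trans (hl m q)) hΛ⟩⟩
  choose l hlim using hc
  let e : Fin d → Space d := fun i => EuclideanSpace.single i 1
  have hpol : ∀ m i j, M m i j =
      1 / 2 * (bil (M m) (e i + e j) (e i + e j) - bil (M m) (e i) (e i) -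
        bil (M m) (e j) (e j)) := fun m i j => by
    have h1 : bil (M m) (e i) (e j) = M m i j := by simp [bil, e]
    have h2 := bil_symm (hM m) (e i) (e j)
    have h3 : bil (M m) (e i + e j) (e i + e j) = bil (M m) (e i) (e i) + bil (M m) (e i) (e j) +
        (bil (M m) (e j) (e i) + bil (M m) (e j) (e j)) := by
      simp [bil, Matrix.mulVec_add, add_dotProduct, dotProduct_add]
      ring
    rw [h3, ← h2, ← h1]
    ring
  have hL : Tendsto M atTop (𝓝 (Matrix.of fun i j =>
      1 / 2 * (l (e i + e j) - l (e i) - l (e j)))) := by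
    refine tendsto_pi_nhds.2 fun i => tendsto_pi_nhds.2 fun j => ?_
    simp only [hpol]
    exact (((hlim _).sub (hlim _)).sub (hlim _)).const_mul _
  generalize (Matrix.of fun i j => 1 / 2 * (l (e i + e j) - l (e i) - l (e j))) = N at hL
  have hb : ∀ q, Tendsto (fun m => bil (M m) q q) atTop (𝓝 (bil N q q)) := fun q =>
    (Continuous.dotProduct continuous_const
      (Continuous.matrix_mulVec continuous_id continuous_const)).tendsto N |>.comp hL
  have hN : IsUnit N.det := isUnit_det_of_bil (Λ := Λ) fun q =>
    ge_of_tendsto' ((hb q).const_mul Λ) fun m => hl m q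
  refine ⟨N⁻¹, ?_, fun q => by rw [Matrix.nonsing_inv_nonsing_inv _ hN]; exact hb q⟩
  simp only [Matrix.inv_def, Ring.inverse_eq_inv']
  exact (((continuous_id.matrix_det.tendsto N).comp hL).inv₀ hN.ne_zero).smul
    ((continuous_id.matrix_adjugate.tendsto N).comp hL)

end matrix

section cube

theorem volume_cube (d m : ℕ) : volume (cube d m) = ENNReal.ofReal (3 ^ m) ^ d := by
  have h : cube d m = (WithLp.ofLp : Space d → Fin d → ℝ) ⁻¹'
      Set.univ.pi fun _ => Set.Ioo (-((3 : ℝ) ^ m / 2)) ((3 : ℝ) ^ m / 2) := by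
    ext x
    simp [cube]
  rw [h, (PiLp.volume_preserving_ofLp (Fin d)).measure_preimage
    (MeasurableSet.univ_pi fun _ => measurableSet_Ioo).nullMeasurableSet, Real.volume_pi_Ioo]
  simp

/-- The next cube serves as `W`: its margin around `□_m` is `3 ^ m ≥ 1`, more than the range `1/2`
of the coefficients. -/
theorem dom_cube (d m : ℕ) : Config.Dom (cube d m) (cube d (m + 1)) := by
  have ho : ∀ m, IsOpen (cube d m) := fun m => by
    rw [cube, Set.ofPred_forall]
    exact isOpen_iInter_of_finite fun i => isOpen_Ioo.preimage (by fun_prop)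
  have h3 : (1 : ℝ) ≤ 3 ^ m := one_le_pow₀ (by norm_num)
  refine ⟨ho m, (ho _).measurableSet, fun x hx i => ?_, ?_, ?_, ?_, ?_, fun z hz x hx i => ?_⟩
  · have := hx i
    rw [Set.mem_Ioo, pow_succ] at *
    constructor <;> linarith
  · simp [volume_cube]
  · rw [volume_cube]
    exact pow_ne_zero _ (by simp)
  · intro x hx y hy s t hs ht hst i
    exact convex_Ioo _ _ (hx i) (hy i) hs ht hst
  · have hb : Bornology.IsBounded (Set.univ.pi fun _ : Fin d =>
        Set.Ioo (-((3 : ℝ) ^ m / 2)) ((3 : ℝ) ^ m / 2)) :=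
      Bornology.IsBounded.pi fun _ => Metric.isBounded_Ioo _ _
    refine ((PiLp.antilipschitzWith_ofLp 2 (fun _ : Fin d => ℝ)).isBounded_preimage hb).subset ?_
    exact fun x hx i _ => hx i
  · have h1 := (PiLp.norm_apply_le (x - z) i).trans_lt (mem_ball_iff_norm.1 hx)
    rw [Real.norm_eq_abs, abs_lt, PiLp.sub_apply] at h1
    have := hz i
    rw [Set.mem_Ioo, pow_succ] at *
    constructor <;> linarith

/-- The centers of the cubes of size `3^m` which tile the cube of size `3^{m+1}`. -/
def center (m : ℕ) (k : Fin d → Fin 3) : Space d :=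
  WithLp.toLp 2 fun i => 3 ^ m * (((k i : ℕ) : ℝ) - 1)

theorem preimage_sub_center_subset (m : ℕ) (k : Fin d → Fin 3) :
    (fun y => y - center m k) ⁻¹' cube d m ⊆ cube d (m + 1) := by
  intro y hy i
  have h := hy i
  have h3 : (0 : ℝ) < 3 ^ m := by positivity
  simp only [center, PiLp.sub_apply, Set.mem_Ioo, pow_succ] at h ⊢
  generalize k i = c at h
  fin_cases c <;> norm_num at h <;> constructor <;> linarith

theorem disjoint_preimage_sub_center (m : ℕ) :
    Pairwise (Function.onFun Disjoint fun k : Fin d → Fin 3 =>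
      (fun y => y - center m k) ⁻¹' cube d m) := by
  intro k k' hk
  refine Set.disjoint_left.2 fun y hy hy' => hk (funext fun i => ?_)
  have h := hy i
  have h' := hy' i
  have h3 : (0 : ℝ) < 3 ^ m := by positivity
  simp only [center, PiLp.sub_apply, Set.mem_Ioo] at h h'
  generalize k i = c at h
  generalize k' i = c' at h'
  fin_cases c <;> fin_cases c' <;> norm_num at h h' ⊢ <;> linarith

end cube

namespace Config

section law

variable {Λ : ℝ} {a₀ : Config d → Matrix (Fin d) (Fin d) ℝ} (ha : IsCoefficient Λ a₀)
  (hΛ : 0 < Λ)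

/-- The value `q · ā_*(U, ρ)⁻¹ q` of the dual problem, if `Γ` is the solution for `q`. -/
def dualVal (W U : Set (Space d)) (q : Space d) (Γ : Config d × Space d → Space d) (ρ : ℝ) : ℝ :=
  (volume.real U)⁻¹ * avg W (pairing W U q Γ) ρ

include ha hΛ

theorem USol.dualVal_cube_succ_le {ρ : ℝ} (hρ : 0 < ρ) {P : Measure (Config d)}
    (hP : IsPoissonLaw ρ P) {m : ℕ} {q : Space d} {Γ Γ' : Config d × Space d → Space d}
    (h : USol a₀ (cube d m) (cube d (m + 1)) q Γ)
    (h' : USol a₀ (cube d (m + 1)) (cube d (m + 2)) q Γ') :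
    dualVal (cube d (m + 2)) (cube d (m + 1)) q Γ' ρ ≤
      dualVal (cube d (m + 1)) (cube d m) q Γ ρ := by
  have hcard : Fintype.card (Fin d → Fin 3) = 3 ^ d := by simp
  have hvol : volume (cube d (m + 1)) =
      Fintype.card (Fin d → Fin 3) * volume (cube d m) := by
    rw [hcard, volume_cube, volume_cube, pow_succ, mul_comm, ENNReal.ofReal_mul (by norm_num),
      mul_pow]
    simp
  have h1 := h.avg_le_of_tiling ha hΛ.le hρ hP (dom_cube d m) (dom_cube d (m + 1)) h' (center m)
    (preimage_sub_center_subset m) (disjoint_preimage_sub_center m) hvol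
  have hpos : 0 < volume.real (cube d m) :=
    ENNReal.toReal_pos (dom_cube d m).pos (dom_cube d m).fin'
  rw [dualVal, dualVal, measureReal_def, hvol, ENNReal.toReal_mul, ← measureReal_def, hcard,
    ENNReal.toReal_natCast, inv_mul_le_iff₀ (by positivity)]
  rw [hcard] at h1
  refine h1.trans_eq ?_
  field_simp

variable {U W : Set (Space d)} (hD : Dom U W)

include hD

theorem USol.abs_pairing_le {q : Space d} {Γ : Config d × Space d → Space d}
    (h : USol a₀ U W q Γ) (n : ℕ) :
    |pairing W U q Γ n| ≤ ‖q‖ ^ 2 * volume.real U * volume.real W ^ n := by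
  rw [abs_of_nonneg (h.pairing_nonneg ha hΛ.le hD n), mul_assoc]
  exact h.pairing_le ha hΛ.le hD n

theorem USol.dualVal_bounds {ρ : ℝ} (hρ : 0 ≤ ρ) {q : Space d}
    {Γ : Config d × Space d → Space d} (h : USol a₀ U W q Γ) :
    dualVal W U q Γ ρ ≤ ‖q‖ ^ 2 ∧ ‖q‖ ^ 2 ≤ Λ * dualVal W U q Γ ρ := by
  have hpos : 0 < volume.real U := ENNReal.toReal_pos hD.pos hD.fin'
  have hc := h.abs_pairing_le ha hΛ hD
  constructor
  · rw [dualVal, inv_mul_le_iff₀ hpos]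
    refine (le_abs_self _).trans ((abs_avg_le hρ hc).trans_eq (mul_comm _ _))
  · have h1 := avg_mono (W := W) (K := ‖q‖ ^ 2 / Λ * volume.real U) hρ (fun n => ?_) hc
      (c := fun n => ‖q‖ ^ 2 / Λ * volume.real U * volume.real W ^ n) fun n => ?_
    · rw [avg_pow] at h1
      rw [div_mul_eq_mul_div, div_le_iff₀' hΛ] at h1
      rw [dualVal, mul_left_comm, le_inv_mul_iff₀ hpos]
      linarith
    · exact (abs_of_nonneg (by positivity)).le
    · have := h.le_pairing ha hΛ.le hD hΛ n
      rw [← div_le_iff₀' hΛ] at this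
      exact (le_of_eq (by ring)).trans this

/-- The fields `Γ q` are chosen separately for each `q`, so linearity in `q` is not known
beforehand; it follows from the symmetry of the pairings. -/
theorem exists_dualMatrix {ρ : ℝ} (hρ : 0 < ρ) {P : Measure (Config d)}
    (hP : IsPoissonLaw ρ P) {Γ : Space d → Config d × Space d → Space d}
    (h : ∀ q, USol a₀ U W q (Γ q)) : ∃ M : Matrix (Fin d) (Fin d) ℝ, M.IsSymm ∧
      ∀ q, bil M q q = dualVal W U q (Γ q) ρ := by
  have := hP.isProbabilityMeasure
  have : IsFiniteMeasure (volume.restrict U) := isFiniteMeasure_restrict.2 hD.fin'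
  have hi : ∀ p q, inner ℝ p ((volume.real U)⁻¹ • ∫ y, Γ q (resFst W y)
      ∂(P.prod (volume.restrict U))) = (volume.real U)⁻¹ * avg W (pairing W U p (Γ q)) ρ :=
    fun p q => by
      rw [inner_smul_right, ← (h q).integral_inner_law ha hΛ.le hD hρ hP p, integral_inner]
      exact ((h q).isSol_law ha hΛ.le hD hρ hP).grad.1.integrable (by norm_num)
  obtain ⟨M, hM, hb⟩ := exists_matrix_of_symm (v := fun q => (volume.real U)⁻¹ •
      ∫ y, Γ q (resFst W y) ∂(P.prod (volume.restrict U))) fun p q => by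
    rw [hi, hi]
    congr 2
    exact funext fun n => (h p).pairing_comm ha hΛ.le hD (h q) n
  exact ⟨M, hM, fun q => (hb q q).trans (hi q q)⟩

/-- The second derivative in the density is the average of second differences of the pairings, which
`USol.quad` bounds by a multiple of `|U| |W|ⁿ`. Dividing by `|U|` leaves a constant without
reference to the domains. -/
theorem USol.taylor {q : Space d} {Γ : Config d × Space d → Space d} (h : USol a₀ U W q Γ)
    {ρ t : ℝ} (hρ : 0 < ρ) (ht : 0 < ρ + t) :
    |dualVal W U q Γ (ρ + t) - (dualVal W U q Γ ρ + t * ((volume.real U)⁻¹ *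
      avg W (fun n => pairing W U q Γ (n + 1) - volume.real W * pairing W U q Γ n) ρ))| ≤
      quadConst (4 * Λ) * volume.real (Metric.ball (0 : Space d) (1 / 2)) ^ 2 * ‖q‖ ^ 2 *
        t ^ 2 := by
  have hpos : 0 < volume.real U := ENNReal.toReal_pos hD.pos hD.fin'
  have hc := h.abs_pairing_le ha hΛ hD
  have hc1 : ∀ n, |pairing W U q Γ (n + 1) - volume.real W * pairing W U q Γ n| ≤
      2 * (‖q‖ ^ 2 * volume.real U) * volume.real W * volume.real W ^ n := fun n => by
    refine (abs_sub _ _).trans ?_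
    rw [abs_mul, abs_of_pos hD.pos']
    have h1 := hc (n + 1)
    have h2 := mul_le_mul_of_nonneg_left (hc n) hD.pos'.le
    rw [pow_succ (volume.real W)] at h1
    linarith
  refine abs_sub_sub_le_of_deriv (fun x _ => (hasDerivAt_avg hc x).const_mul _)
    (fun x _ => (hasDerivAt_avg hc1 x).const_mul _) (fun x hx => ?_) hρ ht
  rw [abs_mul, abs_inv, abs_of_pos hpos, inv_mul_le_iff₀ hpos]
  refine (abs_avg_le (K := quadConst (4 * Λ) * (volume.real (Metric.ball (0 : Space d) (1 / 2)) ^ 2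
    * ‖q‖ ^ 2 * volume.real U)) hx.le fun n => ?_).trans_eq (by ring)
  refine le_trans (le_of_eq ?_) ((h.quad ha hΛ.le hD n).trans_eq (by ring))
  ring_nf

end law

end Config

end

/-! ### Passage to the limit and the theorem. -/

noncomputable section

/-- A pointwise limit of functions with uniform first order expansions is `C^{1,1}`, and the
derivatives converge. -/
theorem exists_deriv_of_uniform_taylor {F D : ℕ → ℝ → ℝ} {f : ℝ → ℝ} {K : ℝ} (hK : 0 ≤ K)
    (hF : ∀ x, 0 < x → Tendsto (fun m => F m x) atTop (𝓝 (f x)))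
    (hD : ∀ m x h, 0 < x → 0 < x + h → |F m (x + h) - (F m x + h * D m x)| ≤ K * h ^ 2) :
    ∃ c : ℝ → ℝ, (∀ x, 0 < x → Tendsto (fun m => D m x) atTop (𝓝 (c x))) ∧
      (∀ x h, 0 < x → 0 < x + h → |f (x + h) - (f x + h * c x)| ≤ K * h ^ 2) ∧
      (∀ x, 0 < x → HasDerivAt f (c x) x) ∧
      ∀ x y, 0 < x → 0 < y → |c y - c x| ≤ 2 * K * |y - x| := by
  have hlim : ∀ x, ∃ l, 0 < x → Tendsto (fun m => D m x) atTop (𝓝 l) := fun x => by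
    by_cases hx : 0 < x
    swap
    · exact ⟨0, fun h => absurd h hx⟩
    refine (cauchySeq_tendsto_of_complete (Metric.cauchySeq_iff'.2 fun ε hε => ?_)).imp
      fun l hl _ => hl
    -- `D m x` is within `K * h` of the difference quotient of `F m` with increment `h`. For fixed
    -- `h` the quotients converge, so it suffices that the two errors together stay below `ε / 2`.
    obtain ⟨h, hh, hKh⟩ : ∃ h : ℝ, 0 < h ∧ 4 * (K * h) < ε := by
      refine ⟨ε / (4 * (K + 1)), by positivity, ?_⟩
      have : 4 * (K * (ε / (4 * (K + 1)))) = ε * (K / (K + 1)) := by field_simp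
      rw [this]
      exact mul_lt_of_lt_one_right hε ((div_lt_one (by positivity)).2 (by linarith))
    have hg : CauchySeq fun m => F m (x + h) - F m x :=
      ((hF _ (by positivity)).sub (hF x hx)).cauchySeq
    obtain ⟨N, hN⟩ := Metric.cauchySeq_iff'.1 hg (ε / 2 * h) (by positivity)
    refine ⟨N, fun n hn => ?_⟩
    have h1 := abs_le.1 (hD n x h hx (by positivity))
    have h2 := abs_le.1 (hD N x h hx (by positivity))
    have h3 := abs_lt.1 (hN n hn)
    rw [Real.dist_eq, ← mul_lt_mul_iff_left₀ hh, ← abs_of_pos hh, ← abs_mul, abs_of_pos hh, abs_lt]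
    have h4 := mul_lt_mul_of_pos_right hKh hh
    constructor <;> nlinarith
  choose c hc using hlim
  have htay : ∀ x h, 0 < x → 0 < x + h → |f (x + h) - (f x + h * c x)| ≤ K * h ^ 2 :=
    fun x h hx hxh => le_of_tendsto' ((hF _ hxh).sub ((hF x hx).add ((hc x hx).const_mul h))).abs
      fun m => hD m x h hx hxh
  refine ⟨c, hc, htay, fun x hx => ?_, fun x y hx hy => ?_⟩
  · rw [hasDerivAt_iff_isLittleO_nhds_zero]
    refine Asymptotics.IsBigO.trans_isLittleO (g := fun h : ℝ => h ^ 2) ?_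
      (Asymptotics.isLittleO_pow_id one_lt_two)
    refine Asymptotics.IsBigO.of_bound K ?_
    filter_upwards [lt_mem_nhds (neg_lt_zero.2 hx)] with h hh
    rw [Real.norm_eq_abs, Real.norm_eq_abs, abs_of_nonneg (sq_nonneg h), smul_eq_mul, sub_sub]
    exact htay x h hx (by linarith)
  · rcases eq_or_ne x y with rfl | hne
    · simp
    -- Adding the expansions at `x` and at `y`, with opposite increments, eliminates `f`.
    have h1 := abs_le.1 (htay x (y - x) hx (by linarith))
    have h2 := abs_le.1 (htay y (x - y) hy (by linarith))
    rw [add_sub_cancel] at h1 h2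
    refine le_of_mul_le_mul_right ?_ (abs_pos.2 (sub_ne_zero.2 hne.symm))
    rw [← abs_mul, mul_assoc, ← pow_two, sq_abs, abs_le]
    constructor <;> nlinarith

variable {d : ℕ}

theorem IsCoefficient.mono {Λ Λ' : ℝ} {a₀ : Config d → Matrix (Fin d) (Fin d) ℝ}
    (ha : IsCoefficient Λ a₀) (h : Λ ≤ Λ') : IsCoefficient Λ' a₀ := by
  refine ⟨ha.measurable, ha.symm, ha.lower, fun μ => ?_, ha.finite_range⟩
  have := (ha.upper μ).add (Matrix.PosSemidef.one.smul (sub_nonneg.2 h))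
  convert this using 1
  rw [sub_smul]
  abel

/-- For `d ≥ 1` the bounds on the coefficient force `1 ≤ Λ`; for `d = 0` all matrices agree. Thus
`Λ` can be replaced by the positive number `max Λ 1`. -/
theorem IsCoefficient.smul_one_eq {Λ : ℝ} {a₀ : Config d → Matrix (Fin d) (Fin d) ℝ}
    (ha : IsCoefficient Λ a₀) :
    max Λ 1 • (1 : Matrix (Fin d) (Fin d) ℝ) = Λ • (1 : Matrix (Fin d) (Fin d) ℝ) := by
  rcases isEmpty_or_nonempty (Fin d) with _ | ⟨⟨i⟩⟩
  · exact Subsingleton.elim _ _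
  have h1 := Config.redCoeff_lower ha (W := ∅) (Config.empty, 0) (EuclideanSpace.single i 1)
  have h2 := Config.redCoeff_inner_le ha (W := ∅) (Config.empty, 0) (EuclideanSpace.single i 1)
  have h3 := h1.trans h2
  simp only [PiLp.norm_single, norm_one, one_pow, mul_one] at h3
  rw [max_eq_left h3]

theorem Config.quadConst_nonneg {L : ℝ} (hL : 0 ≤ L) : 0 ≤ quadConst L := by
  unfold quadConst
  positivity

end

theorem theorem2p1 (d : ℕ) (Λ r : ℝ) :
    ∃ C : ℝ, ∀ a₀ : Config d → Matrix (Fin d) (Fin d) ℝ, IsCoefficient Λ a₀ →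
      ∀ P : ℝ → Measure (Config d), (∀ ρ, 0 < ρ → IsPoissonLaw ρ (P ρ)) →
      ∃ (aStar : ℕ → ℝ → Matrix (Fin d) (Fin d) ℝ) (aBar : ℝ → Matrix (Fin d) (Fin d) ℝ),
        -- `aStar m ρ` is `ā_*(□_m, ρ)`, and `aBar ρ` is the bulk diffusion matrix `ā(ρ)`
        (∀ m ρ, 0 < ρ → IsDualMatrix Λ (P ρ) a₀ ρ (cube d m) (aStar m ρ)) ∧
        (∀ ρ, 0 < ρ → Tendsto (fun m => aStar m ρ) atTop (𝓝 (aBar ρ))) ∧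
        ∀ q : Space d, ‖q‖ = r →
          -- the optimizers `ψ_m` exist, normalized by `E[ψ_m | μ(□_m), μ|_{□_m^c}] = 0`
          (∀ m ρ₀, 0 < ρ₀ → ∃ ψ G, IsOptimizer (P ρ₀) a₀ ρ₀ (cube d m) q ψ G ∧
            (P ρ₀)[ψ | outerAlgebra (cube d m)] =ᵐ[P ρ₀] 0) ∧
          ∃ c₁ : ℝ → ℝ,
            -- the limit defining `c₁` exists, and the integrals converge absolutely
            (∀ ρ₀, 0 < ρ₀ → ∀ (ψ : ℕ → Config d → ℝ) (G : ℕ → Config d → Space d → Space d),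
              (∀ m, IsOptimizer (P ρ₀) a₀ ρ₀ (cube d m) q (ψ m) (G m)) →
              (∀ m, ∫⁻ x₁ : Space d, ∫⁻ μ, ∫⁻ z in cube d m,
                ‖firstIntegrand a₀ (G m) x₁ μ z‖ₑ ∂μ.1 ∂(P ρ₀) < ⊤) ∧
              Tendsto (fun m => firstCoeff (P ρ₀) a₀ ρ₀ (cube d m) (G m)) atTop
                (𝓝 (c₁ ρ₀))) ∧
            -- the expansion, with a constant depending only on `d`, `Λ` and `|q|`
            (∀ ρ₀ ρ, 0 < ρ₀ → 0 < ρ₀ + ρ →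
              |bil (aBar (ρ₀ + ρ))⁻¹ q q - (bil (aBar ρ₀)⁻¹ q q + ρ * c₁ ρ₀)| ≤ C * ρ ^ 2) ∧
            -- `C^{1,1}` regularity, with derivative `c₁`
            (∀ ρ₀, 0 < ρ₀ → HasDerivAt (fun ρ => bil (aBar ρ)⁻¹ q q) (c₁ ρ₀) ρ₀) ∧
            (∀ ρ₀ ρ₁, 0 < ρ₀ → 0 < ρ₁ → |c₁ ρ₁ - c₁ ρ₀| ≤ C * |ρ₁ - ρ₀|) := by
  have hL : 0 < max Λ 1 := lt_max_of_lt_right one_pos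
  have hK : 0 ≤ Config.quadConst (4 * max Λ 1) *
      volume.real (Metric.ball (0 : Space d) (1 / 2)) ^ 2 * r ^ 2 :=
    mul_nonneg (mul_nonneg (Config.quadConst_nonneg (by positivity)) (sq_nonneg _)) (sq_nonneg _)
  -- The factor `2` comes from the Lipschitz bound for `c₁`; the expansion holds with half of this
  -- constant.
  refine ⟨2 * (Config.quadConst (4 * max Λ 1) *
      volume.real (Metric.ball (0 : Space d) (1 / 2)) ^ 2 * r ^ 2), fun a₀ ha₀ P hP => ?_⟩
  have ha := ha₀.mono (le_max_left Λ 1)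
  have hD := dom_cube d
  -- The fields are chosen before the density: this is what makes the finite-volume quantities
  -- analytic in `ρ`.
  choose Γ hΓ using fun m q => Config.exists_uSol ha hL.le (hD m) q
  -- `M m ρ` represents the dual value and is the inverse of `ā_*(□_m, ρ)`; for `ρ ≤ 0` it is an
  -- arbitrary default.
  have hM : ∀ m ρ, ∃ M : Matrix (Fin d) (Fin d) ℝ, 0 < ρ → M.IsSymm ∧ ∀ q,
      bil M q q = Config.dualVal (cube d (m + 1)) (cube d m) q (Γ m q) ρ := fun m ρ => by
    by_cases hρ : 0 < ρ
    · exact (Config.exists_dualMatrix ha hL (hD m) hρ (hP ρ hρ) (hΓ m)).imp fun M h _ => h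
    · exact ⟨0, fun h => absurd h hρ⟩
  choose M hM using hM
  have hl : ∀ m ρ, 0 < ρ → ∀ q, ‖q‖ ^ 2 ≤ max Λ 1 * bil (M m ρ) q q := fun m ρ hρ q => by
    rw [(hM m ρ hρ).2]
    exact ((hΓ m q).dualVal_bounds ha hL (hD m) hρ.le).2
  have hlim : ∀ ρ, ∃ A : Matrix (Fin d) (Fin d) ℝ, 0 < ρ →
      Tendsto (fun m => (M m ρ)⁻¹) atTop (𝓝 A) ∧
      ∀ q, Tendsto (fun m => bil (M m ρ) q q) atTop (𝓝 (bil A⁻¹ q q)) := fun ρ => by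
    by_cases hρ : 0 < ρ
    · refine (exists_tendsto_inv_of_antitone hL (fun m => (hM m ρ hρ).1) (fun m => hl m ρ hρ)
        fun q => antitone_nat_of_succ_le fun m => ?_).imp fun A h _ => h
      rw [(hM m ρ hρ).2, (hM (m + 1) ρ hρ).2]
      exact (hΓ m q).dualVal_cube_succ_le ha hL hρ (hP ρ hρ) (hΓ (m + 1) q)
    · exact ⟨0, fun h => absurd h hρ⟩
  choose A hA using hlim
  refine ⟨fun m ρ => (M m ρ)⁻¹, A, fun m ρ hρ => ?_, fun ρ hρ => (hA ρ hρ).1, fun q hq => ?_⟩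
  · refine ⟨(hM m ρ hρ).1.inv, posSemidef_inv_sub_one (hl m ρ hρ) (hM m ρ hρ).1 hL fun q => ?_,
      ?_, fun q => ?_⟩
    · rw [(hM m ρ hρ).2]
      exact ((hΓ m q).dualVal_bounds ha hL (hD m) hρ.le).1
    · rw [← ha₀.smul_one_eq]
      exact posSemidef_smul_one_sub_inv (hl m ρ hρ) (hM m ρ hρ).1 hL
    · have hg := (hΓ m q).isGreatest ha hL.le (hD m) hρ (hP ρ hρ)
      refine ⟨hg.bddAbove, hg.csSup_eq.trans ?_⟩
      rw [Matrix.nonsing_inv_nonsing_inv _ (isUnit_det_of_bil (hl m ρ hρ)), (hM m ρ hρ).2,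
        Config.dualVal]
  refine ⟨fun m ρ hρ => ?_, ?_⟩
  · obtain ⟨ψ, G, h1, h2, -⟩ := (hΓ m q).exists_isOptimizer ha hL.le (hD m) hρ (hP ρ hρ)
    exact ⟨ψ, G, h1, h2⟩
  obtain ⟨c, h1, h2, h3, h4⟩ := exists_deriv_of_uniform_taylor hK
    (F := fun m => Config.dualVal (cube d (m + 1)) (cube d m) q (Γ m q))
    (f := fun ρ => bil (A ρ)⁻¹ q q) (fun ρ hρ => by
      simpa only [(hM _ ρ hρ).2] using (hA ρ hρ).2 q) fun m ρ t hρ ht => by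
      rw [← hq]
      exact (hΓ m q).taylor ha hL (hD m) hρ ht
  refine ⟨c, fun ρ hρ ψ G hG => ⟨fun m => ?_, ?_⟩, fun ρ t hρ ht => ?_, h3, h4⟩
  · exact (hΓ m q).lintegral_firstIntegrand_lt_top ha hL.le (hD m) hρ (hP ρ hρ) (hG m)
  · refine (h1 ρ hρ).congr fun m => ?_
    exact ((hΓ m q).firstCoeff_eq ha hL.le (hD m) hρ (hP ρ hρ) (hG m)).symm
  · refine (h2 ρ t hρ ht).trans (mul_le_mul_of_nonneg_right ?_ (sq_nonneg t))
    linarith
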